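/- **Setting.** A prefix-closed automaton (PCA) $A$ is a deterministic finite automaton with $n$ states, ordered alphabet $\Sigma=\{1<\dots<\sigma\}$, initial state $q_0$, partial transition function $\delta$, and all states final. It is viewed as a labelled directed multigraph, and $L(A)$ is the set of labels of walks starting in $q_0$. The length of a walk is its number of edges. **Default walks.** For a state $v$ let $\pi(v)\in\mathbb N\cup\{\infty\}$ be the length of a longest walk from $v$. Let $L_v$ be the list of the edges $v\xrightarrow{a}u$ leaving $v$, in decreasing order of $\pi(u)+1$, ties broken by the letter $a$. The first edge of $L_v$ is the default edge of $v$; a default walk uses default edges only, and $(u,\ell)$ denotes the default walk of length $\ell$ from $u$. Let $w_v$ be the value $\pi(u)+1$ of the second edge of $L_v$ ($-\infty$ if there is none). For a default walk $(s,j)$ with $j\ge 1$, let $\mathrm{PMN}(s,j)=(v,d)$, where $v$ is the vertex at distance $d$ from $s$ on $(s,j)$, $0\le d<j$, and $d+w_v$ is maximum, $d$ being the largest possible in case of ties. **Enumeration order.** The strings of $L(A)$ of length $m$ are output by $\mathrm{Enumerate}(q_0,m)$, called if $\pi(q_0)\ge m$. A call $\mathrm{Enumerate}(u,\ell)$, reached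 by a walk from $q_0$ of length $m-\ell$ ending in $u$, first outputs the label of that walk continued by $(u,\ell)$. It returns if $\ell=0$ or if $d+w_v<\ell$ for $(v,d)=\mathrm{PMN}(u,\ell)$. Otherwise it processes a first-in-first-out queue that initially holds only the piece $(u,\ell)$ of the default walk $(u,\ell)$, as follows. Extract the first piece $(s,j)$, starting at distance $h$ from $u$; let $(v',f)=\mathrm{PMN}(s,j)$. Append the pieces $(s,f)$ (at distance $h$) and $(v'',j-f-1)$ (at distance $h+f+1$), where $v''$ is the successor of $v'$, in this order; a piece $(s',j')$ at distance $h'$ is appended only if $j'>0$ and $h'+e+w_r\ge\ell$ for $(r,e)=\mathrm{PMN}(s',j')$. Then go through $L_{v'}$ from its second element on (from its third element on for the initial piece $(u,\ell)$), as long as the current edge $v'\xrightarrow{b}u'$ satisfies $h+f+\pi(u')+1\ge\ell$, and for each such edge call $\mathrm{Enumerate}(u',\ell-h-f-1)$, reached by the current walk continued to $v'$ along default edges and then along this edge. When the queue is empty, the last call is the one for the second edge of $L_v$, where $(v,d)=\mathrm{PMN}(u,\ell)$, with length $\ell-d-1$. **Computational model.** A RAM with memory words of $\mathtt w$ bits,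 where $\mathtt w\ge 1$ and $\log\max\{n\sigma,m\}=O(\mathtt w)$ (so states, letters, transitions and $m$ fit in $O(1)$ words). A number with $b$ bits occupies $\lfloor b/\mathtt w\rfloor+1$ words. Addition, subtraction, comparison, reading and writing take time proportional to the number of words involved; multiplication and division take time proportional to the product of the numbers of words of the two operands. The automaton is given by its transition table. **Theorem (ranking and unranking).** Let $2\le\omega\le 3$ (in particular $\omega$ may be the exponent of matrix multiplication). There are RAM programs, fixed once and for all, such that for every PCA $A$ with $n$ states over $\sigma$ letters and every $m\ge1$: * *Ranking.* Every string $x\in L(A)$ of length $m$ is output by the enumeration, and given $A$ and $x$, the first program computes the number of strings output before $x$. * *Unranking.* Given $A$, $m$ and an integer $i\ge 1$ that is at most the number of strings output, the second program computes the $i$-th output string, which is a string of $L(A)$ of length $m$. Both run in time $$O\!\left(\Bigl(1+\frac{m\log\sigma}{\mathtt w}\Bigr)\bigl(n\sigma+m\,(n^{\omega}+m+\sigma)\bigr)\right),$$ hence in polynomial time. The implied constant depends only on the constant in $\log\max\{n\sigma,m\}=O(\mathtt w)$. -/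

import Mathlib

/-! ### Prefix-closed automata -/

/-- A prefix-closed automaton with state set `Fin n` over the ordered alphabet `Fin σ`: a deterministic
finite automaton with a partial transition function, all of whose states are final. -/
structure PCA (n σ : ℕ) where
  init : Fin n
  step : Fin n → Fin σ → Option (Fin n)

namespace PCA

variable {n σ : ℕ}

/-- The state reached from `v` by reading a string, if all the transitions exist. -/
def run (A : PCA n σ) : Fin n → List (Fin σ) → Option (Fin n)
  | v, [] => some v
  | v, a :: x => (A.step v a).bind fun u => A.run u x

/-- `x` labels a walk that starts in `v`. -/
def IsWalk (A : PCA n σ) (v : Fin n) (x : List (Fin σ)) : Prop :=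
  (A.run v x).isSome

/-- The accepted language: the labels of the walks that start in the initial state. -/
def language (A : PCA n σ) : Language (Fin σ) :=
  {x | A.IsWalk A.init x}

/-! ### Default edges and default walks -/

/-- The length (possibly infinite) of the longest walk that starts in `v`. -/
noncomputable def longest (A : PCA n σ) (v : Fin n) : ℕ∞ :=
  ⨆ x : {x : List (Fin σ) // A.IsWalk v x}, (x.1.length : ℕ∞)

/-- The end of the edge labelled `a` that leaves `v`; used only where that edge exists. -/
def target (A : PCA n σ) (v : Fin n) (a : Fin σ) : Fin n :=
  (A.step v a).getD v

/-- The length of the longest walk whose first edge is the edge labelled `a` that leaves `v`. -/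
noncomputable def edgeLen (A : PCA n σ) (v : Fin n) (a : Fin σ) : ℕ∞ :=
  A.longest (A.target v a) + 1

open Classical in
/-- The list of the edges that leave `v` (given by their labels), in decreasing order of `edgeLen`,
ties being broken by the order of the alphabet. -/
noncomputable def edges (A : PCA n σ) (v : Fin n) : List (Fin σ) :=
  ((List.finRange σ).filter fun a => (A.step v a).isSome).insertionSort
    fun a b => A.edgeLen v b < A.edgeLen v a ∨ (A.edgeLen v b = A.edgeLen v a ∧ a ≤ b)

/-- The end of the default edge of `v`, which is the first edge in `edges v`. -/
noncomputable def next (A : PCA n σ) (v : Fin n) : Fin n :=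
  match (A.edges v)[0]? with
  | some a => A.target v a
  | none => v

/-- The label of the default walk of length `ℓ` from `v` (used only if that walk exists). -/
noncomputable def defaultWord (A : PCA n σ) : Fin n → ℕ → List (Fin σ)
  | _, 0 => []
  | v, ℓ + 1 =>
    match (A.edges v)[0]? with
    | some a => a :: A.defaultWord (A.target v a) ℓ
    | none => []

/-- The vertex at distance `d` from `v` on the default walk from `v`. -/
noncomputable def defaultAt (A : PCA n σ) (v : Fin n) (d : ℕ) : Fin n :=
  A.next^[d] v

/-- The length of the longest walk from `v` that starts with a non-default edge, that is, with the
second edge in `edges v`; it is `⊥` if there is no such edge. -/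
noncomputable def branchLen (A : PCA n σ) (v : Fin n) : WithBot ℕ∞ :=
  match (A.edges v)[1]? with
  | some a => (A.edgeLen v a : WithBot ℕ∞)
  | none => ⊥

/-- The length of the longest walk that follows the default walk from `s` for `d` edges and then
leaves it through a non-default edge. -/
noncomputable def deviation (A : PCA n σ) (s : Fin n) (d : ℕ) : WithBot ℕ∞ :=
  (d : WithBot ℕ∞) + A.branchLen (A.defaultAt s d)

open Classical in
/-- The query on the default walk of length `j ≥ 1` from `s`: the distance from `s` of the vertex of
that walk, other than its last one, for which `deviation` is maximum; among several such vertices,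
the one farthest from `s`. -/
noncomputable def maxPos (A : PCA n σ) (s : Fin n) (j : ℕ) : ℕ :=
  Nat.findGreatest (fun f => ∀ g < j, A.deviation s g ≤ A.deviation s f) (j - 1)

/-! ### The enumeration algorithm -/

/-- On the default walk of length `ℓ` from `u`, consider the piece of length `j` that starts at
distance `h` from `u`: it has a vertex, other than its last one, through which a walk of length `ℓ`
from `u` can leave the default walk. -/
def Branches (A : PCA n σ) (u : Fin n) (ℓ h j : ℕ) : Prop :=
  0 < j ∧ (ℓ : WithBot ℕ∞) ≤
    (h : WithBot ℕ∞) + A.deviation (A.defaultAt u h) (A.maxPos (A.defaultAt u h) j)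

open Classical in
/-- The outer loop of a call with end vertex `u` and length `ℓ`. The queue holds pairs `(h, j)`, the
pieces of length `j` at distance `h` from `u` of the default walk of length `ℓ` from `u`. The first
piece is extracted, its best branching vertex is processed, and the part before it and the part after
it are appended if they contain branching vertices. The result is the list of the distances from `u`
of the processed vertices, in the order of processing. Every iteration removes one vertex for good,
so that `ℓ` iterations (the first argument) always suffice. -/
noncomputable def scan (A : PCA n σ) (u : Fin n) (ℓ : ℕ) : ℕ → List (ℕ × ℕ) → List ℕ
  | 0, _ => []
  | _ + 1, [] => []
  | k + 1, (h, j) :: U =>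
    let f := A.maxPos (A.defaultAt u h) j
    (h + f) :: A.scan u ℓ k (U
      ++ (if A.Branches u ℓ h f then [(h, f)] else [])
      ++ (if A.Branches u ℓ (h + f + 1) (j - f - 1) then [(h + f + 1, j - f - 1)] else []))

open Classical in
/-- The edges, from the `x`-th one on (counted from 0), of the list of the vertex at distance `p` on
the default walk from `u`, as long as they lead to walks of total length at least `ℓ` from `u`. Each
is returned together with `p`. -/
noncomputable def exits (A : PCA n σ) (u : Fin n) (ℓ p x : ℕ) : List (ℕ × Fin σ) :=
  (((A.edges (A.defaultAt u p)).drop x).takeWhile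
    fun b => (ℓ : ℕ∞) ≤ (p : ℕ∞) + A.edgeLen (A.defaultAt u p) b).map fun b => (p, b)

open Classical in
/-- The recursive calls made by the call with end vertex `u` and length `ℓ`, in the order in which
they are made. The call `(p, b)` leaves the default walk after `p` edges through the edge labelled
`b`. The second edge of the first branching vertex is saved for the tail call. -/
noncomputable def calls (A : PCA n σ) (u : Fin n) (ℓ : ℕ) : List (ℕ × Fin σ) :=
  if A.Branches u ℓ 0 ℓ then
    let p₀ := A.maxPos u ℓ
    A.exits u ℓ p₀ 2
      ++ ((A.scan u ℓ ℓ [(0, ℓ)]).drop 1).flatMap (fun p => A.exits u ℓ p 1)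
      ++ (A.exits u ℓ p₀ 1).take 1
  else []

/-- The strings output by the recursive procedure for the end vertex `u` and the length `ℓ`, in the
order of output: first the default walk, then the output of the recursive calls. -/
noncomputable def enumFrom (A : PCA n σ) (u : Fin n) (ℓ : ℕ) : List (List (Fin σ)) :=
  match ℓ with
  | 0 => [[]]
  | k + 1 =>
    A.defaultWord u (k + 1) :: (A.calls u (k + 1)).flatMap fun c =>
      (A.enumFrom (A.target (A.defaultAt u c.1) c.2) (k - c.1)).map fun z =>
        A.defaultWord u c.1 ++ c.2 :: z
termination_by ℓ
decreasing_by omega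

open Classical in
/-- The list of the strings of length `m` in the order in which the enumeration algorithm outputs
them. -/
noncomputable def enumeration (A : PCA n σ) (m : ℕ) : List (List (Fin σ)) :=
  if (m : ℕ∞) ≤ A.longest A.init then A.enumFrom A.init m else []

end PCA

/-! ### Random access machine

Programs are structured programs over registers `0, 1, 2, …` and memory segments `0, 1, 2, …`, each of
them an array with indirect addressing. A program names finitely many registers and segments. Cells
hold natural numbers. With words of `wd` bits, a number occupies as many words as its binary
representation needs, and every operation costs at least the number of words it works on. -/

namespace RAM

/-- The number of words of `wd` bits used for the number `x`. -/
def words (wd x : ℕ) : ℕ := x.size / wd + 1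

/-- Operations: addition, truncated subtraction, multiplication, division with remainder, and the
comparisons `<` and `=` with result 0 or 1. -/
inductive Op where
  | add | sub | mul | div | mod | lt | eq

/-- The value of an operation. -/
def Op.eval : Op → ℕ → ℕ → ℕ
  | .add, x, y => x + y
  | .sub, x, y => x - y
  | .mul, x, y => x * y
  | .div, x, y => x / y
  | .mod, x, y => x % y
  | .lt, x, y => if x < y then 1 else 0
  | .eq, x, y => if x = y then 1 else 0

/-- Cost of an operation: linear in the number of words, and the product of the numbers of words for
multiplication and division. -/
def Op.cost (wd : ℕ) : Op → ℕ → ℕ → ℕ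
  | .mul, x, y => words wd x * words wd y
  | .div, x, y => words wd x * words wd y
  | .mod, x, y => words wd x * words wd y
  | _, x, y => words wd x + words wd y

/-- Contents of the registers and of the memory segments. -/
structure State where
  reg : ℕ → ℕ
  mem : ℕ → ℕ → ℕ

/-- Expressions: constants, registers, operations, and the cell of a segment with a computed address. -/
inductive Expr where
  | lit (c : ℕ)
  | reg (r : ℕ)
  | op (o : Op) (e₁ e₂ : Expr)
  | load (seg : ℕ) (addr : Expr)

/-- The value of an expression. -/
def Expr.eval (s : State) : Expr → ℕ
  | .lit c => c
  | .reg r => s.reg r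
  | .op o e₁ e₂ => o.eval (e₁.eval s) (e₂.eval s)
  | .load g e => s.mem g (e.eval s)

/-- The cost of the evaluation of an expression. -/
def Expr.cost (wd : ℕ) (s : State) : Expr → ℕ
  | .lit c => words wd c
  | .reg r => words wd (s.reg r)
  | .op o e₁ e₂ => e₁.cost wd s + e₂.cost wd s + o.cost wd (e₁.eval s) (e₂.eval s)
  | .load g e => e.cost wd s + words wd (e.eval s) + words wd (s.mem g (e.eval s))

/-- Programs. -/
inductive Prog where
  | skip
  | assign (r : ℕ) (e : Expr)
  | store (seg : ℕ) (addr e : Expr)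
  | seq (p q : Prog)
  | ite (e : Expr) (p q : Prog)
  | while (e : Expr) (p : Prog)

/-- The state after an assignment to a register. -/
def State.setReg (s : State) (r x : ℕ) : State :=
  { s with reg := Function.update s.reg r x }

/-- The state after an assignment to a memory cell. -/
def State.setMem (s : State) (g k x : ℕ) : State :=
  { s with mem := Function.update s.mem g (Function.update (s.mem g) k x) }

/-- `Runs wd p s s' t`: with words of `wd` bits, the program `p` started in the state `s` halts in the
state `s'` after time `t`. -/
inductive Runs (wd : ℕ) : Prog → State → State → ℕ → Prop where
  | skip (s : State) : Runs wd .skip s s 1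
  | assign (s : State) (r : ℕ) (e : Expr) :
      Runs wd (.assign r e) s (s.setReg r (e.eval s)) (e.cost wd s + words wd (e.eval s))
  | store (s : State) (g : ℕ) (a e : Expr) :
      Runs wd (.store g a e) s (s.setMem g (a.eval s) (e.eval s))
        (a.cost wd s + e.cost wd s + words wd (a.eval s) + words wd (e.eval s))
  | seq {p q : Prog} {s s' s'' : State} {t t' : ℕ} :
      Runs wd p s s' t → Runs wd q s' s'' t' → Runs wd (.seq p q) s s'' (t + t')
  | ite_true {e : Expr} {p q : Prog} {s s' : State} {t : ℕ} :
      e.eval s ≠ 0 → Runs wd p s s' t → Runs wd (.ite e p q) s s' (e.cost wd s + t)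
  | ite_false {e : Expr} {p q : Prog} {s s' : State} {t : ℕ} :
      e.eval s = 0 → Runs wd q s s' t → Runs wd (.ite e p q) s s' (e.cost wd s + t)
  | while_true {e : Expr} {p : Prog} {s s' s'' : State} {t t' : ℕ} :
      e.eval s ≠ 0 → Runs wd p s s' t → Runs wd (.while e p) s' s'' t' →
        Runs wd (.while e p) s s'' (e.cost wd s + t + t')
  | while_false {e : Expr} {p : Prog} {s : State} :
      e.eval s = 0 → Runs wd (.while e p) s s (e.cost wd s)

end RAM

namespace PCA

variable {n σ : ℕ}

/-- The transition table, row by row: the cell `q * σ + a` holds `δ(q, a) + 1`, or `0` if `δ(q, a)` is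
undefined. All other cells are `0`. -/
def table (A : PCA n σ) (k : ℕ) : ℕ :=
  if h : k / σ < n ∧ 0 < σ then
    match A.step ⟨k / σ, h.1⟩ ⟨k % σ, Nat.mod_lt k h.2⟩ with
    | some q => q + 1
    | none => 0
  else 0

/-- The input: registers 0 to 4 hold the number of states, the number of letters, the initial state,
the length `m`, and the number `i`; segment 0 holds the transition table and segment 1 the letters
of the string `x`. Everything else is `0`. -/
def input (A : PCA n σ) (m i : ℕ) (x : List (Fin σ)) : RAM.State where
  reg r := [n, σ, A.init, m, i].getD r 0
  mem g k := if g = 0 then A.table k else if g = 1 then (x.map Fin.val).getD k 0 else 0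

end PCA

/-- `(1 + m log σ / wd) (n σ + m (n ^ ω + m + σ))`; the first factor is, up to a constant, the number
of words of `wd` bits of a number up to `σ ^ m`. -/
noncomputable def timeBound (ω : ℝ) (wd n σ m : ℕ) : ℝ :=
  (1 + m * Real.logb 2 σ / wd) * (n * σ + m * ((n : ℝ) ^ ω + m + σ))

/-! A walk of length `ℓ` from `u` either is the default walk or leaves it at exactly one distance
`p` through exactly one non-default edge `b` (`eq_default_or_deviates`). A call outputs the default
walk and then one block for each pair `(p, b)` realised by some walk of length `ℓ`; the block is the
output of a call of length `ℓ - 1 - p`, behind a fixed prefix. By induction no string is repeated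
(`enumFrom_nodup`) and the output has as many strings as there are walks (`length_enumFrom`), so the
size of every block is a number of walks. The position of a string is therefore 0 for the default
walk, and otherwise the offset of its block plus its position in the recursive call
(`Dev.exists_offset`, `index_cases`).

Ranking follows the string through the nested calls and adds the offsets; unranking looks in each
call for the block whose interval of positions contains the index and subtracts its offset. The
length drops with each call, so at most `m` calls are followed, and it suffices to treat one call
with `O(n + m + σ)` operations.

The offset of `(p, b)` is 1, plus the weights of the vertices processed before `p`, plus the sizes
of the blocks of the edges that precede `b` in the list of `p`; the saved edge of the root comes
after everything else. The weight of a vertex other than the root is a difference of two numbers of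
walks (`weight_of_ne_top`), and at the root the saved edge is subtracted as well (`weight_top`). The
order of processing is the breadth-first order of the Cartesian tree of the keys (`scan_eq_bfs`); a
stack builds the tree in linear time (`Cart`), and one traversal of it accumulates the weights
(`bfsProg_spec`). Within one list sorting is avoided: the order of the edges is that of the code of
the length, then of the letter, so a counting sort by codes yields all offsets (`preProg_spec`). The
default edge and the second edge are found by two scans.

The tables are computed once: the adjacency matrix, the lengths of longest walks by topological
sorting (`longestProg_spec`), and the numbers of walks of all lengths up to `m` by repeated products
of the matrix with a vector (`countProg_spec`). This takes `O(nσ + m n²)` operations, and `n² ≤ n ^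
ω`.

Costs are measured in units of a product of a small number, at most `N = O(n + σ + m)`, with an
arbitrary cell, at most `B = N σ ^ m`. Here `N` fits in `O(1)` words and `B` in `O(1 + m log σ /
wd)` words (`U_of_le`), so the unit is the first factor of the bound. Programs are verified with
timed Hoare triples `HT`, whose loop-free parts reduce to weakest preconditions (`HT.of_wp`). -/

/-! ### A Hoare calculus with costs -/

namespace RAM

/-- Word size, bound for small numbers (first factors of products), bound for all cells. -/
structure Cfg where
  wd : ℕ
  N : ℕ
  B : ℕ

/-- The time unit: the cost of a product of a small number and an arbitrary one. -/
def Cfg.U (c : Cfg) : ℕ := words c.wd c.N * words c.wd c.B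

/-- All cells are bounded by `c.B`. -/
def Bdd (c : Cfg) (s : State) : Prop :=
  (∀ r, s.reg r ≤ c.B) ∧ ∀ g k, s.mem g k ≤ c.B

/-- Size of an expression. -/
def Expr.sz : Expr → ℕ
  | .lit _ => 1
  | .reg _ => 1
  | .op _ e₁ e₂ => e₁.sz + e₂.sz + 1
  | .load _ e => e.sz + 1

/-- Literals are bounded, the first factor of a product is small, and division is not used. -/
def Expr.ok (c : Cfg) (s : State) : Expr → Prop
  | .lit x => x ≤ c.B
  | .reg _ => True
  | .op .mul e₁ e₂ => e₁.ok c s ∧ e₂.ok c s ∧ e₁.eval s ≤ c.N ∧ e₂.eval s ≤ c.B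
  | .op .div _ _ => False
  | .op .mod _ _ => False
  | .op _ e₁ e₂ => e₁.ok c s ∧ e₂.ok c s
  | .load _ e => e.ok c s

/-- Cost bound of an expression in time units. -/
def Expr.K (e : Expr) : ℕ := 2 * e.sz * (e.sz + 2)

/-! ### Word counts and the cost of expressions -/

theorem words_mono (wd : ℕ) {x y : ℕ} (h : x ≤ y) : words wd x ≤ words wd y := by
  unfold words
  have := Nat.div_le_div_right (c := wd) (Nat.size_le_size h)
  omega

theorem one_le_words (wd x : ℕ) : 1 ≤ words wd x := Nat.le_add_left _ _

theorem size_mul_le (x y : ℕ) : (x * y).size ≤ x.size + y.size := by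
  rw [Nat.size_le, pow_add]
  exact Nat.mul_lt_mul'' (Nat.lt_size_self x) (Nat.lt_size_self y)

theorem size_two_pow_mul_le (k x : ℕ) : (2 ^ k * x).size ≤ k + x.size := by
  rw [Nat.size_le, pow_add]
  exact Nat.mul_lt_mul_of_pos_left (Nat.lt_size_self x) (by positivity)

theorem add_div_le (a b w : ℕ) : (a + b) / w ≤ a / w + b / w + 1 := by
  rcases Nat.eq_zero_or_pos w with rfl | hw
  · simp
  · have h1 := Nat.lt_div_mul_add (a := a) hw
    have h2 := Nat.lt_div_mul_add (a := b) hw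
    have : (a + b) / w < a / w + b / w + 2 := by
      rw [Nat.div_lt_iff_lt_mul hw]
      nlinarith
    omega

/-- The `k` extra bits take at most `k` further words, and the words of `N` and of `B` are each at
most one unit. This form fits values of expressions of size `k`. -/
theorem words_le_of_le {c : Cfg} {k x : ℕ} (h : x ≤ 2 ^ k * (c.N * c.B)) :
    words c.wd x ≤ (k + 2) * c.U := by
  have h1 : words c.wd x ≤ k + (words c.wd c.N + words c.wd c.B) := by
    refine (words_mono _ h).trans ?_
    unfold words
    have h2 : (2 ^ k * (c.N * c.B)).size ≤ k + (c.N.size + c.B.size) :=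
      (size_two_pow_mul_le _ _).trans (Nat.add_le_add_left (size_mul_le _ _) _)
    -- Division by a word size 0 gives 0, so every number then occupies one word.
    rcases Nat.eq_zero_or_pos c.wd with hw | hw
    · simp [hw]
    have h3 := Nat.div_le_div_right (c := c.wd) h2
    have h4 : (k + (c.N.size + c.B.size)) / c.wd ≤ k + (c.N.size + c.B.size) / c.wd := by
      rw [← Nat.lt_succ_iff, Nat.div_lt_iff_lt_mul hw]
      have := Nat.lt_div_mul_add (a := c.N.size + c.B.size) hw
      have : k ≤ k * c.wd := Nat.le_mul_of_pos_right _ hw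
      simp only [Nat.succ_eq_add_one, Nat.add_mul]
      omega
    have h5 := add_div_le c.N.size c.B.size c.wd
    omega
  have h2 := one_le_words c.wd c.N
  have h3 := one_le_words c.wd c.B
  have h4 : words c.wd c.N ≤ c.U := Nat.le_mul_of_pos_right _ h3
  have h5 : words c.wd c.B ≤ c.U := Nat.le_mul_of_pos_left _ h2
  have h6 : k ≤ k * c.U := Nat.le_mul_of_pos_right _ (Nat.mul_pos h2 h3)
  rw [Nat.add_mul]
  omega

theorem one_le_U (c : Cfg) : 1 ≤ c.U :=
  Nat.mul_pos (one_le_words _ _) (one_le_words _ _)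

theorem words_le_of_le_B {c : Cfg} {x : ℕ} (h : x ≤ c.B) : words c.wd x ≤ c.U :=
  (words_mono _ h).trans (Nat.le_mul_of_pos_left _ (one_le_words _ _))

/-- A sum at most doubles the larger bound, whereas a product has factors bounded by `N` and `B`
themselves. Nested products therefore cannot make the bound grow beyond `N * B` times a power of
two. -/
theorem Expr.eval_le {c : Cfg} (hN : 1 ≤ c.N) {s : State} (hs : Bdd c s) (hB : 1 ≤ c.B) :
    ∀ e : Expr, e.ok c s → e.eval s ≤ 2 ^ e.sz * (c.N * c.B)
  | .lit x, h => by
    have h : x ≤ c.B := h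
    have : c.B ≤ c.N * c.B := Nat.le_mul_of_pos_left _ hN
    simp only [Expr.eval, Expr.sz]; omega
  | .reg r, _ => by
    have := hs.1 r
    have : c.B ≤ c.N * c.B := Nat.le_mul_of_pos_left _ hN
    simp only [Expr.eval, Expr.sz]; omega
  | .load g e, _ => by
    have := hs.2 g (e.eval s)
    have h1 : c.B ≤ c.N * c.B := Nat.le_mul_of_pos_left _ hN
    have h2 : c.N * c.B ≤ 2 ^ (e.sz + 1) * (c.N * c.B) := Nat.le_mul_of_pos_left _ (by positivity)
    simp only [Expr.eval, Expr.sz]; omega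
  | .op o e₁ e₂, h => by
    have hp : 1 ≤ 2 ^ (e₁.sz + e₂.sz + 1) * (c.N * c.B) :=
      Nat.mul_pos (by positivity) (Nat.mul_pos hN hB)
    have hadd : ∀ x y : ℕ, x ≤ 2 ^ e₁.sz * (c.N * c.B) → y ≤ 2 ^ e₂.sz * (c.N * c.B) →
        x + y ≤ 2 ^ (e₁.sz + e₂.sz + 1) * (c.N * c.B) := by
      intro x y hx hy
      have h1 : 2 ^ e₁.sz ≤ 2 ^ (e₁.sz + e₂.sz) := Nat.pow_le_pow_right (by norm_num) (by omega)
      have h2 : 2 ^ e₂.sz ≤ 2 ^ (e₁.sz + e₂.sz) := Nat.pow_le_pow_right (by norm_num) (by omega)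
      have h3 := Nat.mul_le_mul_right (c.N * c.B) h1
      have h4 := Nat.mul_le_mul_right (c.N * c.B) h2
      rw [pow_succ, mul_comm _ 2, mul_assoc]
      omega
    cases o with
    | add => exact hadd _ _ (Expr.eval_le hN hs hB e₁ h.1) (Expr.eval_le hN hs hB e₂ h.2)
    | sub =>
      have := hadd _ _ (Expr.eval_le hN hs hB e₁ h.1) (Expr.eval_le hN hs hB e₂ h.2)
      simp only [Expr.eval, Expr.sz, Op.eval]; omega
    | mul =>
      have h1 := Nat.mul_le_mul h.2.2.1 h.2.2.2
      exact h1.trans (Nat.le_mul_of_pos_left _ (by positivity))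
    | div => exact h.elim
    | mod => exact h.elim
    | lt => simp only [Expr.eval, Expr.sz, Op.eval]; split <;> omega
    | eq => simp only [Expr.eval, Expr.sz, Op.eval]; split <;> omega

theorem Expr.words_eval_le {c : Cfg} (hN : 1 ≤ c.N) {s : State} (hs : Bdd c s) (hB : 1 ≤ c.B)
    (e : Expr) (h : e.ok c s) : words c.wd (e.eval s) ≤ (e.sz + 2) * c.U :=
  words_le_of_le (Expr.eval_le hN hs hB e h)

/-- Each node costs a number of units linear in the sizes of its operands, so the total is quadratic
in the size of the expression. A product costs a single unit, by the choice of the unit. -/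
theorem Expr.cost_le {c : Cfg} (hN : 1 ≤ c.N) {s : State} (hs : Bdd c s) (hB : 1 ≤ c.B) :
    ∀ e : Expr, e.ok c s → e.cost c.wd s ≤ e.K * c.U
  | .lit x, h => by
    have := words_le_of_le_B (c := c) (x := x) h
    simp only [Expr.cost, Expr.K, Expr.sz]; omega
  | .reg r, _ => by
    have := words_le_of_le_B (hs.1 r)
    simp only [Expr.cost, Expr.K, Expr.sz]; omega
  | .load g e, h => by
    have h0 : e.ok c s := h
    have h1 := Expr.cost_le hN hs hB e h0
    have h2 := Expr.words_eval_le hN hs hB e h0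
    have h3 := words_le_of_le_B (hs.2 g (e.eval s))
    simp only [Expr.cost, Expr.K, Expr.sz] at h1 ⊢
    nlinarith
  | .op o e₁ e₂, h => by
    have key : ∀ {t : ℕ}, e₁.ok c s → e₂.ok c s →
        (t ≤ words c.wd (e₁.eval s) + words c.wd (e₂.eval s) ∨ t ≤ c.U) →
        e₁.cost c.wd s + e₂.cost c.wd s + t ≤ (Expr.op o e₁ e₂).K * c.U := by
      intro t k1 k2 ht
      have h1 := Expr.cost_le hN hs hB e₁ k1
      have h2 := Expr.cost_le hN hs hB e₂ k2
      have h3 := Expr.words_eval_le hN hs hB e₁ k1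
      have h4 := Expr.words_eval_le hN hs hB e₂ k2
      simp only [Expr.K, Expr.sz] at h1 h2 ⊢
      have ht' : t ≤ (e₁.sz + e₂.sz + 4) * c.U := by
        rcases ht with ht | ht
        · nlinarith
        · have := Nat.zero_le ((e₁.sz + e₂.sz) * c.U)
          nlinarith
      have e0 : 0 ≤ e₁.sz * e₂.sz * c.U := Nat.zero_le _
      nlinarith
    cases o with
    | add => exact key h.1 h.2 (Or.inl le_rfl)
    | sub => exact key h.1 h.2 (Or.inl le_rfl)
    | lt => exact key h.1 h.2 (Or.inl le_rfl)
    | eq => exact key h.1 h.2 (Or.inl le_rfl)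
    | div => exact h.elim
    | mod => exact h.elim
    | mul =>
      exact key h.1 h.2.1 (Or.inr (Nat.mul_le_mul (words_mono _ h.2.2.1) (words_mono _ h.2.2.2)))

/-! ### Frame conditions -/

/-- Registers written by a program. -/
def Prog.wr : Prog → List ℕ
  | .skip => []
  | .assign r _ => [r]
  | .store _ _ _ => []
  | .seq p q => p.wr ++ q.wr
  | .ite _ p q => p.wr ++ q.wr
  | .while _ p => p.wr

/-- Segments written by a program. -/
def Prog.ws : Prog → List ℕ
  | .skip => []
  | .assign _ _ => []
  | .store g _ _ => [g]
  | .seq p q => p.ws ++ q.ws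
  | .ite _ p q => p.ws ++ q.ws
  | .while _ p => p.ws

/-- The two states differ at most in what `p` writes. -/
structure Fr (p : Prog) (s s' : State) : Prop where
  reg : ∀ r, r ∉ p.wr → s'.reg r = s.reg r
  mem : ∀ g, g ∉ p.ws → s'.mem g = s.mem g

theorem Fr.rfl (p : Prog) (s : State) : Fr p s s := ⟨fun _ _ => .refl _, fun _ _ => .refl _⟩

theorem Fr.trans {p : Prog} {s s' s'' : State} (h : Fr p s s') (h' : Fr p s' s'') : Fr p s s'' :=
  ⟨fun r hr => (h'.reg r hr).trans (h.reg r hr), fun g hg => (h'.mem g hg).trans (h.mem g hg)⟩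

theorem Fr.mono {p q : Prog} {s s' : State} (h : Fr p s s') (h1 : p.wr ⊆ q.wr) (h2 : p.ws ⊆ q.ws) :
    Fr q s s' :=
  ⟨fun r hr => h.reg r fun hh => hr (h1 hh), fun g hg => h.mem g fun hh => hg (h2 hh)⟩

@[simp] theorem setReg_reg (s : State) (r x r' : ℕ) :
    (s.setReg r x).reg r' = if r' = r then x else s.reg r' := by
  simp [State.setReg, Function.update_apply]

@[simp] theorem setReg_mem (s : State) (r x : ℕ) : (s.setReg r x).mem = s.mem := rfl

@[simp] theorem setMem_reg (s : State) (g k x : ℕ) : (s.setMem g k x).reg = s.reg := rfl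

@[simp] theorem setMem_mem (s : State) (g k x g' : ℕ) :
    (s.setMem g k x).mem g' = if g' = g then Function.update (s.mem g) k x else s.mem g' := by
  simp [State.setMem, Function.update_apply]

/-- What a program leaves unchanged can be read off from its text: invariants about untouched
registers and segments are carried along by deciding membership in two concrete lists. -/
theorem Runs.fr {wd : ℕ} {p : Prog} {s s' : State} {t : ℕ} (h : Runs wd p s s' t) : Fr p s s' := by
  induction h with
  | skip s => exact Fr.rfl _ _
  | assign s r e =>
    refine ⟨fun r' hr => ?_, fun g _ => rfl⟩
    have : r' ≠ r := by simpa [Prog.wr] using hr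
    simp [this]
  | store s g a e =>
    refine ⟨fun r' hr => rfl, fun g' hg => ?_⟩
    have : g' ≠ g := by simpa [Prog.ws] using hg
    simp [this]
  | seq _ _ h1 h2 =>
    exact (h1.mono (by simp [Prog.wr]) (by simp [Prog.ws])).trans
      (h2.mono (by simp [Prog.wr]) (by simp [Prog.ws]))
  | ite_true _ _ h => exact h.mono (by simp [Prog.wr]) (by simp [Prog.ws])
  | ite_false _ _ h => exact h.mono (by simp [Prog.wr]) (by simp [Prog.ws])
  | while_true _ _ _ h1 h2 => exact Fr.trans (h1.mono (by simp [Prog.wr]) (by simp [Prog.ws])) h2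
  | while_false _ => exact Fr.rfl _ _

/-! ### Timed Hoare triples and weakest preconditions -/

/-- `p` started in `s` halts in a state satisfying `Q` within `T` time units. -/
def HT (c : Cfg) (p : Prog) (s : State) (T : ℕ) (Q : State → Prop) : Prop :=
  ∃ s' t, Runs c.wd p s s' t ∧ t ≤ T * c.U ∧ Bdd c s' ∧ Q s'

theorem HT.mono {c : Cfg} {p : Prog} {s : State} {T T' : ℕ} {Q Q' : State → Prop}
    (h : HT c p s T Q) (hT : T ≤ T') (hQ : ∀ s', Bdd c s' → Fr p s s' → Q s' → Q' s') :
    HT c p s T' Q' := by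
  obtain ⟨s', t, h1, h2, h3, h4⟩ := h
  exact ⟨s', t, h1, h2.trans (Nat.mul_le_mul_right _ hT), h3, hQ s' h3 h1.fr h4⟩

theorem HT.seq {c : Cfg} {p q : Prog} {s : State} {T₁ T₂ : ℕ} {Q₁ Q : State → Prop}
    (h : HT c p s T₁ Q₁) (h' : ∀ s', Bdd c s' → Fr p s s' → Q₁ s' → HT c q s' T₂ Q) :
    HT c (.seq p q) s (T₁ + T₂) Q := by
  obtain ⟨s₁, t₁, h1, h2, h3, h4⟩ := h
  obtain ⟨s₂, t₂, k1, k2, k3, k4⟩ := h' s₁ h3 h1.fr h4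
  exact ⟨s₂, t₁ + t₂, h1.seq k1, by rw [Nat.add_mul]; omega, k3, k4⟩

/-- Cost bound for programs without loops. -/
def Prog.K : Prog → ℕ
  | .skip => 1
  | .assign _ e => e.K + 1
  | .store _ a e => a.K + e.K + a.sz + 3
  | .seq p q => p.K + q.K
  | .ite e p q => e.K + p.K + q.K
  | .while _ _ => 0

/-- Weakest preconditions of programs without loops. -/
def wp (c : Cfg) : Prog → (State → Prop) → State → Prop
  | .skip, Q, s => Q s
  | .assign r e, Q, s => e.ok c s ∧ e.eval s ≤ c.B ∧ Q (s.setReg r (e.eval s))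
  | .store g a e, Q, s =>
    a.ok c s ∧ e.ok c s ∧ e.eval s ≤ c.B ∧ Q (s.setMem g (a.eval s) (e.eval s))
  | .seq p q, Q, s => wp c p (wp c q Q) s
  | .ite e p q, Q, s => e.ok c s ∧ (e.eval s ≠ 0 → wp c p Q s) ∧ (e.eval s = 0 → wp c q Q s)
  | .while _ _, _, _ => False

theorem Bdd.setReg {c : Cfg} {s : State} (hs : Bdd c s) {r x : ℕ} (hx : x ≤ c.B) :
    Bdd c (s.setReg r x) := by
  refine ⟨fun r' => ?_, hs.2⟩
  rw [setReg_reg]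
  split
  · exact hx
  · exact hs.1 _

theorem Bdd.setMem {c : Cfg} {s : State} (hs : Bdd c s) {g k x : ℕ} (hx : x ≤ c.B) :
    Bdd c (s.setMem g k x) := by
  refine ⟨hs.1, fun g' k' => ?_⟩
  rw [setMem_mem]
  split
  · rw [Function.update_apply]
    split
    · exact hx
    · exact hs.2 _ _
  · exact hs.2 _ _

/-- The time bound depends only on the text of the program, so a loop-free program leaves only
conditions on values to be checked. A loop has the precondition `False`. -/
theorem HT.of_wp {c : Cfg} (hN : 1 ≤ c.N) (hB : 1 ≤ c.B) {p : Prog} : ∀ {s : State}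
    {Q : State → Prop}, Bdd c s → wp c p Q s → HT c p s p.K Q := by
  induction p with
  | skip =>
    intro s Q hs h
    exact ⟨s, 1, .skip s, by simpa [Prog.K] using one_le_U c, hs, h⟩
  | assign r e =>
    intro s Q hs h
    refine ⟨_, _, .assign s r e, ?_, hs.setReg h.2.1, h.2.2⟩
    have h1 := Expr.cost_le hN hs hB e h.1
    have h2 := words_le_of_le_B h.2.1
    simp only [Prog.K, Nat.add_mul]; omega
  | store g a e =>
    intro s Q hs h
    refine ⟨_, _, .store s g a e, ?_, hs.setMem h.2.2.1, h.2.2.2⟩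
    have h1 := Expr.cost_le hN hs hB a h.1
    have h2 := Expr.cost_le hN hs hB e h.2.1
    have h3 := words_le_of_le_B h.2.2.1
    have h4 := Expr.words_eval_le hN hs hB a h.1
    simp only [Prog.K, Nat.add_mul] at *; omega
  | seq p q ihp ihq =>
    intro s Q hs h
    exact HT.seq (ihp hs h) fun s' hs' _ h' => ihq hs' h'
  | ite e p q ihp ihq =>
    intro s Q hs h
    have h1 := Expr.cost_le hN hs hB e h.1
    by_cases he : e.eval s = 0
    · obtain ⟨s', t, k1, k2, k3, k4⟩ := ihq hs (h.2.2 he)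
      refine ⟨s', _, .ite_false he k1, ?_, k3, k4⟩
      have := Nat.zero_le (p.K * c.U)
      simp only [Prog.K, Nat.add_mul]; omega
    · obtain ⟨s', t, k1, k2, k3, k4⟩ := ihp hs (h.2.1 he)
      refine ⟨s', _, .ite_true he k1, ?_, k3, k4⟩
      have := Nat.zero_le (q.K * c.U)
      simp only [Prog.K, Nat.add_mul]; omega
  | _ =>
    intro s Q hs h
    exact h.elim

theorem HT.ite {c : Cfg} (hN : 1 ≤ c.N) (hB : 1 ≤ c.B) {e : Expr} {p q : Prog} {s : State}
    {T : ℕ} {Q : State → Prop} (hs : Bdd c s) (he : e.ok c s)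
    (hp : e.eval s ≠ 0 → HT c p s T Q) (hq : e.eval s = 0 → HT c q s T Q) :
    HT c (.ite e p q) s (e.K + T) Q := by
  have h1 := Expr.cost_le hN hs hB e he
  by_cases h : e.eval s = 0
  · obtain ⟨s', t, k1, k2, k3, k4⟩ := hq h
    exact ⟨s', _, .ite_false h k1, by rw [Nat.add_mul]; omega, k3, k4⟩
  · obtain ⟨s', t, k1, k2, k3, k4⟩ := hp h
    exact ⟨s', _, .ite_true h k1, by rw [Nat.add_mul]; omega, k3, k4⟩

/-- Loops: an invariant `I` and a variant `μ`. -/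
theorem HT.while {c : Cfg} (hN : 1 ≤ c.N) (hB : 1 ≤ c.B) {e : Expr} {p : Prog} {s : State}
    {T k : ℕ} (I : State → Prop) (μ : State → ℕ) (hs : Bdd c s) (h0 : I s) (hk : μ s ≤ k)
    (he : ∀ s', Bdd c s' → Fr p s s' → I s' → e.ok c s')
    (hp : ∀ s', Bdd c s' → Fr p s s' → I s' → e.eval s' ≠ 0 →
      HT c p s' T fun s'' => I s'' ∧ μ s'' < μ s') :
    HT c (.while e p) s (k * (e.K + T) + e.K) fun s' => I s' ∧ e.eval s' = 0 := by
  suffices H : ∀ k s', Bdd c s' → Fr p s s' → I s' → μ s' ≤ k →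
      HT c (.while e p) s' (k * (e.K + T) + e.K) fun s' => I s' ∧ e.eval s' = 0 from
    H k s hs (Fr.rfl _ _) h0 hk
  intro k
  induction k with
  | zero =>
    intro s' hs' hf hI hμ
    have hc := Expr.cost_le hN hs' hB e (he s' hs' hf hI)
    by_cases h : e.eval s' = 0
    · exact ⟨s', _, .while_false h, by simpa using hc, hs', hI, h⟩
    · obtain ⟨_, _, _, _, _, _, h5⟩ := hp s' hs' hf hI h
      omega
  | succ k ih =>
    intro s' hs' hf hI hμ
    have hc := Expr.cost_le hN hs' hB e (he s' hs' hf hI)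
    by_cases h : e.eval s' = 0
    · exact ⟨s', _, .while_false h, hc.trans (Nat.mul_le_mul_right _ (Nat.le_add_left _ _)), hs', hI, h⟩
    · obtain ⟨s₁, t₁, h1, h2, h3, h4, h5⟩ := hp s' hs' hf hI h
      obtain ⟨s₂, t₂, k1, k2, k3, k4⟩ := ih s₁ h3 (hf.trans h1.fr) h4 (by omega)
      refine ⟨s₂, _, .while_true h h1 k1, ?_, k3, k4⟩
      calc e.cost c.wd s' + t₁ + t₂ ≤ e.K * c.U + T * c.U + (k * (e.K + T) + e.K) * c.U := by omega
        _ = _ := by ring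

/-- `for i := 0, …, reg b - 1 do p`. -/
def forTo (i b : ℕ) (p : Prog) : Prog :=
  .seq (.assign i (.lit 0)) (.while (.op .lt (.reg i) (.reg b))
    (.seq p (.assign i (.op .add (.reg i) (.lit 1)))))

/-- A round costs the body, 30 units for the test and 31 for the increment; the initialisation (7)
and the last test (30) make 37. The invariant for `k + 1` is required in the state where the counter
has already been increased. -/
theorem HT.forTo {c : Cfg} (hN : 1 ≤ c.N) (hB : 1 ≤ c.B) {i b : ℕ} {p : Prog} {s : State} {T : ℕ}
    (I : ℕ → State → Prop) (hs : Bdd c s) (hi : i ∉ p.wr) (hb : b ∉ p.wr) (hib : b ≠ i)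
    (h0 : I 0 (s.setReg i 0))
    (hp : ∀ k s', k < s.reg b → Bdd c s' → Fr (forTo i b p) s s' → s'.reg i = k → I k s' →
      HT c p s' T fun s'' => I (k + 1) (s''.setReg i (k + 1))) :
    HT c (forTo i b p) s (s.reg b * (T + 61) + 37) fun s' => I (s.reg b) s' ∧ s'.reg i = s.reg b := by
  have hfr : ∀ {s'}, Fr (p.seq (.assign i (.op .add (.reg i) (.lit 1)))) (s.setReg i 0) s' →
      Fr (RAM.forTo i b p) s s' := by
    intro s' h
    refine ⟨fun r hr => ?_, fun g hg => ?_⟩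
    · have hr1 : r ≠ i := by rintro rfl; exact hr (by simp [RAM.forTo, Prog.wr])
      have := h.reg r (by intro hh; exact hr (by simp [RAM.forTo, Prog.wr] at hh ⊢; tauto))
      simpa [hr1] using this
    · exact h.mem g (by intro hh; exact hg (by simpa [RAM.forTo, Prog.ws] using hh))
  have hb' : ∀ {s'}, Fr (RAM.forTo i b p) s s' → s'.reg b = s.reg b := fun h =>
    h.reg b (by simp [RAM.forTo, Prog.wr, hb, hib])
  have hinit : HT c (.assign i (.lit 0)) s 7 fun s' => s' = s.setReg i 0 :=
    HT.of_wp (p := .assign i (.lit 0)) hN hB hs ⟨Nat.zero_le _, Nat.zero_le _, rfl⟩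
  have hinc : ∀ (k : ℕ) (s' : State), Bdd c s' → k < c.B → s'.reg i = k →
      HT c (.assign i (.op .add (.reg i) (.lit 1))) s' 31 fun s'' => s'' = s'.setReg i (k + 1) := by
    intro k s' hs' hk hk'
    refine HT.of_wp (p := .assign i (.op .add (.reg i) (.lit 1))) hN hB hs' ?_
    simp only [wp, Expr.eval, Op.eval, Expr.ok, hk']
    simp only [and_true, true_and]
    omega
  have := HT.seq hinit (q := .while (.op .lt (.reg i) (.reg b))
    (.seq p (.assign i (.op .add (.reg i) (.lit 1)))))
    (Q := fun s' => I (s.reg b) s' ∧ s'.reg i = s.reg b) (T₂ := s.reg b * (30 + (T + 31)) + 30)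
    (by
    rintro _ hs1 - rfl
    have := HT.while hN hB (e := .op .lt (.reg i) (.reg b)) (T := T + 31) (k := s.reg b)
      (p := .seq p (.assign i (.op .add (.reg i) (.lit 1))))
      (fun s' => I (s'.reg i) s' ∧ s'.reg i ≤ s.reg b) (fun s' => s.reg b - s'.reg i) hs1
      (by simpa using h0) (by simp) (fun s' _ _ _ => ⟨trivial, trivial⟩)
      (by
        intro s' hs' hf hI he
        have hlt : s'.reg i < s.reg b := by
          simpa [Expr.eval, Op.eval, hb' (hfr hf)] using he
        refine HT.seq (hp _ s' hlt hs' (hfr hf) rfl hI.1) ?_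
        intro s'' hs'' hf'' hI''
        refine (hinc (s'.reg i) s'' hs'' (by have := hs.1 b; omega) (hf''.reg i hi)).mono le_rfl ?_
        -- The increased counter is still a legal cell, since it does not exceed the upper limit,
        -- which is itself the content of a register.
        rintro _ - - rfl
        have h1 : (s''.setReg i (s'.reg i + 1)).reg i = s'.reg i + 1 := by simp
        rw [h1]
        exact ⟨⟨hI'', by omega⟩, by omega⟩)
    refine this.mono (le_of_eq rfl) ?_
    rintro s' hs' hf ⟨⟨h1, h2⟩, h3⟩
    have h4 : s'.reg b = s.reg b := hb' (hfr ⟨hf.reg, hf.mem⟩)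
    have h5 : s.reg b ≤ s'.reg i := by simpa [Expr.eval, Op.eval, h4] using h3
    have h6 : s'.reg i = s.reg b := le_antisymm h2 h5
    rw [h6] at h1
    exact ⟨h1, h6⟩)
  refine this.mono (le_of_eq ?_) fun _ _ _ h => h
  rw [show 30 + (T + 31) = T + 61 by ring]
  ring

end RAM

/-! ### Walks, their lengths and their number -/

namespace PCA

variable {n σ : ℕ}

theorem isWalk_nil (A : PCA n σ) (v : Fin n) : A.IsWalk v [] := by simp [IsWalk, run]

theorem isWalk_cons (A : PCA n σ) (v : Fin n) (a : Fin σ) (x : List (Fin σ)) :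
    A.IsWalk v (a :: x) ↔ ∃ u, A.step v a = some u ∧ A.IsWalk u x := by
  cases h : A.step v a <;> simp [IsWalk, run, h]

theorem isWalk_take (A : PCA n σ) : ∀ (x : List (Fin σ)) (v : Fin n) (k : ℕ),
    A.IsWalk v x → A.IsWalk v (x.take k)
  | [], v, k, h => by simpa using h
  | a :: x, v, 0, _ => A.isWalk_nil v
  | a :: x, v, k + 1, h => by
    rw [isWalk_cons] at h
    obtain ⟨u, h1, h2⟩ := h
    rw [List.take_succ_cons, isWalk_cons]
    exact ⟨u, h1, isWalk_take A x u k h2⟩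

/-- Prefixes of walks are walks. Hence, if no walk has length exactly `ℓ`, all walks are shorter
than `ℓ`, and so is their supremum. -/
theorem le_longest_iff (A : PCA n σ) (v : Fin n) (ℓ : ℕ) :
    (ℓ : ℕ∞) ≤ A.longest v ↔ ∃ x, A.IsWalk v x ∧ x.length = ℓ := by
  constructor
  · intro h
    by_contra hc
    push Not at hc
    have hlt : ∀ x : {x : List (Fin σ) // A.IsWalk v x}, x.1.length + 1 ≤ ℓ := by
      rintro ⟨x, hx⟩
      by_contra hlt
      refine hc _ (A.isWalk_take x v ℓ hx) ?_
      simp only [List.length_take]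
      simp only at hlt
      omega
    have hpos : 1 ≤ ℓ := by have := hlt ⟨[], A.isWalk_nil v⟩; simpa using this
    have h2 : A.longest v ≤ ((ℓ - 1 : ℕ) : ℕ∞) := by
      refine iSup_le fun x => ?_
      have := hlt x
      exact_mod_cast (by omega : x.1.length ≤ ℓ - 1)
    have h3 := h.trans h2
    rw [Nat.cast_le] at h3
    omega
  · rintro ⟨x, hx, rfl⟩
    exact le_iSup (fun x : {x : List (Fin σ) // A.IsWalk v x} => (x.1.length : ℕ∞)) ⟨x, hx⟩

theorem target_eq {A : PCA n σ} {v u : Fin n} {a : Fin σ} (h : A.step v a = some u) :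
    A.target v a = u := by simp [target, h]

theorem step_eq_target {A : PCA n σ} {v : Fin n} {a : Fin σ} (h : (A.step v a).isSome) :
    A.step v a = some (A.target v a) := by
  obtain ⟨u, hu⟩ := Option.isSome_iff_exists.1 h
  rw [hu, target_eq hu]

theorem le_edgeLen_iff (A : PCA n σ) (v : Fin n) (a : Fin σ) (ℓ : ℕ) :
    ((ℓ + 1 : ℕ) : ℕ∞) ≤ A.edgeLen v a ↔ (ℓ : ℕ∞) ≤ A.longest (A.target v a) := by
  rw [edgeLen, Nat.cast_add, Nat.cast_one]
  exact ENat.add_le_add_iff_right (by simp)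

theorem succ_le_longest_iff (A : PCA n σ) (v : Fin n) (ℓ : ℕ) :
    ((ℓ + 1 : ℕ) : ℕ∞) ≤ A.longest v ↔
      ∃ a, (A.step v a).isSome ∧ (ℓ : ℕ∞) ≤ A.longest (A.target v a) := by
  rw [le_longest_iff]
  constructor
  · rintro ⟨x, hx, hl⟩
    cases x with
    | nil => simp at hl
    | cons a x =>
      obtain ⟨u, h1, h2⟩ := (A.isWalk_cons v a x).1 hx
      refine ⟨a, by simp [h1], ?_⟩
      rw [target_eq h1, le_longest_iff]
      exact ⟨x, h2, by simpa using hl⟩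
  · rintro ⟨a, h1, h2⟩
    obtain ⟨x, hx, hl⟩ := (A.le_longest_iff _ _).1 h2
    exact ⟨a :: x, (A.isWalk_cons _ _ _).2 ⟨_, step_eq_target h1, hx⟩, by simp [hl]⟩

theorem enat_le_of_forall_nat {x y : ℕ∞} (h : ∀ k : ℕ, (k : ℕ∞) ≤ x → (k : ℕ∞) ≤ y) : x ≤ y :=
  ENat.forall_natCast_le_iff_le.1 h

theorem edgeLen_le_longest {A : PCA n σ} {v : Fin n} {a : Fin σ} (h : (A.step v a).isSome) :
    A.edgeLen v a ≤ A.longest v := by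
  refine enat_le_of_forall_nat fun k hk => ?_
  cases k with
  | zero => simp
  | succ k => exact (A.succ_le_longest_iff v k).2 ⟨a, h, (A.le_edgeLen_iff v a k).1 hk⟩

/-! ### Numbers of walks, and finite longest walks -/

/-- The number of walks of length `ℓ` from `v`. -/
def cnt (A : PCA n σ) : ℕ → Fin n → ℕ
  | 0, _ => 1
  | ℓ + 1, v => ∑ a : Fin σ, if (A.step v a).isSome then A.cnt ℓ (A.target v a) else 0

/-- The number of edges from `v` to `u`. -/
def mult (A : PCA n σ) (v u : Fin n) : ℕ :=
  (Finset.univ.filter fun a => A.step v a = some u).card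

/-- Grouping the edges by their ends turns the recursion into a product of the adjacency matrix with
a vector, which is the form that is computed. -/
theorem cnt_succ (A : PCA n σ) (ℓ : ℕ) (v : Fin n) :
    A.cnt (ℓ + 1) v = ∑ u : Fin n, A.mult v u * A.cnt ℓ u := by
  have h : ∀ a : Fin σ, (if (A.step v a).isSome then A.cnt ℓ (A.target v a) else 0) =
      ∑ u : Fin n, if A.step v a = some u then A.cnt ℓ u else 0 := by
    intro a
    cases hs : A.step v a with
    | none => simp
    | some w => simp [target, hs]
  simp only [cnt, h]
  rw [Finset.sum_comm]
  refine Finset.sum_congr rfl fun u _ => ?_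
  rw [mult, Finset.card_eq_sum_ones, Finset.sum_mul, Finset.sum_filter]
  refine Finset.sum_congr rfl fun a _ => ?_
  split <;> simp

/-- This links the two sides of the argument: tests on lengths of walks, as made by the enumeration,
are tests for nonzero numbers of walks. -/
theorem cnt_pos_iff (A : PCA n σ) : ∀ (ℓ : ℕ) (v : Fin n), 0 < A.cnt ℓ v ↔ (ℓ : ℕ∞) ≤ A.longest v
  | 0, v => by simp [cnt]
  | ℓ + 1, v => by
    rw [succ_le_longest_iff, cnt, Finset.sum_pos_iff]
    refine exists_congr fun a => ?_
    by_cases h : (A.step v a).isSome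
    · simp [h, cnt_pos_iff A ℓ]
    · simp [h]

theorem cnt_le (A : PCA n σ) : ∀ (ℓ : ℕ) (v : Fin n), A.cnt ℓ v ≤ σ ^ ℓ
  | 0, v => by simp [cnt]
  | ℓ + 1, v => by
    rw [cnt, pow_succ, mul_comm]
    refine (Finset.sum_le_card_nsmul Finset.univ _ (σ ^ ℓ) fun a _ => ?_).trans (by simp)
    split
    · exact cnt_le A ℓ _
    · exact Nat.zero_le _

theorem mult_le (A : PCA n σ) (v u : Fin n) : A.mult v u ≤ σ := by
  have := Finset.card_le_univ (Finset.univ.filter fun a => A.step v a = some u)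
  rwa [Fintype.card_fin] at this

theorem exists_longest_pred {A : PCA n σ} {v : Fin n} {k : ℕ} (h : A.longest v = ((k + 1 : ℕ) : ℕ∞)) :
    ∃ a, (A.step v a).isSome ∧ A.longest (A.target v a) = k := by
  obtain ⟨a, h1, h2⟩ := (A.succ_le_longest_iff v k).1 h.ge
  refine ⟨a, h1, le_antisymm ?_ h2⟩
  have := edgeLen_le_longest h1
  rw [h, edgeLen, Nat.cast_add, Nat.cast_one] at this
  exact (ENat.add_le_add_iff_right (by simp)).1 this

/-- Along a longest walk the value drops by one at each edge, so the values `k - 1, …, 0` occur at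
distinct states, all different from `v`. -/
theorem longest_lt_of_ne_top {A : PCA n σ} {v : Fin n} {k : ℕ} (h : A.longest v = k) : k < n := by
  have key : ∀ (k : ℕ) (v : Fin n), A.longest v = (k : ℕ∞) →
      k ≤ (Finset.univ.filter fun u => A.longest u < k).card := by
    intro k
    induction k with
    | zero => simp
    | succ k ih =>
      intro v hv
      obtain ⟨a, _, h2⟩ := exists_longest_pred hv
      refine (Nat.succ_le_succ (ih _ h2)).trans ?_
      -- The end of the chosen edge has value exactly `k`, so it is new compared with the states of
      -- value less than `k`.
      rw [Nat.succ_eq_add_one, ← Finset.card_insert_of_notMem (a := A.target v a) (by simp [h2])]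
      refine Finset.card_le_card fun u hu => ?_
      rcases Finset.mem_insert.1 hu with rfl | hu
      · simp only [Finset.mem_filter, Finset.mem_univ, true_and, h2]
        exact_mod_cast Nat.lt_succ_self k
      · simp only [Finset.mem_filter, Finset.mem_univ, true_and] at hu ⊢
        exact hu.trans (by exact_mod_cast Nat.lt_succ_self k)
  refine (key k v h).trans_lt ?_
  -- The state `v` has the value `k` and is not counted.
  calc _ < (Finset.univ : Finset (Fin n)).card :=
        Finset.card_lt_card (Finset.filter_ssubset.2 ⟨v, Finset.mem_univ _, by simp [h]⟩)
    _ = n := by simp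

/-! ### The sorted lists of edges -/

/-- The order of the edges in the list of `v`. -/
def Before (A : PCA n σ) (v : Fin n) (a b : Fin σ) : Prop :=
  A.edgeLen v b < A.edgeLen v a ∨ (A.edgeLen v b = A.edgeLen v a ∧ a ≤ b)

theorem before_trans {A : PCA n σ} {v : Fin n} {a b c : Fin σ} (h : A.Before v a b)
    (h' : A.Before v b c) : A.Before v a c := by
  rcases h with h | ⟨h, h2⟩ <;> rcases h' with h' | ⟨h', h2'⟩
  · exact Or.inl (h'.trans h)
  · exact Or.inl (h' ▸ h)
  · exact Or.inl (h ▸ h')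
  · exact Or.inr ⟨h'.trans h, h2.trans h2'⟩

theorem before_total (A : PCA n σ) (v : Fin n) (a b : Fin σ) : A.Before v a b ∨ A.Before v b a := by
  rcases lt_trichotomy (A.edgeLen v a) (A.edgeLen v b) with h | h | h
  · exact Or.inr (Or.inl h)
  · rcases le_total a b with h' | h'
    · exact Or.inl (Or.inr ⟨h.symm, h'⟩)
    · exact Or.inr (Or.inr ⟨h, h'⟩)
  · exact Or.inl (Or.inl h)

theorem before_antisymm {A : PCA n σ} {v : Fin n} {a b : Fin σ} (h : A.Before v a b)
    (h' : A.Before v b a) : a = b := by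
  rcases h with h | ⟨h, h2⟩ <;> rcases h' with h' | ⟨h', h2'⟩
  · exact absurd h' h.asymm
  · exact absurd h' h.ne'
  · exact absurd h h'.ne'
  · exact le_antisymm h2 h2'

theorem edges_pairwise (A : PCA n σ) (v : Fin n) : (A.edges v).Pairwise (A.Before v) := by
  have : Std.Total fun a b : Fin σ =>
      A.edgeLen v b < A.edgeLen v a ∨ (A.edgeLen v b = A.edgeLen v a ∧ a ≤ b) := ⟨A.before_total v⟩
  have : IsTrans (Fin σ) fun a b : Fin σ =>
      A.edgeLen v b < A.edgeLen v a ∨ (A.edgeLen v b = A.edgeLen v a ∧ a ≤ b) :=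
    ⟨fun _ _ _ => before_trans⟩
  classical
  have h := List.pairwise_insertionSort (fun a b : Fin σ =>
      A.edgeLen v b < A.edgeLen v a ∨ (A.edgeLen v b = A.edgeLen v a ∧ a ≤ b))
    ((List.finRange σ).filter fun a => (A.step v a).isSome)
  unfold edges
  convert h using 1
  rfl

theorem mem_edges {A : PCA n σ} {v : Fin n} {a : Fin σ} :
    a ∈ A.edges v ↔ (A.step v a).isSome := by
  classical
  simp [edges, List.mem_insertionSort]

theorem edges_nodup (A : PCA n σ) (v : Fin n) : (A.edges v).Nodup := by
  classical
  exact (List.perm_insertionSort _ _).nodup_iff.2 ((List.nodup_finRange σ).filter _)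

/-- In a list sorted by an antisymmetric relation the head is the unique least element. The default
edge can thus be found by one scan, without sorting. -/
theorem getElem?_edges_zero {A : PCA n σ} {v : Fin n} {a : Fin σ} :
    (A.edges v)[0]? = some a ↔ (A.step v a).isSome ∧ ∀ b, (A.step v b).isSome → A.Before v a b := by
  have hp := A.edges_pairwise v
  simp only [← mem_edges]
  cases h : A.edges v with
  | nil => simp
  | cons c l =>
    rw [h, List.pairwise_cons] at hp
    have hc : ∀ b ∈ c :: l, A.Before v c b := by
      intro b hb
      rcases List.mem_cons.1 hb with rfl | hb
      · exact Or.inr ⟨rfl, le_rfl⟩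
      · exact hp.1 b hb
    constructor
    · rintro h1
      obtain rfl : c = a := by simpa using h1
      exact ⟨by simp, hc⟩
    · rintro ⟨h1, h2⟩
      simpa using before_antisymm (hc a h1) (h2 c (by simp))

/-- The second edge is the least one once the default edge is excluded, so a second scan finds it.
-/
theorem getElem?_edges_one {A : PCA n σ} {v : Fin n} {a c : Fin σ} (h0 : (A.edges v)[0]? = some c) :
    (A.edges v)[1]? = some a ↔ ((A.step v a).isSome ∧ a ≠ c) ∧
      ∀ b, (A.step v b).isSome ∧ b ≠ c → A.Before v a b := by
  have hp := A.edges_pairwise v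
  have hn := A.edges_nodup v
  simp only [← mem_edges]
  cases h : A.edges v with
  | nil => simp [h] at h0
  | cons c' l =>
    obtain rfl : c' = c := by simpa [h] using h0
    rw [h] at hp hn
    have hm : ∀ b, b ∈ c' :: l ∧ b ≠ c' ↔ b ∈ l := by
      intro b
      constructor
      · rintro ⟨h1, h2⟩
        exact (List.mem_cons.1 h1).resolve_left h2
      · intro h1
        exact ⟨List.mem_cons_of_mem _ h1, fun h => (List.nodup_cons.1 hn).1 (h ▸ h1)⟩
    simp only [hm]
    cases l with
    | nil => simp
    | cons d l =>
      have hp' := (List.pairwise_cons.1 (List.pairwise_cons.1 hp).2).1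
      have hc : ∀ b ∈ d :: l, A.Before v d b := by
        intro b hb
        rcases List.mem_cons.1 hb with rfl | hb
        · exact Or.inr ⟨rfl, le_rfl⟩
        · exact hp' b hb
      constructor
      · rintro h1
        obtain rfl : d = a := by simpa using h1
        exact ⟨by simp, hc⟩
      · rintro ⟨h1, h2⟩
        simpa using before_antisymm (hc a h1) (h2 d (by simp))

/-! ### Default walks -/

theorem longest_eq_edgeLen {A : PCA n σ} {v : Fin n} {a : Fin σ} (h : (A.edges v)[0]? = some a) :
    A.longest v = A.edgeLen v a := by
  obtain ⟨h1, h2⟩ := getElem?_edges_zero.1 h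
  refine le_antisymm (enat_le_of_forall_nat fun k hk => ?_) (edgeLen_le_longest h1)
  cases k with
  | zero => simp
  | succ k =>
    obtain ⟨b, h3, h4⟩ := (A.succ_le_longest_iff v k).1 hk
    have h5 := (A.le_edgeLen_iff v b k).2 h4
    rcases h2 b h3 with h | h
    · exact h5.trans h.le
    · exact h5.trans h.1.le

theorem exists_default {A : PCA n σ} {v : Fin n} (h : (1 : ℕ∞) ≤ A.longest v) :
    ∃ a, (A.edges v)[0]? = some a := by
  obtain ⟨b, h3, _⟩ := (A.succ_le_longest_iff v 0).1 (by simpa using h)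
  have := mem_edges.2 h3
  cases h : A.edges v with
  | nil => simp [h] at this
  | cons c l => exact ⟨c, by simp⟩

theorem next_eq {A : PCA n σ} {v : Fin n} {a : Fin σ} (h : (A.edges v)[0]? = some a) :
    A.next v = A.target v a := by simp [next, h]

theorem le_longest_next {A : PCA n σ} {v : Fin n} {ℓ : ℕ} (h : ((ℓ + 1 : ℕ) : ℕ∞) ≤ A.longest v) :
    (ℓ : ℕ∞) ≤ A.longest (A.next v) := by
  obtain ⟨a, ha⟩ := exists_default (A := A) (v := v) (le_trans (by simp) h)
  rw [next_eq ha, ← le_edgeLen_iff, ← longest_eq_edgeLen ha]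
  exact h

theorem defaultAt_zero (A : PCA n σ) (v : Fin n) : A.defaultAt v 0 = v := rfl

theorem defaultAt_add (A : PCA n σ) (v : Fin n) (a b : ℕ) :
    A.defaultAt (A.defaultAt v a) b = A.defaultAt v (a + b) := by
  rw [defaultAt, defaultAt, defaultAt, add_comm, Function.iterate_add_apply]

theorem defaultAt_succ (A : PCA n σ) (v : Fin n) (d : ℕ) :
    A.defaultAt v (d + 1) = A.next (A.defaultAt v d) := Function.iterate_succ_apply' _ _ _

theorem defaultAt_succ' (A : PCA n σ) (v : Fin n) (d : ℕ) :
    A.defaultAt v (d + 1) = A.defaultAt (A.next v) d := Function.iterate_succ_apply _ _ _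

/-- Following the default edge uses up exactly one unit of the longest length, so a default walk can
be prolonged as far as any walk can. -/
theorem le_longest_defaultAt {A : PCA n σ} {v : Fin n} {ℓ : ℕ} (h : (ℓ : ℕ∞) ≤ A.longest v) :
    ∀ {d : ℕ}, d ≤ ℓ → ((ℓ - d : ℕ) : ℕ∞) ≤ A.longest (A.defaultAt v d)
  | 0, _ => h
  | d + 1, hd => by
    rw [defaultAt_succ]
    refine le_longest_next ?_
    rw [show ℓ - (d + 1) + 1 = ℓ - d by omega]
    exact le_longest_defaultAt h (by omega)

theorem exists_default_at {A : PCA n σ} {v : Fin n} {ℓ d : ℕ} (h : (ℓ : ℕ∞) ≤ A.longest v)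
    (hd : d < ℓ) : ∃ a, (A.edges (A.defaultAt v d))[0]? = some a := by
  refine exists_default (le_trans ?_ (le_longest_defaultAt h hd.le))
  exact_mod_cast (by omega : 1 ≤ ℓ - d)

theorem length_defaultWord {A : PCA n σ} : ∀ {v : Fin n} {ℓ : ℕ}, (ℓ : ℕ∞) ≤ A.longest v →
    (A.defaultWord v ℓ).length = ℓ
  | v, 0, _ => rfl
  | v, ℓ + 1, h => by
    obtain ⟨a, ha⟩ := exists_default (A := A) (v := v) (le_trans (by simp) h)
    have := le_longest_next h
    rw [next_eq ha] at this
    simp [defaultWord, ha, length_defaultWord this]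

theorem getElem?_defaultWord {A : PCA n σ} : ∀ {v : Fin n} {ℓ : ℕ}, (ℓ : ℕ∞) ≤ A.longest v →
    ∀ {k : ℕ}, k < ℓ → (A.defaultWord v ℓ)[k]? = (A.edges (A.defaultAt v k))[0]?
  | v, ℓ + 1, h, k, hk => by
    obtain ⟨a, ha⟩ := exists_default (A := A) (v := v) (le_trans (by simp) h)
    have h' := le_longest_next h
    have h2 := next_eq ha
    rw [h2] at h'
    cases k with
    | zero => simp [defaultWord, ha, defaultAt_zero]
    | succ k =>
      rw [defaultAt_succ', h2, ← getElem?_defaultWord h' (by omega : k < ℓ)]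
      simp [defaultWord, ha]

theorem isWalk_defaultWord_append {A : PCA n σ} : ∀ {v : Fin n} {ℓ : ℕ}, (ℓ : ℕ∞) ≤ A.longest v →
    ∀ x, A.IsWalk v (A.defaultWord v ℓ ++ x) ↔ A.IsWalk (A.defaultAt v ℓ) x
  | v, 0, _, x => by simp [defaultWord, defaultAt_zero]
  | v, ℓ + 1, h, x => by
    obtain ⟨a, ha⟩ := exists_default (A := A) (v := v) (le_trans (by simp) h)
    have h' := le_longest_next h
    have h2 := next_eq ha
    rw [h2] at h'
    have h3 := step_eq_target (getElem?_edges_zero.1 ha).1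
    rw [defaultAt_succ', h2, ← isWalk_defaultWord_append h' x]
    simp [defaultWord, ha, isWalk_cons, h3]

/-- A walk is the default walk or leaves it at some vertex. -/
theorem eq_default_or_deviates {A : PCA n σ} : ∀ {v : Fin n} {ℓ : ℕ} {x : List (Fin σ)},
    A.IsWalk v x → x.length = ℓ → x = A.defaultWord v ℓ ∨
      ∃ p < ℓ, ∃ b z, x = A.defaultWord v p ++ b :: z ∧ (A.step (A.defaultAt v p) b).isSome ∧
        (A.edges (A.defaultAt v p))[0]? ≠ some b ∧ A.IsWalk (A.target (A.defaultAt v p) b) z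
  | v, _, [], _, rfl => Or.inl rfl
  | v, _, a :: x, h, rfl => by
    obtain ⟨u, h1, h2⟩ := (A.isWalk_cons v a x).1 h
    by_cases ha : (A.edges v)[0]? = some a
    · have hu : A.next v = u := by rw [next_eq ha, target_eq h1]
      rcases eq_default_or_deviates h2 rfl with h3 | ⟨p, hp, b, z, h3, h4, h5, h6⟩
      · left
        conv_lhs => rw [h3]
        simp [defaultWord, ha, target_eq h1]
      · right
        refine ⟨p + 1, by simpa using hp, b, z, ?_, ?_⟩
        · conv_lhs => rw [h3]
          simp [defaultWord, ha, target_eq h1]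
        · rw [defaultAt_succ', hu]
          exact ⟨h4, h5, h6⟩
    · right
      exact ⟨0, by simp, a, x, by simp [defaultWord], by simp [defaultAt_zero, h1], ha,
        by rwa [defaultAt_zero, target_eq h1]⟩

end PCA

/-! ### Numerical codes for lengths, and the positions of maxima -/

namespace PCA

variable {n σ : ℕ}

open Classical in
/-- A code for `longest v`: infinity is replaced by `n + m`. -/
noncomputable def lenC (A : PCA n σ) (m : ℕ) (v : Fin n) : ℕ :=
  if A.longest v = ⊤ then n + m else (A.longest v).toNat

/-- Finite lengths are less than `n`. The code of infinity exceeds them by more than `m`, so it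
still dominates after distances less than `m` have been added. -/
theorem lenC_cases (A : PCA n σ) (m : ℕ) (v : Fin n) :
    (A.longest v = ⊤ ∧ A.lenC m v = n + m) ∨ ∃ k < n, A.longest v = k ∧ A.lenC m v = k := by
  by_cases h : A.longest v = ⊤
  · exact Or.inl ⟨h, by simp [lenC, h]⟩
  · have h1 := ENat.natCast_toNat h
    exact Or.inr ⟨_, longest_lt_of_ne_top h1.symm, h1.symm, by simp [lenC, h]⟩

theorem lenC_le (A : PCA n σ) (m : ℕ) (v : Fin n) : A.lenC m v ≤ n + m := by
  rcases A.lenC_cases m v with ⟨_, h⟩ | ⟨k, hk, _, h⟩ <;> omega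

theorem lenC_lt_iff (A : PCA n σ) (m : ℕ) (u v : Fin n) :
    A.lenC m u < A.lenC m v ↔ A.longest u < A.longest v := by
  rcases A.lenC_cases m u with ⟨h1, h2⟩ | ⟨k, hk, h1, h2⟩ <;>
  rcases A.lenC_cases m v with ⟨h3, h4⟩ | ⟨k', hk', h3, h4⟩ <;> rw [h1, h2, h3, h4]
  · simp
  · simp; omega
  · simp; omega
  · simp

theorem edgeLen_lt_iff (A : PCA n σ) (m : ℕ) (v : Fin n) (a b : Fin σ) :
    A.edgeLen v a < A.edgeLen v b ↔ A.lenC m (A.target v a) < A.lenC m (A.target v b) := by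
  rw [lenC_lt_iff, edgeLen, edgeLen]
  exact ENat.add_lt_add_iff_right (by simp)

theorem edgeLen_eq_iff (A : PCA n σ) (m : ℕ) (v : Fin n) (a b : Fin σ) :
    A.edgeLen v a = A.edgeLen v b ↔ A.lenC m (A.target v a) = A.lenC m (A.target v b) := by
  have h1 := A.edgeLen_lt_iff m v a b
  have h2 := A.edgeLen_lt_iff m v b a
  constructor
  · intro h
    rw [h] at h1 h2
    simp only [lt_irrefl, false_iff] at h1 h2
    omega
  · intro h
    rw [h] at h1 h2
    simp only [lt_irrefl, iff_false, not_lt] at h1 h2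
    exact le_antisymm h2 h1

theorem before_iff (A : PCA n σ) (m : ℕ) (v : Fin n) (a b : Fin σ) :
    A.Before v a b ↔ A.lenC m (A.target v b) < A.lenC m (A.target v a) ∨
      (A.lenC m (A.target v b) = A.lenC m (A.target v a) ∧ a ≤ b) := by
  rw [Before, edgeLen_lt_iff A m, edgeLen_eq_iff A m]

/-- A code for `branchLen v`: `⊥` is replaced by `0`. -/
noncomputable def brC (A : PCA n σ) (m : ℕ) (v : Fin n) : ℕ :=
  match (A.edges v)[1]? with
  | some a => A.lenC m (A.target v a) + 1
  | none => 0

theorem brC_le (A : PCA n σ) (m : ℕ) (v : Fin n) : A.brC m v ≤ n + m + 1 := by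
  unfold brC
  split
  · have := A.lenC_le m (A.target v ‹_›); omega
  · omega

theorem deviation_cases (A : PCA n σ) (m : ℕ) (u : Fin n) (p : ℕ) :
    (A.deviation u p = ⊥ ∧ A.brC m (A.defaultAt u p) = 0) ∨
    (∃ k < n, A.deviation u p = ((p + k + 1 : ℕ) : ℕ∞) ∧ A.brC m (A.defaultAt u p) = k + 1) ∨
    (A.deviation u p = ((⊤ : ℕ∞) : WithBot ℕ∞) ∧ A.brC m (A.defaultAt u p) = n + m + 1) := by
  unfold deviation branchLen brC
  cases (A.edges (A.defaultAt u p))[1]? with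
  | none => exact Or.inl ⟨by simp, rfl⟩
  | some a =>
    right
    simp only [edgeLen]
    rcases A.lenC_cases m (A.target (A.defaultAt u p) a) with ⟨h1, h2⟩ | ⟨k, hk, h1, h2⟩
    · right
      rw [h1, h2]
      exact ⟨by rfl, rfl⟩
    · left
      rw [h1, h2]
      refine ⟨k, hk, ?_, rfl⟩
      rw [add_assoc p k 1]
      rfl

/-- The total length of the walks that leave the default walk from `u` at distance `p`, if it is at
least `ℓ`, and `0` otherwise. -/
noncomputable def key (A : PCA n σ) (m : ℕ) (u : Fin n) (ℓ p : ℕ) : ℕ :=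
  if A.brC m (A.defaultAt u p) ≠ 0 ∧ ℓ ≤ p + A.brC m (A.defaultAt u p) then
    p + A.brC m (A.defaultAt u p) else 0

theorem key_ne_zero_iff (A : PCA n σ) {m ℓ : ℕ} (u : Fin n) (p : ℕ) (hm : ℓ ≤ m) :
    A.key m u ℓ p ≠ 0 ↔ (ℓ : WithBot ℕ∞) ≤ A.deviation u p := by
  have hc : ((ℓ : ℕ) : WithBot ℕ∞) = ((ℓ : ℕ∞) : WithBot ℕ∞) := rfl
  rcases A.deviation_cases m u p with ⟨h1, h2⟩ | ⟨k, hk, h1, h2⟩ | ⟨h1, h2⟩ <;>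
    rw [key, h1, h2, hc]
  · simp
  · rw [WithBot.coe_le_coe, Nat.cast_le]
    split <;> omega
  · rw [WithBot.coe_le_coe]
    simp only [le_top, iff_true]
    split <;> omega

/-- Two infinite deviations are equal, but their keys differ by the difference of the positions. The
hypothesis `p ≤ q` makes both comparisons true in this case. An infinite and a finite deviation
compare correctly, since `q + k + 1 < n + m + 1` for `q < m` and `k < n`. -/
theorem key_le_iff (A : PCA n σ) {m ℓ p q : ℕ} (u : Fin n) (hm : ℓ ≤ m) (hpq : p ≤ q) (hq : q < ℓ)
    (hk : A.key m u ℓ q ≠ 0) :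
    A.key m u ℓ p ≤ A.key m u ℓ q ↔ A.deviation u p ≤ A.deviation u q := by
  have hq' : A.brC m (A.defaultAt u q) ≠ 0 ∧ ℓ ≤ q + A.brC m (A.defaultAt u q) := by
    by_contra h
    exact hk (if_neg h)
  rw [show A.key m u ℓ q = q + A.brC m (A.defaultAt u q) from if_pos hq']
  clear hk
  unfold key
  rcases A.deviation_cases m u p with ⟨h1, h2⟩ | ⟨k, hk, h1, h2⟩ | ⟨h1, h2⟩ <;>
  rcases A.deviation_cases m u q with ⟨h3, h4⟩ | ⟨k', hk', h3, h4⟩ | ⟨h3, h4⟩ <;>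
    simp only [h1, h2, h3, h4, WithBot.coe_le_coe, Nat.cast_le, le_top, bot_le, top_le_iff,
      ENat.natCast_ne_top, le_bot_iff, WithBot.coe_ne_bot, iff_true, iff_false] <;>
    (try split) <;> omega

/-- The counterpart for positions after `q`: among infinite deviations the keys now increase with
the position, so both strict inequalities fail. Together with `key_le_iff`, the last maximum of the
deviations is the last maximum of the keys. -/
theorem key_lt_iff (A : PCA n σ) {m ℓ p q : ℕ} (u : Fin n) (hm : ℓ ≤ m) (hpq : q < p) (hp : p < ℓ)
    (hk : A.key m u ℓ q ≠ 0) :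
    A.key m u ℓ p < A.key m u ℓ q ↔ A.deviation u p < A.deviation u q := by
  have hq' : A.brC m (A.defaultAt u q) ≠ 0 ∧ ℓ ≤ q + A.brC m (A.defaultAt u q) := by
    by_contra h
    exact hk (if_neg h)
  rw [show A.key m u ℓ q = q + A.brC m (A.defaultAt u q) from if_pos hq']
  clear hk
  unfold key
  rcases A.deviation_cases m u p with ⟨h1, h2⟩ | ⟨k, hk, h1, h2⟩ | ⟨h1, h2⟩ <;>
  rcases A.deviation_cases m u q with ⟨h3, h4⟩ | ⟨k', hk', h3, h4⟩ | ⟨h3, h4⟩ <;>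
    simp only [h1, h2, h3, h4, WithBot.coe_lt_coe, Nat.cast_lt, not_top_lt, WithBot.bot_lt_coe,
      ENat.natCast_lt_top, not_lt_bot, lt_irrefl, iff_true, iff_false] <;>
    (try split) <;> omega

/-! ### Last positions of maxima on intervals -/

/-- `r` is the last position of the maximum of `k` on `[a, b)`, and this maximum is not `0`. -/
structure IsTop (k : ℕ → ℕ) (a b r : ℕ) : Prop where
  le : a ≤ r
  lt : r < b
  ne : k r ≠ 0
  before : ∀ q, a ≤ q → q < r → k q ≤ k r
  after : ∀ q, r < q → q < b → k q < k r

theorem IsTop.unique {k : ℕ → ℕ} {a b r r' : ℕ} (h : IsTop k a b r) (h' : IsTop k a b r') :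
    r = r' := by
  rcases lt_trichotomy r r' with hh | hh | hh
  · have := h.after r' hh h'.lt
    have := h'.before r h.le hh
    omega
  · exact hh
  · have := h'.after r hh h.lt
    have := h.before r' h'.le hh
    omega

/-- One plus the position of the maximum on `[a, b)`, and `0` if `k` vanishes there. -/
def topPos (k : ℕ → ℕ) (a : ℕ) : ℕ → ℕ
  | 0 => 0
  | b + 1 =>
    if a ≤ b ∧ k b ≠ 0 ∧ (topPos k a b = 0 ∨ k (topPos k a b - 1) ≤ k b) then b + 1
    else topPos k a b

theorem topPos_spec (k : ℕ → ℕ) (a : ℕ) : ∀ b : ℕ,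
    (topPos k a b = 0 ∧ ∀ q, a ≤ q → q < b → k q = 0) ∨ ∃ r, topPos k a b = r + 1 ∧ IsTop k a b r
  | 0 => Or.inl ⟨rfl, by omega⟩
  | b + 1 => by
    unfold topPos
    rcases topPos_spec k a b with ⟨h1, h2⟩ | ⟨r, h1, h2⟩
    · by_cases hb : a ≤ b ∧ k b ≠ 0
      · right
        refine ⟨b, by simp [hb, h1], hb.1, by omega, hb.2, fun q h3 h4 => ?_, by omega⟩
        rw [h2 q h3 h4]; omega
      · left
        refine ⟨by rw [if_neg (by tauto), h1], fun q h3 h4 => ?_⟩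
        rcases Nat.lt_succ_iff_lt_or_eq.1 h4 with h5 | rfl
        · exact h2 q h3 h5
        · by_contra h6; exact hb ⟨h3, h6⟩
    · right
      have h3 := h2.le
      have h4 := h2.lt
      have h5 := h2.ne
      rw [h1]
      by_cases hb : k r ≤ k b
      · refine ⟨b, by rw [if_pos]; exact ⟨by omega, by omega, Or.inr hb⟩, by omega, by omega,
          by omega, fun q h6 h7 => ?_, by omega⟩
        rcases lt_trichotomy q r with h8 | rfl | h8
        · have := h2.before q h6 h8; omega
        · omega
        · have := h2.after q h8 h7; omega
      · refine ⟨r, by rw [if_neg]; rintro ⟨_, _, h | h⟩ <;> simp at h; omega, h3, by omega, h5,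
          h2.before, fun q h6 h7 => ?_⟩
        rcases Nat.lt_succ_iff_lt_or_eq.1 h7 with h8 | rfl
        · exact h2.after q h6 h8
        · omega

theorem topPos_eq_zero_iff {k : ℕ → ℕ} {a b : ℕ} :
    topPos k a b = 0 ↔ ∀ q, a ≤ q → q < b → k q = 0 := by
  rcases topPos_spec k a b with ⟨h1, h2⟩ | ⟨r, h1, h2⟩
  · exact ⟨fun _ => h2, fun _ => h1⟩
  · constructor
    · omega
    · intro h; exact absurd (h r h2.le h2.lt) h2.ne

theorem topPos_eq_succ_iff {k : ℕ → ℕ} {a b r : ℕ} : topPos k a b = r + 1 ↔ IsTop k a b r := by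
  rcases topPos_spec k a b with ⟨h1, h2⟩ | ⟨r', h1, h2⟩
  · constructor
    · omega
    · intro h; exact absurd (h2 r h.le h.lt) h.ne
  · constructor
    · intro h; obtain rfl : r' = r := by omega
      exact h2
    · intro h; rw [h1, h.unique h2]

theorem isTop_of_ne {k : ℕ → ℕ} {a b : ℕ} (h : topPos k a b ≠ 0) : IsTop k a b (topPos k a b - 1) :=
  topPos_eq_succ_iff.1 (by omega)

theorem add_le_add_iff_natCast_withBot (h : ℕ) (x y : WithBot ℕ∞) :
    (h : WithBot ℕ∞) + x ≤ h + y ↔ x ≤ y := by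
  have hc : ((h : ℕ) : WithBot ℕ∞) = ((h : ℕ∞) : WithBot ℕ∞) := rfl
  rw [hc]
  induction x using WithBot.recBotCoe with
  | bot => simp
  | coe x =>
    induction y using WithBot.recBotCoe with
    | bot => rw [← WithBot.coe_add, WithBot.add_bot]; simp
    | coe y =>
      rw [← WithBot.coe_add, ← WithBot.coe_add, WithBot.coe_le_coe, WithBot.coe_le_coe]
      exact ENat.add_le_add_iff_left (by simp)

theorem natCast_add_deviation (A : PCA n σ) (u : Fin n) (h g : ℕ) :
    (h : WithBot ℕ∞) + A.deviation (A.defaultAt u h) g = A.deviation u (h + g) := by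
  rw [deviation, deviation, defaultAt_add, ← add_assoc, Nat.cast_add]

theorem deviation_le_iff (A : PCA n σ) (u : Fin n) (h f g : ℕ) :
    A.deviation (A.defaultAt u h) f ≤ A.deviation (A.defaultAt u h) g ↔
      A.deviation u (h + f) ≤ A.deviation u (h + g) := by
  rw [← natCast_add_deviation, ← natCast_add_deviation, add_le_add_iff_natCast_withBot]

/-- A maximum over a finite nonempty range exists, so `Nat.findGreatest` returns a genuine
maximiser; being the greatest one, it strictly beats every later position. -/
theorem maxPos_spec (A : PCA n σ) (s : Fin n) {j : ℕ} (hj : 0 < j) :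
    A.maxPos s j < j ∧ (∀ g < j, A.deviation s g ≤ A.deviation s (A.maxPos s j)) ∧
      ∀ g < j, A.maxPos s j < g → A.deviation s g < A.deviation s (A.maxPos s j) := by
  classical
  obtain ⟨f, hf, hmax⟩ := Finset.exists_max_image (Finset.range j) (A.deviation s) ⟨0, by simpa⟩
  simp only [Finset.mem_range] at hf hmax
  have h1 : ∀ g < j, A.deviation s g ≤ A.deviation s (A.maxPos s j) :=
    Nat.findGreatest_spec (P := fun f => ∀ g < j, A.deviation s g ≤ A.deviation s f)
      (by omega : f ≤ j - 1) hmax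
  have h2 : A.maxPos s j ≤ j - 1 := Nat.findGreatest_le _
  refine ⟨by omega, h1, fun g hg hlt => lt_of_le_of_ne (h1 g hg) fun he => ?_⟩
  have h3 := Nat.findGreatest_is_greatest (P := fun f => ∀ g < j, A.deviation s g ≤ A.deviation s f)
    hlt (by omega)
  exact h3 fun g' hg' => (h1 g' hg').trans he.ge

theorem isTop_maxPos (A : PCA n σ) {m ℓ h j : ℕ} (u : Fin n) (hm : ℓ ≤ m) (hj : 0 < j)
    (hl : h + j ≤ ℓ) (hk : A.key m u ℓ (h + A.maxPos (A.defaultAt u h) j) ≠ 0) :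
    IsTop (A.key m u ℓ) h (h + j) (h + A.maxPos (A.defaultAt u h) j) := by
  obtain ⟨h1, h2, h3⟩ := A.maxPos_spec (A.defaultAt u h) hj
  refine ⟨by omega, by omega, hk, fun q h4 h5 => ?_, fun q h4 h5 => ?_⟩
  · obtain ⟨g, rfl⟩ := Nat.exists_eq_add_of_le h4
    rw [key_le_iff A u hm h5.le (by omega) hk, ← deviation_le_iff]
    exact h2 g (by omega)
  · obtain ⟨g, rfl⟩ := Nat.exists_eq_add_of_le (show h ≤ q by omega)
    rw [key_lt_iff A u hm h4 (by omega) hk, ← not_le, ← deviation_le_iff, not_le]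
    exact h3 g (by omega) (by omega)

/-- The test for appending a piece asks whether some key on the piece is nonzero. After this lemma
and `add_maxPos_eq`, only the natural-number function `key` matters for the queue. -/
theorem branches_iff (A : PCA n σ) {m ℓ h j : ℕ} (u : Fin n) (hm : ℓ ≤ m) (hl : h + j ≤ ℓ) :
    A.Branches u ℓ h j ↔ topPos (A.key m u ℓ) h (h + j) ≠ 0 := by
  rw [Branches, natCast_add_deviation, ← key_ne_zero_iff A u _ hm]
  constructor
  · rintro ⟨h1, h2⟩
    rw [topPos_eq_succ_iff.2 (A.isTop_maxPos u hm h1 hl h2)]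
    omega
  · intro h1
    have h2 := isTop_of_ne h1
    have hj : 0 < j := by have := h2.le; have := h2.lt; omega
    refine ⟨hj, ?_⟩
    obtain ⟨g, hg⟩ := Nat.exists_eq_add_of_le h2.le
    have h3 := h2.ne
    rw [hg, key_ne_zero_iff A u _ hm] at h3
    rw [key_ne_zero_iff A u _ hm]
    refine h3.trans ?_
    rw [← deviation_le_iff]
    exact (A.maxPos_spec _ hj).2.1 g (by have := h2.lt; omega)

theorem add_maxPos_eq (A : PCA n σ) {m ℓ h j : ℕ} (u : Fin n) (hm : ℓ ≤ m) (hl : h + j ≤ ℓ)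
    (hk : topPos (A.key m u ℓ) h (h + j) ≠ 0) :
    h + A.maxPos (A.defaultAt u h) j = topPos (A.key m u ℓ) h (h + j) - 1 := by
  obtain ⟨h1, h2⟩ := (A.branches_iff u hm hl).2 hk
  rw [natCast_add_deviation, ← key_ne_zero_iff A u _ hm] at h2
  rw [topPos_eq_succ_iff.2 (A.isTop_maxPos u hm h1 hl h2), Nat.add_sub_cancel]

/-! ### The order in which the branching vertices are processed -/

/-- The interval `[a, b)` as a list, if `k` does not vanish on it. -/
def piece (k : ℕ → ℕ) (a b : ℕ) : List (ℕ × ℕ) := if topPos k a b ≠ 0 then [(a, b)] else []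

/-- Processing of a queue of intervals: the maximum of the first interval is output, and the two
parts of the interval are appended. -/
def bfs (k : ℕ → ℕ) : ℕ → List (ℕ × ℕ) → List ℕ
  | 0, _ => []
  | _ + 1, [] => []
  | f + 1, (a, b) :: U =>
    (topPos k a b - 1) :: bfs k f
      (U ++ piece k a (topPos k a b - 1) ++ piece k (topPos k a b - 1 + 1) b)

open Classical in
-- A piece of length `j` at distance `h` becomes the interval `[h, h + j)`, and the queue is then
-- driven by the keys alone.
theorem scan_eq_bfs (A : PCA n σ) {m ℓ : ℕ} (u : Fin n) (hm : ℓ ≤ m) : ∀ (f : ℕ) (U : List (ℕ × ℕ)),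
    (∀ c ∈ U, c.1 ≤ c.2 ∧ c.2 ≤ ℓ ∧ topPos (A.key m u ℓ) c.1 c.2 ≠ 0) →
    A.scan u ℓ f (U.map fun c => (c.1, c.2 - c.1)) = bfs (A.key m u ℓ) f U
  | 0, U, _ => by cases U <;> rfl
  | f + 1, [], _ => rfl
  | f + 1, (a, b) :: U, hU => by
    obtain ⟨h1, h2, h3⟩ := hU (a, b) (by simp)
    simp only at h1 h2 h3
    have hb : a + (b - a) = b := by omega
    have h4 := isTop_of_ne h3
    have hr : a + A.maxPos (A.defaultAt u a) (b - a) = topPos (A.key m u ℓ) a b - 1 := by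
      rw [add_maxPos_eq A u hm (by omega) (by rwa [hb]), hb]
    have h5 := h4.le
    have h6 := h4.lt
    set r := topPos (A.key m u ℓ) a b - 1
    have hf : A.maxPos (A.defaultAt u a) (b - a) = r - a := by omega
    have hpl : (piece (A.key m u ℓ) a r).map (fun c => (c.1, c.2 - c.1)) =
        if A.Branches u ℓ a (r - a) then [(a, r - a)] else [] := by
      have := A.branches_iff (h := a) (j := r - a) u hm (by omega)
      rw [show a + (r - a) = r by omega] at this
      unfold piece
      simp only [this]
      split <;> simp
    have hpr : (piece (A.key m u ℓ) (r + 1) b).map (fun c => (c.1, c.2 - c.1)) =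
        if A.Branches u ℓ (r + 1) (b - a - (r - a) - 1) then [(r + 1, b - a - (r - a) - 1)] else [] := by
      have := A.branches_iff (h := r + 1) (j := b - a - (r - a) - 1) u hm (by omega)
      rw [show r + 1 + (b - a - (r - a) - 1) = b by omega] at this
      unfold piece
      simp only [this]
      split
      · simp; omega
      · simp
    simp only [List.map_cons, scan, bfs]
    rw [hr, hf, ← hpl, ← hpr, ← List.map_append, ← List.map_append]
    congr 1
    refine scan_eq_bfs A u hm f _ fun c hc => ?_
    rw [List.mem_append, List.mem_append] at hc
    rcases hc with (hc | hc) | hc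
    · exact hU c (by simp [hc])
    · unfold piece at hc
      split at hc
      · obtain rfl : c = (a, r) := by simpa using hc
        exact ⟨h5, by simp only; omega, ‹_›⟩
      · simp at hc
    · unfold piece at hc
      split at hc
      · obtain rfl : c = (r + 1, b) := by simpa using hc
        exact ⟨by simp only; omega, by simp only; omega, ‹_›⟩
      · simp at hc

theorem mem_piece {k : ℕ → ℕ} {a b : ℕ} {c : ℕ × ℕ} :
    c ∈ piece k a b ↔ c = (a, b) ∧ topPos k a b ≠ 0 := by
  unfold piece
  split <;> simp_all

/-- The intervals in the queue stay disjoint. A step outputs one position of an interval and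
replaces the interval by the rest of it; a part that is not appended contains only zeros of `k`. The
total length of the intervals drops at each step, which is why fuel equal to it suffices. -/
theorem bfs_spec (k : ℕ → ℕ) : ∀ (f : ℕ) (U : List (ℕ × ℕ)), (∀ c ∈ U, topPos k c.1 c.2 ≠ 0) →
    U.Pairwise (fun c d => c.2 ≤ d.1 ∨ d.2 ≤ c.1) → (U.map fun c => c.2 - c.1).sum ≤ f →
    (bfs k f U).Nodup ∧ ∀ p, p ∈ bfs k f U ↔ k p ≠ 0 ∧ ∃ c ∈ U, c.1 ≤ p ∧ p < c.2
  | 0, U, h1, _, h3 => by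
    cases U with
    | nil => simp [bfs]
    | cons c U =>
      have := isTop_of_ne (h1 c (by simp))
      have h5 := this.le
      have h6 := this.lt
      simp only [List.map_cons, List.sum_cons] at h3
      omega
  | f + 1, [], _, _, _ => by simp [bfs]
  | f + 1, (a, b) :: U, h1, h2, h3 => by
    have ht := isTop_of_ne (h1 (a, b) (by simp))
    simp only at ht
    have h5 := ht.le
    have h6 := ht.lt
    simp only [bfs]
    set r := topPos k a b - 1
    rw [List.pairwise_cons] at h2
    have hl : ∀ c d : ℕ, ((piece k c d).map fun c => c.2 - c.1).sum ≤ d - c := by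
      intro c d
      unfold piece
      split <;> simp
    have hl1 := hl a r
    have hl2 := hl (r + 1) b
    have hmemU : ∀ c ∈ U ++ piece k a r ++ piece k (r + 1) b, c ∈ U ∨
        (c = (a, r) ∧ topPos k a r ≠ 0) ∨ (c = (r + 1, b) ∧ topPos k (r + 1) b ≠ 0) := by
      intro c hc
      rw [List.mem_append, List.mem_append, mem_piece, mem_piece] at hc
      tauto
    obtain ⟨ih1, ih2⟩ := bfs_spec k f (U ++ piece k a r ++ piece k (r + 1) b)
      (by
        intro c hc
        rcases hmemU c hc with h | ⟨rfl, h⟩ | ⟨rfl, h⟩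
        · exact h1 c (by simp [h])
        · exact h
        · exact h)
      (by
        have hsing : ∀ c d : ℕ, (piece k c d).Pairwise fun c d => c.2 ≤ d.1 ∨ d.2 ≤ c.1 := by
          intro c d
          unfold piece
          split <;> simp
        rw [List.pairwise_append, List.pairwise_append]
        refine ⟨⟨h2.2, hsing _ _, ?_⟩, hsing _ _, ?_⟩
        · intro c hc d hd
          obtain ⟨rfl, _⟩ := mem_piece.1 hd
          have := h2.1 c hc
          simp only at this ⊢
          omega
        · intro c hc d hd
          obtain ⟨rfl, _⟩ := mem_piece.1 hd
          rcases List.mem_append.1 hc with hc | hc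
          · have := h2.1 c hc
            simp only at this ⊢
            omega
          · obtain ⟨rfl, _⟩ := mem_piece.1 hc
            simp only
            omega)
      (by
        simp only [List.map_append, List.sum_append, List.map_cons, List.sum_cons] at h3 ⊢
        omega)
    refine ⟨List.nodup_cons.2 ⟨fun hr => ?_, ih1⟩, fun p => ?_⟩
    · obtain ⟨_, c, hc, h7, h8⟩ := (ih2 r).1 hr
      rcases hmemU c hc with h | ⟨rfl, h⟩ | ⟨rfl, h⟩
      · have := h2.1 c h
        simp only at this
        omega
      · simp only at h8; omega
      · simp only at h7; omega
    · rw [List.mem_cons, ih2]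
      constructor
      · rintro (rfl | ⟨h7, c, hc, h8, h9⟩)
        · exact ⟨ht.ne, (a, b), by simp, h5, h6⟩
        · refine ⟨h7, ?_⟩
          rcases hmemU c hc with h | ⟨rfl, h⟩ | ⟨rfl, h⟩
          · exact ⟨c, by simp [h], h8, h9⟩
          · simp only at h8 h9
            exact ⟨(a, b), by simp, h8, by simp only; omega⟩
          · simp only at h8 h9
            exact ⟨(a, b), by simp, by simp only; omega, h9⟩
      · rintro ⟨h7, c, hc, h8, h9⟩
        rcases List.mem_cons.1 hc with rfl | hc
        · simp only at h8 h9
          rcases lt_trichotomy p r with h | h | h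
          · right
            refine ⟨h7, (a, r), ?_, h8, h⟩
            simp only [List.mem_append, mem_piece, true_and]
            left; right
            intro h0
            exact h7 (topPos_eq_zero_iff.1 h0 p h8 h)
          · exact Or.inl h
          · right
            refine ⟨h7, (r + 1, b), ?_, h, h9⟩
            simp only [List.mem_append, mem_piece, true_and]
            right
            intro h0
            exact h7 (topPos_eq_zero_iff.1 h0 p h h9)
        · exact Or.inr ⟨h7, c, by simp [hc], h8, h9⟩

/-- The branching vertices in the order in which they are processed. -/
noncomputable def order (A : PCA n σ) (m : ℕ) (u : Fin n) (ℓ : ℕ) : List ℕ :=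
  bfs (A.key m u ℓ) ℓ (piece (A.key m u ℓ) 0 ℓ)

theorem order_nodup (A : PCA n σ) (m : ℕ) (u : Fin n) (ℓ : ℕ) : (A.order m u ℓ).Nodup :=
  (bfs_spec _ ℓ _ (by intro c hc; obtain ⟨rfl, h⟩ := mem_piece.1 hc; exact h)
    (by unfold piece; split <;> simp) (by unfold piece; split <;> simp)).1

theorem mem_order {A : PCA n σ} {m : ℕ} {u : Fin n} {ℓ p : ℕ} :
    p ∈ A.order m u ℓ ↔ p < ℓ ∧ A.key m u ℓ p ≠ 0 := by
  rw [order, (bfs_spec _ ℓ _ (by intro c hc; obtain ⟨rfl, h⟩ := mem_piece.1 hc; exact h)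
    (by unfold piece; split <;> simp) (by unfold piece; split <;> simp)).2]
  constructor
  · rintro ⟨h1, c, hc, _, h2⟩
    obtain ⟨rfl, _⟩ := mem_piece.1 hc
    exact ⟨h2, h1⟩
  · rintro ⟨h1, h2⟩
    exact ⟨h2, (0, ℓ), mem_piece.2 ⟨rfl, fun h => h2 (topPos_eq_zero_iff.1 h p (by omega) h1)⟩,
      by simp, h1⟩

theorem scan_eq_order (A : PCA n σ) {m ℓ : ℕ} (u : Fin n) (hm : ℓ ≤ m) (h : A.Branches u ℓ 0 ℓ) :
    A.scan u ℓ ℓ [(0, ℓ)] = A.order m u ℓ := by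
  have h1 := (A.branches_iff u hm (by omega)).1 h
  rw [zero_add] at h1
  have := A.scan_eq_bfs u hm ℓ [(0, ℓ)] (by simpa using h1)
  simpa [order, piece, h1] using this

end PCA

/-! ### Positions in the enumeration -/

namespace PCA

variable {n σ : ℕ}

/-- In a list sorted by length, stopping at the first edge that is too short discards exactly the
edges that are too short. -/
theorem takeWhile_eq_filter {α : Type*} {p : α → Bool} : ∀ {l : List α},
    l.Pairwise (fun a b => p b = true → p a = true) → l.takeWhile p = l.filter p
  | [], _ => rfl
  | a :: l, h => by
    rw [List.pairwise_cons] at h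
    by_cases ha : p a = true
    · rw [List.takeWhile_cons_of_pos ha, List.filter_cons_of_pos ha, takeWhile_eq_filter h.2]
    · rw [List.takeWhile_cons_of_neg ha, List.filter_cons_of_neg ha, eq_comm, List.filter_eq_nil_iff]
      exact fun b hb hpb => ha (h.1 b hb hpb)

open Classical in
theorem sum_map_eq_sum_ite {d : List (Fin σ)} (hd : d.Nodup) {P : Fin σ → Prop}
    (hP : ∀ a, a ∈ d ↔ P a) (w : Fin σ → ℕ) : (d.map w).sum = ∑ a, if P a then w a else 0 := by
  rw [← List.sum_toFinset w hd, ← Finset.sum_filter]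
  refine Finset.sum_congr ?_ fun _ _ => rfl
  ext a
  simp [hP]

theorem sum_flatMap {α : Type*} (f : α → List ℕ) :
    ∀ l : List α, (l.flatMap f).sum = (l.map fun a => (f a).sum).sum
  | [] => rfl
  | a :: l => by simp [sum_flatMap f l]

theorem getElem?_flatMap_append {α β : Type*} (f : α → List β) (c : α) (l₂ : List α) :
    ∀ (l₁ : List α) {r : ℕ}, r < (f c).length →
      ((l₁ ++ c :: l₂).flatMap f)[(l₁.map fun c => (f c).length).sum + r]? = (f c)[r]?
  | [], r, hr => by
    simp only [List.nil_append, List.flatMap_cons, List.map_nil, List.sum_nil, zero_add]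
    rw [List.getElem?_append_left hr]
  | d :: l₁, r, hr => by
    simp only [List.cons_append, List.flatMap_cons, List.map_cons, List.sum_cons, add_assoc]
    rw [List.getElem?_append_right (Nat.le_add_right _ _), Nat.add_sub_cancel_left]
    exact getElem?_flatMap_append f c l₂ l₁ hr

/-- The first branching vertex to be processed. -/
noncomputable def top (A : PCA n σ) (m : ℕ) (u : Fin n) (ℓ : ℕ) : ℕ := topPos (A.key m u ℓ) 0 ℓ - 1

/-- The edges at distance `p` that are not treated when this vertex is processed. -/
def Skip (A : PCA n σ) (m : ℕ) (u : Fin n) (ℓ p : ℕ) (a : Fin σ) : Prop :=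
  (A.edges (A.defaultAt u p))[0]? = some a ∨
    (p = A.top m u ℓ ∧ (A.edges (A.defaultAt u p))[1]? = some a)

/-- The number of walks of length `ℓ` that leave the default walk at distance `p` along `a`. -/
noncomputable def wt (A : PCA n σ) (u : Fin n) (ℓ p : ℕ) (a : Fin σ) : ℕ :=
  A.cnt (ℓ - 1 - p) (A.target (A.defaultAt u p) a)

open Classical in
/-- The number of strings output while the vertex at distance `p` is processed. -/
noncomputable def weight (A : PCA n σ) (m : ℕ) (u : Fin n) (ℓ p : ℕ) : ℕ :=
  ∑ a : Fin σ, if (A.step (A.defaultAt u p) a).isSome ∧ ¬ A.Skip m u ℓ p a then A.wt u ℓ p a else 0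

open Classical in
/-- The number of these strings that are output before those for the edge `b`. -/
noncomputable def pre (A : PCA n σ) (m : ℕ) (u : Fin n) (ℓ p : ℕ) (b : Fin σ) : ℕ :=
  ∑ a : Fin σ, if ((A.step (A.defaultAt u p) a).isSome ∧ ¬ A.Skip m u ℓ p a) ∧
    (A.Before (A.defaultAt u p) a b ∧ a ≠ b) then A.wt u ℓ p a else 0

theorem defaultAt_zero_top (A : PCA n σ) {m ℓ : ℕ} (u : Fin n) (hm : ℓ ≤ m)
    (h : topPos (A.key m u ℓ) 0 ℓ ≠ 0) : A.maxPos u ℓ = A.top m u ℓ := by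
  have := A.add_maxPos_eq (h := 0) (j := ℓ) u hm (by omega) (by rwa [zero_add])
  rwa [zero_add, zero_add, defaultAt_zero] at this

theorem order_eq_cons (A : PCA n σ) {m ℓ : ℕ} (u : Fin n) (hℓ : 0 < ℓ)
    (h : topPos (A.key m u ℓ) 0 ℓ ≠ 0) :
    A.order m u ℓ = A.top m u ℓ :: (A.order m u ℓ).drop 1 := by
  obtain ⟨k, rfl⟩ := Nat.exists_eq_add_of_lt hℓ
  unfold order
  rw [piece, if_pos h, zero_add]
  simp [bfs, top]

theorem getElem?_zero_of_one {α : Type*} {l : List α} {b : α} (h : l[1]? = some b) :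
    ∃ c, l[0]? = some c := by
  cases l with
  | nil => simp at h
  | cons c l => exact ⟨c, rfl⟩

theorem exists_second {A : PCA n σ} {m ℓ p : ℕ} {u : Fin n} (h : A.key m u ℓ p ≠ 0) :
    ∃ b, (A.edges (A.defaultAt u p))[1]? = some b := by
  cases hb : (A.edges (A.defaultAt u p))[1]? with
  | some b => exact ⟨b, rfl⟩
  | none => simp [key, brC, hb] at h

theorem key_ne_zero_of_second {A : PCA n σ} {m ℓ p : ℕ} {u : Fin n} {b : Fin σ} (hm : ℓ ≤ m)
    (hb : (A.edges (A.defaultAt u p))[1]? = some b) :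
    A.key m u ℓ p ≠ 0 ↔ (ℓ : ℕ∞) ≤ p + A.edgeLen (A.defaultAt u p) b := by
  rw [key_ne_zero_iff A u p hm, deviation, branchLen, hb]
  exact WithBot.coe_le_coe

/-- The edge leads to a walk of total length at least `ℓ`. -/
def Good (A : PCA n σ) (u : Fin n) (ℓ p : ℕ) (a : Fin σ) : Prop :=
  (ℓ : ℕ∞) ≤ (p : ℕ∞) + A.edgeLen (A.defaultAt u p) a

theorem good_iff (A : PCA n σ) {u : Fin n} {ℓ p : ℕ} {a : Fin σ} (hp : p < ℓ) :
    A.Good u ℓ p a ↔ ((ℓ - 1 - p : ℕ) : ℕ∞) ≤ A.longest (A.target (A.defaultAt u p) a) := by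
  rw [Good, ← le_edgeLen_iff, show ℓ = p + (ℓ - 1 - p + 1) by omega]
  rw [Nat.cast_add p, ENat.add_le_add_iff_left (by simp)]
  rw [show p + (ℓ - 1 - p + 1) - 1 - p + 1 = ℓ - 1 - p + 1 by omega]

/-- An edge passes the length test exactly if its block is nonempty. Sums of block sizes may
therefore run over all edges, whether or not they are called. -/
theorem good_iff_wt (A : PCA n σ) {u : Fin n} {ℓ p : ℕ} {a : Fin σ} (hp : p < ℓ) :
    A.Good u ℓ p a ↔ 0 < A.wt u ℓ p a := by
  rw [A.good_iff hp, wt, cnt_pos_iff]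

theorem good_of_before {A : PCA n σ} {u : Fin n} {ℓ p : ℕ} {a b : Fin σ}
    (h : A.Before (A.defaultAt u p) a b) (hb : A.Good u ℓ p b) : A.Good u ℓ p a := by
  refine hb.trans (add_le_add le_rfl ?_)
  rcases h with h | h
  · exact h.le
  · exact h.1.le

open Classical in
theorem exits_eq (A : PCA n σ) (u : Fin n) (ℓ p x : ℕ) :
    A.exits u ℓ p x = (((A.edges (A.defaultAt u p)).drop x).filter
      fun b => A.Good u ℓ p b).map fun b => (p, b) := by
  unfold exits
  rw [takeWhile_eq_filter]
  · congr 1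
    refine List.filter_congr fun b _ => ?_
    simp only [Good]
    congr
  · refine ((A.edges_pairwise _).sublist (List.drop_sublist _ _)).imp fun {a b} h => ?_
    simp only [decide_eq_true_eq]
    exact good_of_before h

/-- The number of edges skipped at distance `p`. -/
noncomputable def skips (A : PCA n σ) (m : ℕ) (u : Fin n) (ℓ p : ℕ) : ℕ :=
  if p = A.top m u ℓ then 2 else 1

theorem calls_eq_nil (A : PCA n σ) {m ℓ : ℕ} (u : Fin n) (hm : ℓ ≤ m)
    (h : topPos (A.key m u ℓ) 0 ℓ = 0) : A.calls u ℓ = [] := by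
  have := A.branches_iff (h := 0) (j := ℓ) u hm (by omega)
  rw [zero_add] at this
  rw [calls, if_neg (by rw [this]; simpa using h)]

/-- The root is the first position of the order, so the three parts of `calls` merge into one pass
over the order, which skips two edges at the root and one elsewhere, followed by the saved edge. -/
theorem calls_eq (A : PCA n σ) {m ℓ : ℕ} (u : Fin n) (hm : ℓ ≤ m) (hℓ : 0 < ℓ)
    (h : topPos (A.key m u ℓ) 0 ℓ ≠ 0) {b : Fin σ}
    (hb : (A.edges (A.defaultAt u (A.top m u ℓ)))[1]? = some b) :
    A.calls u ℓ = (A.order m u ℓ).flatMap (fun p => A.exits u ℓ p (A.skips m u ℓ p)) ++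
      [(A.top m u ℓ, b)] := by
  classical
  have hbr := A.branches_iff (h := 0) (j := ℓ) u hm (by omega)
  rw [zero_add] at hbr
  have hbr := hbr.2 h
  have htop := isTop_of_ne h
  have hgood : A.Good u ℓ (A.top m u ℓ) b := (key_ne_zero_of_second hm hb).1 htop.ne
  rw [calls, if_pos hbr, A.defaultAt_zero_top u hm h, A.scan_eq_order u hm hbr]
  have hlast : (A.exits u ℓ (A.top m u ℓ) 1).take 1 = [(A.top m u ℓ, b)] := by
    rw [exits_eq]
    have hd : (A.edges (A.defaultAt u (A.top m u ℓ))).drop 1 =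
        b :: (A.edges (A.defaultAt u (A.top m u ℓ))).drop 2 := by
      obtain ⟨h1, h2⟩ := List.getElem?_eq_some_iff.1 hb
      rw [List.drop_eq_getElem_cons h1, h2]
    rw [hd, List.filter_cons_of_pos (by simpa using hgood)]
    simp
  have hnd := A.order_nodup m u ℓ
  have hcons := A.order_eq_cons u hℓ h
  have hrest : ((A.order m u ℓ).drop 1).flatMap (fun p => A.exits u ℓ p 1) =
      ((A.order m u ℓ).drop 1).flatMap (fun p => A.exits u ℓ p (A.skips m u ℓ p)) := by
    refine List.flatMap_congr fun p hp => ?_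
    -- The root does not occur again in the order, so only the default edge is skipped from here on.
    rw [hcons, List.nodup_cons] at hnd
    rw [skips, if_neg]
    rintro rfl
    exact hnd.1 hp
  simp only
  rw [hlast, hrest]
  conv_rhs => rw [hcons, List.flatMap_cons]
  simp [skips]

theorem mem_drop_one {α : Type*} {l : List α} (h : l.Nodup) {a : α} :
    a ∈ l.drop 1 ↔ a ∈ l ∧ l[0]? ≠ some a := by
  cases l with
  | nil => simp
  | cons c l =>
    have := (List.nodup_cons.1 h).1
    simp only [List.drop_succ_cons, List.drop_zero, List.mem_cons, List.getElem?_cons_zero, ne_eq,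
      Option.some.injEq]
    constructor
    · intro ha; exact ⟨Or.inr ha, fun hc => this (hc ▸ ha)⟩
    · rintro ⟨h1 | h1, h2⟩
      · exact absurd h1.symm h2
      · exact h1

theorem mem_drop_two {α : Type*} {l : List α} (h : l.Nodup) {a : α} :
    a ∈ l.drop 2 ↔ a ∈ l ∧ l[0]? ≠ some a ∧ l[1]? ≠ some a := by
  rw [show 2 = 1 + 1 from rfl, ← List.drop_drop, mem_drop_one (h.sublist (List.drop_sublist _ _)),
    mem_drop_one h]
  simp [and_assoc]

theorem mem_drop_skips (A : PCA n σ) (m : ℕ) (u : Fin n) (ℓ p : ℕ) (a : Fin σ) :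
    a ∈ (A.edges (A.defaultAt u p)).drop (A.skips m u ℓ p) ↔
      (A.step (A.defaultAt u p) a).isSome ∧ ¬ A.Skip m u ℓ p a := by
  have hn := A.edges_nodup (A.defaultAt u p)
  unfold skips Skip
  split
  · rw [mem_drop_two hn, mem_edges]; tauto
  · rw [mem_drop_one hn, mem_edges]; tauto

theorem sum_filter_good (A : PCA n σ) {u : Fin n} {ℓ p : ℕ} (hp : p < ℓ) [DecidablePred (A.Good u ℓ p)] :
    ∀ d : List (Fin σ), ((d.filter fun b => A.Good u ℓ p b).map (A.wt u ℓ p)).sum =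
      (d.map (A.wt u ℓ p)).sum
  | [] => rfl
  | a :: d => by
    by_cases h : A.Good u ℓ p a
    · rw [List.filter_cons_of_pos (by simpa using h)]
      simp [sum_filter_good A hp d]
    · rw [List.filter_cons_of_neg (by simpa using h), sum_filter_good A hp d]
      rw [A.good_iff_wt hp] at h
      simp [Nat.eq_zero_of_not_pos h]

theorem sum_exits (A : PCA n σ) {m : ℕ} {u : Fin n} {ℓ p : ℕ} (hp : p < ℓ) :
    ((A.exits u ℓ p (A.skips m u ℓ p)).map fun c => A.wt u ℓ c.1 c.2).sum = A.weight m u ℓ p := by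
  classical
  rw [exits_eq, List.map_map]
  have := A.sum_filter_good (u := u) hp ((A.edges (A.defaultAt u p)).drop (A.skips m u ℓ p))
  refine this.trans ?_
  rw [sum_map_eq_sum_ite ((A.edges_nodup _).sublist (List.drop_sublist _ _))
    (A.mem_drop_skips m u ℓ p), weight]
  exact Finset.sum_congr rfl fun a _ => by congr

/-- The list is sorted and free of repetitions, so the entries in front of `b` are the treated edges
that strictly precede `b`; those removed by the length test have weight 0. -/
theorem exits_split (A : PCA n σ) {m : ℕ} {u : Fin n} {ℓ p : ℕ} {b : Fin σ} (hp : p < ℓ)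
    (hb : (A.step (A.defaultAt u p) b).isSome) (hs : ¬ A.Skip m u ℓ p b) (hg : 0 < A.wt u ℓ p b) :
    ∃ l₁ l₂, A.exits u ℓ p (A.skips m u ℓ p) = l₁ ++ (p, b) :: l₂ ∧
      (l₁.map fun c => A.wt u ℓ c.1 c.2).sum = A.pre m u ℓ p b := by
  classical
  have hmem := (A.mem_drop_skips m u ℓ p b).2 ⟨hb, hs⟩
  obtain ⟨d₁, d₂, hd⟩ := List.append_of_mem hmem
  have hsub := List.drop_sublist (A.skips m u ℓ p) (A.edges (A.defaultAt u p))
  have hnd := (A.edges_nodup _).sublist hsub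
  have hpw := (A.edges_pairwise _).sublist hsub
  have hm : ∀ a, a ∈ d₁ ↔ ((A.step (A.defaultAt u p) a).isSome ∧ ¬ A.Skip m u ℓ p a) ∧
      (A.Before (A.defaultAt u p) a b ∧ a ≠ b) := by
    intro a
    rw [← mem_drop_skips, hd]
    rw [hd, List.pairwise_append] at hpw
    rw [hd, List.nodup_append] at hnd
    constructor
    · intro ha
      exact ⟨by simp [ha], hpw.2.2 a ha b (by simp), hnd.2.2 a ha b (by simp)⟩
    · rintro ⟨h1, h2, h3⟩
      rw [List.mem_append, List.mem_cons] at h1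
      rcases h1 with h1 | h1 | h1
      · exact h1
      · exact absurd h1 h3
      · exact absurd (before_antisymm h2 ((List.pairwise_cons.1 hpw.2.1).1 a h1)) h3
  refine ⟨(d₁.filter fun b => A.Good u ℓ p b).map fun b => (p, b),
    (d₂.filter fun b => A.Good u ℓ p b).map fun b => (p, b), ?_, ?_⟩
  · rw [exits_eq, hd, List.filter_append,
      List.filter_cons_of_pos (by simpa using (A.good_iff_wt hp).2 hg)]
    simp
  · rw [List.map_map]
    refine (A.sum_filter_good (u := u) hp d₁).trans ?_
    have hnd' : d₁.Nodup := by rw [hd] at hnd; exact (List.nodup_append.1 hnd).1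
    rw [sum_map_eq_sum_ite hnd' hm, pre]
    exact Finset.sum_congr rfl fun a _ => by congr

/-! ### The output of a call as a concatenation of blocks -/

/-- The strings output by a recursive call. -/
noncomputable def block (A : PCA n σ) (u : Fin n) (ℓ : ℕ) (c : ℕ × Fin σ) : List (List (Fin σ)) :=
  (A.enumFrom (A.target (A.defaultAt u c.1) c.2) (ℓ - 1 - c.1)).map fun z =>
    A.defaultWord u c.1 ++ c.2 :: z

theorem enumFrom_eq (A : PCA n σ) (u : Fin n) {ℓ : ℕ} (hℓ : 0 < ℓ) :
    A.enumFrom u ℓ = A.defaultWord u ℓ :: (A.calls u ℓ).flatMap (A.block u ℓ) := by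
  obtain ⟨k, rfl⟩ := Nat.exists_eq_add_of_lt hℓ
  rw [zero_add, enumFrom]
  rfl

theorem mem_calls {A : PCA n σ} {m ℓ : ℕ} {u : Fin n} (hm : ℓ ≤ m) (hℓ : 0 < ℓ) {c : ℕ × Fin σ}
    (hc : c ∈ A.calls u ℓ) : c.1 < ℓ ∧ (A.step (A.defaultAt u c.1) c.2).isSome ∧
      (A.edges (A.defaultAt u c.1))[0]? ≠ some c.2 ∧ A.Good u ℓ c.1 c.2 := by
  classical
  by_cases h : topPos (A.key m u ℓ) 0 ℓ = 0
  · rw [A.calls_eq_nil u hm h] at hc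
    simp at hc
  have htop := isTop_of_ne h
  obtain ⟨b, hb⟩ := exists_second htop.ne
  rw [A.calls_eq u hm hℓ h hb, List.mem_append, List.mem_singleton, List.mem_flatMap] at hc
  rcases hc with ⟨p, hp, hc⟩ | rfl
  · have hpl := (mem_order.1 hp).1
    rw [exits_eq, List.mem_map] at hc
    obtain ⟨a, ha, rfl⟩ := hc
    rw [List.mem_filter, mem_drop_skips] at ha
    exact ⟨hpl, ha.1.1, fun h => ha.1.2 (Or.inl h), by simpa using ha.2⟩
  · obtain ⟨c, hc⟩ := getElem?_zero_of_one hb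
    have h1 := ((getElem?_edges_one hc).1 hb).1
    refine ⟨htop.lt, h1.1, ?_, (key_ne_zero_of_second hm hb).1 htop.ne⟩
    intro h0
    exact h1.2 (Option.some.inj (h0.symm.trans hc))

/-- Neither the order of the vertices nor the list of a vertex has repetitions, and the saved edge
is among the skipped ones. -/
theorem calls_nodup (A : PCA n σ) {m ℓ : ℕ} (u : Fin n) (hm : ℓ ≤ m) (hℓ : 0 < ℓ) :
    (A.calls u ℓ).Nodup := by
  classical
  by_cases h : topPos (A.key m u ℓ) 0 ℓ = 0
  · rw [A.calls_eq_nil u hm h]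
    exact List.nodup_nil
  obtain ⟨b, hb⟩ := exists_second (isTop_of_ne h).ne
  rw [A.calls_eq u hm hℓ h hb, List.nodup_append]
  refine ⟨?_, by simp, ?_⟩
  · rw [List.nodup_flatMap]
    refine ⟨fun p _ => ?_, ?_⟩
    · rw [exits_eq]
      refine List.Nodup.map (fun a b h => (Prod.ext_iff.1 h).2) (List.Nodup.filter _ ?_)
      exact (A.edges_nodup _).sublist (List.drop_sublist _ _)
    · refine (A.order_nodup m u ℓ).imp fun {p q} hpq => ?_
      rw [Function.onFun, List.disjoint_left]
      intro c hc hd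
      rw [exits_eq, List.mem_map] at hc hd
      obtain ⟨a, _, rfl⟩ := hc
      obtain ⟨a', _, h'⟩ := hd
      exact hpq (Prod.ext_iff.1 h').1.symm
  · intro c hc d hd
    rw [List.mem_singleton] at hd
    subst hd
    rintro rfl
    rw [List.mem_flatMap] at hc
    obtain ⟨p, hp, hc⟩ := hc
    rw [exits_eq, List.mem_map] at hc
    obtain ⟨a, ha, he⟩ := hc
    rw [Prod.mk.injEq] at he
    obtain ⟨rfl, rfl⟩ := he
    rw [List.mem_filter, mem_drop_skips] at ha
    exact ha.1.2 (Or.inr ⟨rfl, hb⟩)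

theorem natCast_le_longest_of_le {A : PCA n σ} {u : Fin n} {p ℓ : ℕ} (h : (ℓ : ℕ∞) ≤ A.longest u)
    (hp : p ≤ ℓ) : (p : ℕ∞) ≤ A.longest u := le_trans (by exact_mod_cast hp) h

theorem mem_enumFrom (A : PCA n σ) (ℓ : ℕ) : ∀ (u : Fin n), (ℓ : ℕ∞) ≤ A.longest u →
    ∀ x ∈ A.enumFrom u ℓ, A.IsWalk u x ∧ x.length = ℓ := by
  induction ℓ using Nat.strong_induction_on with
  | _ ℓ ih =>
    intro u hu x hx
    rcases Nat.eq_zero_or_pos ℓ with rfl | hℓ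
    · rw [enumFrom] at hx
      obtain rfl : x = [] := by simpa using hx
      exact ⟨A.isWalk_nil u, rfl⟩
    · rw [A.enumFrom_eq u hℓ, List.mem_cons, List.mem_flatMap] at hx
      rcases hx with rfl | ⟨⟨p, b⟩, hc, hx⟩
      · refine ⟨?_, length_defaultWord hu⟩
        have := (isWalk_defaultWord_append hu []).2 (A.isWalk_nil _)
        rwa [List.append_nil] at this
      · obtain ⟨hp, hs, _, hg⟩ := mem_calls le_rfl hℓ hc
        simp only at hp hs hg
        have hup := natCast_le_longest_of_le hu hp.le
        rw [block, List.mem_map] at hx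
        obtain ⟨z, hz, rfl⟩ := hx
        obtain ⟨h1, h2⟩ := ih _ (by omega) _ ((A.good_iff hp).1 hg) z hz
        constructor
        · rw [isWalk_defaultWord_append hup, isWalk_cons]
          exact ⟨_, step_eq_target hs, h1⟩
        · simp only [List.length_append, List.length_cons, length_defaultWord hup, h2]
          omega

/-- The two strings differ in the letter at position `p`: one has `b`, the other the default letter,
because its default part is longer. -/
theorem deviation_ne {A : PCA n σ} {u : Fin n} {ℓ p q : ℕ} {b : Fin σ} {z y : List (Fin σ)}
    (hu : (ℓ : ℕ∞) ≤ A.longest u) (hp : p < q) (hq : q ≤ ℓ)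
    (hb : (A.edges (A.defaultAt u p))[0]? ≠ some b) :
    A.defaultWord u p ++ b :: z ≠ A.defaultWord u q ++ y := by
  intro h
  have hup := natCast_le_longest_of_le hu (by omega : p ≤ ℓ)
  have huq := natCast_le_longest_of_le hu hq
  have h1 : (A.defaultWord u p ++ b :: z)[p]? = (A.defaultWord u q ++ y)[p]? := by rw [h]
  rw [List.getElem?_append_right (by rw [length_defaultWord hup]), length_defaultWord hup,
    List.getElem?_append_left (by rw [length_defaultWord huq]; exact hp),
    getElem?_defaultWord huq hp] at h1
  rw [Nat.sub_self, List.getElem?_cons_zero] at h1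
  exact hb h1.symm

/-- Strings of different blocks leave the default walk at different distances (`deviation_ne`), or
at the same distance with different letters. -/
theorem enumFrom_nodup (A : PCA n σ) (ℓ : ℕ) : ∀ (u : Fin n), (ℓ : ℕ∞) ≤ A.longest u →
    (A.enumFrom u ℓ).Nodup := by
  induction ℓ using Nat.strong_induction_on with
  | _ ℓ ih =>
    intro u hu
    rcases Nat.eq_zero_or_pos ℓ with rfl | hℓ
    · rw [enumFrom]; simp
    rw [A.enumFrom_eq u hℓ, List.nodup_cons, List.nodup_flatMap]
    refine ⟨fun hd => ?_, fun c hc => ?_, ?_⟩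
    · rw [List.mem_flatMap] at hd
      obtain ⟨c, hc, hd⟩ := hd
      obtain ⟨hp, _, hb, _⟩ := mem_calls le_rfl hℓ hc
      rw [block, List.mem_map] at hd
      obtain ⟨z, _, hz⟩ := hd
      exact deviation_ne (y := []) hu hp le_rfl hb (by rw [List.append_nil]; exact hz)
    · obtain ⟨hp, _, _, hg⟩ := mem_calls le_rfl hℓ hc
      refine List.Nodup.map (fun y z h => ?_) (ih _ (by omega) _ ((A.good_iff hp).1 hg))
      simpa using h
    · refine (A.calls_nodup u (le_refl ℓ) hℓ).imp_of_mem fun {c d} hc hd hcd => ?_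
      rw [Function.onFun, List.disjoint_left]
      intro x hx hx'
      obtain ⟨hp, _, hb, _⟩ := mem_calls le_rfl hℓ hc
      obtain ⟨hp', _, hb', _⟩ := mem_calls le_rfl hℓ hd
      rw [block, List.mem_map] at hx hx'
      obtain ⟨z, _, rfl⟩ := hx
      obtain ⟨z', _, hz⟩ := hx'
      rcases lt_trichotomy c.1 d.1 with h | h | h
      · exact deviation_ne hu h hp'.le hb hz.symm
      · rw [h] at hz
        have := List.append_cancel_left hz
        rw [List.cons.injEq] at this
        exact hcd (Prod.ext h this.1.symm)
      · exact deviation_ne hu h hp.le hb' hz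

/-! ### Weights as differences of numbers of walks -/

theorem sum_split_default (A : PCA n σ) {u : Fin n} {ℓ p : ℕ} (hu : (ℓ : ℕ∞) ≤ A.longest u)
    (hp : p < ℓ) [DecidablePred fun a => (A.edges (A.defaultAt u p))[0]? = some a] :
    A.cnt (ℓ - p) (A.defaultAt u p) = A.cnt (ℓ - (p + 1)) (A.defaultAt u (p + 1)) +
      ∑ a : Fin σ, if (A.step (A.defaultAt u p) a).isSome ∧
        ¬ (A.edges (A.defaultAt u p))[0]? = some a then A.wt u ℓ p a else 0 := by
  obtain ⟨c, hc⟩ := exists_default_at hu hp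
  rw [show ℓ - p = ℓ - 1 - p + 1 by omega, cnt, defaultAt_succ, next_eq hc,
    show ℓ - (p + 1) = ℓ - 1 - p by omega]
  have h1 : A.cnt (ℓ - 1 - p) (A.target (A.defaultAt u p) c) = ∑ a : Fin σ,
      if a = c then A.wt u ℓ p a else 0 := by simp [wt]
  rw [h1, ← Finset.sum_add_distrib]
  refine Finset.sum_congr rfl fun a _ => ?_
  by_cases hac : a = c
  · subst hac
    simp [(getElem?_edges_zero.1 hc).1, hc, wt]
  · have : ¬ some c = some a := by simpa using Ne.symm hac
    simp [hac, hc, wt, this]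

/-- Away from the first branching vertex, the weight is a difference of numbers of walks. -/
theorem weight_of_ne_top (A : PCA n σ) {m ℓ p : ℕ} {u : Fin n} (hu : (ℓ : ℕ∞) ≤ A.longest u)
    (hp : p < ℓ) (h : p ≠ A.top m u ℓ) :
    A.cnt (ℓ - p) (A.defaultAt u p) =
      A.cnt (ℓ - (p + 1)) (A.defaultAt u (p + 1)) + A.weight m u ℓ p := by
  classical
  rw [A.sum_split_default hu hp]
  simp [weight, Skip, h]

/-- At the first branching vertex, the second edge is left out. -/
theorem weight_top (A : PCA n σ) {m ℓ : ℕ} {u : Fin n} {b : Fin σ} (hu : (ℓ : ℕ∞) ≤ A.longest u)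
    (hp : A.top m u ℓ < ℓ) (hb : (A.edges (A.defaultAt u (A.top m u ℓ)))[1]? = some b) :
    A.cnt (ℓ - A.top m u ℓ) (A.defaultAt u (A.top m u ℓ)) =
      A.cnt (ℓ - (A.top m u ℓ + 1)) (A.defaultAt u (A.top m u ℓ + 1)) +
        (A.weight m u ℓ (A.top m u ℓ) + A.wt u ℓ (A.top m u ℓ) b) := by
  classical
  rw [A.sum_split_default hu hp]
  obtain ⟨c, hc⟩ := exists_default_at hu hp
  have h1 := ((getElem?_edges_one hc).1 hb).1
  have h2 : A.wt u ℓ (A.top m u ℓ) b = ∑ a : Fin σ,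
      if a = b then A.wt u ℓ (A.top m u ℓ) a else 0 := by simp
  rw [h2, weight, ← Finset.sum_add_distrib]
  congr 1
  refine Finset.sum_congr rfl fun a _ => ?_
  unfold Skip
  rw [hb, hc]
  by_cases hab : a = b
  · subst hab
    simp [h1.1, h1.2.symm]
  · simp [hab, Ne.symm hab]

theorem sum_calls (A : PCA n σ) {m ℓ : ℕ} {u : Fin n} {b : Fin σ} (hm : ℓ ≤ m) (hℓ : 0 < ℓ)
    (h : topPos (A.key m u ℓ) 0 ℓ ≠ 0)
    (hb : (A.edges (A.defaultAt u (A.top m u ℓ)))[1]? = some b) :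
    ((A.calls u ℓ).map fun c => A.wt u ℓ c.1 c.2).sum =
      ((A.order m u ℓ).map (A.weight m u ℓ)).sum + A.wt u ℓ (A.top m u ℓ) b := by
  rw [A.calls_eq u hm hℓ h hb, List.map_append, List.sum_append, List.map_flatMap, sum_flatMap]
  congr 1
  · congr 1
    refine List.map_congr_left fun p hp => ?_
    exact A.sum_exits (mem_order.1 hp).1

/-- If the key vanishes, even the longest non-default edge, which is the second in the list, leads
to no walk of length `ℓ`. Positions outside the order thus contribute nothing. -/
theorem weight_eq_zero {A : PCA n σ} {m ℓ p : ℕ} {u : Fin n} (hu : (ℓ : ℕ∞) ≤ A.longest u)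
    (hm : ℓ ≤ m) (hp : p < ℓ) (hk : A.key m u ℓ p = 0) {a : Fin σ}
    (ha : (A.step (A.defaultAt u p) a).isSome) (h0 : (A.edges (A.defaultAt u p))[0]? ≠ some a) :
    A.wt u ℓ p a = 0 := by
  by_contra hw
  have hg := (A.good_iff_wt hp).2 (Nat.pos_of_ne_zero hw)
  have hmem := (mem_drop_one (A.edges_nodup _)).2 ⟨mem_edges.2 ha, h0⟩
  obtain ⟨c, hc⟩ := exists_default_at hu hp
  obtain ⟨b, hb⟩ : ∃ b, (A.edges (A.defaultAt u p))[1]? = some b := by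
    have h1 := List.length_pos_of_mem hmem
    rw [List.length_drop] at h1
    exact ⟨_, List.getElem?_eq_getElem (by omega)⟩
  have h2 := ((getElem?_edges_one hc).1 hb).2 a ⟨ha, fun h => h0 (h ▸ hc)⟩
  exact (key_ne_zero_of_second hm hb).2 (good_of_before h2 hg) hk

/-- The numbers of walks telescope along the default walk; the remaining 1 counts the default walk
itself. -/
theorem sum_range_weights (A : PCA n σ) {ℓ : ℕ} {u : Fin n} (w : ℕ → ℕ) (hw : ∀ p < ℓ, A.cnt (ℓ - p) (A.defaultAt u p) =
      A.cnt (ℓ - (p + 1)) (A.defaultAt u (p + 1)) + w p) :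
    A.cnt ℓ u = 1 + ∑ p ∈ Finset.range ℓ, w p := by
  have key : ∀ k ≤ ℓ, A.cnt ℓ u = A.cnt (ℓ - k) (A.defaultAt u k) + ∑ p ∈ Finset.range k, w p := by
    intro k
    induction k with
    | zero => intro _; simp [defaultAt_zero]
    | succ k ih =>
      intro hk
      rw [ih (by omega), hw k (by omega), Finset.sum_range_succ]
      ring
  rw [key ℓ le_rfl, Nat.sub_self, cnt]

/-- The weight of the root leaves out the saved edge, whose block therefore appears as a separate
summand. -/
theorem cnt_eq (A : PCA n σ) {m ℓ : ℕ} {u : Fin n} (hm : ℓ ≤ m) (hu : (ℓ : ℕ∞) ≤ A.longest u) :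
    (topPos (A.key m u ℓ) 0 ℓ = 0 → A.cnt ℓ u = 1) ∧
    (topPos (A.key m u ℓ) 0 ℓ ≠ 0 → ∀ b,
      (A.edges (A.defaultAt u (A.top m u ℓ)))[1]? = some b →
      A.cnt ℓ u = 1 + ((A.order m u ℓ).map (A.weight m u ℓ)).sum + A.wt u ℓ (A.top m u ℓ) b) := by
  classical
  constructor
  · intro h
    rw [topPos_eq_zero_iff] at h
    rw [A.sum_range_weights (fun _ => 0)]
    · simp
    · intro p hp
      rw [A.sum_split_default hu hp]
      congr 1
      refine Finset.sum_eq_zero fun a _ => ?_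
      split
      · rename_i ha
        exact weight_eq_zero hu hm hp (h p (by omega) hp) ha.1 ha.2
      · rfl
  · intro h b hb
    have htop := isTop_of_ne h
    have hlt : A.top m u ℓ < ℓ := htop.lt
    rw [A.sum_range_weights (fun p => A.weight m u ℓ p +
      if p = A.top m u ℓ then A.wt u ℓ (A.top m u ℓ) b else 0)]
    · rw [Finset.sum_add_distrib, Finset.sum_ite_eq', if_pos (Finset.mem_range.2 hlt), add_assoc,
        ← List.sum_toFinset _ (A.order_nodup m u ℓ)]
      congr 2
      refine (Finset.sum_subset ?_ ?_).symm
      · intro p hp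
        exact Finset.mem_range.2 (mem_order.1 (List.mem_toFinset.1 hp)).1
      · intro p hp hp'
        rw [Finset.mem_range] at hp
        have hk : A.key m u ℓ p = 0 := by
          by_contra hk
          exact hp' (List.mem_toFinset.2 (mem_order.2 ⟨hp, hk⟩))
        refine Finset.sum_eq_zero fun a _ => ?_
        split
        · rename_i ha
          exact weight_eq_zero hu hm hp hk ha.1 fun h => ha.2 (Or.inl h)
        · rfl
    · intro p hp
      by_cases hpt : p = A.top m u ℓ
      · rw [if_pos hpt, hpt]
        exact A.weight_top hu hlt hb
      · rw [if_neg hpt, add_zero]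
        exact A.weight_of_ne_top hu hp hpt

/-- By induction the blocks have the sizes `wt`, and their sum agrees with the count of the walks by
the distance at which they leave the default walk. -/
theorem length_enumFrom (A : PCA n σ) (ℓ : ℕ) : ∀ (u : Fin n), (ℓ : ℕ∞) ≤ A.longest u →
    (A.enumFrom u ℓ).length = A.cnt ℓ u := by
  induction ℓ using Nat.strong_induction_on with
  | _ ℓ ih =>
    intro u hu
    rcases Nat.eq_zero_or_pos ℓ with rfl | hℓ
    · rw [enumFrom]; rfl
    rw [A.enumFrom_eq u hℓ, List.length_cons, List.length_flatMap]
    have h1 : (A.calls u ℓ).map (fun c => (A.block u ℓ c).length) =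
        (A.calls u ℓ).map fun c => A.wt u ℓ c.1 c.2 := by
      refine List.map_congr_left fun c hc => ?_
      obtain ⟨hp, _, _, hg⟩ := mem_calls le_rfl hℓ hc
      rw [block, List.length_map, ih _ (by omega) _ ((A.good_iff hp).1 hg), wt]
    rw [h1]
    -- The output does not depend on the parameter `m` of the keys, so the choice `m = ℓ` is free.
    by_cases h : topPos (A.key ℓ u ℓ) 0 ℓ = 0
    · rw [A.calls_eq_nil u le_rfl h, (A.cnt_eq le_rfl hu).1 h]
      rfl
    · obtain ⟨b, hb⟩ := exists_second (isTop_of_ne h).ne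
      rw [A.sum_calls le_rfl hℓ h hb, (A.cnt_eq le_rfl hu).2 h b hb]
      ring

/-! ### Positions of strings in the output -/

theorem length_block (A : PCA n σ) {u : Fin n} {ℓ : ℕ} {c : ℕ × Fin σ} (hp : c.1 < ℓ)
    (hg : A.Good u ℓ c.1 c.2) : (A.block u ℓ c).length = A.wt u ℓ c.1 c.2 := by
  rw [block, List.length_map, A.length_enumFrom _ _ ((A.good_iff hp).1 hg), wt]

theorem getElem?_enumFrom_zero (A : PCA n σ) {u : Fin n} {ℓ : ℕ} (hℓ : 0 < ℓ) :
    (A.enumFrom u ℓ)[0]? = some (A.defaultWord u ℓ) := by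
  rw [A.enumFrom_eq u hℓ]; rfl

/-- In front of the string there are the default walk (the 1), the complete blocks of the earlier
calls, and `r` strings of its own block. -/
theorem getElem?_enumFrom_of_calls (A : PCA n σ) {m ℓ : ℕ} {u : Fin n} (hm : ℓ ≤ m) (hℓ : 0 < ℓ)
    {l₁ l₂ : List (ℕ × Fin σ)} {p r : ℕ} {b : Fin σ} {z : List (Fin σ)}
    (hc : A.calls u ℓ = l₁ ++ (p, b) :: l₂)
    (hz : (A.enumFrom (A.target (A.defaultAt u p) b) (ℓ - 1 - p))[r]? = some z) :
    (A.enumFrom u ℓ)[1 + (l₁.map fun c => A.wt u ℓ c.1 c.2).sum + r]? =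
      some (A.defaultWord u p ++ b :: z) := by
  have h1 : ∀ c ∈ A.calls u ℓ, (A.block u ℓ c).length = A.wt u ℓ c.1 c.2 := fun c hc => by
    obtain ⟨hp, _, _, hg⟩ := mem_calls hm hℓ hc
    exact A.length_block hp hg
  have h2 : l₁.map (fun c => A.wt u ℓ c.1 c.2) = l₁.map fun c => (A.block u ℓ c).length :=
    List.map_congr_left fun c hc' => (h1 c (by rw [hc]; simp [hc'])).symm
  have h3 : (A.block u ℓ (p, b))[r]? = some (A.defaultWord u p ++ b :: z) := by
    rw [block, List.getElem?_map, hz]; rfl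
  rw [A.enumFrom_eq u hℓ, h2, add_assoc, add_comm 1, List.getElem?_cons_succ, hc,
    getElem?_flatMap_append _ _ _ _ (List.getElem?_eq_some_iff.1 h3).1, h3]

/-- Positions of the strings that are output by calls other than the last one. -/
theorem getElem?_enumFrom (A : PCA n σ) {m ℓ : ℕ} {u : Fin n} (hm : ℓ ≤ m) (hℓ : 0 < ℓ)
    {o₁ o₂ : List ℕ} {p r : ℕ} {b : Fin σ} {z : List (Fin σ)}
    (ho : A.order m u ℓ = o₁ ++ p :: o₂)
    (hb : (A.step (A.defaultAt u p) b).isSome) (hs : ¬ A.Skip m u ℓ p b) (hg : 0 < A.wt u ℓ p b)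
    (hz : (A.enumFrom (A.target (A.defaultAt u p) b) (ℓ - 1 - p))[r]? = some z) :
    (A.enumFrom u ℓ)[1 + (o₁.map (A.weight m u ℓ)).sum + A.pre m u ℓ p b + r]? =
      some (A.defaultWord u p ++ b :: z) := by
  have hp : p < ℓ := (mem_order (A := A) (m := m) (u := u).1 (by rw [ho]; simp)).1
  obtain ⟨l₁, l₂, h1, h2⟩ := A.exits_split hp hb hs hg
  have h : topPos (A.key m u ℓ) 0 ℓ ≠ 0 := by
    intro h
    -- If all keys vanish, the queue is empty from the start, and `p` cannot occur in the order.
    simp [order, piece, h] at ho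
    cases ℓ <;> simp [bfs] at ho
  obtain ⟨b₂, hb₂⟩ := exists_second (isTop_of_ne h).ne
  have hc := A.calls_eq u hm hℓ h hb₂
  rw [ho, List.flatMap_append, List.flatMap_cons, h1] at hc
  have := A.getElem?_enumFrom_of_calls hm hℓ
    (l₁ := o₁.flatMap (fun p => A.exits u ℓ p (A.skips m u ℓ p)) ++ l₁)
    (l₂ := l₂ ++ o₂.flatMap (fun p => A.exits u ℓ p (A.skips m u ℓ p)) ++ [(A.top m u ℓ, b₂)])
    (by rw [hc]; simp) hz
  rw [List.map_append, List.sum_append, h2, List.map_flatMap, sum_flatMap] at this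
  have h3 : o₁.map (fun p => ((A.exits u ℓ p (A.skips m u ℓ p)).map fun c => A.wt u ℓ c.1 c.2).sum) =
      o₁.map (A.weight m u ℓ) :=
    List.map_congr_left fun q hq => A.sum_exits
      (mem_order (A := A) (m := m) (u := u).1 (by rw [ho]; simp [hq])).1
  rw [h3] at this
  rw [← this]
  congr 1
  ring

/-- Positions of the strings that are output by the last call. -/
theorem getElem?_enumFrom_last (A : PCA n σ) {m ℓ : ℕ} {u : Fin n} (hm : ℓ ≤ m) (hℓ : 0 < ℓ)
    (h : topPos (A.key m u ℓ) 0 ℓ ≠ 0) {r : ℕ} {b : Fin σ} {z : List (Fin σ)}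
    (hb : (A.edges (A.defaultAt u (A.top m u ℓ)))[1]? = some b)
    (hz : (A.enumFrom (A.target (A.defaultAt u (A.top m u ℓ)) b) (ℓ - 1 - A.top m u ℓ))[r]? =
      some z) :
    (A.enumFrom u ℓ)[1 + ((A.order m u ℓ).map (A.weight m u ℓ)).sum + r]? =
      some (A.defaultWord u (A.top m u ℓ) ++ b :: z) := by
  have := A.getElem?_enumFrom_of_calls hm hℓ (A.calls_eq u hm hℓ h hb) hz
  rw [List.map_flatMap, sum_flatMap] at this
  rw [← this]
  congr 4
  exact List.map_congr_left fun q hq => (A.sum_exits (mem_order.1 hq).1).symm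

end PCA

/-! ### The adjacency matrix -/

namespace RAM

infixl:65 "+ₑ" => Expr.op Op.add
infixl:65 "-ₑ" => Expr.op Op.sub
infixl:70 "*ₑ" => Expr.op Op.mul
infix:50 "<ₑ" => Expr.op Op.lt
infix:50 "=ₑ" => Expr.op Op.eq
infixr:30 ";;" => Prog.seq

theorem eval_lt_ne_zero {s : State} {e₁ e₂ : Expr} :
    (e₁ <ₑ e₂).eval s ≠ 0 ↔ e₁.eval s < e₂.eval s := by
  simp only [Expr.eval, Op.eval]
  split <;> simp [*]

theorem eval_lt_eq_zero {s : State} {e₁ e₂ : Expr} :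
    (e₁ <ₑ e₂).eval s = 0 ↔ e₂.eval s ≤ e₁.eval s := by
  rw [← not_lt, ← eval_lt_ne_zero, not_not]

/-- Conditions on the bounds for cells. -/
structure Cfg.Fits (c : Cfg) (n σ m : ℕ) : Prop where
  small : 2 * (n + σ + m) + 8 ≤ c.N
  le : c.N ≤ c.B
  pow : σ ^ m ≤ c.B
  npos : 0 < n
  σpos : 0 < σ
  mpos : 0 < m

theorem Cfg.Fits.hN {c : Cfg} {n σ m : ℕ} (h : c.Fits n σ m) : 1 ≤ c.N := by
  have := h.small; omega

theorem Cfg.Fits.hB {c : Cfg} {n σ m : ℕ} (h : c.Fits n σ m) : 1 ≤ c.B := by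
  have := h.small; have := h.le; omega

/-- The registers 0, 1, 3 and the segment 0 hold the numbers of states and letters, the length, and
the transition table. -/
structure Inp {n σ : ℕ} (A : PCA n σ) (m : ℕ) (s : State) : Prop where
  n : s.reg 0 = n
  σ : s.reg 1 = σ
  m : s.reg 3 = m
  table : ∀ k, s.mem 0 k = A.table k

theorem Inp.fr {n σ : ℕ} {A : PCA n σ} {m : ℕ} {s s' : State} {p : Prog} (h : Inp A m s)
    (hf : Fr p s s') (h0 : 0 ∉ p.wr := by decide) (h1 : 1 ∉ p.wr := by decide)
    (h3 : 3 ∉ p.wr := by decide) (ht : 0 ∉ p.ws := by decide) : Inp A m s' :=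
  ⟨(hf.reg _ h0).trans h.n, (hf.reg _ h1).trans h.σ, (hf.reg _ h3).trans h.m,
    fun k => by rw [hf.mem _ ht]; exact h.table k⟩

theorem table_apply {n σ : ℕ} (A : PCA n σ) (v : Fin n) (a : Fin σ) :
    A.table (v * σ + a) = if (A.step v a).isSome then (A.target v a : ℕ) + 1 else 0 := by
  have hσ : 0 < σ := a.pos
  have h1 : (v * σ + a : ℕ) / σ = v := by
    rw [mul_comm, Nat.mul_add_div hσ, Nat.div_eq_of_lt a.2, add_zero]
  have h2 : (v * σ + a : ℕ) % σ = a := by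
    rw [mul_comm, Nat.mul_add_mod, Nat.mod_eq_of_lt a.2]
  unfold PCA.table
  rw [dif_pos ⟨by rw [h1]; exact v.2, hσ⟩]
  have h3 : (⟨(v * σ + a : ℕ) / σ, by rw [h1]; exact v.2⟩ : Fin n) = v := Fin.ext h1
  have h4 : (⟨(v * σ + a : ℕ) % σ, Nat.mod_lt _ hσ⟩ : Fin σ) = a := Fin.ext h2
  rw [h3, h4]
  cases h : A.step v a with
  | none => simp
  | some q => simp [PCA.target, h]

theorem addr_inj {n v v' u u' : ℕ} (hu : u < n) (hu' : u' < n) :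
    v * n + u = v' * n + u' ↔ v = v' ∧ u = u' := by
  constructor
  · intro h
    have h1 : (v * n + u) / n = v := by
      rw [mul_comm, Nat.mul_add_div (by omega), Nat.div_eq_of_lt hu, add_zero]
    have h2 : (v' * n + u') / n = v' := by
      rw [mul_comm, Nat.mul_add_div (by omega), Nat.div_eq_of_lt hu', add_zero]
    have h3 : v = v' := by rw [← h1, ← h2, h]
    subst h3
    exact ⟨rfl, by omega⟩
  · rintro ⟨rfl, rfl⟩; rfl

/-- The number of edges from `v` to `u` with labels less than `j`. -/
def multTo {n σ : ℕ} (A : PCA n σ) (v u : Fin n) (j : ℕ) : ℕ :=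
  (Finset.univ.filter fun a : Fin σ => a.val < j ∧ A.step v a = some u).card

/-- The number of edges from `v` with labels less than `j`. -/
def degTo {n σ : ℕ} (A : PCA n σ) (v : Fin n) (j : ℕ) : ℕ :=
  (Finset.univ.filter fun a : Fin σ => a.val < j ∧ (A.step v a).isSome).card

theorem card_filter_lt_succ {σ j : ℕ} (hj : j < σ) (P : Fin σ → Prop) [DecidablePred P] :
    (Finset.univ.filter fun a : Fin σ => a.val < j + 1 ∧ P a).card =
      (Finset.univ.filter fun a : Fin σ => a.val < j ∧ P a).card + if P ⟨j, hj⟩ then 1 else 0 := by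
  have h : (Finset.univ.filter fun a : Fin σ => a.val < j + 1 ∧ P a) =
      (Finset.univ.filter fun a : Fin σ => a.val < j ∧ P a) ∪
        if P ⟨j, hj⟩ then {⟨j, hj⟩} else ∅ := by
    ext a
    simp only [Finset.mem_filter, Finset.mem_univ, true_and, Finset.mem_union]
    by_cases ha : a = ⟨j, hj⟩
    · subst ha
      by_cases hp : P ⟨j, hj⟩ <;> simp [hp]
    · have : a.val ≠ j := fun h => ha (Fin.ext h)
      have : (a ∈ if P ⟨j, hj⟩ then ({⟨j, hj⟩} : Finset (Fin σ)) else ∅) ↔ False := by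
        split <;> simp [ha]
      rw [this, or_false]
      constructor
      · rintro ⟨h1, h2⟩; exact ⟨by omega, h2⟩
      · rintro ⟨h1, h2⟩; exact ⟨by omega, h2⟩
  rw [h, Finset.card_union_of_disjoint]
  · split <;> simp
  · rw [Finset.disjoint_left]
    intro a ha
    simp only [Finset.mem_filter, Finset.mem_univ, true_and] at ha
    split
    · rw [Finset.mem_singleton]
      rintro rfl
      simp at ha
    · simp

theorem multTo_le {n σ : ℕ} (A : PCA n σ) (v u : Fin n) (j : ℕ) : multTo A v u j ≤ σ := by
  have := Finset.card_le_univ (Finset.univ.filter fun a : Fin σ => a.val < j ∧ A.step v a = some u)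
  rwa [Fintype.card_fin] at this

theorem degTo_le {n σ : ℕ} (A : PCA n σ) (v : Fin n) (j : ℕ) : degTo A v j ≤ σ := by
  have := Finset.card_le_univ (Finset.univ.filter fun a : Fin σ => a.val < j ∧ (A.step v a).isSome)
  rwa [Fintype.card_fin] at this

/-- Entry of one edge into the matrix. -/
def matrixCell : Prog :=
  .assign 7 (.load 0 (.reg 5 *ₑ .reg 1 +ₑ .reg 6)) ;;
  .ite (.reg 7)
    (.store 2 (.reg 5 *ₑ .reg 0 +ₑ (.reg 7 -ₑ .lit 1))
      (.load 2 (.reg 5 *ₑ .reg 0 +ₑ (.reg 7 -ₑ .lit 1)) +ₑ .lit 1) ;;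
      .store 3 (.reg 5) (.load 3 (.reg 5) +ₑ .lit 1))
    .skip

/-- The numbers of edges between states and the numbers of edges that leave the states. -/
def matrixProg : Prog := forTo 5 0 (forTo 6 1 matrixCell)

/-- The number of letters treated for the row `v` when the cell `(k, j)` is reached. -/
def rowPos (σ k j v : ℕ) : ℕ := if v < k then σ else if v = k then j else 0

/-- Invariant of `matrixProg`. -/
structure MatrixInv {n σ : ℕ} (A : PCA n σ) (k j : ℕ) (s : State) : Prop where
  mat : ∀ v u : Fin n, s.mem 2 (v * n + u) = multTo A v u (rowPos σ k j v)
  deg : ∀ v : Fin n, s.mem 3 v = degTo A v (rowPos σ k j v)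

theorem matrixCell_spec {n σ m : ℕ} (A : PCA n σ) {c : Cfg} (hc : c.Fits n σ m) {s : State}
    (hs : Bdd c s) (hi : Inp A m s) {k : Fin n} {j : Fin σ} (h5 : s.reg 5 = k)
    (h6 : s.reg 6 = j) (hI : MatrixInv A k j s) :
    HT c matrixCell s matrixCell.K fun s' => MatrixInv A k (j + 1) s' := by
  have hsm := hc.small
  have hle := hc.le
  have hk := k.2
  have hj := j.2
  have htab := table_apply A k j
  have hrow : ∀ v : Fin n, rowPos σ k (j + 1) v = if v = k then (j : ℕ) + 1 else rowPos σ k j v := by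
    intro v
    unfold rowPos
    by_cases hv : v = k
    · subst hv; simp
    · have : (v : ℕ) ≠ k := fun h => hv (Fin.ext h)
      simp [hv, this]
  have hrow' : rowPos σ k j k = j := by simp [rowPos]
  have hm1 : ∀ u, multTo A k u (j + 1) = multTo A k u j + if A.step k j = some u then 1 else 0 :=
    fun u => card_filter_lt_succ hj fun a => A.step k a = some u
  have hd1 : degTo A k (j + 1) = degTo A k j + if (A.step k j).isSome then 1 else 0 :=
    card_filter_lt_succ hj fun a => (A.step k a).isSome
  refine HT.of_wp hc.hN hc.hB hs ?_
  by_cases hsome : (A.step k j).isSome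
  · have hst := PCA.step_eq_target hsome
    rw [if_pos hsome] at htab hd1
    rw [hst] at hm1
    have hq := (A.target k j).2
    have hmm := hI.mat k (A.target k j)
    have hdd := hI.deg k
    rw [hrow'] at hmm hdd
    have := multTo_le A k (A.target k j) j
    have := degTo_le A k j
    simp [matrixCell, wp, Expr.ok, Expr.eval, Op.eval, hi.n, hi.σ, h5, h6, hi.table, htab, hmm, hdd]
    constructorm* _ ∧ _
    any_goals omega
    refine ⟨fun v u => ?_, fun v => ?_⟩
    · simp only [setMem_mem, setReg_mem, hrow]
      by_cases hv : v = k
      · subst hv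
        by_cases hu : A.target v j = u
        · subst hu
          simp [hm1]
        · have : (v * n + u : ℕ) ≠ v * n + A.target v j := by
            rw [ne_eq, addr_inj u.2 hq]
            exact fun h => hu (Fin.ext h.2.symm)
          have h2 := hI.mat v u
          rw [hrow'] at h2
          simp [hm1, hu, Function.update_of_ne this, h2]
      · have : (v * n + u : ℕ) ≠ k * n + A.target k j := by
          rw [ne_eq, addr_inj u.2 hq]
          exact fun h => hv (Fin.ext h.1)
        simp [hv, this, hI.mat]
    · simp only [setMem_mem, setReg_mem, hrow]
      by_cases hv : v = k
      · subst hv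
        simp [hd1]
      · have : (v : ℕ) ≠ k := fun h => hv (Fin.ext h)
        simp [hv, this, hI.deg]
  · have hnone : A.step k j = none := by simpa using hsome
    rw [if_neg hsome] at htab hd1
    rw [hnone] at hm1
    simp [matrixCell, wp, Expr.ok, Expr.eval, Op.eval, hi.n, hi.σ, h5, h6, hi.table, htab]
    refine ⟨⟨by omega, by omega⟩, fun v u => ?_, fun v => ?_⟩
    · by_cases hv : v = k
      · subst hv
        have h2 := hI.mat v u
        rw [hrow'] at h2
        simp [hrow, hm1, h2]
      · simp [hrow, hv, hI.mat]
    · by_cases hv : v = k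
      · subst hv
        have h2 := hI.deg v
        rw [hrow'] at h2
        simp [hrow, hd1, h2]
      · simp [hrow, hv, hI.deg]

theorem MatrixInv.setReg {n σ : ℕ} {A : PCA n σ} {k j : ℕ} {s : State} (h : MatrixInv A k j s)
    (r x : ℕ) : MatrixInv A k j (s.setReg r x) := ⟨h.mat, h.deg⟩

theorem MatrixInv.next_row {n σ : ℕ} {A : PCA n σ} {k : ℕ} {s : State} (h : MatrixInv A k σ s) :
    MatrixInv A (k + 1) 0 s := by
  have : ∀ v, rowPos σ k σ v = rowPos σ (k + 1) 0 v := by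
    intro v; unfold rowPos; split_ifs <;> omega
  exact ⟨fun v u => by rw [h.mat, this], fun v => by rw [h.deg, this]⟩

/-- Segments 2 and 3 hold the adjacency matrix and the numbers of edges that leave the states. -/
structure MatrixOut {n σ : ℕ} (A : PCA n σ) (s : State) : Prop where
  mat : ∀ v u : Fin n, s.mem 2 (v * n + u) = A.mult v u
  deg : ∀ v : Fin n, s.mem 3 v = (Finset.univ.filter fun a => (A.step v a).isSome).card

theorem matrixProg_spec : ∃ K, ∀ {n σ m : ℕ} (A : PCA n σ) {c : Cfg} {s : State},
    c.Fits n σ m → Bdd c s → Inp A m s → (∀ k, s.mem 2 k = 0) → (∀ k, s.mem 3 k = 0) →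
    HT c matrixProg s (K * (n * σ)) (MatrixOut A) := by
  -- A cell costs 61 beyond its body; a row costs 37 for the inner loop and 61 for the outer one.
  -- The lower-order terms are absorbed by `n ≤ n * σ` and `1 ≤ n * σ`.
  refine ⟨matrixCell.K + 61 + 98 + 37, fun {n σ m} A {c s} hc hs hi h2 h3 => ?_⟩
  have h := HT.forTo hc.hN hc.hB (i := 5) (b := 0) (p := forTo 6 1 matrixCell) (s := s)
    (T := σ * (matrixCell.K + 61) + 37) (fun k s' => MatrixInv A k 0 s') hs (by decide) (by decide)
    (by decide)
    (by
      have : ∀ v, rowPos σ 0 0 v = 0 := by intro v; simp [rowPos]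
      constructor
      · intro v u; simp [h2, this, multTo]
      · intro v; simp [h3, this, degTo])
    (by
      intro k s₁ hk hs₁ hf₁ h5 hI
      have hi₁ := hi.fr hf₁
      rw [hi.n] at hk
      have h := HT.forTo hc.hN hc.hB (i := 6) (b := 1) (p := matrixCell) (s := s₁)
        (T := matrixCell.K) (fun j s' => MatrixInv A k j s') hs₁ (by decide) (by decide)
        (by decide) (hI.setReg _ _)
        (by
          intro j s₂ hj hs₂ hf₂ h6 hI₂
          have hi₂ := hi₁.fr hf₂
          rw [hi₁.σ] at hj
          refine (matrixCell_spec A hc hs₂ hi₂ (k := ⟨k, hk⟩) (j := ⟨j, hj⟩)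
            ((hf₂.reg 5 (by decide)).trans h5) h6 hI₂).mono le_rfl fun s' _ _ h => h.setReg _ _)
      rw [hi₁.σ] at h
      exact h.mono le_rfl fun s' _ _ h => h.1.next_row.setReg _ _)
  rw [hi.n] at h
  refine h.mono ?_ fun s' _ _ h => ?_
  · have h1 : n ≤ n * σ := Nat.le_mul_of_pos_right _ hc.σpos
    have h2 : 1 ≤ n * σ := Nat.mul_pos hc.npos hc.σpos
    calc _ = (matrixCell.K + 61) * (n * σ) + 98 * n + 37 * 1 := by ring
      _ ≤ (matrixCell.K + 61) * (n * σ) + 98 * (n * σ) + 37 * (n * σ) := by gcongr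
      _ = _ := by ring
  · have hr : ∀ v : Fin n, rowPos σ n 0 v = σ := fun v => by simp [rowPos]
    refine ⟨fun v u => ?_, fun v => ?_⟩
    · rw [h.1.mat, hr, multTo, PCA.mult]; simp
    · rw [h.1.deg, hr, degTo]; simp

end RAM

/-! ### The lengths of the longest walks -/

namespace RAM

variable {n σ m : ℕ}

/-- The number of edges from `u` that do not end in `P`. -/
def remDeg (A : PCA n σ) (P : Finset (Fin n)) (u : Fin n) : ℕ :=
  (Finset.univ.filter fun a => (A.step u a).isSome ∧ A.target u a ∉ P).card

theorem remDeg_empty (A : PCA n σ) (u : Fin n) :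
    remDeg A ∅ u = (Finset.univ.filter fun a => (A.step u a).isSome).card := by simp [remDeg]

/-- The edges to `v` are exactly those that stop being counted, so a single subtraction of a matrix
entry treats all of them. -/
theorem remDeg_insert (A : PCA n σ) {P : Finset (Fin n)} {u v : Fin n} (hv : v ∉ P) :
    remDeg A P u = remDeg A (insert v P) u + A.mult u v := by
  rw [remDeg, remDeg, PCA.mult, ← Finset.card_union_of_disjoint]
  · congr 1
    ext a
    simp only [Finset.mem_filter, Finset.mem_univ, true_and, Finset.mem_union, Finset.mem_insert]
    cases h : A.step u a with
    | none => simp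
    | some w =>
      simp only [PCA.target, h, Option.isSome_some, Option.getD_some, true_and, Option.some.injEq]
      by_cases hw : w = v
      · subst hw; simp [hv]
      · simp [hw]
  · rw [Finset.disjoint_left]
    intro a ha hb
    simp only [Finset.mem_filter, Finset.mem_univ, true_and, Finset.mem_insert] at ha hb
    exact ha.2 (Or.inl (PCA.target_eq hb))

theorem mult_ne_zero_iff {A : PCA n σ} {u w : Fin n} :
    A.mult u w ≠ 0 ↔ ∃ a, (A.step u a).isSome ∧ A.target u a = w := by
  rw [PCA.mult, Finset.card_ne_zero]
  constructor
  · rintro ⟨a, ha⟩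
    have h : A.step u a = some w := by simpa using ha
    exact ⟨a, by simp [h], PCA.target_eq h⟩
  · rintro ⟨a, h1, rfl⟩
    exact ⟨a, by simpa using PCA.step_eq_target h1⟩

theorem longest_eq_of {A : PCA n σ} {u : Fin n} {k : ℕ}
    (h1 : ∀ a, (A.step u a).isSome → A.longest (A.target u a) + 1 ≤ k)
    (h2 : k = 0 ∨ ∃ a, (A.step u a).isSome ∧ A.longest (A.target u a) + 1 = k) :
    A.longest u = k := by
  refine le_antisymm (PCA.enat_le_of_forall_nat fun j hj => ?_) ?_
  · cases j with
    | zero => simp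
    | succ j =>
      obtain ⟨a, h3, h4⟩ := (A.succ_le_longest_iff u j).1 hj
      refine le_trans ?_ (h1 a h3)
      rw [Nat.cast_add, Nat.cast_one]
      exact add_le_add h4 le_rfl
  · rcases h2 with rfl | ⟨a, h3, h4⟩
    · simp
    · rw [← h4]
      exact PCA.edgeLen_le_longest h3

/-- From `P` one can step into `P` again and again, which yields walks of every length. -/
theorem longest_eq_top {A : PCA n σ} {P : Fin n → Prop}
    (h : ∀ u, P u → ∃ a, (A.step u a).isSome ∧ P (A.target u a)) {u : Fin n} (hu : P u) :
    A.longest u = ⊤ := by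
  have key : ∀ (k : ℕ) (u : Fin n), P u → (k : ℕ∞) ≤ A.longest u := by
    intro k
    induction k with
    | zero => simp
    | succ k ih =>
      intro u hu
      obtain ⟨a, h1, h2⟩ := h u hu
      exact (A.succ_le_longest_iff u k).2 ⟨a, h1, ih _ h2⟩
  rw [← top_le_iff]
  exact PCA.enat_le_of_forall_nat fun k _ => key k u hu

/-! ### Topological sorting from the sinks -/

/-- Invariant: `S u` is the set of the states whose incoming edges from `u` have been treated, and `L`
is the list of the states for which no untreated edge is left. -/
structure Kahn (A : PCA n σ) (S : Fin n → Finset (Fin n)) (L : List (Fin n)) (s : State) : Prop where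
  deg : ∀ u : Fin n, s.mem 3 u = remDeg A (S u) u
  ub : ∀ u w : Fin n, w ∈ S u → A.mult u w ≠ 0 → s.mem 4 w + 1 ≤ s.mem 4 u
  lb : ∀ u : Fin n, s.mem 4 u = 0 ∨ ∃ w ∈ S u, A.mult u w ≠ 0 ∧ s.mem 4 u = s.mem 4 w + 1
  queue : ∀ (i : ℕ) (v : Fin n), L[i]? = some v → s.mem 5 i = v
  tail : s.reg 9 = L.length
  nodup : L.Nodup
  mem : ∀ u, u ∈ L ↔ remDeg A (S u) u = 0
  len : ∀ u ∈ L, A.longest u = s.mem 4 u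
  sub : ∀ u w, w ∈ S u → w ∈ L

theorem Kahn.congr {A : PCA n σ} {S : Fin n → Finset (Fin n)} {L : List (Fin n)} {s s' : State}
    (h : Kahn A S L s) (h3 : s'.mem 3 = s.mem 3) (h4 : s'.mem 4 = s.mem 4)
    (h5 : s'.mem 5 = s.mem 5) (h9 : s'.reg 9 = s.reg 9) : Kahn A S L s' := by
  constructor
  · rw [h3]; exact h.deg
  · rw [h4]; exact h.ub
  · rw [h4]; exact h.lb
  · rw [h5]; exact h.queue
  · rw [h9]; exact h.tail
  · exact h.nodup
  · exact h.mem
  · rw [h4]; exact h.len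
  · exact h.sub

/-- Treatment of the edges from one state to the state in register 5. -/
def relaxCell : Prog :=
  .assign 7 (.load 2 (.reg 6 *ₑ .reg 0 +ₑ .reg 5)) ;;
  .ite (.reg 7)
    (.store 3 (.reg 6) (.load 3 (.reg 6) -ₑ .reg 7) ;;
      .ite (.load 4 (.reg 6) <ₑ .reg 10) (.store 4 (.reg 6) (.reg 10)) .skip ;;
      .ite (.load 3 (.reg 6)) .skip
        (.store 5 (.reg 9) (.reg 6) ;; .assign 9 (.reg 9 +ₑ .lit 1)))
    .skip

/-- If an untreated edge joins `u` to `v`, then `u` is not yet in the queue, so a change of its cell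
affects no final value. When the last edge of `u` has been treated, all its successors have final
values, and the maximum collected in the cell of `u` is its longest length. -/
theorem relaxCell_spec (A : PCA n σ) {c : Cfg} (hc : c.Fits n σ m) {s : State}
    (hs : Bdd c s) (h0 : s.reg 0 = n) (hmat : ∀ v u : Fin n, s.mem 2 (v * n + u) = A.mult v u)
    {S : Fin n → Finset (Fin n)} {L : List (Fin n)} {u v : Fin n} (h5 : s.reg 5 = v)
    (h6 : s.reg 6 = u) (h10 : s.reg 10 = s.mem 4 v + 1) (hv : v ∈ L) (hvS : v ∉ S u)
    (hI : Kahn A S L s) :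
    HT c relaxCell s relaxCell.K fun s' => ∃ L', s'.mem 4 v = s.mem 4 v ∧
      Kahn A (Function.update S u (insert v (S u))) (L ++ L') s' := by
  have hsm := hc.small
  have hle := hc.le
  have hu := u.2
  have hm := hmat u v
  have hrem := remDeg_insert A (u := u) hvS
  have hdeg := hI.deg u
  have hpv : s.mem 4 v < n := PCA.longest_lt_of_ne_top (hI.len v hv)
  have hpu := hs.2 4 u
  have hcard : L.length ≤ n := by simpa using hI.nodup.length_le_card
  -- States in the queue have remaining degree 0, but that of `u` is at least the number of edges
  -- from `u` to `v`.
  have hvL : ∀ w, w ∈ L → A.mult u v ≠ 0 → w ≠ u := by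
    rintro w hw h rfl
    rw [hI.mem] at hw
    omega
  refine HT.of_wp hc.hN hc.hB hs ?_
  -- Without edges from `u` to `v` nothing is written; putting `v` into `S u` changes neither
  -- remaining degrees nor bounds.
  by_cases hz : A.mult u v = 0
  · rw [hz, add_zero] at hrem
    simp [relaxCell, wp, Expr.ok, Expr.eval, Op.eval, h0, h5, h6, hm, hz]
    refine ⟨⟨by omega, by omega⟩, [], ?_⟩
    rw [List.append_nil]
    have hS : ∀ u' w, w ∈ Function.update S u (insert v (S u)) u' → A.mult u' w ≠ 0 → w ∈ S u' := by
      intro u' w hw h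
      by_cases hu' : u' = u
      · subst hu'
        rw [Function.update_self, Finset.mem_insert] at hw
        rcases hw with rfl | hw
        · exact absurd hz h
        · exact hw
      · rwa [Function.update_of_ne hu'] at hw
    have hS' : ∀ u' w, w ∈ S u' → w ∈ Function.update S u (insert v (S u)) u' := by
      intro u' w hw
      by_cases hu' : u' = u
      · subst hu'
        rw [Function.update_self]
        exact Finset.mem_insert_of_mem hw
      · rwa [Function.update_of_ne hu']
    have hR : ∀ u', remDeg A (Function.update S u (insert v (S u)) u') u' = remDeg A (S u') u' := by
      intro u'
      by_cases hu' : u' = u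
      · subst hu'; rw [Function.update_self, hrem]
      · rw [Function.update_of_ne hu']
    refine ⟨fun u' => ?_, fun u' w hw h => hI.ub u' w (hS _ _ hw h) h, fun u' => ?_, hI.queue,
      by simpa using hI.tail, hI.nodup, fun u' => ?_, hI.len, fun u' w hw => ?_⟩
    · rw [hR]; exact hI.deg u'
    · rcases hI.lb u' with h | ⟨w, h1, h2⟩
      · exact Or.inl h
      · exact Or.inr ⟨w, hS' _ _ h1, h2⟩
    · rw [hR]; exact hI.mem u'
    · by_cases hu' : u' = u
      · subst hu'
        rw [Function.update_self, Finset.mem_insert] at hw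
        rcases hw with rfl | hw
        · exact hv
        · exact hI.sub _ _ hw
      · rw [Function.update_of_ne hu'] at hw
        exact hI.sub _ _ hw
  · have hsub : s.mem 3 u - A.mult u v = remDeg A (insert v (S u)) u := by omega
    have hmle := A.mult_le u v
    have hd3 := hs.2 3 u
    have huL : u ∉ L := fun h => hvL u h hz rfl
    have huv : (v : ℕ) ≠ u := fun h => huL (Fin.ext h ▸ hv)
    have htl := hI.tail
    have hne : ∀ w : Fin n, w ≠ u → (w : ℕ) ≠ u := fun w h hw => h (Fin.ext hw)
    -- the general step, with the new value `x` in segment 4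
    have step : ∀ (s' : State) (L' : List (Fin n)),
        s'.mem 3 = Function.update (s.mem 3) u (remDeg A (insert v (S u)) u) →
        s'.mem 4 = Function.update (s.mem 4) u (max (s.mem 4 u) (s.mem 4 v + 1)) →
        (∀ i, i < L.length → s'.mem 5 i = s.mem 5 i) →
        (remDeg A (insert v (S u)) u ≠ 0 ∧ L' = [] ∨
          remDeg A (insert v (S u)) u = 0 ∧ L' = [u] ∧ s'.mem 5 L.length = u) →
        s'.reg 9 = L.length + L'.length →
        s'.mem 4 v = s.mem 4 v ∧ Kahn A (Function.update S u (insert v (S u))) (L ++ L') s' := by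
      intro s' L' e3 e4 e5 eL e9
      have e4u : s'.mem 4 u = max (s.mem 4 u) (s.mem 4 v + 1) := by rw [e4, Function.update_self]
      have e4n : ∀ w : Fin n, w ≠ u → s'.mem 4 w = s.mem 4 w := fun w h => by
        rw [e4, Function.update_of_ne (hne w h)]
      have hmemL : ∀ w, w ∈ L ++ L' ↔ w ∈ L ∨ (w = u ∧ remDeg A (insert v (S u)) u = 0) := by
        intro w
        rcases eL with ⟨h1, rfl⟩ | ⟨h1, rfl, _⟩ <;> simp [h1]
      have hub : ∀ u' w : Fin n, w ∈ Function.update S u (insert v (S u)) u' → A.mult u' w ≠ 0 →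
          s'.mem 4 w + 1 ≤ s'.mem 4 u' := by
        intro u' w hw h
        by_cases hu' : u' = u
        · subst hu'
          rw [Function.update_self, Finset.mem_insert] at hw
          rw [e4u]
          rcases hw with rfl | hw
          · rw [e4n w (hvL w hv hz)]
            exact le_max_right _ _
          · rw [e4n w (hvL w (hI.sub _ _ hw) hz)]
            exact (hI.ub _ _ hw h).trans (le_max_left _ _)
        · rw [Function.update_of_ne hu'] at hw
          rw [e4n u' hu', e4n w (hvL w (hI.sub _ _ hw) hz)]
          exact hI.ub _ _ hw h
      have hlb : ∀ u' : Fin n, s'.mem 4 u' = 0 ∨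
          ∃ w ∈ Function.update S u (insert v (S u)) u', A.mult u' w ≠ 0 ∧
            s'.mem 4 u' = s'.mem 4 w + 1 := by
        intro u'
        by_cases hu' : u' = u
        · subst hu'
          rw [Function.update_self, e4u]
          rcases le_total (s.mem 4 u') (s.mem 4 v + 1) with hh | hh
          · right
            refine ⟨v, Finset.mem_insert_self _ _, hz, ?_⟩
            rw [e4n v (hvL v hv hz), max_eq_right hh]
          · rw [max_eq_left hh]
            rcases hI.lb u' with h | ⟨w, h1, h2, h3⟩
            · exact Or.inl h
            · exact Or.inr ⟨w, Finset.mem_insert_of_mem h1, h2, by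
                rw [h3, e4n w (hvL w (hI.sub _ _ h1) hz)]⟩
        · rw [Function.update_of_ne hu', e4n u' hu']
          rcases hI.lb u' with h | ⟨w, h1, h2, h3⟩
          · exact Or.inl h
          · exact Or.inr ⟨w, h1, h2, by rw [h3, e4n w (hvL w (hI.sub _ _ h1) hz)]⟩
      have hsub' : ∀ u' w, w ∈ Function.update S u (insert v (S u)) u' → w ∈ L := by
        intro u' w hw
        by_cases hu' : u' = u
        · subst hu'
          rw [Function.update_self, Finset.mem_insert] at hw
          rcases hw with rfl | hw
          · exact hv
          · exact hI.sub _ _ hw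
        · rw [Function.update_of_ne hu'] at hw
          exact hI.sub _ _ hw
      refine ⟨e4n v (hvL v hv hz), ⟨fun u' => ?_, hub, hlb, fun i w hw => ?_, ?_, ?_, fun u' => ?_,
        fun u' hu' => ?_, fun u' w hw => (hmemL w).2 (Or.inl (hsub' u' w hw))⟩⟩
      · rw [e3]
        by_cases hu' : u' = u
        · subst hu'; simp
        · rw [Function.update_of_ne (hne u' hu'), Function.update_of_ne hu']
          exact hI.deg u'
      · by_cases hi : i < L.length
        · rw [List.getElem?_append_left hi] at hw
          rw [e5 i hi]
          exact hI.queue i w hw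
        · rw [List.getElem?_append_right (by omega)] at hw
          rcases eL with ⟨_, rfl⟩ | ⟨_, rfl, h3⟩
          · simp at hw
          · have hi' : i - L.length = 0 := by
              by_contra h
              rw [List.getElem?_eq_none (by simp; omega)] at hw
              simp at hw
            obtain rfl : i = L.length := by omega
            rw [hi'] at hw
            obtain rfl : u = w := by simpa using hw
            exact h3
      · rw [e9, List.length_append]
      · rcases eL with ⟨_, rfl⟩ | ⟨_, rfl, _⟩
        · simpa using hI.nodup
        · rw [List.nodup_append]
          refine ⟨hI.nodup, by simp, fun a ha b hb => ?_⟩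
          rw [List.mem_singleton.1 hb]
          exact hvL a ha hz
      · rw [hmemL]
        by_cases hu' : u' = u
        · subst hu'
          simp [huL]
        · rw [Function.update_of_ne hu', ← hI.mem]
          simp [hu']
      · rcases (hmemL u').1 hu' with h | ⟨rfl, h⟩
        · rw [e4n u' (hvL u' h hz)]
          exact hI.len u' h
        -- Remaining degree 0 means that all edges of `u'` end in treated states.
        · have hall : ∀ a, (A.step u' a).isSome → A.target u' a ∈ insert v (S u') := by
            intro a ha
            rw [remDeg, Finset.card_eq_zero, Finset.filter_eq_empty_iff] at h
            by_contra hn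
            exact h (Finset.mem_univ a) ⟨ha, hn⟩
          have hlen : ∀ w, w ∈ L → A.longest w = s'.mem 4 w := fun w hw => by
            rw [e4n w (hvL w hw hz)]; exact hI.len w hw
          refine longest_eq_of (fun a ha => ?_) ?_
          · have h1 := hub u' (A.target u' a) (by rw [Function.update_self]; exact hall a ha)
              (mult_ne_zero_iff.2 ⟨a, ha, rfl⟩)
            rw [hlen _ (hsub' u' _ (by rw [Function.update_self]; exact hall a ha))]
            exact_mod_cast h1
          · rcases hlb u' with h1 | ⟨w, h1, h2, h3⟩
            · exact Or.inl h1
            · obtain ⟨a, ha, rfl⟩ := mult_ne_zero_iff.1 h2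
              refine Or.inr ⟨a, ha, ?_⟩
              rw [hlen _ (hsub' u' _ h1), h3]
              norm_cast
    have hmax : ∀ x, s.mem 4 u = x → (x < s.mem 4 v + 1 →
        max (s.mem 4 u) (s.mem 4 v + 1) = s.mem 4 v + 1) ∧ (s.mem 4 v + 1 ≤ x →
        max (s.mem 4 u) (s.mem 4 v + 1) = s.mem 4 u) := by
      intro x hx
      exact ⟨fun h => max_eq_right (by omega), fun h => max_eq_left (by omega)⟩
    have hmax := hmax _ rfl
    generalize hQ : (fun s' : State => ∃ L', s'.mem 4 v = s.mem 4 v ∧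
      Kahn A (Function.update S u (insert v (S u))) (L ++ L') s') = Q
    replace step := fun s' L' e3 e4 e5 eL e9 =>
      show Q s' from hQ ▸ ⟨L', step s' L' e3 e4 e5 eL e9⟩
    simp [relaxCell, wp, Expr.ok, Expr.eval, Op.eval, h0, h5, h6, hm, hz, h10]
    rw [hsub]
    refine ⟨⟨by omega, by omega⟩, by omega, by omega, fun h => ⟨by omega, fun hd => ?_, fun hd => ?_⟩,
      fun h => ⟨fun hd => ?_, fun hd => ?_⟩⟩
    · refine step _ [] ?_ ?_ ?_ (Or.inl ⟨hd, rfl⟩) ?_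
      · simp
      · simp only [setMem_mem, setReg_mem]; rw [hmax.1 (by omega)]; rfl
      · intro i _; simp
      · simp [htl]
    · refine ⟨by omega, by omega, by omega, step _ [u] ?_ ?_ ?_ (Or.inr ⟨hd, rfl, ?_⟩) ?_⟩
      · simp
      · simp only [setMem_mem, setReg_mem]; rw [hmax.1 (by omega)]; rfl
      · intro i hi
        have : i ≠ L.length := by omega
        simp [htl, this]
      · simp [htl]
      · simp [htl]
    · refine step _ [] ?_ ?_ ?_ (Or.inl ⟨hd, rfl⟩) ?_
      · simp
      · simp only [setMem_mem, setReg_mem]; rw [hmax.2 (by omega)]; simp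
      · intro i _; simp
      · simp [htl]
    · refine ⟨by omega, by omega, by omega, step _ [u] ?_ ?_ ?_ (Or.inr ⟨hd, rfl, ?_⟩) ?_⟩
      · simp
      · simp only [setMem_mem, setReg_mem]; rw [hmax.2 (by omega)]; simp
      · intro i hi
        have : i ≠ L.length := by omega
        simp [htl, this]
      · simp [htl]
      · simp [htl]

/-- Treatment of the first state in the queue. -/
def relaxProg : Prog :=
  (.assign 5 (.load 5 (.reg 8)) ;; .assign 8 (.reg 8 +ₑ .lit 1) ;;
    .assign 10 (.load 4 (.reg 5) +ₑ .lit 1)) ;;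
  forTo 6 0 relaxCell

/-- The states without outgoing edges are put into the queue. -/
def sinkCell : Prog :=
  .ite (.load 3 (.reg 5)) .skip (.store 5 (.reg 9) (.reg 5) ;; .assign 9 (.reg 9 +ₑ .lit 1))

/-- Infinite lengths are replaced by their code. -/
def infCell : Prog := .ite (.load 3 (.reg 5)) (.store 4 (.reg 5) (.reg 10)) .skip

/-- Computation of the lengths of the longest walks. -/
def longestProg : Prog :=
  .assign 9 (.lit 0) ;; forTo 5 0 sinkCell ;; .assign 8 (.lit 0) ;;
    .while (.reg 8 <ₑ .reg 9) relaxProg ;; .assign 10 (.reg 0 +ₑ .reg 3) ;; forTo 5 0 infCell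

theorem relaxProg_spec (A : PCA n σ) {c : Cfg} (hc : c.Fits n σ m) {s : State}
    (hs : Bdd c s) (h0 : s.reg 0 = n) (hmat : ∀ v u : Fin n, s.mem 2 (v * n + u) = A.mult v u)
    {L : List (Fin n)} (h8 : s.reg 8 < L.length)
    (hI : Kahn A (fun _ => (L.take (s.reg 8)).toFinset) L s) :
    HT c relaxProg s (200 + (n * (relaxCell.K + 61) + 37)) fun s' => s'.reg 8 = s.reg 8 + 1 ∧
      ∃ L', Kahn A (fun _ => ((L ++ L').take (s'.reg 8)).toFinset) (L ++ L') s' := by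
  have hsm := hc.small
  have hle := hc.le
  set h := s.reg 8 with hh
  obtain ⟨v, hv⟩ : ∃ v, L[h]? = some v := ⟨_, List.getElem?_eq_getElem h8⟩
  have hvL : v ∈ L := List.mem_of_getElem? hv
  have hq := hI.queue h v hv
  have hpv : s.mem 4 v < n := PCA.longest_lt_of_ne_top (hI.len v hvL)
  have hcard : L.length ≤ n := by simpa using hI.nodup.length_le_card
  have htake : ∀ L', ((L ++ L').take h) = L.take h := fun L' => by
    rw [List.take_append_of_le_length h8.le]
  -- The queue has no repetitions, so `v` has not been treated earlier.
  have hv' : v ∉ (L.take h).toFinset := by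
    rw [List.mem_toFinset]
    intro hm
    have h1 := (hI.nodup.sublist (List.take_sublist (h + 1) L))
    rw [List.take_add_one, hv] at h1
    exact (List.nodup_append.1 h1).2.2 v hm v (by simp) rfl
  have htake' : ∀ L', ((L ++ L').take (h + 1)).toFinset = insert v (L.take h).toFinset := by
    intro L'
    rw [List.take_append_of_le_length h8, List.take_add_one, hv]
    ext w
    simp
  have hpro : HT c (.assign 5 (.load 5 (.reg 8)) ;; .assign 8 (.reg 8 +ₑ .lit 1) ;;
      .assign 10 (.load 4 (.reg 5) +ₑ .lit 1)) s 200 fun s' => s'.reg 0 = n ∧ s'.mem = s.mem ∧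
        s'.reg 9 = s.reg 9 ∧ s'.reg 5 = v ∧ s'.reg 8 = h + 1 ∧ s'.reg 10 = s.mem 4 v + 1 := by
    refine (HT.of_wp hc.hN hc.hB hs (Q := fun s' => s'.reg 0 = n ∧ s'.mem = s.mem ∧
        s'.reg 9 = s.reg 9 ∧ s'.reg 5 = v ∧ s'.reg 8 = h + 1 ∧ s'.reg 10 = s.mem 4 v + 1) ?_).mono
      (by decide) fun _ _ _ h => h
    simp [wp, Expr.ok, Expr.eval, Op.eval, h0, ← hh, hq]
    omega
  refine HT.seq hpro ?_
  rintro s₁ hs₁ - ⟨g0, gm, g9, g5, g8, g10⟩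
  have hloop := HT.forTo hc.hN hc.hB (i := 6) (b := 0) (p := relaxCell) (s := s₁)
    (T := relaxCell.K) (fun j s' => s'.mem 4 v = s.mem 4 v ∧ ∃ L', Kahn A (fun u => if u.val < j then
      insert v (L.take h).toFinset else (L.take h).toFinset) (L ++ L') s') hs₁ (by decide)
    (by decide) (by decide)
    ⟨by simp [gm], [], by
      rw [List.append_nil]
      exact Kahn.congr (s := s) (by simpa using hI) (by simp [gm]) (by simp [gm]) (by simp [gm])
        (by simp [g9])⟩
    (by
      rintro j s₂ hj hs₂ hf₂ h6 ⟨h4, L', hL'⟩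
      rw [g0] at hj
      refine (relaxCell_spec A hc hs₂ ((hf₂.reg 0 (by decide)).trans g0) (u := ⟨j, hj⟩) (v := v)
        (by rw [hf₂.mem 2 (by decide), gm]; exact hmat) ((hf₂.reg 5 (by decide)).trans g5) h6
        (by rw [h4, hf₂.reg 10 (by decide), g10]) (by simp [hvL]) (by simpa using hv') hL').mono
        le_rfl ?_
      rintro s₃ _ _ ⟨L'', h5, h6⟩
      refine ⟨by simpa [h4] using h5, L' ++ L'', ?_⟩
      rw [← List.append_assoc]
      refine Kahn.congr (s := s₃) ?_ rfl rfl rfl (by simp)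
      convert h6 using 1
      funext u
      by_cases hu : u = ⟨j, hj⟩
      · subst hu; simp
      · have : u.val ≠ j := fun h => hu (Fin.ext h)
        rw [Function.update_of_ne hu]
        congr 1
        simp only [eq_iff_iff]
        omega)
  rw [g0] at hloop
  refine hloop.mono le_rfl ?_
  rintro s₂ _ hf ⟨⟨_, L', hL'⟩, _⟩
  have e8 : s₂.reg 8 = h + 1 := (hf.reg 8 (by decide)).trans g8
  refine ⟨e8, L', ?_⟩
  rw [e8]
  convert hL' using 1
  funext u
  rw [htake', if_pos u.2]

/-- Segment 4 holds the codes of the lengths of the longest walks. -/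
def LenOut (A : PCA n σ) (m : ℕ) (s : State) : Prop := ∀ v : Fin n, s.mem 4 v = A.lenC m v

theorem sinkCell_spec (A : PCA n σ) {c : Cfg} (hc : c.Fits n σ m) {s : State} (hs : Bdd c s)
    {L : List (Fin n)} {u : Fin n} (h5 : s.reg 5 = u) (h9 : s.reg 9 = L.length)
    (hcard : L.length ≤ n)
    (hdeg : s.mem 3 u = remDeg A ∅ u) (hq : ∀ (i : ℕ) (v : Fin n), L[i]? = some v → s.mem 5 i = v) :
    HT c sinkCell s sinkCell.K fun s' =>
      s'.reg 9 = (L ++ if remDeg A ∅ u = 0 then [u] else []).length ∧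
      ∀ (i : ℕ) (v : Fin n), (L ++ if remDeg A ∅ u = 0 then [u] else [])[i]? = some v →
        s'.mem 5 i = v := by
  have hsm := hc.small
  have hle := hc.le
  have hu := u.2
  refine HT.of_wp hc.hN hc.hB hs ?_
  by_cases hz : remDeg A ∅ u = 0
  · simp only [hz, if_true]
    simp only [sinkCell, wp, Expr.ok, Expr.eval, Op.eval, h5, hdeg, hz, h9]
    refine ⟨trivial, fun h => absurd rfl h, fun _ => ⟨trivial, trivial, by omega,
      ⟨trivial, by omega⟩, ?_, ?_, ?_⟩⟩
    · simp [h9]; omega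
    · simp [h9]
    · intro i v hv
      by_cases hi : i < L.length
      · rw [List.getElem?_append_left hi] at hv
        simp [Nat.ne_of_lt hi, hq i v hv]
      · rw [List.getElem?_append_right (by omega)] at hv
        have hi' : i - L.length = 0 := by
          by_contra h
          rw [List.getElem?_eq_none (by simp; omega)] at hv
          simp at hv
        obtain rfl : i = L.length := by omega
        rw [hi'] at hv
        obtain rfl : u = v := by simpa using hv
        simp
  · simp only [hz, if_false, List.append_nil]
    simp only [sinkCell, wp, Expr.ok, Expr.eval, Op.eval, h5, hdeg, h9]
    exact ⟨trivial, fun _ => ⟨trivial, hq⟩, fun h => absurd h hz⟩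

theorem infCell_spec {c : Cfg} (hc : c.Fits n σ m) {s : State} (hs : Bdd c s) {u x : ℕ}
    (h5 : s.reg 5 = u) (h10 : s.reg 10 = x) :
    HT c infCell s infCell.K fun s' => s'.mem 3 = s.mem 3 ∧
      s'.mem 4 = Function.update (s.mem 4) u (if s.mem 3 u = 0 then s.mem 4 u else x) := by
  have hx := hs.1 10
  refine HT.of_wp hc.hN hc.hB hs ?_
  simp only [infCell, wp, Expr.ok, Expr.eval, h5, h10] at hx ⊢
  refine ⟨trivial, fun h => ⟨trivial, trivial, hx, by simp, by simp [h]⟩, fun h => ⟨trivial, by simp [h]⟩⟩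

/-- Each state enters the queue at most once, and its treatment looks at `n` matrix entries. A state
that never enters the queue has an edge to another such state, so arbitrarily long walks start in
it. -/
theorem longestProg_spec : ∃ K, ∀ {n σ m : ℕ} (A : PCA n σ) {c : Cfg} {s : State},
    c.Fits n σ m → Bdd c s → Inp A m s → MatrixOut A s → (∀ k, s.mem 4 k = 0) →
    HT c longestProg s (K * (n * n)) (LenOut A m) := by
  refine ⟨relaxCell.K + sinkCell.K + infCell.K + 2000, fun {n σ m} A {c s} hc hs hi hm h4 => ?_⟩
  have hsm := hc.small
  have hle := hc.le
  have hn := hc.npos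
  have hb : HT c longestProg s (7 + ((n * (sinkCell.K + 61) + 37) + (7 + ((n * (30 + (200 +
      (n * (relaxCell.K + 61) + 37))) + 30) + (31 + (n * (infCell.K + 61) + 37)))))) (LenOut A m) := by
    refine HT.seq (T₁ := 7) (Q₁ := fun s' => s' = s.setReg 9 0)
      (HT.of_wp (p := .assign 9 (.lit 0)) hc.hN hc.hB hs ⟨Nat.zero_le _, Nat.zero_le _, rfl⟩) ?_
    rintro _ hs₁ - rfl
    -- the sinks
    have hsink := HT.forTo hc.hN hc.hB (i := 5) (b := 0) (p := sinkCell) (s := s.setReg 9 0)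
      (T := sinkCell.K) (fun j s' => ∃ L : List (Fin n), L.Nodup ∧ s'.reg 9 = L.length ∧
        (∀ (i : ℕ) (v : Fin n), L[i]? = some v → s'.mem 5 i = v) ∧
        ∀ v, v ∈ L ↔ v.val < j ∧ remDeg A ∅ v = 0) hs₁ (by decide) (by decide) (by decide)
      ⟨[], by simp⟩
      (by
        rintro j s₂ hj hs₂ hf₂ h5 ⟨L, hL1, hL2, hL3, hL4⟩
        have hj : j < n := by simpa [hi.n] using hj
        refine (sinkCell_spec A hc hs₂ (u := ⟨j, hj⟩) h5 hL2 (by simpa using hL1.length_le_card)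
          (by rw [hf₂.mem 3 (by decide), remDeg_empty]; exact hm.deg _) hL3).mono le_rfl ?_
        rintro s₃ - - ⟨k1, k2⟩
        refine ⟨_, ?_, by simpa using k1, k2, fun v => ?_⟩
        · rw [List.nodup_append]
          refine ⟨hL1, by split <;> simp, fun a ha b hb => ?_⟩
          rintro rfl
          split at hb
          · rw [List.mem_singleton.1 hb, hL4] at ha
            simp at ha
          · simp at hb
        · rw [List.mem_append, hL4]
          by_cases hv : v = ⟨j, hj⟩
          · subst hv
            split <;> simp [*]
          · have : v.val ≠ j := fun h => hv (Fin.ext h)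
            have h2 : v ∉ (if remDeg A ∅ ⟨j, hj⟩ = 0 then [(⟨j, hj⟩ : Fin n)] else []) := by
              split <;> simp [hv]
            simp only [h2, or_false]
            constructor <;> rintro ⟨h3, h4⟩ <;> exact ⟨by omega, h4⟩)
    have e0 : (s.setReg 9 0).reg 0 = n := by simp [hi.n]
    rw [e0] at hsink
    refine HT.seq hsink ?_
    rintro s₂ hs₂ hf₂ ⟨⟨L, hL1, hL2, hL3, hL4⟩, -⟩
    have hi₂ : Inp A m s₂ := Inp.fr (s := s.setReg 9 0)
      ⟨by simp [hi.n], by simp [hi.σ], by simp [hi.m], by simpa using hi.table⟩ hf₂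
    have e2 : s₂.mem 2 = s.mem 2 := hf₂.mem 2 (by decide)
    have e3 : s₂.mem 3 = s.mem 3 := hf₂.mem 3 (by decide)
    have e4 : s₂.mem 4 = s.mem 4 := hf₂.mem 4 (by decide)
    refine HT.seq (T₁ := 7) (Q₁ := fun s' => s' = s₂.setReg 8 0)
      (HT.of_wp (p := .assign 8 (.lit 0)) hc.hN hc.hB hs₂ ⟨Nat.zero_le _, Nat.zero_le _, rfl⟩) ?_
    rintro _ hs₃ - rfl
    have hk0 : Kahn A (fun _ => ∅) L s₂ := by
      refine ⟨fun u => ?_, by simp, fun u => Or.inl (by rw [e4, h4]), hL3, hL2, hL1, fun u => ?_,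
        fun u hu => ?_, by simp⟩
      · rw [e3, remDeg_empty, hm.deg]
      · rw [hL4]; simp [u.2]
      · rw [e4, h4]
        refine longest_eq_of (fun a ha => ?_) (Or.inl rfl)
        have h1 := ((hL4 u).1 hu).2
        rw [remDeg_empty, Finset.card_eq_zero, Finset.filter_eq_empty_iff] at h1
        exact absurd ha (h1 (Finset.mem_univ a))
    -- the main loop
    have hloop := HT.while hc.hN hc.hB (e := .reg 8 <ₑ .reg 9) (p := relaxProg) (s := s₂.setReg 8 0)
      (T := 200 + (n * (relaxCell.K + 61) + 37)) (k := n)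
      (fun s' => s'.reg 8 ≤ s'.reg 9 ∧ ∃ L : List (Fin n),
        Kahn A (fun _ => (L.take (s'.reg 8)).toFinset) L s') (fun s' => n - s'.reg 8) hs₃
      ⟨by simp, L, Kahn.congr (s := s₂) (by simpa using hk0) rfl rfl rfl (by simp)⟩
      (by simp) (fun _ _ _ _ => ⟨trivial, trivial⟩)
      (by
        rintro s₄ hs₄ hf₄ ⟨h8, L, hL⟩ he
        have h89 : s₄.reg 8 < L.length := by
          rw [← hL.tail]
          exact eval_lt_ne_zero.1 he
        have hcard : L.length ≤ n := by simpa using hL.nodup.length_le_card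
        refine (relaxProg_spec A hc hs₄ ((hf₄.reg 0 (by decide)).trans (by simp [hi₂.n]))
          (by rw [hf₄.mem 2 (by decide), setReg_mem, e2]; exact hm.mat) h89 hL).mono le_rfl ?_
        rintro s₅ - - ⟨k1, L', k2⟩
        refine ⟨⟨?_, _, k2⟩, by omega⟩
        rw [k1, k2.tail, List.length_append]
        omega)
    refine HT.seq (T₁ := n * (30 + (200 + (n * (relaxCell.K + 61) + 37))) + 30) hloop ?_
    rintro s₄ hs₄ hf₄ ⟨⟨h8, L, hL⟩, he⟩
    have h89 : L.length ≤ s₄.reg 8 := by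
      rw [← hL.tail]
      exact eval_lt_eq_zero.1 he
    rw [List.take_of_length_le h89] at hL
    have hi₄ : Inp A m s₄ := Inp.fr (s := s₂.setReg 8 0)
      ⟨by simp [hi₂.n], by simp [hi₂.σ], by simp [hi₂.m], by simpa using hi₂.table⟩ hf₄
    refine HT.seq (T₁ := 31) (Q₁ := fun s' => s' = s₄.setReg 10 (n + m))
      (HT.of_wp (p := .assign 10 (.reg 0 +ₑ .reg 3)) hc.hN hc.hB hs₄ ?_) ?_
    · simp [wp, Expr.ok, Expr.eval, Op.eval, hi₄.n, hi₄.m]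
      omega
    rintro _ hs₅ - rfl
    have hfin : ∀ v : Fin n, A.lenC m v = if s₄.mem 3 v = 0 then s₄.mem 4 v else n + m := by
      intro v
      rw [hL.deg]
      by_cases hv : v ∈ L
      · rw [if_pos ((hL.mem v).1 hv)]
        have := hL.len v hv
        rcases A.lenC_cases m v with ⟨h1, _⟩ | ⟨k, _, h1, h2⟩
        · rw [h1] at this
          simp at this
        · rw [h1] at this
          rw [h2]
          exact_mod_cast this
      · have hv' := fun h => hv ((hL.mem v).2 h)
        rw [if_neg hv']
        have : A.longest v = ⊤ := by
          -- At the end all queued states have been treated, so a positive remaining degree exhibits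
          -- an edge that ends outside the queue.
          refine longest_eq_top (P := fun u => u ∉ L) (fun u hu => ?_) hv
          have h1 : remDeg A L.toFinset u ≠ 0 := fun h => hu ((hL.mem u).2 h)
          rw [remDeg, Finset.card_ne_zero] at h1
          obtain ⟨a, ha⟩ := h1
          exact ⟨a, by simpa using ha⟩
        simp [PCA.lenC, this]
    have hend := HT.forTo hc.hN hc.hB (i := 5) (b := 0) (p := infCell) (s := s₄.setReg 10 (n + m))
      (T := infCell.K) (fun j s' => s'.mem 3 = s₄.mem 3 ∧ ∀ v : Fin n,
        s'.mem 4 v = if v.val < j then A.lenC m v else s₄.mem 4 v) hs₅ (by decide) (by decide)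
      (by decide) (by simp)
      (by
        rintro j s₆ hj hs₆ hf₆ h5 ⟨k3, k4⟩
        have hj : j < n := by simpa [hi₄.n] using hj
        refine (infCell_spec hc hs₆ h5 (x := n + m) ((hf₆.reg 10 (by decide)).trans (by simp))).mono
          le_rfl ?_
        rintro s₇ - - ⟨l3, l4⟩
        refine ⟨by simp [l3, k3], fun v => ?_⟩
        rw [setReg_mem, l4]
        by_cases hv : v.val = j
        · subst hv
          have h1 := k4 v
          rw [if_neg (lt_irrefl _)] at h1
          rw [Function.update_self, k3, h1, if_pos (show v.val < v.val + 1 by omega), hfin]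
        · rw [Function.update_of_ne hv, k4]
          congr 1
          simp only [eq_iff_iff]
          omega)
    have e5 : (s₄.setReg 10 (n + m)).reg 0 = n := by simp [hi₄.n]
    rw [e5] at hend
    refine hend.mono le_rfl ?_
    rintro s₆ - - ⟨⟨_, h⟩, _⟩ v
    rw [h, if_pos v.2]
  refine hb.mono ?_ fun _ _ _ h => h
  have h1 : n ≤ n * n := Nat.le_mul_of_pos_right _ hn
  have h2 : 1 ≤ n * n := Nat.mul_pos hn hn
  calc _ = (relaxCell.K + 61) * (n * n) + (sinkCell.K + infCell.K + 389) * n + 149 * 1 := by ring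
    _ ≤ (relaxCell.K + 61) * (n * n) + (sinkCell.K + infCell.K + 389) * (n * n) + 149 * (n * n) := by
      gcongr
    _ ≤ _ := by
      rw [← Nat.add_mul, ← Nat.add_mul]
      exact Nat.mul_le_mul_right _ (by omega)

end RAM

/-! ### The numbers of walks -/

namespace RAM

variable {n σ m : ℕ}

theorem sum_lt_succ {k : ℕ} (hk : k < n) (f : Fin n → ℕ) :
    (∑ u : Fin n, if u.val < k + 1 then f u else 0) =
      (∑ u : Fin n, if u.val < k then f u else 0) + f ⟨k, hk⟩ := by
  have h : f ⟨k, hk⟩ = ∑ u : Fin n, if u = ⟨k, hk⟩ then f u else 0 := by simp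
  rw [h, ← Finset.sum_add_distrib]
  refine Finset.sum_congr rfl fun u _ => ?_
  by_cases hu : u = ⟨k, hk⟩
  · subst hu; simp
  · have : u.val ≠ k := fun h => hu (Fin.ext h)
    simp only [hu, if_false, add_zero]
    congr 1
    simp only [eq_iff_iff]
    omega

theorem sum_lt_le (k : ℕ) (f : Fin n → ℕ) :
    (∑ u : Fin n, if u.val < k then f u else 0) ≤ ∑ u, f u := by
  refine Finset.sum_le_sum fun u _ => ?_
  split <;> omega

/-- One term of a row times a vector of numbers of walks. -/
def countCell : Prog :=
  .assign 8 (.reg 8 +ₑ .load 2 (.reg 6 *ₑ .reg 0 +ₑ .reg 7) *ₑ .load 6 (.reg 5 *ₑ .reg 0 +ₑ .reg 7))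

/-- The number of walks of a given length from one state. -/
def countRow : Prog :=
  .assign 8 (.lit 0) ;; forTo 7 0 countCell ;;
    .store 6 ((.reg 5 +ₑ .lit 1) *ₑ .reg 0 +ₑ .reg 6) (.reg 8)

/-- The numbers of walks of all lengths up to `m`. -/
def countProg : Prog :=
  forTo 5 0 (.store 6 (.reg 5) (.lit 1)) ;; forTo 5 3 (forTo 6 0 countRow)

/-- Segment 6 holds the numbers of walks. -/
def CountOut (A : PCA n σ) (m : ℕ) (s : State) : Prop :=
  ∀ (l : ℕ) (v : Fin n), l ≤ m → s.mem 6 (l * n + v) = A.cnt l v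

theorem Cfg.Fits.cnt_le {c : Cfg} (hc : c.Fits n σ m) (A : PCA n σ) {l : ℕ} (hl : l ≤ m) (v : Fin n) :
    A.cnt l v ≤ c.B :=
  (A.cnt_le l v).trans ((Nat.pow_le_pow_right hc.σpos hl).trans hc.pow)

theorem countRow_spec (A : PCA n σ) {c : Cfg} (hc : c.Fits n σ m) {s : State} (hs : Bdd c s)
    (h0 : s.reg 0 = n) (hmat : ∀ v u : Fin n, s.mem 2 (v * n + u) = A.mult v u) {l : ℕ} (hl : l < m)
    {v : Fin n} (h5 : s.reg 5 = l) (h6 : s.reg 6 = v)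
    (hcnt : ∀ u : Fin n, s.mem 6 (l * n + u) = A.cnt l u) :
    HT c countRow s (7 + ((n * (countCell.K + 61) + 37) + 300)) fun s' =>
      s'.mem 6 = Function.update (s.mem 6) ((l + 1) * n + v) (A.cnt (l + 1) v) := by
  have hsm := hc.small
  have hle := hc.le
  have hv := v.2
  refine HT.seq (T₁ := 7) (Q₁ := fun s' => s' = s.setReg 8 0)
    (HT.of_wp (p := .assign 8 (.lit 0)) hc.hN hc.hB hs ⟨Nat.zero_le _, Nat.zero_le _, rfl⟩) ?_
  rintro _ hs₁ - rfl
  have hloop := HT.forTo hc.hN hc.hB (i := 7) (b := 0) (p := countCell) (s := s.setReg 8 0)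
    (T := countCell.K) (fun k s' => s'.reg 8 = ∑ u : Fin n, if u.val < k then
      A.mult v u * A.cnt l u else 0) hs₁ (by decide) (by decide) (by decide) (by simp)
    (by
      intro k s₂ hk hs₂ hf h7 hI
      have hk : k < n := by simpa [h0] using hk
      have e0 : s₂.reg 0 = n := (hf.reg 0 (by decide)).trans (by simp [h0])
      have e5 : s₂.reg 5 = l := (hf.reg 5 (by decide)).trans (by simp [h5])
      have e6 : s₂.reg 6 = v := (hf.reg 6 (by decide)).trans (by simp [h6])
      have m2 := hmat v ⟨k, hk⟩
      have m6 := hcnt ⟨k, hk⟩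
      have em2 : s₂.mem 2 = s.mem 2 := hf.mem 2 (by decide)
      have em6 : s₂.mem 6 = s.mem 6 := hf.mem 6 (by decide)
      rw [← em2] at m2
      rw [← em6] at m6
      have hm := A.mult_le v ⟨k, hk⟩
      have hb := hc.cnt_le A hl.le ⟨k, hk⟩
      have hsum := sum_lt_succ hk fun u => A.mult v u * A.cnt l u
      -- A partial sum is at most the full sum, which is a number of walks; hence the accumulator
      -- never exceeds the bound for cells.
      have hsum' := sum_lt_le (k + 1) fun u => A.mult v u * A.cnt l u
      rw [← A.cnt_succ] at hsum'
      have hb' : A.cnt (l + 1) v ≤ c.B := hc.cnt_le A (Nat.succ_le_of_lt hl) v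
      refine HT.of_wp hc.hN hc.hB hs₂ ?_
      simp [countCell, wp, Expr.ok, Expr.eval, Op.eval, e0, e5, e6, h7, m2, m6, hI, hsum,
        -Order.lt_add_one_iff]
      rw [hsum] at hsum'
      constructorm* _ ∧ _
      any_goals omega)
  rw [show (s.setReg 8 0).reg 0 = n by simp [h0]] at hloop
  refine HT.seq hloop ?_
  rintro s₂ hs₂ hf ⟨h8, -⟩
  have e0 : s₂.reg 0 = n := (hf.reg 0 (by decide)).trans (by simp [h0])
  have e5 : s₂.reg 5 = l := (hf.reg 5 (by decide)).trans (by simp [h5])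
  have e6 : s₂.reg 6 = v := (hf.reg 6 (by decide)).trans (by simp [h6])
  have e8 : s₂.reg 8 = A.cnt (l + 1) v := by
    rw [h8, A.cnt_succ]
    simp
  have em : s₂.mem 6 = s.mem 6 := hf.mem 6 (by decide)
  have hb' : A.cnt (l + 1) v ≤ c.B := hc.cnt_le A (Nat.succ_le_of_lt hl) v
  refine (HT.of_wp hc.hN hc.hB hs₂ ?_).mono (by decide) fun s' _ _ h => h
  simp [wp, Expr.ok, Expr.eval, Op.eval, e0, e5, e6, e8, em]
  omega

theorem countProg_spec : ∃ K, ∀ {n σ m : ℕ} (A : PCA n σ) {c : Cfg} {s : State},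
    c.Fits n σ m → Bdd c s → Inp A m s → (∀ v u : Fin n, s.mem 2 (v * n + u) = A.mult v u) →
    HT c countProg s (K * (m * (n * n))) (CountOut A m) := by
  refine ⟨countCell.K + 2000, fun {n σ m} A {c s} hc hs hi hmat => ?_⟩
  have hsm := hc.small
  have hle := hc.le
  have hinit := HT.forTo hc.hN hc.hB (i := 5) (b := 0) (p := .store 6 (.reg 5) (.lit 1)) (s := s)
    (T := 100) (fun k s' => ∀ v : Fin n, v.val < k → s'.mem 6 v = 1) hs (by decide) (by decide)
    (by decide) (by simp)
    (by
      intro k s₁ hk hs₁ hf h5 hI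
      refine (HT.of_wp hc.hN hc.hB hs₁ (Q := fun s' => s'.mem 6 = Function.update (s₁.mem 6) k 1)
        ?_).mono (by decide) ?_
      · simp [wp, Expr.ok, Expr.eval, h5]
        omega
      · intro s₂ _ _ h2 v hv
        rw [setReg_mem, h2]
        by_cases hvk : v.val = k
        · simp [hvk]
        · rw [Function.update_of_ne hvk]
          exact hI v (by omega))
  rw [hi.n] at hinit
  have hb : HT c countProg s ((n * (100 + 61) + 37) + (m * ((n * ((7 + ((n * (countCell.K + 61) + 37)
      + 300)) + 61) + 37) + 61) + 37)) (CountOut A m) := by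
    refine HT.seq hinit ?_
    rintro s₁ hs₁ hf₁ ⟨h1, -⟩
    have hi₁ := hi.fr hf₁
    have hmat₁ : ∀ v u : Fin n, s₁.mem 2 (v * n + u) = A.mult v u := by
      rw [hf₁.mem 2 (by decide)]; exact hmat
    have hloop := HT.forTo hc.hN hc.hB (i := 5) (b := 3) (p := forTo 6 0 countRow) (s := s₁)
      (T := n * ((7 + ((n * (countCell.K + 61) + 37) + 300)) + 61) + 37)
      (fun k s' => ∀ (l : ℕ) (v : Fin n), l ≤ k → s'.mem 6 (l * n + v) = A.cnt l v) hs₁ (by decide)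
      (by decide) (by decide)
      (by
        intro l v hl
        obtain rfl : l = 0 := by omega
        rw [zero_mul, zero_add, setReg_mem, PCA.cnt]
        exact h1 v v.2)
      (by
        intro k s₂ hk hs₂ hf₂ h5 hI
        have hi₂ := hi₁.fr hf₂
        rw [hi₁.m] at hk
        have hl2 := HT.forTo hc.hN hc.hB (i := 6) (b := 0) (p := countRow) (s := s₂)
          (T := 7 + ((n * (countCell.K + 61) + 37) + 300))
          (fun j s' => (∀ (l : ℕ) (v : Fin n), l ≤ k → s'.mem 6 (l * n + v) = A.cnt l v) ∧
            ∀ v : Fin n, v.val < j → s'.mem 6 ((k + 1) * n + v) = A.cnt (k + 1) v) hs₂ (by decide)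
          (by decide) (by decide) (by simpa using hI)
          (by
            rintro j s₃ hj hs₃ hf₃ h6 ⟨hI1, hI2⟩
            rw [hi₂.n] at hj
            refine (countRow_spec A hc hs₃ ((hf₃.reg 0 (by decide)).trans hi₂.n)
              (by rw [hf₃.mem 2 (by decide), hf₂.mem 2 (by decide)]; exact hmat₁) hk (v := ⟨j, hj⟩)
              ((hf₃.reg 5 (by decide)).trans h5) h6 (fun u => hI1 k u le_rfl)).mono le_rfl ?_
            intro s₄ _ _ h4
            constructor
            · intro l v hl
              rw [setReg_mem, h4, Function.update_of_ne, hI1 l v hl]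
              rw [ne_eq, addr_inj v.2 hj]
              omega
            · intro v hv
              rw [setReg_mem, h4]
              by_cases hvj : v = ⟨j, hj⟩
              · subst hvj; simp
              · have : v.val ≠ j := fun h => hvj (Fin.ext h)
                rw [Function.update_of_ne, hI2 v (by omega)]
                rw [ne_eq, addr_inj v.2 hj]
                omega)
        rw [hi₂.n] at hl2
        refine hl2.mono le_rfl ?_
        rintro s₃ - - ⟨⟨h2, h3⟩, -⟩ l v hl
        rw [setReg_mem]
        rcases Nat.lt_succ_iff_lt_or_eq.1 (Nat.lt_succ_of_le hl) with h | rfl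
        · exact h2 l v (by omega)
        · exact h3 v v.2)
    rw [hi₁.m] at hloop
    refine hloop.mono le_rfl ?_
    rintro s₂ - - ⟨h2, -⟩ l v hl
    exact h2 l v hl
  refine hb.mono ?_ fun _ _ _ h => h
  have hn := hc.npos
  have hm := hc.mpos
  have h1 : m * n ≤ m * (n * n) := Nat.mul_le_mul_left _ (Nat.le_mul_of_pos_right _ hn)
  have h2 : m ≤ m * (n * n) := Nat.le_mul_of_pos_right _ (Nat.mul_pos hn hn)
  have h3 : n ≤ m * (n * n) :=
    (Nat.le_mul_of_pos_right _ hn).trans (Nat.le_mul_of_pos_left _ hm)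
  have h4 : 1 ≤ m * (n * n) := Nat.mul_pos hm (Nat.mul_pos hn hn)
  -- A state of one length costs 7 + 37 + 300 + 61 = 405 besides the inner rounds, a length costs 37
  -- + 61 = 98, and the initial vector takes 161 per state.
  calc _ = (countCell.K + 61) * (m * (n * n)) + 405 * (m * n) + 98 * m + 161 * n + 74 * 1 := by ring
    _ ≤ (countCell.K + 61) * (m * (n * n)) + 405 * (m * (n * n)) + 98 * (m * (n * n)) +
        161 * (m * (n * n)) + 74 * (m * (n * n)) := by gcongr
    _ ≤ _ := by
      rw [← Nat.add_mul, ← Nat.add_mul, ← Nat.add_mul, ← Nat.add_mul]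
      exact Nat.mul_le_mul_right _ (by omega)

/-! ### The first two edges of the sorted lists -/

/-- Comparison of one edge with the best edge found so far. -/
def bestCell : Prog :=
  .assign 7 (.load 0 (.reg 5 *ₑ .reg 1 +ₑ .reg 6)) ;;
  .ite (.reg 7)
    (.ite (.reg 6 +ₑ .lit 1 =ₑ .reg 9) .skip
      (.ite (.reg 10 <ₑ .load 4 (.reg 7 -ₑ .lit 1) +ₑ .lit 1)
        (.assign 8 (.reg 6 +ₑ .lit 1) ;; .assign 10 (.load 4 (.reg 7 -ₑ .lit 1) +ₑ .lit 1) ;;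
          .assign 11 (.reg 7 -ₑ .lit 1))
        .skip))
    .skip

/-- The best edge other than the one in register 9. -/
def bestProg : Prog :=
  (.assign 8 (.lit 0) ;; .assign 10 (.lit 0) ;; .assign 11 (.lit 0)) ;; forTo 6 1 bestCell

/-- Best edge, with a label less than `j` and with code different from `x`. -/
def BestInv (A : PCA n σ) (m : ℕ) (v : Fin n) (x j : ℕ) (s : State) : Prop :=
  (s.reg 8 = 0 ∧ s.reg 10 = 0 ∧ ∀ a : Fin σ, a.val < j → (A.step v a).isSome → a.val + 1 = x) ∨
  ∃ b : Fin σ, b.val < j ∧ (A.step v b).isSome ∧ b.val + 1 ≠ x ∧ s.reg 8 = b + 1 ∧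
    s.reg 10 = A.lenC m (A.target v b) + 1 ∧ s.reg 11 = A.target v b ∧
    ∀ a : Fin σ, a.val < j → (A.step v a).isSome → a.val + 1 ≠ x → A.Before v b a

/-- The letters are scanned in increasing order and only a strictly larger code replaces the best
one, so ties go to the smaller letter. Labels and codes are stored plus one: 0 in register 10 means
that no edge has been found, and `x = 0` excludes no letter. -/
theorem bestCell_spec (A : PCA n σ) {c : Cfg} (hc : c.Fits n σ m) {s : State} (hs : Bdd c s)
    (hi : Inp A m s) (hlen : LenOut A m s) {v : Fin n} {a : Fin σ} {x : ℕ} (h5 : s.reg 5 = v)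
    (h6 : s.reg 6 = a) (h9 : s.reg 9 = x) (hI : BestInv A m v x a s) :
    HT c bestCell s bestCell.K (BestInv A m v x (a + 1)) := by
  have hsm := hc.small
  have hle := hc.le
  have hv := v.2
  have ha := a.2
  have htab := table_apply A v a
  have hl := hlen (A.target v a)
  have hlb := A.lenC_le m (A.target v a)
  have hq := (A.target v a).2
  have hlast : ∀ b : Fin σ, b.val < a + 1 → b.val < a ∨ b = a := by
    intro b hb
    rcases Nat.lt_succ_iff_lt_or_eq.1 hb with h | h
    · exact Or.inl h
    · exact Or.inr (Fin.ext h)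
  -- the best edge does not change
  have keep : ∀ s' : State, s'.reg 8 = s.reg 8 → s'.reg 10 = s.reg 10 → s'.reg 11 = s.reg 11 →
      ((A.step v a).isSome → a.val + 1 ≠ x → A.lenC m (A.target v a) + 1 ≤ s.reg 10) →
      BestInv A m v x (a + 1) s' := by
    intro s' e8 e10 e11 h
    unfold BestInv
    rw [e8, e10, e11]
    rcases hI with ⟨k1, k2, k3⟩ | ⟨b, k1, k2, k3, k4, k5, k6, k7⟩
    · refine Or.inl ⟨k1, k2, fun d hd hd' => ?_⟩
      rcases hlast d hd with h1 | rfl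
      · exact k3 d h1 hd'
      · by_contra hne
        have := h hd' hne
        omega
    · refine Or.inr ⟨b, by omega, k2, k3, k4, k5, k6, fun d hd hd' hne => ?_⟩
      rcases hlast d hd with h1 | rfl
      · exact k7 d h1 hd' hne
      · have := h hd' hne
        rw [PCA.before_iff A m]
        by_cases he : A.lenC m (A.target v d) = A.lenC m (A.target v b)
        · exact Or.inr ⟨he, by rw [Fin.le_def]; omega⟩
        · left; omega
  generalize hQ : BestInv A m v x (a + 1) = Q at keep ⊢
  refine HT.of_wp hc.hN hc.hB hs ?_
  by_cases hsome : (A.step v a).isSome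
  · rw [if_pos hsome] at htab
    simp [bestCell, wp, Expr.ok, Expr.eval, Op.eval, hi.σ, h5, h6, h9, hi.table, htab, hl]
    refine ⟨⟨by omega, by omega⟩, by omega, by omega, fun he => ?_, fun hne => ⟨by omega, fun hlt =>
      ⟨by omega, ?_⟩, fun hge => ?_⟩⟩
    · exact keep _ (by simp) (by simp) (by simp) fun _ h => absurd he h
    · rw [← hQ]
      unfold BestInv
      refine ⟨by omega, by omega, by omega, by omega, by omega, Or.inr ⟨a, by omega, hsome, hne, by simp, by simp, by simp, fun d hd hd' hne' => ?_⟩⟩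
      rcases hlast d hd with h1 | rfl
      · rcases hI with ⟨k1, k2, k3⟩ | ⟨b, k1, k2, k3, k4, k5, k6, k7⟩
        · exact absurd (k3 d h1 hd') hne'
        · refine PCA.before_trans ?_ (k7 d h1 hd' hne')
          rw [PCA.before_iff A m]
          left; omega
      · exact Or.inr ⟨rfl, le_rfl⟩
    · exact keep _ (by simp) (by simp) (by simp) fun _ _ => by omega
  · rw [if_neg hsome] at htab
    simp [bestCell, wp, Expr.ok, Expr.eval, Op.eval, hi.σ, h5, h6, hi.table, htab]
    refine ⟨⟨by omega, by omega⟩, keep _ (by simp) (by simp) (by simp) fun h => absurd h hsome⟩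

theorem bestProg_spec (A : PCA n σ) {c : Cfg} (hc : c.Fits n σ m) {s : State} (hs : Bdd c s)
    (hi : Inp A m s) (hlen : LenOut A m s) {v : Fin n} {x : ℕ} (h5 : s.reg 5 = v)
    (h9 : s.reg 9 = x) :
    HT c bestProg s (50 + (σ * (bestCell.K + 61) + 37)) (BestInv A m v x σ) := by
  refine HT.seq (T₁ := 50) (Q₁ := fun s' => s' = ((s.setReg 8 0).setReg 10 0).setReg 11 0)
    ((HT.of_wp hc.hN hc.hB hs (by simp [wp, Expr.ok, Expr.eval])).mono (by decide)
      fun _ _ _ h => h) ?_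
  rintro _ hs₁ hf rfl
  have hi₁ := hi.fr hf
  set s₁ := ((s.setReg 8 0).setReg 10 0).setReg 11 0 with hs1
  have hloop := HT.forTo hc.hN hc.hB (i := 6) (b := 1) (p := bestCell) (s := s₁)
    (T := bestCell.K) (fun k s' => BestInv A m v x k s') hs₁ (by decide) (by decide)
    (by decide) (Or.inl ⟨by simp [hs1], by simp [hs1], by simp⟩)
    (by
      intro k s₂ hk hs₂ hf₂ h6 hI
      rw [hi₁.σ] at hk
      refine (bestCell_spec A hc hs₂ (hi₁.fr hf₂) (fun u => ?_) (a := ⟨k, hk⟩) ?_ h6 ?_ hI).mono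
        le_rfl ?_
      · rw [hf₂.mem 4 (by decide)]; exact hlen u
      · rw [hf₂.reg 5 (by decide)]; simp [hs1, h5]
      · rw [hf₂.reg 9 (by decide)]; simp [hs1, h9]
      · intro s₃ _ _ h
        simpa [BestInv] using h)
  rw [hi₁.σ] at hloop
  exact hloop.mono le_rfl fun s' _ _ h => h.1

/-- A code for an edge that may not exist. -/
def optC (o : Option (Fin σ)) : ℕ :=
  match o with
  | some a => a + 1
  | none => 0

/-- The cells of the segments 7 to 10 for the state `v`. -/
structure EdgeCell (A : PCA n σ) (m : ℕ) (v : Fin n) (s : State) : Prop where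
  fst : s.mem 7 v = optC (A.edges v)[0]?
  snd : s.mem 8 v = optC (A.edges v)[1]?
  nxt : (A.edges v)[0]? ≠ none → s.mem 9 v = A.next v
  br : s.mem 10 v = A.brC m v

/-- The first two edges of one state. -/
def edgeCell : Prog :=
  .assign 9 (.lit 0) ;; bestProg ;;
  (.store 7 (.reg 5) (.reg 8) ;; .store 9 (.reg 5) (.reg 11) ;; .assign 9 (.reg 8)) ;; bestProg ;;
  .store 8 (.reg 5) (.reg 8) ;; .store 10 (.reg 5) (.reg 10)

/-- The first two edges of all states. -/
def edgeProg : Prog := forTo 5 0 edgeCell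

/-- The first scan excludes nothing, and the second excludes its result. What the second scan leaves
in register 10 is the branch code `brC`, including the value 0 when there is no second edge. -/
theorem edgeCell_spec (A : PCA n σ) {c : Cfg} (hc : c.Fits n σ m) {s : State} (hs : Bdd c s)
    (hi : Inp A m s) (hlen : LenOut A m s) {v : Fin n} (h5 : s.reg 5 = v) :
    HT c edgeCell s (7 + ((50 + (σ * (bestCell.K + 61) + 37)) + (100 +
      ((50 + (σ * (bestCell.K + 61) + 37)) + 100)))) fun s' => EdgeCell A m v s' ∧
        ∀ k, k ≠ v.val → s'.mem 7 k = s.mem 7 k ∧ s'.mem 8 k = s.mem 8 k ∧ s'.mem 9 k = s.mem 9 k ∧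
          s'.mem 10 k = s.mem 10 k := by
  refine HT.seq (T₁ := 7) (Q₁ := fun s' => s' = s.setReg 9 0)
    (HT.of_wp (p := .assign 9 (.lit 0)) hc.hN hc.hB hs ⟨Nat.zero_le _, Nat.zero_le _, rfl⟩) ?_
  rintro _ hs₁ hf₁ rfl
  have hi₁ := hi.fr hf₁
  refine HT.seq (bestProg_spec A hc hs₁ hi₁ hlen (v := v) (x := 0) (by simp [h5]) (by simp)) ?_
  intro s₂ hs₂ hf₂ hB₂
  have hi₂ := hi₁.fr hf₂
  have e5 : s₂.reg 5 = v := (hf₂.reg 5 (by decide)).trans (by simp [h5])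
  have em : ∀ g, g ∉ bestProg.ws → s₂.mem g = s.mem g := fun g hg => hf₂.mem g hg
  have h8b := hs₂.1 8
  have h11b := hs₂.1 11
  refine HT.seq (T₁ := 100) (Q₁ := fun s' => s'.reg 5 = v ∧ s'.reg 9 = s₂.reg 8 ∧
    s'.mem 7 = Function.update (s.mem 7) v (s₂.reg 8) ∧
    s'.mem 9 = Function.update (s.mem 9) v (s₂.reg 11) ∧ s'.mem 8 = s.mem 8 ∧
    s'.mem 10 = s.mem 10 ∧ s'.mem 4 = s.mem 4) ((HT.of_wp hc.hN hc.hB hs₂ ?_).mono (by decide)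
      fun _ _ _ h => h) ?_
  · simp [wp, Expr.ok, Expr.eval, e5, h8b, h11b, em 7 (by decide), em 8 (by decide),
      em 9 (by decide), em 10 (by decide), em 4 (by decide)]
  rintro s₃ hs₃ hf₃ ⟨g5, g9, g7, gm9, g8, g10, g4⟩
  have hi₃ := hi₂.fr hf₃
  refine HT.seq (bestProg_spec A hc hs₃ hi₃ (by unfold LenOut; rw [g4]; exact hlen) g5 g9) ?_
  intro s₄ hs₄ hf₄ hB₄
  have k5 : s₄.reg 5 = v := (hf₄.reg 5 (by decide)).trans g5
  have km : ∀ g, g ∉ bestProg.ws → s₄.mem g = s₃.mem g := fun g hg => hf₄.mem g hg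
  have h8b := hs₄.1 8
  have h10b := hs₄.1 10
  refine (HT.of_wp hc.hN hc.hB hs₄ (Q := fun s' =>
    s'.mem 7 = Function.update (s.mem 7) v (s₂.reg 8) ∧
    s'.mem 9 = Function.update (s.mem 9) v (s₂.reg 11) ∧
    s'.mem 8 = Function.update (s.mem 8) v (s₄.reg 8) ∧
    s'.mem 10 = Function.update (s.mem 10) v (s₄.reg 10)) ?_).mono (by decide) ?_
  · simp [wp, Expr.ok, Expr.eval, k5, h8b, h10b, km 7 (by decide), km 8 (by decide),
      km 9 (by decide), km 10 (by decide), g7, g8, gm9, g10]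
  rintro s₅ - - ⟨l7, l9, l8, l10⟩
  refine ⟨?_, fun k hk => ?_⟩
  · rcases hB₂ with ⟨b1, b2, b3⟩ | ⟨b, b1, b2, b3, b4, b5, b6, b7⟩
    · have hnil : A.edges v = [] := by
        rw [List.eq_nil_iff_forall_not_mem]
        intro a ha
        have := b3 a a.2 (PCA.mem_edges.1 ha)
        omega
      have hB4 : s₄.reg 8 = 0 ∧ s₄.reg 10 = 0 := by
        rcases hB₄ with ⟨d1, d2, _⟩ | ⟨d, d1, d2, _⟩
        · exact ⟨d1, d2⟩
        · have := b3 d d.2 d2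
          omega
      constructor
      · rw [l7, Function.update_self, b1, hnil]; rfl
      · rw [l8, Function.update_self, hB4.1, hnil]; rfl
      · rw [hnil]; simp
      · rw [l10, Function.update_self, hB4.2, PCA.brC, hnil]; rfl
    · have hfst : (A.edges v)[0]? = some b :=
        PCA.getElem?_edges_zero.2 ⟨b2, fun a ha => b7 a a.2 ha (by omega)⟩
      have hx : ∀ a : Fin σ, a.val + 1 = s₂.reg 8 ↔ a = b := by
        intro a
        rw [b4, Fin.ext_iff]
        omega
      have hsnd : s₄.reg 8 = optC (A.edges v)[1]? ∧ s₄.reg 10 = A.brC m v := by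
        rcases hB₄ with ⟨d1, d2, d3⟩ | ⟨d, d1, d2, d3, d4, d5, d6, d7⟩
        · have hnone : (A.edges v)[1]? = none := by
            cases h : (A.edges v)[1]? with
            | none => rfl
            | some d =>
              have h1 := ((PCA.getElem?_edges_one hfst).1 h).1
              exact absurd ((hx d).1 (d3 d d.2 h1.1)) h1.2
          simp [PCA.brC, hnone, d1, d2, optC]
        · have hsome : (A.edges v)[1]? = some d := by
            refine (PCA.getElem?_edges_one hfst).2 ⟨⟨d2, fun h => d3 ((hx d).2 h)⟩, fun a ha => ?_⟩
            exact d7 a a.2 ha.1 fun h => ha.2 ((hx a).1 h)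
          simp [PCA.brC, hsome, d4, d5, optC]
      constructor
      · rw [l7, Function.update_self, b4, hfst]; rfl
      · rw [l8, Function.update_self, hsnd.1]
      · intro _
        rw [l9, Function.update_self, b6, PCA.next_eq hfst]
      · rw [l10, Function.update_self, hsnd.2]
  · rw [l7, l8, l9, l10]
    simp [Function.update_of_ne hk]

theorem edgeProg_spec : ∃ K, ∀ {n σ m : ℕ} (A : PCA n σ) {c : Cfg} {s : State},
    c.Fits n σ m → Bdd c s → Inp A m s → LenOut A m s →
    HT c edgeProg s (K * (n * σ)) fun s' => ∀ v, EdgeCell A m v s' := by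
  refine ⟨2 * bestCell.K + 2000, fun {n σ m} A {c s} hc hs hi hlen => ?_⟩
  have hloop := HT.forTo hc.hN hc.hB (i := 5) (b := 0) (p := edgeCell) (s := s)
    (T := 7 + ((50 + (σ * (bestCell.K + 61) + 37)) + (100 +
      ((50 + (σ * (bestCell.K + 61) + 37)) + 100))))
    (fun k s' => ∀ v : Fin n, v.val < k → EdgeCell A m v s') hs (by decide) (by decide) (by decide)
    (by intro v hv; omega)
    (by
      intro k s₁ hk hs₁ hf₁ h5 hI
      rw [hi.n] at hk
      refine (edgeCell_spec A hc hs₁ (hi.fr hf₁) (by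
        intro v; rw [hf₁.mem 4 (by decide)]; exact hlen v) (v := ⟨k, hk⟩) h5).mono le_rfl ?_
      rintro s₂ - - ⟨h1, h2⟩ v hv
      by_cases hvk : v = ⟨k, hk⟩
      · subst hvk
        exact ⟨h1.fst, h1.snd, h1.nxt, h1.br⟩
      · have hne : v.val ≠ k := fun h => hvk (Fin.ext h)
        obtain ⟨e7, e8, e9, e10⟩ := h2 v hne
        have := hI v (by omega)
        exact ⟨e7.trans this.fst, e8.trans this.snd, fun h => e9.trans (this.nxt h),
          e10.trans this.br⟩)
  rw [hi.n] at hloop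
  refine hloop.mono ?_ fun s' _ _ h v => h.1 v v.2
  have h1 : n ≤ n * σ := Nat.le_mul_of_pos_right _ hc.σpos
  have h2 : 1 ≤ n * σ := Nat.mul_pos hc.npos hc.σpos
  calc _ = (2 * bestCell.K + 122) * (n * σ) + 442 * n + 37 * 1 := by ring
    _ ≤ (2 * bestCell.K + 122) * (n * σ) + 442 * (n * σ) + 37 * (n * σ) := by gcongr
    _ ≤ _ := by
      rw [← Nat.add_mul, ← Nat.add_mul]
      exact Nat.mul_le_mul_right _ (by omega)

end RAM

/-! ### Left and right subtrees of a Cartesian tree -/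

namespace PCA

theorem IsTop.topPos_eq {k : ℕ → ℕ} {a b r : ℕ} (h : IsTop k a b r) : topPos k a b = r + 1 :=
  topPos_eq_succ_iff.2 h

theorem topPos_self (k : ℕ → ℕ) (a : ℕ) : topPos k a a = 0 :=
  topPos_eq_zero_iff.2 fun q h1 h2 => by omega

/-- A new position that is beaten by some earlier one is not the maximum of the prolonged interval.
-/
theorem topPos_succ_of_lt {k : ℕ → ℕ} {a p q : ℕ} (hq : a ≤ q) (hqp : q < p) (h : k p < k q) :
    topPos k a (p + 1) = topPos k a p := by
  have h0 : topPos k a p ≠ 0 := fun h0 => by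
    have := topPos_eq_zero_iff.1 h0 q hq hqp
    omega
  have ht := isTop_of_ne h0
  have hle : k q ≤ k (topPos k a p - 1) := by
    rcases lt_trichotomy q (topPos k a p - 1) with h1 | h1 | h1
    · exact ht.before q hq h1
    · rw [← h1]
    · exact (ht.after q h1 hqp).le
  rw [topPos, if_neg]
  rintro ⟨_, _, h1 | h1⟩ <;> omega

theorem topPos_succ_of_zero {k : ℕ → ℕ} {a p : ℕ} (h : k p = 0) :
    topPos k a (p + 1) = topPos k a p := by
  rw [topPos, if_neg]
  rintro ⟨_, h1, _⟩
  exact h1 h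

theorem topPos_succ_of_forall {k : ℕ → ℕ} {a p : ℕ} (ha : a ≤ p) (hp : k p ≠ 0)
    (h : ∀ q, a ≤ q → q < p → k q ≤ k p) : topPos k a (p + 1) = p + 1 :=
  IsTop.topPos_eq ⟨ha, by omega, hp, h, fun q _ _ => by omega⟩

/-- The start of the interval whose maximum is the `i`-th element of the stack. -/
def lo (stack : ℕ → ℕ) : ℕ → ℕ
  | 0 => 0
  | i + 1 => stack i + 1

/-- The invariant of the construction of a Cartesian tree with a stack: the positions less than `p`
have been processed, and `last` is the code of the root of the subtree popped last. -/
structure Cart (k : ℕ → ℕ) (p sp last : ℕ) (stack left right : ℕ → ℕ) : Prop where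
  sp_le : sp ≤ p
  stack_eq : ∀ i, i < sp → stack i + 1 = topPos k (lo stack i) p
  last_eq : last = topPos k (lo stack sp) p
  last_le : last = 0 ∨ k (last - 1) ≤ k p
  left_eq : ∀ q a, q < p → a ≤ q → k q ≠ 0 → (∀ x, a ≤ x → x < q → k x ≤ k q) →
    (a = 0 ∨ k q < k (a - 1)) → left q = topPos k a q
  right_eq : ∀ q b, q < b → b ≤ p → k q ≠ 0 → (∀ x, q < x → x < b → k x < k q) →
    (b = p ∨ k q ≤ k b) → right q = topPos k (q + 1) b

namespace Cart

variable {k : ℕ → ℕ} {p sp last : ℕ} {stack left right : ℕ → ℕ}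

theorem init (k stack left right : ℕ → ℕ) : Cart k 0 0 0 stack left right where
  sp_le := le_rfl
  stack_eq i hi := by omega
  last_eq := rfl
  last_le := Or.inl rfl
  left_eq q a h := by omega
  right_eq q b h h' := by omega

theorem isTop (h : Cart k p sp last stack left right) {i : ℕ} (hi : i < sp) :
    IsTop k (lo stack i) p (stack i) :=
  topPos_eq_succ_iff.1 (h.stack_eq i hi).symm

theorem lo_le (h : Cart k p sp last stack left right) {i : ℕ} (hi : i ≤ sp) : lo stack i ≤ p := by
  cases i with
  | zero => exact Nat.zero_le _
  | succ i => exact (h.isTop hi).lt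

/-- The positions after the top of the stack form the subtree popped last, and its root was popped
because its key is at most `k p`. If nothing was popped, their keys are 0. -/
theorem le_of_lo_le (h : Cart k p sp last stack left right) {x : ℕ} (h1 : lo stack sp ≤ x)
    (h2 : x < p) : k x ≤ k p := by
  by_cases h0 : last = 0
  · have := topPos_eq_zero_iff.1 (h.last_eq.symm.trans h0) x h1 h2
    omega
  · have ht := isTop_of_ne (h.last_eq ▸ h0)
    rw [← h.last_eq] at ht
    have hl : k (last - 1) ≤ k p := by
      rcases h.last_le with h3 | h3
      · exact absurd h3 h0
      · exact h3
    refine le_trans ?_ hl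
    rcases lt_trichotomy x (last - 1) with h3 | h3 | h3
    · exact ht.before x h1 h3
    · rw [← h3]
    · exact (ht.after x h3 h2).le

/-- The keys strictly decrease from the bottom of the stack to its top, since each element is the
last maximum of its interval and the later ones lie in that interval. Comparing with the top is
enough. -/
theorem lt_of_lt_top (h : Cart k p sp last stack left right) (hsp : sp ≠ 0 → k p < k (stack (sp - 1)))
    {i : ℕ} (hi : i < sp) : k p < k (stack i) := by
  have h1 := hsp (by omega)
  rcases Nat.lt_or_ge i (sp - 1) with h2 | h2
  · have h3 := (h.isTop (i := sp - 1) (by omega))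
    have h4 : stack i < stack (sp - 1) := by
      have : ∀ j, i < j → j < sp → stack i < stack j := by
        intro j hij
        induction j, hij using Nat.le_induction with
        | base => intro hj; exact (h.isTop hj).le
        | succ j hj ih =>
          intro hj'
          have := (h.isTop hj').le
          simp only [lo] at this
          have := ih (by omega)
          omega
      exact this _ h2 (by omega)
    have := (h.isTop hi).after _ h4 h3.lt
    omega
  · rwa [show i = sp - 1 by omega]

theorem skip (h : Cart k p sp last stack left right) (hp : k p = 0) :
    Cart k (p + 1) sp last stack left right := by
  have h0 : last = 0 := by
    rcases h.last_le with h1 | h1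
    · exact h1
    · by_contra hne
      have ht := isTop_of_ne (h.last_eq ▸ hne)
      rw [← h.last_eq] at ht
      have := ht.ne
      omega
  refine ⟨by have := h.sp_le; omega, fun i hi => ?_, ?_, Or.inl h0, fun q a h1 h2 h3 h4 h5 => ?_,
    fun q b h1 h2 h3 h4 h5 => ?_⟩
  · rw [topPos_succ_of_zero hp]; exact h.stack_eq i hi
  · rw [topPos_succ_of_zero hp]; exact h.last_eq
  · have hqp : q ≠ p := by rintro rfl; exact h3 hp
    exact h.left_eq q a (by omega) h2 h3 h4 h5
  · have hqp : q ≠ p := by rintro rfl; exact h3 hp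
    by_cases hb : b = p + 1
    · subst hb
      rw [topPos_succ_of_zero hp]
      exact h.right_eq q p (by omega) le_rfl h3 (fun x hx hx' => h4 x hx (by omega)) (Or.inl rfl)
    · exact h.right_eq q b h1 (by omega) h3 h4 (by omega)

/-- The popped element is the root of everything behind the new top, hence the new value of `last`.
-/
theorem pop (h : Cart k p sp last stack left right) (hsp : sp ≠ 0) (hle : k (stack (sp - 1)) ≤ k p) :
    Cart k p (sp - 1) (stack (sp - 1) + 1) stack left right :=
  ⟨by have := h.sp_le; omega, fun i hi => h.stack_eq i (by omega), h.stack_eq _ (by omega),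
    Or.inr hle, h.left_eq, h.right_eq⟩

/-- The new array of right subtrees after a push. -/
def pushRight (sp p : ℕ) (stack right : ℕ → ℕ) : ℕ → ℕ :=
  if sp = 0 then Function.update right p 0
  else Function.update (Function.update right p 0) (stack (sp - 1)) (p + 1)

/-- The subtree popped last becomes the left subtree of `p`, and `p` becomes the right child of the
old top of the stack. -/
theorem push (h : Cart k p sp last stack left right) (hp : k p ≠ 0)
    (hsp : sp ≠ 0 → k p < k (stack (sp - 1))) :
    Cart k (p + 1) (sp + 1) 0 (Function.update stack sp p) (Function.update left p last)
      (pushRight sp p stack right) := by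
  have hlo : ∀ i, i ≤ sp → lo (Function.update stack sp p) i = lo stack i := by
    intro i hi
    cases i with
    | zero => rfl
    | succ i => simp only [lo]; rw [Function.update_of_ne (by omega)]
  have hlo' : lo (Function.update stack sp p) (sp + 1) = p + 1 := by simp [lo]
  have hlosp := h.lo_le le_rfl
  refine ⟨by have := h.sp_le; omega, fun i hi => ?_, ?_, Or.inl rfl, fun q a h1 h2 h3 h4 h5 => ?_,
    fun q b h1 h2 h3 h4 h5 => ?_⟩
  · rw [hlo i (by omega)]
    by_cases hi' : i = sp
    · subst hi'
      rw [Function.update_self, topPos_succ_of_forall hlosp hp fun q => h.le_of_lo_le]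
    · rw [Function.update_of_ne hi', h.stack_eq i (by omega)]
      have ht := h.isTop (i := i) (by omega)
      exact (topPos_succ_of_lt ht.le ht.lt (h.lt_of_lt_top hsp (by omega))).symm
  · rw [hlo', topPos_self]
  · by_cases hq : q = p
    · subst hq
      rw [Function.update_self, h.last_eq]
      -- An interval dominated by the new position with a larger key just before it must begin right
      -- behind the top of the stack: the keys from there on are at most the new one, and that of
      -- the top is larger.
      have : lo stack sp = a := by
        cases sp with
        | zero =>
          rcases Nat.eq_zero_or_pos a with rfl | ha
          · rfl
          · have := h.le_of_lo_le (x := a - 1) (Nat.zero_le _) (by omega)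
            omega
        | succ j =>
          have h6 := hsp (by omega)
          have h7 := h.isTop (i := j) (by omega)
          simp only [Nat.add_sub_cancel] at h6
          have h8 : stack j < a := by
            by_contra hc
            have := h4 (stack j) (by omega) h7.lt
            omega
          rcases h5 with rfl | h5
          · omega
          · by_contra hne
            simp only [lo] at hne
            have := h.le_of_lo_le (x := a - 1) (by simp only [lo]; omega) (by omega)
            omega
      rw [this]
    · rw [Function.update_of_ne hq]
      exact h.left_eq q a (by omega) h2 h3 h4 h5
  · have hps : sp ≠ 0 → stack (sp - 1) < p := fun h0 => (h.isTop (by omega)).lt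
    by_cases hq : q = p
    · subst hq
      obtain rfl : b = q + 1 := by omega
      rw [topPos_self, pushRight]
      split
      · simp
      · rename_i h0
        have := hps h0
        rw [Function.update_of_ne (by omega), Function.update_self]
    by_cases ht : sp ≠ 0 ∧ q = stack (sp - 1)
    · obtain ⟨h0, rfl⟩ := ht
      have h6 := hsp h0
      have h7 : ∀ x, stack (sp - 1) < x → x < p → k x ≤ k p := by
        intro x hx hx'
        refine h.le_of_lo_le ?_ hx'
        rw [show sp = sp - 1 + 1 by omega]
        exact hx
      -- The keys behind the top, including that of `p`, are smaller than the key of the top, so no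
      -- right boundary can be reached before `p + 1`.
      have hb : b = p + 1 := by
        rcases h5 with h5 | h5
        · exact h5
        · rcases Nat.lt_or_ge b p with hbp | hbp
          · have := h7 b h1 hbp
            omega
          · rcases Nat.lt_or_ge p b with h8 | h8
            · omega
            · obtain rfl : b = p := by omega
              omega
      subst hb
      rw [pushRight, if_neg h0, Function.update_self]
      exact (topPos_succ_of_forall (hps h0) hp fun x hx hx' => h7 x hx hx').symm
    · have hr : pushRight sp p stack right q = right q := by
        unfold pushRight
        split
        · rw [Function.update_of_ne hq]
        · rename_i h0
          rw [Function.update_of_ne fun hh => ht ⟨h0, hh⟩, Function.update_of_ne hq]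
      rw [hr]
      by_cases hb : b = p + 1
      · subst hb
        have h6 := h4 p (by omega) (by omega)
        -- Positions behind the top have keys at most `k p`, but here `k p < k q`, and `q` is not
        -- the top itself.
        have h7 : sp ≠ 0 ∧ q < stack (sp - 1) := by
          by_contra hc
          have h8 : lo stack sp ≤ q := by
            cases sp with
            | zero => exact Nat.zero_le _
            | succ j =>
              simp only [lo, Nat.add_sub_cancel] at hc ht ⊢
              omega
          have := h.le_of_lo_le h8 (by omega)
          omega
        rw [topPos_succ_of_lt (q := stack (sp - 1)) h7.2 (hps h7.1) (hsp h7.1)]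
        exact h.right_eq q p (by omega) le_rfl h3 (fun x hx hx' => h4 x hx (by omega)) (Or.inl rfl)
      · exact h.right_eq q b h1 (by omega) h3 h4 (by
          rcases h5 with h5 | h5
          · exact absurd h5 hb
          · exact Or.inr h5)

/-- The code of the root. -/
theorem root_eq (h : Cart k p sp last stack left right) :
    topPos k 0 p = if sp = 0 then last else stack 0 + 1 := by
  split
  · rename_i h0
    subst h0
    exact h.last_eq.symm
  · exact (h.stack_eq 0 (by omega)).symm

end Cart

end PCA

/-! ### Preparation of a call: the default walk, its keys and its Cartesian tree -/

namespace RAM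

variable {n σ m : ℕ}

/-- The tables that are computed once and for all. -/
structure Tab (A : PCA n σ) (m : ℕ) (s : State) : Prop where
  inp : Inp A m s
  len : LenOut A m s
  cnt : CountOut A m s
  cell : ∀ v, EdgeCell A m v s

theorem Tab.of_eq {A : PCA n σ} {s s' : State} (h : Tab A m s)
    (hr : ∀ r ∈ [0, 1, 3], s'.reg r = s.reg r)
    (hm : ∀ g ∈ [0, 4, 6, 7, 8, 9, 10], s'.mem g = s.mem g) : Tab A m s' where
  inp := ⟨(hr 0 (by simp)).trans h.inp.n, (hr 1 (by simp)).trans h.inp.σ,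
    (hr 3 (by simp)).trans h.inp.m, by rw [hm 0 (by simp)]; exact h.inp.table⟩
  len := by unfold LenOut; rw [hm 4 (by simp)]; exact h.len
  cnt := by unfold CountOut; rw [hm 6 (by simp)]; exact h.cnt
  cell v := ⟨by rw [hm 7 (by simp)]; exact (h.cell v).fst, by rw [hm 8 (by simp)]; exact (h.cell v).snd,
    by rw [hm 9 (by simp)]; exact (h.cell v).nxt, by rw [hm 10 (by simp)]; exact (h.cell v).br⟩

theorem Tab.fr {A : PCA n σ} {s s' : State} {p : Prog} (h : Tab A m s) (hf : Fr p s s')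
    (hr : ∀ r ∈ [0, 1, 3], r ∉ p.wr := by decide)
    (hm : ∀ g ∈ [0, 4, 6, 7, 8, 9, 10], g ∉ p.ws := by decide) : Tab A m s' :=
  h.of_eq (fun r h1 => hf.reg r (hr r h1)) fun g h1 => hf.mem g (hm g h1)

/-- One vertex of the default walk. -/
def walkCell : Prog :=
  .store 11 (.reg 5) (.reg 6) ;;
  .ite (.load 10 (.reg 6))
    (.ite (.reg 5 +ₑ .load 10 (.reg 6) <ₑ .reg 12) (.store 12 (.reg 5) (.lit 0))
      (.store 12 (.reg 5) (.reg 5 +ₑ .load 10 (.reg 6))))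
    (.store 12 (.reg 5) (.lit 0)) ;;
  .store 18 (.reg 5) (.load 6 ((.reg 12 -ₑ .reg 5) *ₑ .reg 0 +ₑ .reg 6) -ₑ
    .load 6 ((.reg 12 -ₑ (.reg 5 +ₑ .lit 1)) *ₑ .reg 0 +ₑ .load 9 (.reg 6))) ;;
  .assign 6 (.load 9 (.reg 6))

/-- The default walk of length `reg 12` from `reg 2`. -/
def walkProg : Prog := .assign 6 (.reg 2) ;; forTo 5 12 walkCell

/-- The default walk, the keys, and the differences of the numbers of walks, up to distance `k`. -/
def WalkOut (A : PCA n σ) (m : ℕ) (u : Fin n) (ℓ k : ℕ) (s : State) : Prop :=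
  ∀ h, h < k → s.mem 11 h = A.defaultAt u h ∧ s.mem 12 h = A.key m u ℓ h ∧
    s.mem 18 h = A.cnt (ℓ - h) (A.defaultAt u h) - A.cnt (ℓ - (h + 1)) (A.defaultAt u (h + 1))

theorem walkCell_spec (A : PCA n σ) {c : Cfg} (hc : c.Fits n σ m) {s : State} (hs : Bdd c s)
    (ht : Tab A m s) {u : Fin n} {ℓ k : ℕ} (hℓ : ℓ ≤ m) (hu : (ℓ : ℕ∞) ≤ A.longest u)
    (h12 : s.reg 12 = ℓ) (hk : k < ℓ) (h5 : s.reg 5 = k) (h6 : s.reg 6 = A.defaultAt u k)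
    (hI : WalkOut A m u ℓ k s) :
    HT c walkCell s walkCell.K fun s' => s'.reg 6 = A.defaultAt u (k + 1) ∧
      WalkOut A m u ℓ (k + 1) s' := by
  have hsm := hc.small
  have hle := hc.le
  obtain ⟨a, ha⟩ := PCA.exists_default_at hu hk
  have hnx : s.mem 9 (A.defaultAt u k) = A.defaultAt u (k + 1) := by
    rw [(ht.cell _).nxt (by simp [ha]), PCA.defaultAt_succ]
  have hbr := (ht.cell (A.defaultAt u k)).br
  have hbb := A.brC_le m (A.defaultAt u k)
  have hv := (A.defaultAt u k).2
  have hv' := (A.defaultAt u (k + 1)).2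
  have c1 := ht.cnt (ℓ - k) (A.defaultAt u k) (by omega)
  have c2 := ht.cnt (ℓ - (k + 1)) (A.defaultAt u (k + 1)) (by omega)
  have c3 := hc.cnt_le A (l := ℓ - k) (by omega) (A.defaultAt u k)
  have main : ∀ x : ℕ, x = A.key m u ℓ k → ∀ s' : State,
      s'.reg 6 = A.defaultAt u (k + 1) →
      s'.mem 11 = Function.update (s.mem 11) k (A.defaultAt u k) →
      s'.mem 12 = Function.update (s.mem 12) k x →
      s'.mem 18 = Function.update (s.mem 18) k (A.cnt (ℓ - k) (A.defaultAt u k) -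
        A.cnt (ℓ - (k + 1)) (A.defaultAt u (k + 1))) →
      s'.reg 6 = A.defaultAt u (k + 1) ∧ WalkOut A m u ℓ (k + 1) s' := by
    rintro x rfl s' h6 h11 h12 h18
    refine ⟨h6, fun h hh => ?_⟩
    rw [h11, h12, h18]
    by_cases hhk : h = k
    · subst hhk; simp
    · rw [Function.update_of_ne hhk, Function.update_of_ne hhk, Function.update_of_ne hhk]
      exact hI h (by omega)
  generalize hQ : (fun s' : State => s'.reg 6 = A.defaultAt u (k + 1) ∧
      WalkOut A m u ℓ (k + 1) s') = Q
  have main' : ∀ x : ℕ, x = A.key m u ℓ k → ∀ s' : State,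
      s'.reg 6 = A.defaultAt u (k + 1) →
      s'.mem 11 = Function.update (s.mem 11) k (A.defaultAt u k) →
      s'.mem 12 = Function.update (s.mem 12) k x →
      s'.mem 18 = Function.update (s.mem 18) k (A.cnt (ℓ - k) (A.defaultAt u k) -
        A.cnt (ℓ - (k + 1)) (A.defaultAt u (k + 1))) → Q s' := by
    rw [← hQ]; exact main
  refine HT.of_wp hc.hN hc.hB hs ?_
  simp [walkCell, wp, Expr.ok, Expr.eval, Op.eval, ht.inp.n, h5, h6, h12, hnx, hbr, c1, c2]
  refine ⟨by omega, fun h1 => ⟨fun h2 => ⟨⟨by omega, by omega⟩, by omega, by omega, ?_⟩,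
    fun h2 => ⟨by omega, ⟨by omega, by omega⟩, by omega, by omega, ?_⟩⟩,
    fun h1 => ⟨⟨by omega, by omega⟩, by omega, by omega, ?_⟩⟩
  · refine main' 0 ?_ _ (by simp) (by simp) (by simp) (by simp)
    rw [PCA.key, if_neg]; omega
  · refine main' (k + A.brC m (A.defaultAt u k)) ?_ _ (by simp) (by simp) (by simp) (by simp)
    rw [PCA.key, if_pos]; exact ⟨h1, h2⟩
  · refine main' 0 ?_ _ (by simp) (by simp) (by simp) (by simp)
    rw [PCA.key, if_neg]; omega

theorem walkProg_spec (A : PCA n σ) {c : Cfg} (hc : c.Fits n σ m) {s : State} (hs : Bdd c s)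
    (ht : Tab A m s) {u : Fin n} {ℓ : ℕ} (hℓ : ℓ ≤ m) (hu : (ℓ : ℕ∞) ≤ A.longest u)
    (h2 : s.reg 2 = u) (h12 : s.reg 12 = ℓ) :
    HT c walkProg s (20 + (ℓ * (walkCell.K + 61) + 37)) (WalkOut A m u ℓ ℓ) := by
  have hun := u.2
  have hsm := hc.small
  have hle := hc.le
  refine HT.seq (T₁ := 20) (Q₁ := fun s' => s' = s.setReg 6 u)
    ((HT.of_wp hc.hN hc.hB hs (by simp [wp, Expr.ok, Expr.eval, h2]; omega)).mono (by decide)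
      fun _ _ _ h => h) ?_
  rintro _ hs₁ hf rfl
  have ht₁ := ht.fr hf
  have hloop := HT.forTo hc.hN hc.hB (i := 5) (b := 12) (p := walkCell) (s := s.setReg 6 u)
    (T := walkCell.K) (fun k s' => s'.reg 6 = A.defaultAt u k ∧ WalkOut A m u ℓ k s') hs₁
    (by decide) (by decide) (by decide) ⟨by simp [PCA.defaultAt_zero], fun h hh => by omega⟩
    (by
      rintro k s₂ hk hs₂ hf₂ h5 ⟨h6, hI⟩
      have e12 : (s.setReg 6 u).reg 12 = ℓ := by simp [h12]
      rw [e12] at hk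
      refine (walkCell_spec A hc hs₂ (ht₁.fr hf₂) hℓ hu ((hf₂.reg 12 (by decide)).trans e12) hk h5 h6
        hI).mono le_rfl ?_
      rintro s₃ - - ⟨h1, h2⟩
      exact ⟨by simpa using h1, h2⟩)
  rw [show (s.setReg 6 u).reg 12 = ℓ by simp [h12]] at hloop
  exact hloop.mono le_rfl fun s' _ _ h => h.1.2

/-! ### Building the Cartesian tree in linear time -/

/-- A push to the stack. -/
def pushProg : Prog :=
  .store 13 (.reg 5) (.reg 7) ;; .store 14 (.reg 5) (.lit 0) ;;
  .ite (.reg 6) (.store 14 (.load 15 (.reg 6 -ₑ .lit 1)) (.reg 5 +ₑ .lit 1)) .skip ;;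
  .store 15 (.reg 6) (.reg 5) ;; .assign 6 (.reg 6 +ₑ .lit 1) ;; .assign 5 (.reg 5 +ₑ .lit 1) ;;
  .assign 7 (.lit 0)

/-- One step of the construction of the Cartesian tree. -/
def stackCell : Prog :=
  .ite (.load 12 (.reg 5))
    (.ite (.reg 6)
      (.ite (.load 12 (.reg 5) <ₑ .load 12 (.load 15 (.reg 6 -ₑ .lit 1))) pushProg
        (.assign 6 (.reg 6 -ₑ .lit 1) ;; .assign 7 (.load 15 (.reg 6) +ₑ .lit 1)))
      pushProg)
    (.assign 5 (.reg 5 +ₑ .lit 1))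

/-- The Cartesian tree of the keys. -/
def stackProg : Prog :=
  (.assign 5 (.lit 0) ;; .assign 6 (.lit 0) ;; .assign 7 (.lit 0)) ;;
    .while (.reg 5 <ₑ .reg 12) stackCell

/-- The invariant of `stackProg`. -/
def StackInv (k : ℕ → ℕ) (ℓ : ℕ) (s : State) : Prop :=
  s.reg 5 ≤ ℓ ∧ PCA.Cart k (s.reg 5) (s.reg 6) (s.reg 7) (s.mem 15) (s.mem 13) (s.mem 14)

/-- The variant `2 (ℓ - p) + sp` falls in every step: a pop lowers `sp`, and a push raises both `p`
and `sp` by one. This gives at most `2 ℓ` steps. -/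
theorem stackCell_spec {c : Cfg} (hN : 1 ≤ c.N) (hB : 1 ≤ c.B) {s : State} (hs : Bdd c s) {k : ℕ → ℕ}
    {ℓ : ℕ} (hl : ℓ + 8 ≤ c.B) (hk : ∀ h, h < ℓ → s.mem 12 h = k h) (hI : StackInv k ℓ s)
    (hlt : s.reg 5 < ℓ) :
    HT c stackCell s stackCell.K fun s' => StackInv k ℓ s' ∧
      2 * (ℓ - s'.reg 5) + s'.reg 6 < 2 * (ℓ - s.reg 5) + s.reg 6 := by
  obtain ⟨h5, hC⟩ := hI
  generalize hp : s.reg 5 = p at *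
  generalize hsp : s.reg 6 = sp at *
  generalize hla : s.reg 7 = last at *
  have hspp := hC.sp_le
  have hlb := hs.1 7
  rw [hla] at hlb
  have hkp := hk p hlt
  refine HT.of_wp hN hB hs ?_
  by_cases hk0 : k p = 0
  · simp [stackCell, wp, Expr.ok, Expr.eval, Op.eval, hp, hkp, hk0, StackInv, hsp, hla]
    constructorm* _ ∧ _
    any_goals omega
    exact hC.skip hk0
  by_cases hsp0 : sp = 0
  · have := hC.push hk0 (fun h => absurd hsp0 h)
    subst hsp0
    simp only [PCA.Cart.pushRight, if_true] at this
    simp [stackCell, pushProg, wp, Expr.ok, Expr.eval, Op.eval, hp, hkp, hk0, StackInv, hsp, hla]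
    constructorm* _ ∧ _
    any_goals omega
  have hst := (hC.isTop (i := sp - 1) (by omega)).lt
  have hkt := hk (s.mem 15 (sp - 1)) (by omega)
  by_cases hcmp : k p < k (s.mem 15 (sp - 1))
  · have := hC.push hk0 (fun _ => hcmp)
    simp only [PCA.Cart.pushRight, if_neg hsp0] at this
    simp [stackCell, pushProg, wp, Expr.ok, Expr.eval, Op.eval, hp, hkp, hk0, StackInv, hsp, hla, hsp0,
      hkt, hcmp]
    constructorm* _ ∧ _
    any_goals omega
  · have := hC.pop hsp0 (by omega)
    simp [stackCell, wp, Expr.ok, Expr.eval, Op.eval, hp, hkp, hk0, StackInv, hsp, hsp0, hkt, hcmp]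
    constructorm* _ ∧ _
    any_goals omega

theorem stackProg_spec {c : Cfg} (hN : 1 ≤ c.N) (hB : 1 ≤ c.B) {s : State} (hs : Bdd c s) {k : ℕ → ℕ}
    {ℓ : ℕ} (hl : ℓ + 8 ≤ c.B) (hk : ∀ h, h < ℓ → s.mem 12 h = k h) (h12 : s.reg 12 = ℓ) :
    HT c stackProg s (50 + (2 * ℓ * (30 + stackCell.K) + 30)) fun s' =>
      PCA.Cart k ℓ (s'.reg 6) (s'.reg 7) (s'.mem 15) (s'.mem 13) (s'.mem 14) := by
  refine HT.seq (T₁ := 50) (Q₁ := fun s' => s' = ((s.setReg 5 0).setReg 6 0).setReg 7 0)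
    ((HT.of_wp hN hB hs (by simp [wp, Expr.ok, Expr.eval])).mono (by decide)
      fun _ _ _ h => h) ?_
  rintro _ hs₁ hf₁ rfl
  set s₁ := ((s.setReg 5 0).setReg 6 0).setReg 7 0 with hs1
  have e12 : s₁.reg 12 = ℓ := by simp [hs1, h12]
  refine (HT.while hN hB (e := .reg 5 <ₑ .reg 12) (I := StackInv k ℓ) (μ := fun s' => 2 * (ℓ - s'.reg 5) + s'.reg 6)
    (T := stackCell.K) (k := 2 * ℓ) hs₁ ?_ ?_ (fun _ _ _ _ => ⟨trivial, trivial⟩) ?_).mono le_rfl ?_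
  · have := PCA.Cart.init k (s.mem 15) (s.mem 13) (s.mem 14)
    exact ⟨by simp [hs1], by simpa [hs1] using this⟩
  · simp [hs1]
  · intro s₂ hs₂ hf₂ hI he
    have e12' : s₂.reg 12 = ℓ := (hf₂.reg 12 (by decide)).trans e12
    rw [eval_lt_ne_zero] at he
    simp only [Expr.eval, e12'] at he
    refine stackCell_spec hN hB hs₂ hl (fun h hh => ?_) hI he
    rw [hf₂.mem 12 (by decide)]
    exact hk h hh
  · rintro s₂ hs₂ hf₂ ⟨⟨h1, h2⟩, he⟩
    have e12' : s₂.reg 12 = ℓ := (hf₂.reg 12 (by decide)).trans e12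
    rw [eval_lt_eq_zero] at he
    simp only [Expr.eval, e12'] at he
    rwa [show s₂.reg 5 = ℓ by omega] at h2

end RAM

/-! ### Preparation of a call: the order of processing -/

namespace PCA

/-- The intervals in the queue are pieces at which the Cartesian tree can be read off. -/
def Pieces (k : ℕ → ℕ) (ℓ : ℕ) (U : List (ℕ × ℕ)) : Prop :=
  ∀ c ∈ U, c.2 ≤ ℓ ∧ topPos k c.1 c.2 ≠ 0 ∧
    (c.1 = 0 ∨ k (topPos k c.1 c.2 - 1) < k (c.1 - 1)) ∧
    (c.2 = ℓ ∨ k (topPos k c.1 c.2 - 1) ≤ k c.2)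

theorem Pieces.init (k : ℕ → ℕ) (ℓ : ℕ) : Pieces k ℓ (piece k 0 ℓ) := by
  intro c hc
  obtain ⟨rfl, h⟩ := mem_piece.1 hc
  exact ⟨le_rfl, h, Or.inl rfl, Or.inl rfl⟩

/-- Each new boundary of a part is next to the extracted maximum, whose key is at least the keys to
its left and exceeds those to its right. The asymmetry in `Pieces` comes from taking the last
maximum. -/
theorem Pieces.step {k : ℕ → ℕ} {ℓ a b : ℕ} {U : List (ℕ × ℕ)} (h : Pieces k ℓ ((a, b) :: U)) :
    Pieces k ℓ (U ++ piece k a (topPos k a b - 1) ++ piece k (topPos k a b - 1 + 1) b) := by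
  obtain ⟨h1, h2, h3, h4⟩ := h (a, b) (by simp)
  simp only at h1 h2 h3 h4
  have ht := isTop_of_ne h2
  intro c hc
  rw [List.mem_append, List.mem_append] at hc
  rcases hc with (hc | hc) | hc
  · exact h c (by simp [hc])
  · obtain ⟨rfl, hne⟩ := mem_piece.1 hc
    have ht' := isTop_of_ne hne
    have h5 := ht.before _ ht'.le ht'.lt
    exact ⟨by have := ht.lt; simp only; omega, hne, by simp only; omega, Or.inr h5⟩
  · obtain ⟨rfl, hne⟩ := mem_piece.1 hc
    have ht' := isTop_of_ne hne
    have h5 := ht.after _ ht'.le ht'.lt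
    exact ⟨h1, hne, Or.inr h5, by simp only; omega⟩

theorem map_piece (k : ℕ → ℕ) (a b : ℕ) :
    (piece k a b).map (fun c => topPos k c.1 c.2 - 1) =
      if topPos k a b = 0 then [] else [topPos k a b - 1] := by
  unfold piece
  by_cases h : topPos k a b = 0 <;> simp [h]

theorem sum_piece_le (k : ℕ → ℕ) (a b : ℕ) : ((piece k a b).map fun c => c.2 - c.1).sum ≤ b - a := by
  unfold piece
  split <;> simp

end PCA

namespace RAM

variable {n σ m : ℕ}

open PCA (topPos piece bfs Pieces)

/-- The queue in segment 16 between the positions `h` and `reg 9`. -/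
def QOut (h : ℕ) (L : List ℕ) (s : State) : Prop :=
  s.reg 9 = h + L.length ∧ ∀ i x, L[i]? = some x → s.mem 16 (h + i) = x

/-- Append a root given by its code in segment `g`. -/
def childProg (g : ℕ) : Prog :=
  .ite (.load g (.reg 5)) (.store 16 (.reg 9) (.load g (.reg 5) -ₑ .lit 1) ;;
    .assign 9 (.reg 9 +ₑ .lit 1)) .skip

theorem childProg_spec {c : Cfg} (hN : 1 ≤ c.N) (hB : 1 ≤ c.B) {s : State} (hs : Bdd c s) {g : ℕ}
    {h : ℕ} {L : List ℕ} (hq : QOut h L s) (hb : h + L.length < c.B) :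
    HT c (childProg g) s 200 (QOut h (L ++
      if s.mem g (s.reg 5) = 0 then [] else [s.mem g (s.reg 5) - 1])) := by
  have hK : (childProg g).K ≤ 200 := by
    simp [childProg, Prog.K, Expr.K, Expr.sz]
  refine (HT.of_wp hN hB hs ?_).mono hK fun _ _ _ h => h
  have hmb := hs.2 g (s.reg 5)
  obtain ⟨h1, h2⟩ := hq
  by_cases h0 : s.mem g (s.reg 5) = 0
  · simp [childProg, wp, Expr.ok, Expr.eval, h0]
    exact ⟨h1, h2⟩
  · simp [childProg, wp, Expr.ok, Expr.eval, Op.eval, h0, h1]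
    refine ⟨by omega, by omega, by omega, by omega, by simp; omega, fun i x hi => ?_⟩
    simp only [setReg_mem, setMem_mem, if_true]
    rcases Nat.lt_or_ge i L.length with hlt | hge
    · rw [Function.update_of_ne (by omega)]
      rw [List.getElem?_append_left hlt] at hi
      exact h2 i x hi
    · rw [List.getElem?_append_right hge] at hi
      have hi' : i = L.length := by
        have := (List.getElem?_eq_some_iff.1 hi).1
        simp at this
        omega
      subst hi'
      simp at hi ⊢
      exact hi

/-- One step of the breadth-first traversal. -/
def bfsCell : Prog :=
  (.assign 5 (.load 16 (.reg 8)) ;; .store 17 (.reg 5) (.reg 10) ;;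
    .assign 10 (.reg 10 +ₑ .load 18 (.reg 5))) ;;
  childProg 13 ;; childProg 14 ;; .assign 8 (.reg 8 +ₑ .lit 1)

/-- The arrays in the segments 13 and 14 hold the subtrees. -/
def TreeOut (k : ℕ → ℕ) (ℓ : ℕ) (s : State) : Prop :=
  ∀ a b, b ≤ ℓ → topPos k a b ≠ 0 → (a = 0 ∨ k (topPos k a b - 1) < k (a - 1)) →
    (b = ℓ ∨ k (topPos k a b - 1) ≤ k b) →
    s.mem 13 (topPos k a b - 1) = topPos k a (topPos k a b - 1) ∧
    s.mem 14 (topPos k a b - 1) = topPos k (topPos k a b - 1 + 1) b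

/-- The boundary conditions of a piece are those under which the arrays of the Cartesian tree are
specified, so the two parts of a piece are found by two loads. -/
theorem TreeOut.of_cart {k : ℕ → ℕ} {ℓ sp last : ℕ} {s : State} {stack : ℕ → ℕ}
    (h : PCA.Cart k ℓ sp last stack (s.mem 13) (s.mem 14)) : TreeOut k ℓ s := by
  intro a b hb hne ha hkb
  have ht := PCA.isTop_of_ne hne
  exact ⟨h.left_eq _ a (by have := ht.lt; omega) ht.le ht.ne ht.before ha,
    h.right_eq _ b ht.lt hb ht.ne ht.after hkb⟩

/-- The first positions of `O` have got their offsets. -/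
structure BfsInv (k W : ℕ → ℕ) (ℓ : ℕ) (O done : List ℕ) (U : List (ℕ × ℕ)) (s : State) : Prop where
  head : s.reg 8 = done.length
  queue : QOut done.length (U.map fun c => topPos k c.1 c.2 - 1) s
  order : O = done ++ bfs k (ℓ - done.length) U
  acc : s.reg 10 = 1 + (done.map W).sum
  start : ∀ o₁ p o₂, done = o₁ ++ p :: o₂ → s.mem 17 p = 1 + (o₁.map W).sum
  pieces : Pieces k ℓ U
  fuel : (U.map fun c => c.2 - c.1).sum + done.length ≤ ℓ

/-- Pieces in the queue are nonempty intervals, so the queue never has more than `ℓ` entries and its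
addresses stay within the bound. -/
theorem length_le_sum {k : ℕ → ℕ} {ℓ : ℕ} : ∀ {U : List (ℕ × ℕ)}, Pieces k ℓ U →
    U.length ≤ (U.map fun c => c.2 - c.1).sum
  | [], _ => by simp
  | c :: U, h => by
    have ih := length_le_sum (U := U) fun d hd => h d (by simp [hd])
    have ht := PCA.isTop_of_ne (h c (by simp)).2.1
    have h1 := ht.le
    have h2 := ht.lt
    simp only [List.map_cons, List.sum_cons, List.length_cons]
    omega

/-- Before its weight is added to the accumulator, the extracted position receives the accumulated
sum: this is the offset of its strings. -/
theorem bfsCell_spec {c : Cfg} (hN : 1 ≤ c.N) (hB : 1 ≤ c.B) {s : State} (hs : Bdd c s) {k W : ℕ → ℕ}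
    {ℓ : ℕ} {O done : List ℕ} {U : List (ℕ × ℕ)} (hl : ℓ + 8 ≤ c.B) (hO : O.Nodup)
    (hW : ∀ p ∈ O, s.mem 18 p = W p) (hWB : 1 + (O.map W).sum ≤ c.B) (hT : TreeOut k ℓ s)
    (hI : BfsInv k W ℓ O done U s) (hlt : s.reg 8 < s.reg 9) :
    HT c bfsCell s (100 + (200 + (200 + 100))) fun s' =>
      (∃ done' U', BfsInv k W ℓ O done' U' s') ∧ ℓ - s'.reg 8 < ℓ - s.reg 8 := by
  obtain ⟨hh, ⟨hq1, hq2⟩, ho, ha, hst, hP, hf⟩ := hI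
  cases U with
  | nil =>
    simp at hq1
    omega
  | cons ab U =>
  obtain ⟨a, b⟩ := ab
  obtain ⟨p1, p2, p3, p4⟩ := hP (a, b) (by simp)
  simp only at p1 p2 p3 p4
  obtain ⟨hL, hR⟩ := hT a b p1 p2 p3 p4
  have ht := PCA.isTop_of_ne p2
  have hstep := hP.step
  have hlen := length_le_sum hstep
  have hr1 := ht.le
  have hr2 := ht.lt
  have hsum : ((U ++ piece k a (topPos k a b - 1) ++ piece k (topPos k a b - 1 + 1) b).map
      fun c => c.2 - c.1).sum + (done.length + 1) ≤ ℓ := by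
    have h1 := PCA.sum_piece_le k a (topPos k a b - 1)
    have h2 := PCA.sum_piece_le k (topPos k a b - 1 + 1) b
    simp only [List.map_cons, List.sum_cons] at hf
    simp only [List.map_append, List.sum_append]
    omega
  have hroots : (U ++ piece k a (topPos k a b - 1) ++ piece k (topPos k a b - 1 + 1) b).map
      (fun c => topPos k c.1 c.2 - 1) = U.map (fun c => topPos k c.1 c.2 - 1) ++
        (if topPos k a (topPos k a b - 1) = 0 then [] else [topPos k a (topPos k a b - 1) - 1]) ++
        (if topPos k (topPos k a b - 1 + 1) b = 0 then []
          else [topPos k (topPos k a b - 1 + 1) b - 1]) := by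
    rw [List.map_append, List.map_append, PCA.map_piece, PCA.map_piece]
  have hfuel : ℓ - done.length = ℓ - (done.length + 1) + 1 := by omega
  have ho' := ho
  rw [hfuel, bfs] at ho'
  have hlen' := congrArg List.length hroots
  rw [List.length_map] at hlen'
  generalize hr : topPos k a b - 1 = r at *
  have hq0 := hq2 0 r (by simp [hr])
  rw [add_zero] at hq0
  simp only [List.map_cons, List.length_cons, List.length_map] at hq1
  have hmem : r ∈ O := by rw [ho']; simp
  have hWr := hW r hmem
  have hacc : 1 + (done.map W).sum + W r ≤ c.B := by
    rw [ho', List.map_append, List.sum_append, List.map_cons, List.sum_cons] at hWB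
    omega
  refine HT.seq (T₁ := 100) (Q₁ := fun s' => s' = ((s.setReg 5 r).setMem 17 r
    (1 + (done.map W).sum)).setReg 10 (1 + (done.map W).sum + W r))
    ((HT.of_wp hN hB hs ?_).mono (by decide) fun _ _ _ h => h) ?_
  · simp [wp, Expr.ok, Expr.eval, Op.eval, hh, hq0, hWr, ha]
    omega
  rintro _ hs₁ - rfl
  set s₁ := ((s.setReg 5 r).setMem 17 r
    (1 + (done.map W).sum)).setReg 10 (1 + (done.map W).sum + W r) with hs1
  have hQ₁ : QOut (done.length + 1) (U.map fun c => topPos k c.1 c.2 - 1) s₁ := by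
    refine ⟨by simp [hs1, hq1]; omega, fun i x hi => ?_⟩
    have := hq2 (i + 1) x (by simpa using hi)
    simp only [hs1, setReg_mem, setMem_mem]
    rw [if_neg (by decide), ← this]
    congr 1
    ring
  have e13 : s₁.mem 13 (s₁.reg 5) = topPos k a r := by simp [hs1, hL]
  simp only [List.length_append, List.length_map] at hlen hlen'
  have h1 := childProg_spec hN hB hs₁ (g := 13) hQ₁ (by rw [List.length_map]; omega)
  rw [e13] at h1
  refine HT.seq h1 ?_
  intro s₂ hs₂ hf₂ hQ₂
  have e14 : s₂.mem 14 (s₂.reg 5) = topPos k (r + 1) b := by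
    rw [hf₂.mem 14 (by decide), hf₂.reg 5 (by decide)]
    simp [hs1, hR]
  have h2 := childProg_spec hN hB hs₂ (g := 14) hQ₂ (by
    rw [List.length_append, List.length_map]; omega)
  rw [e14] at h2
  refine HT.seq h2 ?_
  intro s₃ hs₃ hf₃ hQ₃
  have e8 : s₃.reg 8 = done.length := by
    rw [hf₃.reg 8 (by decide), hf₂.reg 8 (by decide)]
    simp [hs1, hh]
  have e10 : s₃.reg 10 = 1 + (done.map W).sum + W r := by
    rw [hf₃.reg 10 (by decide), hf₂.reg 10 (by decide)]
    simp [hs1]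
  have e17 : s₃.mem 17 = Function.update (s.mem 17) r (1 + (done.map W).sum) := by
    rw [hf₃.mem 17 (by decide), hf₂.mem 17 (by decide)]
    simp [hs1]
  refine (HT.of_wp hN hB hs₃ (Q := fun s' => s' = s₃.setReg 8 (done.length + 1)) ?_).mono (by decide) ?_
  · simp [wp, Expr.ok, Expr.eval, Op.eval, e8]
    omega
  rintro _ - - rfl
  refine ⟨⟨done ++ [r], U ++ piece k a r ++ piece k (r + 1) b, ?_⟩, by simp; omega⟩
  refine ⟨by simp, ?_, ?_, ?_, ?_, hstep, by simpa using hsum⟩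
  · rw [hroots]
    refine ⟨?_, fun i x hi => ?_⟩
    · have := hQ₃.1
      simpa using this
    · have := hQ₃.2 i x hi
      simpa using this
  · rw [List.length_append, List.length_singleton, List.append_assoc]
    exact ho'
  · simp [e10, add_assoc]
  · intro o₁ p o₂ he
    rw [setReg_mem, e17]
    rcases List.eq_nil_or_concat o₂ with rfl | ⟨o₃, x, rfl⟩
    · have := List.append_inj' (s₁ := done) (t₁ := [r]) (s₂ := o₁) (t₂ := [p]) he rfl
      obtain ⟨rfl, h⟩ := this
      simp at h
      subst h
      simp
    · have h3 : done = o₁ ++ p :: o₃ := by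
        have h4 : done ++ [r] = (o₁ ++ p :: o₃) ++ [x] := by rw [he]; simp
        exact (List.append_inj' h4 rfl).1
      -- The order has no repetitions, so the offset of an earlier position is not overwritten.
      have hne : p ≠ r := by
        rintro rfl
        rw [ho', h3] at hO
        have := List.disjoint_of_nodup_append hO (a := p) (by simp)
        exact this (by simp)
      rw [Function.update_of_ne hne]
      exact hst o₁ p o₃ h3

end RAM

/-! ### Preparation of a call: assembly -/

/-- Keeps the accumulator of the traversal within the bound for cells. -/
theorem PCA.one_add_sum_weight_le {n σ m : ℕ} (A : PCA n σ) {u : Fin n} {ℓ : ℕ} (hℓ : ℓ ≤ m)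
    (hu : (ℓ : ℕ∞) ≤ A.longest u) :
    1 + ((A.order m u ℓ).map (A.weight m u ℓ)).sum ≤ A.cnt ℓ u := by
  by_cases h0 : topPos (A.key m u ℓ) 0 ℓ = 0
  · have : A.order m u ℓ = [] := by
      rw [List.eq_nil_iff_forall_not_mem]
      intro p hp
      have := PCA.mem_order.1 hp
      exact this.2 (PCA.topPos_eq_zero_iff.1 h0 p (Nat.zero_le _) this.1)
    rw [this, (A.cnt_eq hℓ hu).1 h0]
    simp
  · obtain ⟨b, hb⟩ := PCA.exists_second (PCA.isTop_of_ne h0).ne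
    have := (A.cnt_eq hℓ hu).2 h0 b hb
    omega

namespace RAM

variable {n σ m : ℕ}

open PCA (topPos piece bfs Pieces)

/-- The breadth-first traversal. -/
def bfsProg : Prog := .while (.reg 8 <ₑ .reg 9) bfsCell

theorem bfsProg_spec {c : Cfg} (hN : 1 ≤ c.N) (hB : 1 ≤ c.B) {s : State} (hs : Bdd c s) {k W : ℕ → ℕ}
    {ℓ : ℕ} {O : List ℕ} (hl : ℓ + 8 ≤ c.B) (hO : O.Nodup) (hOk : O = bfs k ℓ (piece k 0 ℓ))
    (hW : ∀ p ∈ O, s.mem 18 p = W p) (hWB : 1 + (O.map W).sum ≤ c.B) (hT : TreeOut k ℓ s)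
    (h8 : s.reg 8 = 0) (h10 : s.reg 10 = 1)
    (hq : QOut 0 ((piece k 0 ℓ).map fun c => topPos k c.1 c.2 - 1) s) :
    HT c bfsProg s (ℓ * (30 + 600) + 30) fun s' => s'.reg 10 = 1 + (O.map W).sum ∧
      ∀ o₁ p o₂, O = o₁ ++ p :: o₂ → s'.mem 17 p = 1 + (o₁.map W).sum := by
  refine (HT.while hN hB (e := .reg 8 <ₑ .reg 9)
    (I := fun s' => ∃ done U, BfsInv k W ℓ O done U s') (μ := fun s' => ℓ - s'.reg 8)
    (T := 600) (k := ℓ) hs ?_ (Nat.sub_le _ _) (fun _ _ _ _ => ⟨trivial, trivial⟩) ?_).mono le_rfl ?_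
  · refine ⟨[], piece k 0 ℓ, by simp [h8], by simpa using hq, by simpa using hOk, by simp [h10],
      by simp, Pieces.init k ℓ, ?_⟩
    have := PCA.sum_piece_le k 0 ℓ
    simpa using this
  · rintro s₁ hs₁ hf₁ ⟨done, U, hI⟩ he
    rw [eval_lt_ne_zero] at he
    refine bfsCell_spec hN hB hs₁ hl hO (by rw [hf₁.mem 18 (by decide)]; exact hW) hWB ?_ hI he
    unfold TreeOut
    rw [hf₁.mem 13 (by decide), hf₁.mem 14 (by decide)]
    exact hT
  · rintro s₁ - - ⟨⟨done, U, hI⟩, he⟩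
    rw [eval_lt_eq_zero] at he
    simp only [Expr.eval] at he
    have h1 := hI.queue.1
    have h2 := hI.head
    have hU : U = [] := by
      rw [List.length_map] at h1
      exact List.eq_nil_of_length_eq_zero (by omega)
    have ho := hI.order
    have hnil : ∀ f, bfs k f [] = [] := by intro f; cases f <;> rfl
    rw [hU, hnil, List.append_nil] at ho
    rw [ho]
    exact ⟨hI.acc, hI.start⟩

/-- The initial queue; the second edge of the root is taken out of the weight of the root. -/
def rootProg : Prog :=
  .ite (.reg 6) (.assign 11 (.load 15 (.lit 0) +ₑ .lit 1)) (.assign 11 (.reg 7)) ;;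
  .assign 8 (.lit 0) ;; .assign 10 (.lit 1) ;;
  .ite (.reg 11)
    (.store 16 (.lit 0) (.reg 11 -ₑ .lit 1) ;; .assign 9 (.lit 1) ;;
      .assign 6 (.load 11 (.reg 11 -ₑ .lit 1)) ;;
      .assign 7 (.load 0 (.reg 6 *ₑ .reg 1 +ₑ (.load 8 (.reg 6) -ₑ .lit 1)) -ₑ .lit 1) ;;
      .store 18 (.reg 11 -ₑ .lit 1) (.load 18 (.reg 11 -ₑ .lit 1) -ₑ
        .load 6 ((.reg 12 -ₑ .reg 11) *ₑ .reg 0 +ₑ .reg 7)))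
    (.assign 9 (.lit 0))

/-- Everything that is needed for a call with end vertex `u` and length `ℓ`. -/
structure PrepOut (A : PCA n σ) (m : ℕ) (u : Fin n) (ℓ : ℕ) (s : State) : Prop where
  walk : ∀ h, h < ℓ → s.mem 11 h = A.defaultAt u h
  key : ∀ h, h < ℓ → s.mem 12 h = A.key m u ℓ h
  weight : ∀ p ∈ A.order m u ℓ, s.mem 18 p = A.weight m u ℓ p
  root : s.reg 11 = topPos (A.key m u ℓ) 0 ℓ
  start : ∀ o₁ p o₂, A.order m u ℓ = o₁ ++ p :: o₂ →
    s.mem 17 p = 1 + (o₁.map (A.weight m u ℓ)).sum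
  acc : s.reg 10 = 1 + ((A.order m u ℓ).map (A.weight m u ℓ)).sum

/-- Preparation of a call with end vertex `reg 2` and length `reg 12`. -/
def prepProg : Prog := walkProg ;; stackProg ;; rootProg ;; bfsProg

/-- Differences of consecutive numbers of walks are already the weights, except at the root, where
the block of the saved edge has to be subtracted. -/
theorem rootProg_spec (A : PCA n σ) {c : Cfg} (hc : c.Fits n σ m) {s : State} (hs : Bdd c s)
    (ht : Tab A m s) {u : Fin n} {ℓ : ℕ} (hℓ : ℓ ≤ m) (hu : (ℓ : ℕ∞) ≤ A.longest u)
    (h12 : s.reg 12 = ℓ) (hw : WalkOut A m u ℓ ℓ s)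
    (hC : PCA.Cart (A.key m u ℓ) ℓ (s.reg 6) (s.reg 7) (s.mem 15) (s.mem 13) (s.mem 14)) :
    HT c rootProg s rootProg.K fun s' => s'.reg 8 = 0 ∧ s'.reg 10 = 1 ∧
      s'.reg 11 = topPos (A.key m u ℓ) 0 ℓ ∧
      (∀ p ∈ A.order m u ℓ, s'.mem 18 p = A.weight m u ℓ p) ∧
      QOut 0 ((piece (A.key m u ℓ) 0 ℓ).map fun c => topPos (A.key m u ℓ) c.1 c.2 - 1) s' := by
  have hsm := hc.small
  have hle := hc.le
  have hdiff : ∀ p, p < ℓ → p ≠ A.top m u ℓ → s.mem 18 p = A.weight m u ℓ p := by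
    intro p hp hne
    rw [(hw p hp).2.2, A.weight_of_ne_top hu hp hne]
    omega
  have hroot := hC.root_eq
  -- the part after the root is known
  have main : ∀ s₁ : State, Bdd c s₁ → s₁.mem = s.mem → (∀ r, r ≠ 11 → s₁.reg r = s.reg r) →
      s₁.reg 11 = topPos (A.key m u ℓ) 0 ℓ → ∀ Q : State → Prop,
      (∀ s' : State, s'.reg 8 = 0 ∧ s'.reg 10 = 1 ∧ s'.reg 11 = topPos (A.key m u ℓ) 0 ℓ ∧
      (∀ p ∈ A.order m u ℓ, s'.mem 18 p = A.weight m u ℓ p) ∧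
      QOut 0 ((piece (A.key m u ℓ) 0 ℓ).map fun c => topPos (A.key m u ℓ) c.1 c.2 - 1) s' → Q s') →
      wp c (.assign 8 (.lit 0) ;; .assign 10 (.lit 1) ;;
  .ite (.reg 11)
    (.store 16 (.lit 0) (.reg 11 -ₑ .lit 1) ;; .assign 9 (.lit 1) ;;
      .assign 6 (.load 11 (.reg 11 -ₑ .lit 1)) ;;
      .assign 7 (.load 0 (.reg 6 *ₑ .reg 1 +ₑ (.load 8 (.reg 6) -ₑ .lit 1)) -ₑ .lit 1) ;;
      .store 18 (.reg 11 -ₑ .lit 1) (.load 18 (.reg 11 -ₑ .lit 1) -ₑ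
        .load 6 ((.reg 12 -ₑ .reg 11) *ₑ .reg 0 +ₑ .reg 7)))
    (.assign 9 (.lit 0))) Q s₁ := by
    intro s₁ hs₁ hm hr h11 Q hQ
    rw [PCA.map_piece] at hQ
    by_cases h0 : topPos (A.key m u ℓ) 0 ℓ = 0
    · simp [wp, Expr.ok, Expr.eval, h11, h0]
      refine ⟨by omega, hQ _ ⟨by simp, by simp, by simp [h11, h0], ?_, ?_⟩⟩
      · intro p hp
        have := PCA.mem_order.1 hp
        exact absurd (PCA.topPos_eq_zero_iff.1 h0 p (Nat.zero_le _) this.1) this.2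
      · rw [if_pos h0]
        exact ⟨by simp, by simp⟩
    · have htop := PCA.isTop_of_ne h0
      obtain ⟨b, hb⟩ := PCA.exists_second htop.ne
      have e11 : topPos (A.key m u ℓ) 0 ℓ - 1 = A.top m u ℓ := rfl
      have hlt := htop.lt
      rw [e11] at htop hb hlt
      obtain ⟨a, ha⟩ := PCA.exists_default_at hu hlt
      have hbs := ((PCA.getElem?_edges_one ha).1 hb).1.1
      have e1 := (hw _ hlt).1
      have e2 := (ht.cell (A.defaultAt u (A.top m u ℓ))).snd
      rw [hb, optC] at e2
      have e3 := table_apply A (A.defaultAt u (A.top m u ℓ)) b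
      rw [if_pos hbs] at e3
      have e4 := ht.cnt (ℓ - topPos (A.key m u ℓ) 0 ℓ) (A.target (A.defaultAt u (A.top m u ℓ)) b)
        (by omega)
      have e5 := A.weight_top hu hlt hb
      have e6 := (hw _ hlt).2.2
      have e7 := hs.2 18 (A.top m u ℓ)
      have hbσ := b.2
      have hvn := (A.defaultAt u (A.top m u ℓ)).2
      have hqn := (A.target (A.defaultAt u (A.top m u ℓ)) b).2
      simp [wp, Expr.ok, Expr.eval, Op.eval, h11, h0, e11, hm, hr, e1, e2, e3, e4, h12, ht.inp.n,
        ht.inp.σ, ht.inp.table]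
      constructorm* _ ∧ _
      any_goals omega
      refine hQ _ ⟨by simp, by simp, by simp [h11], ?_, ?_⟩
      · intro p hp
        have hp' := PCA.mem_order.1 hp
        simp [hm]
        by_cases hpt : p = A.top m u ℓ
        · rw [hpt, Function.update_self, e6, e5, PCA.wt]
          have : ℓ - topPos (A.key m u ℓ) 0 ℓ = ℓ - 1 - A.top m u ℓ := by omega
          rw [this]
          omega
        · rw [Function.update_of_ne hpt]
          exact hdiff p hp'.1 hpt
      · rw [if_neg h0]
        refine ⟨by simp, fun i x hi => ?_⟩
        have hi' : i = 0 := by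
          have := (List.getElem?_eq_some_iff.1 hi).1
          simpa using this
        subst hi'
        simp at hi ⊢
        omega
  generalize hQ : (fun s' : State => s'.reg 8 = 0 ∧ s'.reg 10 = 1 ∧
      s'.reg 11 = topPos (A.key m u ℓ) 0 ℓ ∧
      (∀ p ∈ A.order m u ℓ, s'.mem 18 p = A.weight m u ℓ p) ∧
      QOut 0 ((piece (A.key m u ℓ) 0 ℓ).map fun c => topPos (A.key m u ℓ) c.1 c.2 - 1) s') = Q
  refine HT.of_wp hc.hN hc.hB hs ?_
  have hQ' : ∀ s' : State, s'.reg 8 = 0 ∧ s'.reg 10 = 1 ∧ s'.reg 11 = topPos (A.key m u ℓ) 0 ℓ ∧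
      (∀ p ∈ A.order m u ℓ, s'.mem 18 p = A.weight m u ℓ p) ∧
      QOut 0 ((piece (A.key m u ℓ) 0 ℓ).map fun c => topPos (A.key m u ℓ) c.1 c.2 - 1) s' → Q s' := by
    rw [← hQ]; exact fun _ h => h
  unfold rootProg wp
  have hr7 := hs.1 7
  by_cases h6 : s.reg 6 = 0
  · rw [if_pos h6] at hroot
    refine ⟨trivial, fun h => absurd h6 h, fun _ => ⟨trivial, hr7, ?_⟩⟩
    refine main _ (hs.setReg hr7) rfl (fun r hr => by simp [hr]) (by simp [hroot]) Q hQ'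
  · rw [if_neg h6] at hroot
    have hlt : s.mem 15 0 < ℓ := by
      have h0 : topPos (A.key m u ℓ) 0 ℓ ≠ 0 := by omega
      have := (PCA.isTop_of_ne h0).lt
      omega
    have hle' : s.mem 15 0 + 1 ≤ c.B := by omega
    refine ⟨trivial, fun _ => ⟨⟨Nat.zero_le _, by simp [Expr.ok]; omega⟩, hle', ?_⟩,
      fun h => absurd h h6⟩
    refine main _ (hs.setReg hle') rfl (fun r hr => by simp [hr]) (by simp [hroot])
      Q hQ'

/-- The walk, the tree and the traversal take time linear in `ℓ ≤ m`. -/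
theorem prepProg_spec : ∃ K, ∀ {n σ m : ℕ} (A : PCA n σ) {c : Cfg} {s : State} {u : Fin n} {ℓ : ℕ},
    c.Fits n σ m → Bdd c s → Tab A m s → ℓ ≤ m → (ℓ : ℕ∞) ≤ A.longest u → s.reg 2 = u →
    s.reg 12 = ℓ → HT c prepProg s (K * m) (PrepOut A m u ℓ) := by
  refine ⟨walkCell.K + 2 * stackCell.K + rootProg.K + 2000,
    fun {n σ m} A {c s u ℓ} hc hs ht hℓ hu h2 h12 => ?_⟩
  have hsm := hc.small
  have hle := hc.le
  have h : HT c prepProg s ((20 + (ℓ * (walkCell.K + 61) + 37)) +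
      ((50 + (2 * ℓ * (30 + stackCell.K) + 30)) + (rootProg.K + (ℓ * (30 + 600) + 30))))
      (PrepOut A m u ℓ) := by
    refine HT.seq (walkProg_spec A hc hs ht hℓ hu h2 h12) ?_
    intro s₁ hs₁ hf₁ hw₁
    have h12₁ : s₁.reg 12 = ℓ := (hf₁.reg 12 (by decide)).trans h12
    have ht₁ := ht.fr hf₁
    refine HT.seq (stackProg_spec hc.hN hc.hB hs₁ (k := A.key m u ℓ) (by omega)
      (fun h hh => (hw₁ h hh).2.1) h12₁) ?_
    intro s₂ hs₂ hf₂ hC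
    have h12₂ : s₂.reg 12 = ℓ := (hf₂.reg 12 (by decide)).trans h12₁
    have ht₂ := ht₁.fr hf₂
    have hw₂ : WalkOut A m u ℓ ℓ s₂ := by
      unfold WalkOut
      rw [hf₂.mem 11 (by decide), hf₂.mem 12 (by decide), hf₂.mem 18 (by decide)]
      exact hw₁
    refine HT.seq (rootProg_spec A hc hs₂ ht₂ hℓ hu h12₂ hw₂ hC) ?_
    rintro s₃ hs₃ hf₃ ⟨g8, g10, g11, g18, gq⟩
    have hT₃ : TreeOut (A.key m u ℓ) ℓ s₃ := by
      have := TreeOut.of_cart hC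
      unfold TreeOut at this ⊢
      rw [hf₃.mem 13 (by decide), hf₃.mem 14 (by decide)]
      exact this
    have hcnt := hc.cnt_le A hℓ u
    have hWB := (A.one_add_sum_weight_le hℓ hu).trans hcnt
    refine (bfsProg_spec hc.hN hc.hB hs₃ (by omega) (A.order_nodup m u ℓ) rfl g18 hWB hT₃ g8 g10
      gq).mono le_rfl ?_
    rintro s₄ - hf₄ ⟨k10, k17⟩
    refine ⟨fun h hh => ?_, fun h hh => ?_, ?_, ?_, k17, k10⟩
    · rw [hf₄.mem 11 (by decide), hf₃.mem 11 (by decide)]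
      exact (hw₂ h hh).1
    · rw [hf₄.mem 12 (by decide), hf₃.mem 12 (by decide)]
      exact (hw₂ h hh).2.1
    · rw [hf₄.mem 18 (by decide)]
      exact g18
    · rw [hf₄.reg 11 (by decide), g11]
  refine h.mono ?_ fun _ _ _ h => h
  have hm := hc.mpos
  generalize rootProg.K = k₁
  generalize walkCell.K = k₂
  generalize stackCell.K = k₃
  have h3 : k₁ ≤ m * k₁ := Nat.le_mul_of_pos_left _ hm
  calc _ = ℓ * (k₂ + 2 * k₃ + 751) + (k₁ + 167) := by ring
    _ ≤ m * (k₂ + 2 * k₃ + 751) + (m * k₁ + m * 167) := by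
      gcongr
      omega
    _ = (k₂ + 2 * k₃ + k₁ + 918) * m := by ring
    _ ≤ _ := Nat.mul_le_mul_right _ (by omega)

end RAM

/-! ### Positions in the enumeration and recursive calls -/

namespace PCA

variable {n σ : ℕ}

/-- The walks of length `ℓ` from `u` that leave the default walk at distance `p` along `b`. -/
structure Dev (A : PCA n σ) (u : Fin n) (ℓ p : ℕ) (b : Fin σ) : Prop where
  lt : p < ℓ
  isSome : (A.step (A.defaultAt u p) b).isSome
  ne : (A.edges (A.defaultAt u p))[0]? ≠ some b
  le : ((ℓ - 1 - p : ℕ) : ℕ∞) ≤ A.longest (A.target (A.defaultAt u p) b)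

/-- The edge `b` at distance `p` belongs to the last call. -/
def Last (A : PCA n σ) (m : ℕ) (u : Fin n) (ℓ p : ℕ) (b : Fin σ) : Prop :=
  topPos (A.key m u ℓ) 0 ℓ = p + 1 ∧ (A.edges (A.defaultAt u p))[1]? = some b

/-- The number of strings output before those of the call for the edge `b` at distance `p`. -/
def Offset (A : PCA n σ) (m : ℕ) (u : Fin n) (ℓ p : ℕ) (b : Fin σ) (o : ℕ) : Prop :=
  (A.Last m u ℓ p b ∧ o = 1 + ((A.order m u ℓ).map (A.weight m u ℓ)).sum) ∨
  (¬ A.Last m u ℓ p b ∧ ¬ A.Skip m u ℓ p b ∧ ∃ o₁ o₂, A.order m u ℓ = o₁ ++ p :: o₂ ∧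
    o = 1 + (o₁.map (A.weight m u ℓ)).sum + A.pre m u ℓ p b)

theorem Dev.wt_pos {A : PCA n σ} {u : Fin n} {ℓ p : ℕ} {b : Fin σ} (h : A.Dev u ℓ p b) :
    0 < A.wt u ℓ p b := by
  rw [wt, cnt_pos_iff]; exact h.le

theorem Dev.key_ne_zero {A : PCA n σ} {m : ℕ} {u : Fin n} {ℓ p : ℕ} {b : Fin σ} (h : A.Dev u ℓ p b)
    (hm : ℓ ≤ m) (hu : (ℓ : ℕ∞) ≤ A.longest u) : A.key m u ℓ p ≠ 0 := fun hk => by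
  have := h.wt_pos
  have := weight_eq_zero hu hm h.lt hk h.isSome h.ne
  omega

/-- A non-default edge is either the saved edge of the root or is treated while its vertex is
processed; its vertex is in the order because its key is nonzero. -/
theorem Dev.exists_offset {A : PCA n σ} {m : ℕ} {u : Fin n} {ℓ p : ℕ} {b : Fin σ} (h : A.Dev u ℓ p b)
    (hm : ℓ ≤ m) (hu : (ℓ : ℕ∞) ≤ A.longest u) : ∃ o, A.Offset m u ℓ p b o ∧
      ∀ r z, (A.enumFrom (A.target (A.defaultAt u p) b) (ℓ - 1 - p))[r]? = some z →
        (A.enumFrom u ℓ)[o + r]? = some (A.defaultWord u p ++ b :: z) := by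
  have hℓ : 0 < ℓ := lt_of_le_of_lt (Nat.zero_le _) h.lt
  have hk := h.key_ne_zero hm hu
  have h0 : topPos (A.key m u ℓ) 0 ℓ ≠ 0 := fun h0 =>
    hk (topPos_eq_zero_iff.1 h0 p (Nat.zero_le _) h.lt)
  by_cases hl : A.Last m u ℓ p b
  · refine ⟨_, Or.inl ⟨hl, rfl⟩, fun r z hz => ?_⟩
    have hp : A.top m u ℓ = p := by rw [top, hl.1]; rfl
    have := A.getElem?_enumFrom_last hm hℓ h0 (r := r) (b := b) (z := z) (by rw [hp]; exact hl.2)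
      (by rw [hp]; exact hz)
    rwa [hp] at this
  · have hs : ¬ A.Skip m u ℓ p b := by
      rintro (hs | ⟨hp, hs⟩)
      · exact h.ne hs
      · refine hl ⟨?_, hs⟩
        rw [hp, top]; omega
    obtain ⟨o₁, o₂, ho⟩ := List.append_of_mem (mem_order.2 ⟨h.lt, hk⟩)
    exact ⟨_, Or.inr ⟨hl, hs, o₁, o₂, ho, rfl⟩, fun r z hz =>
      A.getElem?_enumFrom hm hℓ ho h.isSome hs h.wt_pos hz⟩

theorem dev_of_isWalk {A : PCA n σ} {u : Fin n} {ℓ p : ℕ} {b : Fin σ} {z : List (Fin σ)} (hp : p < ℓ)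
    (h1 : (A.step (A.defaultAt u p) b).isSome) (h2 : (A.edges (A.defaultAt u p))[0]? ≠ some b)
    (h3 : A.IsWalk (A.target (A.defaultAt u p) b) z) (h4 : z.length = ℓ - 1 - p) : A.Dev u ℓ p b :=
  ⟨hp, h1, h2, (A.le_longest_iff _ _).2 ⟨z, h3, h4⟩⟩

theorem le_longest_of_isWalk {A : PCA n σ} {u : Fin n} {ℓ : ℕ} {z : List (Fin σ)} (h : A.IsWalk u z)
    (hz : z.length = ℓ) : (ℓ : ℕ∞) ≤ A.longest u := (A.le_longest_iff _ _).2 ⟨z, h, hz⟩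

/-- The decomposition of a walk that is not the default walk. -/
theorem exists_dev {A : PCA n σ} {u : Fin n} {ℓ : ℕ} {x : List (Fin σ)} (h : A.IsWalk u x)
    (hx : x.length = ℓ) (hne : x ≠ A.defaultWord u ℓ) : ∃ p b z, A.Dev u ℓ p b ∧
      x = A.defaultWord u p ++ b :: z ∧ A.IsWalk (A.target (A.defaultAt u p) b) z ∧
      z.length = ℓ - 1 - p := by
  have hu := le_longest_of_isWalk h hx
  rcases eq_default_or_deviates h hx with h1 | ⟨p, hp, b, z, h1, h2, h3, h4⟩
  · exact absurd h1 hne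
  · have hz : z.length = ℓ - 1 - p := by
      have := congrArg List.length h1
      rw [List.length_append, length_defaultWord (natCast_le_longest_of_le hu hp.le),
        List.length_cons] at this
      omega
    exact ⟨p, b, z, dev_of_isWalk hp h2 h3 h4 hz, h1, h4, hz⟩

/-- Completeness: a walk other than the default walk lies in the block of the edge through which it
leaves, by induction on the length. -/
theorem mem_enumFrom_of_isWalk (A : PCA n σ) (ℓ : ℕ) : ∀ (u : Fin n) (x : List (Fin σ)),
    A.IsWalk u x → x.length = ℓ → x ∈ A.enumFrom u ℓ := by
  induction ℓ using Nat.strong_induction_on with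
  | _ ℓ ih =>
  intro u x hx hl
  rcases Nat.eq_zero_or_pos ℓ with rfl | hℓ
  · rw [List.length_eq_zero_iff] at hl
    simp [enumFrom, hl]
  by_cases hne : x = A.defaultWord u ℓ
  · rw [hne]
    exact List.mem_of_getElem? (A.getElem?_enumFrom_zero hℓ)
  · obtain ⟨p, b, z, hd, rfl, hz, hzl⟩ := exists_dev hx hl hne
    obtain ⟨r, hr⟩ := List.mem_iff_getElem?.1 (ih (ℓ - 1 - p) (by omega) _ z hz hzl)
    obtain ⟨o, _, ho⟩ := hd.exists_offset le_rfl (le_longest_of_isWalk hx hl)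
    exact List.mem_of_getElem? (ho r z hr)

/-- The position of a string in the enumeration determines its position in a recursive call. -/
theorem index_cases {A : PCA n σ} {m : ℕ} {u : Fin n} {ℓ r : ℕ} {x : List (Fin σ)} (hm : ℓ ≤ m)
    (hℓ : 0 < ℓ) (hu : (ℓ : ℕ∞) ≤ A.longest u) (h : (A.enumFrom u ℓ)[r]? = some x) :
    (r = 0 ∧ x = A.defaultWord u ℓ) ∨ ∃ p b z o r', A.Dev u ℓ p b ∧ A.Offset m u ℓ p b o ∧
      r = o + r' ∧ x = A.defaultWord u p ++ b :: z ∧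
      (A.enumFrom (A.target (A.defaultAt u p) b) (ℓ - 1 - p))[r']? = some z ∧ r' < A.wt u ℓ p b := by
  have hn := A.enumFrom_nodup ℓ u hu
  obtain ⟨hw, hl⟩ := A.mem_enumFrom ℓ u hu x (List.mem_of_getElem? h)
  have huniq : ∀ i j : ℕ, (A.enumFrom u ℓ)[i]? = some x → (A.enumFrom u ℓ)[j]? = some x → i = j := by
    intro i j hi hj
    exact (List.getElem?_inj (List.getElem?_eq_some_iff.1 hi).1 hn).1 (hi.trans hj.symm)
  by_cases hne : x = A.defaultWord u ℓ
  · exact Or.inl ⟨huniq r 0 h (by rw [hne]; exact A.getElem?_enumFrom_zero hℓ), hne⟩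
  · right
    obtain ⟨p, b, z, hd, hx, hz, hzl⟩ := exists_dev hw hl hne
    obtain ⟨r', hr⟩ := List.mem_iff_getElem?.1 (A.mem_enumFrom_of_isWalk _ _ z hz hzl)
    obtain ⟨o, ho, ho'⟩ := hd.exists_offset hm hu
    have h3 := ho' r' z hr
    rw [← hx] at h3
    refine ⟨p, b, z, o, r', hd, ho, huniq _ _ h h3, hx, hr, ?_⟩
    rw [wt, ← A.length_enumFrom _ _ hd.le]
    exact (List.getElem?_eq_some_iff.1 hr).1

/-! ### Offsets within one list of edges, by levels -/

/-- The edge `a` at distance `p` is treated when this vertex is processed. -/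
def Act (A : PCA n σ) (m : ℕ) (u : Fin n) (ℓ p : ℕ) (a : Fin σ) : Prop :=
  (A.step (A.defaultAt u p) a).isSome ∧ ¬ A.Skip m u ℓ p a

open Classical in
/-- The weight of an edge that is treated, and `0` for the other edges. -/
noncomputable def awt (A : PCA n σ) (m : ℕ) (u : Fin n) (ℓ p : ℕ) (a : Fin σ) : ℕ :=
  if A.Act m u ℓ p a then A.wt u ℓ p a else 0

theorem weight_eq_sum_awt (A : PCA n σ) (m : ℕ) (u : Fin n) (ℓ p : ℕ) :
    A.weight m u ℓ p = ∑ a : Fin σ, A.awt m u ℓ p a := by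
  classical
  exact Finset.sum_congr rfl fun a _ => by unfold awt Act; congr

/-- The number of strings output for edges to states with code of the length greater than `l`, or
equal to `l` and label less than `k`. -/
noncomputable def levelSum (A : PCA n σ) (m : ℕ) (u : Fin n) (ℓ p l k : ℕ) : ℕ :=
  ∑ a : Fin σ, if l < A.lenC m (A.target (A.defaultAt u p) a) ∨
    (A.lenC m (A.target (A.defaultAt u p) a) = l ∧ a.val < k) then A.awt m u ℓ p a else 0

/-- The edges before `b` have a larger code, or the same code and a smaller letter. Offsets can thus
be found without sorting the list. -/
theorem pre_eq_levelSum (A : PCA n σ) (m : ℕ) (u : Fin n) (ℓ p : ℕ) (b : Fin σ) :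
    A.pre m u ℓ p b = A.levelSum m u ℓ p (A.lenC m (A.target (A.defaultAt u p) b)) b := by
  classical
  refine Finset.sum_congr rfl fun a _ => ?_
  rw [before_iff A m]
  unfold awt Act
  by_cases h : A.lenC m (A.target (A.defaultAt u p) b) < A.lenC m (A.target (A.defaultAt u p) a) ∨
    (A.lenC m (A.target (A.defaultAt u p) a) = A.lenC m (A.target (A.defaultAt u p) b) ∧ a.val < b)
  · rw [if_pos h]
    congr 1
    simp only [eq_iff_iff]
    refine ⟨fun h => h.1, fun h' => ⟨h', ?_⟩⟩
    rcases h with h | ⟨h1, h2⟩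
    · exact ⟨Or.inl h, by rintro rfl; omega⟩
    · exact ⟨Or.inr ⟨h1.symm, by rw [Fin.le_def]; omega⟩, by rintro rfl; omega⟩
  · rw [if_neg h, if_neg]
    rintro ⟨_, h1, h2⟩
    refine h ?_
    rcases h1 with h1 | ⟨h1, h3⟩
    · exact Or.inl h1
    · exact Or.inr ⟨h1.symm, lt_of_le_of_ne h3 fun h => h2 (Fin.ext h)⟩

theorem levelSum_le (A : PCA n σ) (m : ℕ) (u : Fin n) (ℓ p l k : ℕ) :
    A.levelSum m u ℓ p l k ≤ A.weight m u ℓ p := by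
  rw [weight_eq_sum_awt]
  refine Finset.sum_le_sum fun a _ => ?_
  split <;> omega

theorem levelSum_succ (A : PCA n σ) (m : ℕ) (u : Fin n) (ℓ p l : ℕ) (a : Fin σ) :
    A.levelSum m u ℓ p l (a + 1) = A.levelSum m u ℓ p l a +
      if A.lenC m (A.target (A.defaultAt u p) a) = l then A.awt m u ℓ p a else 0 := by
  have h : (if A.lenC m (A.target (A.defaultAt u p) a) = l then A.awt m u ℓ p a else 0) =
      ∑ d : Fin σ, if d = a then (if A.lenC m (A.target (A.defaultAt u p) d) = l then
        A.awt m u ℓ p d else 0) else 0 := by simp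
  rw [h, levelSum, levelSum, ← Finset.sum_add_distrib]
  refine Finset.sum_congr rfl fun d _ => ?_
  by_cases hd : d = a
  · subst hd
    by_cases hl : A.lenC m (A.target (A.defaultAt u p) d) = l
    · simp [hl]
    · simp [hl]
  · have : d.val ≠ a := fun h => hd (Fin.ext h)
    simp only [hd, if_false, add_zero]
    congr 1
    simp only [eq_iff_iff]
    omega

/-- A level begins where the next higher one ends; this drives the summation from the highest code
downwards. -/
theorem levelSum_pred (A : PCA n σ) (m : ℕ) (u : Fin n) (ℓ p l : ℕ) :
    A.levelSum m u ℓ p l 0 = A.levelSum m u ℓ p (l + 1) σ := by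
  refine Finset.sum_congr rfl fun a _ => ?_
  congr 1
  have := a.2
  simp only [eq_iff_iff]
  omega

theorem levelSum_mono (A : PCA n σ) (m : ℕ) (u : Fin n) (ℓ p : ℕ) {l k l' k' : ℕ}
    (h : l' < l ∨ (l' = l ∧ k ≤ k')) : A.levelSum m u ℓ p l k ≤ A.levelSum m u ℓ p l' k' := by
  refine Finset.sum_le_sum fun a _ => ?_
  split_ifs with h1 h2 h2
  · exact le_rfl
  · omega
  · exact Nat.zero_le _
  · exact le_rfl

theorem pre_add_wt (A : PCA n σ) {m : ℕ} {u : Fin n} {ℓ p : ℕ} {b : Fin σ} (hb : A.Act m u ℓ p b) :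
    A.pre m u ℓ p b + A.wt u ℓ p b =
      A.levelSum m u ℓ p (A.lenC m (A.target (A.defaultAt u p) b)) (b + 1) := by
  rw [levelSum_succ, if_pos rfl, pre_eq_levelSum, awt, if_pos hb]

theorem pre_add_wt_le_weight (A : PCA n σ) {m : ℕ} {u : Fin n} {ℓ p : ℕ} {b : Fin σ}
    (hb : A.Act m u ℓ p b) : A.pre m u ℓ p b + A.wt u ℓ p b ≤ A.weight m u ℓ p := by
  rw [pre_add_wt A hb]
  exact A.levelSum_le m u ℓ p _ _

/-- The intervals of positions of different edges are disjoint, because the earlier edge ends before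
the later one begins. -/
theorem eq_of_pre {A : PCA n σ} {m : ℕ} {u : Fin n} {ℓ p r : ℕ} {a b : Fin σ} (ha : A.Act m u ℓ p a)
    (hb : A.Act m u ℓ p b) (ha1 : A.pre m u ℓ p a ≤ r) (ha2 : r < A.pre m u ℓ p a + A.wt u ℓ p a)
    (hb1 : A.pre m u ℓ p b ≤ r) (hb2 : r < A.pre m u ℓ p b + A.wt u ℓ p b) : a = b := by
  have key : ∀ a b : Fin σ, A.Act m u ℓ p a → A.Before (A.defaultAt u p) a b → a ≠ b →
      A.pre m u ℓ p a + A.wt u ℓ p a ≤ A.pre m u ℓ p b := by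
    intro a b ha h hne
    rw [pre_add_wt A ha, pre_eq_levelSum]
    refine A.levelSum_mono m u ℓ p ?_
    rcases (before_iff A m _ a b).1 h with h | ⟨h, h'⟩
    · exact Or.inl h
    · exact Or.inr ⟨h, lt_of_le_of_ne h' hne⟩
  by_contra hne
  rcases A.before_total (A.defaultAt u p) a b with h | h
  · have := key a b ha h hne
    omega
  · have := key b a hb h (Ne.symm hne)
    omega

/-- Positions in disjoint intervals. -/
theorem eq_of_prefix_sum {O o₁ o₂ o₃ o₄ : List ℕ} {W : ℕ → ℕ} {p q r : ℕ}
    (hp : O = o₁ ++ p :: o₂) (hq : O = o₃ ++ q :: o₄)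
    (hp1 : (o₁.map W).sum ≤ r) (hp2 : r < (o₁.map W).sum + W p)
    (hq1 : (o₃.map W).sum ≤ r) (hq2 : r < (o₃.map W).sum + W q) : p = q := by
  rcases List.append_eq_append_iff.1 (hp.symm.trans hq) with ⟨as, h1, h2⟩ | ⟨as, h1, h2⟩
  · cases as with
    | nil => simp at h2; exact h2.1
    | cons x as =>
      simp at h2
      obtain ⟨rfl, _⟩ := h2
      rw [h1] at hq1
      simp at hq1
      omega
  · cases as with
    | nil => simp at h2; exact h2.1.symm
    | cons x as =>
      simp at h2
      obtain ⟨rfl, _⟩ := h2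
      rw [h1] at hp1
      simp at hp1
      omega

end PCA

/-! ### The offsets of the edges of one vertex -/

namespace RAM

variable {n σ m : ℕ}

theorem optC_eq {o : Option (Fin σ)} {a : Fin σ} : a.val + 1 = optC o ↔ o = some a := by
  cases o with
  | none => simp [optC]
  | some b => simp [optC, Fin.ext_iff, eq_comm]

/-- The vertex at distance `reg 5` on the default walk is being treated. -/
structure Vert (A : PCA n σ) (m : ℕ) (u : Fin n) (ℓ p : ℕ) (s : State) : Prop where
  tab : Tab A m s
  pos : s.reg 5 = p
  vert : s.reg 6 = A.defaultAt u p
  root : s.reg 11 = PCA.topPos (A.key m u ℓ) 0 ℓ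
  len : s.reg 12 = ℓ

theorem Vert.fr {A : PCA n σ} {u : Fin n} {ℓ p : ℕ} {s s' : State} {q : Prog} (h : Vert A m u ℓ p s)
    (hf : Fr q s s') (hr : ∀ r ∈ [0, 1, 3, 5, 6, 11, 12], r ∉ q.wr := by decide)
    (hm : ∀ g ∈ [0, 4, 6, 7, 8, 9, 10], g ∉ q.ws := by decide) : Vert A m u ℓ p s' :=
  ⟨h.tab.fr hf (fun r h1 => hr r (by simp at h1 ⊢; tauto)) hm, (hf.reg 5 (hr 5 (by simp))).trans h.pos,
    (hf.reg 6 (hr 6 (by simp))).trans h.vert, (hf.reg 11 (hr 11 (by simp))).trans h.root,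
    (hf.reg 12 (hr 12 (by simp))).trans h.len⟩

/-- The end of the edge `reg 9`, if this edge is treated. -/
def selCell : Prog :=
  .assign 14 (.load 0 (.reg 6 *ₑ .reg 1 +ₑ .reg 9)) ;;
  .ite (.reg 9 +ₑ .lit 1 =ₑ .load 7 (.reg 6)) (.assign 14 (.lit 0)) .skip ;;
  .ite ((.reg 5 +ₑ .lit 1 =ₑ .reg 11) *ₑ (.reg 9 +ₑ .lit 1 =ₑ .load 8 (.reg 6)))
    (.assign 14 (.lit 0)) .skip

open Classical in
theorem selCell_spec (A : PCA n σ) {c : Cfg} (hc : c.Fits n σ m) {s : State} (hs : Bdd c s) {u : Fin n}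
    {ℓ p : ℕ} (hv : Vert A m u ℓ p s) (h0 : PCA.topPos (A.key m u ℓ) 0 ℓ ≠ 0) {a : Fin σ}
    (h9 : s.reg 9 = a) :
    HT c selCell s selCell.K fun s' => s'.reg 14 =
      if A.Act m u ℓ p a then (A.target (A.defaultAt u p) a : ℕ) + 1 else 0 := by
  have hsm := hc.small
  have hle := hc.le
  have ha := a.2
  have htab := table_apply A (A.defaultAt u p) a
  have hN := (A.defaultAt u p).2
  have hq := (A.target (A.defaultAt u p) a).2
  have e1 := (hv.tab.cell (A.defaultAt u p)).fst
  have e2 := (hv.tab.cell (A.defaultAt u p)).snd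
  have etop : p + 1 = PCA.topPos (A.key m u ℓ) 0 ℓ ↔ p = A.top m u ℓ := by rw [PCA.top]; omega
  refine HT.of_wp hc.hN hc.hB hs ?_
  have hAct : A.Act m u ℓ p a ↔ (A.step (A.defaultAt u p) a).isSome ∧
      ¬ (a.val + 1 = optC (A.edges (A.defaultAt u p))[0]?) ∧
      ¬ (p + 1 = PCA.topPos (A.key m u ℓ) 0 ℓ ∧ a.val + 1 = optC (A.edges (A.defaultAt u p))[1]?) := by
    rw [PCA.Act, PCA.Skip, optC_eq, optC_eq, etop]
    tauto
  have hx : (if A.Act m u ℓ p a then (A.target (A.defaultAt u p) a : ℕ) + 1 else 0) =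
      if (A.step (A.defaultAt u p) a).isSome ∧
      ¬ (a.val + 1 = optC (A.edges (A.defaultAt u p))[0]?) ∧
      ¬ (p + 1 = PCA.topPos (A.key m u ℓ) 0 ℓ ∧ a.val + 1 = optC (A.edges (A.defaultAt u p))[1]?)
      then (A.target (A.defaultAt u p) a : ℕ) + 1 else 0 := by
    congr 1
    exact propext hAct
  generalize (if A.Act m u ℓ p a then (A.target (A.defaultAt u p) a : ℕ) + 1 else 0) = x at hx ⊢
  generalize optC (A.edges (A.defaultAt u p))[0]? = o₀ at *
  generalize optC (A.edges (A.defaultAt u p))[1]? = o₁ at *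
  by_cases hsome : (A.step (A.defaultAt u p) a).isSome <;> by_cases h1 : a.val + 1 = o₀ <;>
    by_cases h2 : p + 1 = PCA.topPos (A.key m u ℓ) 0 ℓ <;> by_cases h3 : a.val + 1 = o₁ <;>
    simp only [hsome, h1, h2, h3, if_true, if_false, and_true, true_and, and_false, false_and,
      not_true_eq_false, not_false_eq_true, Bool.false_eq_true] at htab hx <;>
    simp [selCell, wp, Expr.ok, Expr.eval, Op.eval, hv.tab.inp.σ, hv.tab.inp.table, htab, h9, hv.vert,
      e1, e2, hv.pos, hv.root, h1, h2, h3, hx] <;>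
    (try split_ifs) <;> omega

/-- Contribution of one edge to the sums by levels. -/
def levelCell : Prog :=
  selCell ;;
  .ite (.reg 14) (.assign 17 (.load 4 (.reg 14 -ₑ .lit 1)) ;;
    .store 19 (.reg 17) (.load 19 (.reg 17) +ₑ
      .load 6 ((.reg 12 -ₑ (.reg 5 +ₑ .lit 1)) *ₑ .reg 0 +ₑ (.reg 14 -ₑ .lit 1)))) .skip

/-- One step of the summation over the levels. -/
def sumCell : Prog :=
  .assign 17 (.reg 15 -ₑ (.reg 7 +ₑ .lit 1)) ;; .assign 18 (.load 19 (.reg 17)) ;;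
  .store 19 (.reg 17) (.reg 16) ;; .assign 16 (.reg 16 +ₑ .reg 18)

/-- The offset of one edge. -/
def preCell : Prog :=
  selCell ;;
  .ite (.reg 14) (.assign 17 (.load 4 (.reg 14 -ₑ .lit 1)) ;;
    .store 20 (.reg 9) (.load 19 (.reg 17)) ;;
    .store 19 (.reg 17) (.load 19 (.reg 17) +ₑ
      .load 6 ((.reg 12 -ₑ (.reg 5 +ₑ .lit 1)) *ₑ .reg 0 +ₑ (.reg 14 -ₑ .lit 1)))) .skip

/-- The offsets of all edges that are treated. -/
def preProg : Prog :=
  .assign 15 (.reg 0 +ₑ .reg 3 +ₑ .lit 1) ;; forTo 7 15 (.store 19 (.reg 7) (.lit 0)) ;;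
  forTo 9 1 levelCell ;; .assign 16 (.lit 0) ;; forTo 7 15 sumCell ;; forTo 9 1 preCell

/-- Cell `l` collects the weights of the edges with code `l` and label less than `a`; the invariant
expresses this as a difference of two level sums, written without subtraction. -/
theorem levelCell_spec (A : PCA n σ) {c : Cfg} (hc : c.Fits n σ m) {s : State} (hs : Bdd c s)
    {u : Fin n} {ℓ p : ℕ} (hℓ : ℓ ≤ m) (hp : p < ℓ) (hv : Vert A m u ℓ p s)
    (h0 : PCA.topPos (A.key m u ℓ) 0 ℓ ≠ 0) (hW : A.weight m u ℓ p ≤ c.B) {a : Fin σ}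
    (h9 : s.reg 9 = a)
    (hI : ∀ l, l ≤ n + m → s.mem 19 l + A.levelSum m u ℓ p l 0 = A.levelSum m u ℓ p l a) :
    HT c levelCell s (selCell.K + 1000) fun s' => ∀ l, l ≤ n + m →
      s'.mem 19 l + A.levelSum m u ℓ p l 0 = A.levelSum m u ℓ p l (a + 1) := by
  classical
  have hsm := hc.small
  have hle := hc.le
  refine HT.seq (selCell_spec A hc hs hv h0 h9) ?_
  intro s₁ hs₁ hf₁ h14
  have hv₁ := hv.fr hf₁
  have em : s₁.mem 19 = s.mem 19 := hf₁.mem 19 (by decide)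
  refine (HT.of_wp hc.hN hc.hB hs₁ ?_).mono (by decide) fun _ _ _ h => h
  have hstep := fun l => A.levelSum_succ m u ℓ p l a
  have hlen := A.lenC_le m (A.target (A.defaultAt u p) a)
  have hl := hv₁.tab.len (A.target (A.defaultAt u p) a)
  by_cases hA : A.Act m u ℓ p a
  · rw [if_pos hA] at h14
    have hcnt := hv₁.tab.cnt (ℓ - (p + 1)) (A.target (A.defaultAt u p) a) (by omega)
    have hwt : A.awt m u ℓ p a = A.cnt (ℓ - (p + 1)) (A.target (A.defaultAt u p) a) := by
      rw [PCA.awt, if_pos hA, PCA.wt]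
      congr 1
      omega
    have hIl := hI _ hlen
    have hb := A.levelSum_le m u ℓ p (A.lenC m (A.target (A.defaultAt u p) a)) (a + 1)
    have hst := hstep (A.lenC m (A.target (A.defaultAt u p) a))
    rw [if_pos rfl, hwt] at hst
    simp [wp, Expr.ok, Expr.eval, Op.eval, h14, hl, hv₁.len, hv₁.pos, hv₁.tab.inp.n, hcnt, em]
    have hn := hc.npos
    refine ⟨by omega, by omega, by omega, ?_, fun l hl' => ?_⟩
    · omega
    by_cases hll : l = A.lenC m (A.target (A.defaultAt u p) a)
    · rw [hll, Function.update_self]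
      omega
    · rw [Function.update_of_ne hll, hstep, if_neg (Ne.symm hll)]
      exact hI l hl'
  · rw [if_neg hA] at h14
    have hwt : A.awt m u ℓ p a = 0 := by rw [PCA.awt, if_neg hA]
    simp [wp, Expr.ok, Expr.eval, h14, em]
    intro l hl'
    rw [hstep, hwt, ite_self, add_zero]
    exact hI l hl'

/-- In the second pass cell `l` holds the offset of the next edge with code `l`, as in a counting
sort; it is copied to the edge and then advanced by the weight. -/
theorem preCell_spec (A : PCA n σ) {c : Cfg} (hc : c.Fits n σ m) {s : State} (hs : Bdd c s)
    {u : Fin n} {ℓ p : ℕ} (hℓ : ℓ ≤ m) (hp : p < ℓ) (hv : Vert A m u ℓ p s)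
    (h0 : PCA.topPos (A.key m u ℓ) 0 ℓ ≠ 0) (hW : A.weight m u ℓ p ≤ c.B) {a : Fin σ}
    (h9 : s.reg 9 = a)
    (hI : (∀ l, l ≤ n + m → s.mem 19 l = A.levelSum m u ℓ p l a) ∧
      ∀ d : Fin σ, d.val < a → A.Act m u ℓ p d → s.mem 20 d = A.pre m u ℓ p d) :
    HT c preCell s (selCell.K + 1000) fun s' =>
      (∀ l, l ≤ n + m → s'.mem 19 l = A.levelSum m u ℓ p l (a + 1)) ∧
      ∀ d : Fin σ, d.val < a + 1 → A.Act m u ℓ p d → s'.mem 20 d = A.pre m u ℓ p d := by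
  classical
  have hsm := hc.small
  have hle := hc.le
  refine HT.seq (selCell_spec A hc hs hv h0 h9) ?_
  intro s₁ hs₁ hf₁ h14
  have hv₁ := hv.fr hf₁
  have em : s₁.mem 19 = s.mem 19 := hf₁.mem 19 (by decide)
  have em' : s₁.mem 20 = s.mem 20 := hf₁.mem 20 (by decide)
  have e9 : s₁.reg 9 = a := (hf₁.reg 9 (by decide)).trans h9
  refine (HT.of_wp hc.hN hc.hB hs₁ ?_).mono (by decide) fun _ _ _ h => h
  have hstep := fun l => A.levelSum_succ m u ℓ p l a
  have hlen := A.lenC_le m (A.target (A.defaultAt u p) a)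
  have hl := hv₁.tab.len (A.target (A.defaultAt u p) a)
  by_cases hA : A.Act m u ℓ p a
  · rw [if_pos hA] at h14
    have hcnt := hv₁.tab.cnt (ℓ - (p + 1)) (A.target (A.defaultAt u p) a) (by omega)
    have hwt : A.awt m u ℓ p a = A.cnt (ℓ - (p + 1)) (A.target (A.defaultAt u p) a) := by
      rw [PCA.awt, if_pos hA, PCA.wt]
      congr 1
      omega
    have hIl := hI.1 _ hlen
    have hb := A.levelSum_le m u ℓ p (A.lenC m (A.target (A.defaultAt u p) a)) (a + 1)
    have hst := hstep (A.lenC m (A.target (A.defaultAt u p) a))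
    rw [if_pos rfl, hwt] at hst
    have hpre := A.pre_eq_levelSum m u ℓ p a
    simp [wp, Expr.ok, Expr.eval, Op.eval, h14, hl, hv₁.len, hv₁.pos, hv₁.tab.inp.n, hcnt, em, em', e9,
      hIl, -Order.lt_add_one_iff]
    have hn := hc.npos
    refine ⟨by omega, by omega, by omega, by omega, by omega, fun l hl' => ?_, fun d hd hd' => ?_⟩
    · by_cases hll : l = A.lenC m (A.target (A.defaultAt u p) a)
      · rw [hll, Function.update_self]
        omega
      · rw [Function.update_of_ne hll, hstep, if_neg (Ne.symm hll), add_zero]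
        exact hI.1 l hl'
    · by_cases hda : d = a
      · rw [hda, Function.update_self, hpre]
      · have : d.val ≠ a := fun h => hda (Fin.ext h)
        rw [Function.update_of_ne this]
        exact hI.2 d (by omega) hd'
  · rw [if_neg hA] at h14
    have hwt : A.awt m u ℓ p a = 0 := by rw [PCA.awt, if_neg hA]
    simp [wp, Expr.ok, Expr.eval, h14, em, em', -Order.lt_add_one_iff]
    refine ⟨fun l hl' => ?_, fun d hd hd' => ?_⟩
    · rw [hstep, hwt, ite_self, add_zero]
      exact hI.1 l hl'
    · refine hI.2 d ?_ hd'
      have : d.val ≠ a := fun h => hA (Fin.ext h ▸ hd')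
      omega

/-- A counting sort with `n + m + 1` levels: it takes two passes over the `σ` letters and two over
the levels. -/
theorem preProg_spec : ∃ K, ∀ {n σ m : ℕ} (A : PCA n σ) {c : Cfg} {s : State} {u : Fin n} {ℓ p : ℕ},
    c.Fits n σ m → Bdd c s → Vert A m u ℓ p s → ℓ ≤ m → p < ℓ →
    PCA.topPos (A.key m u ℓ) 0 ℓ ≠ 0 → A.weight m u ℓ p ≤ c.B →
    HT c preProg s (K * (n + m + σ)) fun s' =>
      ∀ a : Fin σ, A.Act m u ℓ p a → s'.mem 20 a = A.pre m u ℓ p a := by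
  refine ⟨2 * selCell.K + 3000, fun {n σ m} A {c s u ℓ p} hc hs hv hℓ hp h0 hW => ?_⟩
  have hsm := hc.small
  have hle := hc.le
  have h : HT c preProg s (100 + (((n + m + 1) * (100 + 61) + 37) +
      ((σ * ((selCell.K + 1000) + 61) + 37) + (7 + (((n + m + 1) * (200 + 61) + 37) +
      (σ * ((selCell.K + 1000) + 61) + 37)))))) fun s' =>
      ∀ a : Fin σ, A.Act m u ℓ p a → s'.mem 20 a = A.pre m u ℓ p a := by
    refine HT.seq (T₁ := 100) (Q₁ := fun s' => s'.reg 15 = n + m + 1)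
      ((HT.of_wp hc.hN hc.hB hs (by
        simp [wp, Expr.ok, Expr.eval, Op.eval, hv.tab.inp.n, hv.tab.inp.m]; omega)).mono (by decide)
        fun _ _ _ h => h) ?_
    intro s₁ hs₁ hf₁ e15
    have hv₁ := hv.fr hf₁
    have hclear := HT.forTo hc.hN hc.hB (i := 7) (b := 15) (p := .store 19 (.reg 7) (.lit 0)) (s := s₁)
      (T := 100) (fun k s' => ∀ l, l < k → s'.mem 19 l = 0) hs₁ (by decide) (by decide)
      (by decide) (by simp)
      (by
        intro k s₂ hk hs₂ hf₂ h7 hI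
        refine (HT.of_wp hc.hN hc.hB hs₂ (Q := fun s' => s'.mem 19 = Function.update (s₂.mem 19) k 0)
          ?_).mono (by decide) ?_
        · simp [wp, Expr.ok, Expr.eval, h7]
        · intro s₃ _ _ h2 v hv
          rw [setReg_mem, h2]
          by_cases hvk : v = k
          · simp [hvk]
          · rw [Function.update_of_ne hvk]
            exact hI v (by omega))
    rw [e15] at hclear
    refine HT.seq hclear ?_
    rintro s₂ hs₂ hf₂ ⟨h2, -⟩
    have hv₂ := hv₁.fr hf₂
    have e15₂ : s₂.reg 15 = n + m + 1 := (hf₂.reg 15 (by decide)).trans e15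
    have hlev := HT.forTo hc.hN hc.hB (i := 9) (b := 1) (p := levelCell) (s := s₂)
      (T := selCell.K + 1000) (fun k s' => ∀ l, l ≤ n + m →
        s'.mem 19 l + A.levelSum m u ℓ p l 0 = A.levelSum m u ℓ p l k) hs₂ (by decide) (by decide)
      (by decide) (by intro l hl; rw [setReg_mem, h2 l (by omega), zero_add])
      (by
        intro k s₃ hk hs₃ hf₃ h9 hI
        rw [hv₂.tab.inp.σ] at hk
        exact (levelCell_spec A hc hs₃ hℓ hp (hv₂.fr hf₃) h0 hW (a := ⟨k, hk⟩) h9 hI).mono le_rfl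
          fun s' _ _ h => h)
    rw [hv₂.tab.inp.σ] at hlev
    refine HT.seq hlev ?_
    rintro s₃ hs₃ hf₃ ⟨h3, -⟩
    have hv₃ := hv₂.fr hf₃
    have e15₃ : s₃.reg 15 = n + m + 1 := (hf₃.reg 15 (by decide)).trans e15₂
    refine HT.seq (T₁ := 7) (Q₁ := fun s' => s' = s₃.setReg 16 0)
      (HT.of_wp (p := .assign 16 (.lit 0)) hc.hN hc.hB hs₃ ⟨Nat.zero_le _, Nat.zero_le _, rfl⟩) ?_
    rintro _ hs₄ hf₄ rfl
    have hv₄ := hv₃.fr hf₄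
    set s₄ := s₃.setReg 16 0 with hs4
    have e15₄ : s₄.reg 15 = n + m + 1 := by simp [hs4, e15₃]
    -- No code exceeds `n + m`, so nothing precedes the highest level.
    have hz : A.levelSum m u ℓ p (n + m) 0 = 0 := by
      refine Finset.sum_eq_zero fun a _ => ?_
      have := A.lenC_le m (A.target (A.defaultAt u p) a)
      rw [if_neg]
      omega
    -- Round `j` treats the level `n + m - j` and replaces its total by the sum of all higher
    -- levels.
    have hsum := HT.forTo hc.hN hc.hB (i := 7) (b := 15) (p := sumCell) (s := s₄) (T := 200)
      (fun j s' => (j ≤ n + m → s'.reg 16 = A.levelSum m u ℓ p (n + m - j) 0) ∧ ∀ l, l ≤ n + m →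
        (n + m < l + j → s'.mem 19 l = A.levelSum m u ℓ p l 0) ∧
        (l + j ≤ n + m → s'.mem 19 l + A.levelSum m u ℓ p l 0 = A.levelSum m u ℓ p l σ)) hs₄
      (by decide) (by decide) (by decide)
      (by
        refine ⟨fun _ => by simp [hs4, hz], fun l hl => ⟨fun h => by omega, fun _ => ?_⟩⟩
        exact h3 l hl)
      (by
        rintro j s₅ hj hs₅ hf₅ h7 ⟨hI1, hI2⟩
        rw [e15₄] at hj
        have e15₅ : s₅.reg 15 = n + m + 1 := (hf₅.reg 15 (by decide)).trans e15₄
        have hI1 := hI1 (by omega)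
        have hI3 := (hI2 (n + m - j) (by omega)).2 (by omega)
        have hb := A.levelSum_le m u ℓ p (n + m - j) σ
        have hmb := hs₅.2 19 (n + m - j)
        have e1 : n + m + 1 - (j + 1) = n + m - j := by omega
        refine (HT.of_wp hc.hN hc.hB hs₅ (Q := fun s' =>
          s'.reg 16 = A.levelSum m u ℓ p (n + m - j) σ ∧
          s'.mem 19 = Function.update (s₅.mem 19) (n + m - j) (A.levelSum m u ℓ p (n + m - j) 0))
          ?_).mono (by decide) ?_
        · simp [sumCell, wp, Expr.ok, Expr.eval, Op.eval, h7, e15₅, hI1]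
          omega
        · rintro s₆ - - ⟨k1, k2⟩
          refine ⟨fun hj' => ?_, fun l hl => ?_⟩
          · simp only [setReg_reg]
            rw [if_neg (by decide), k1, A.levelSum_pred]
            congr 1
            omega
          · rw [setReg_mem, k2]
            by_cases hlj : l = n + m - j
            · rw [hlj, Function.update_self]
              exact ⟨fun _ => rfl, fun h => by omega⟩
            · rw [Function.update_of_ne hlj]
              exact ⟨fun h => (hI2 l hl).1 (by omega), fun h => (hI2 l hl).2 (by omega)⟩)
    rw [e15₄] at hsum
    refine HT.seq hsum ?_
    rintro s₅ hs₅ hf₅ ⟨⟨-, h5⟩, -⟩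
    have hv₅ := hv₄.fr hf₅
    have hpre := HT.forTo hc.hN hc.hB (i := 9) (b := 1) (p := preCell) (s := s₅)
      (T := selCell.K + 1000) (fun k s' => (∀ l, l ≤ n + m → s'.mem 19 l = A.levelSum m u ℓ p l k) ∧
        ∀ d : Fin σ, d.val < k → A.Act m u ℓ p d → s'.mem 20 d = A.pre m u ℓ p d) hs₅ (by decide)
      (by decide) (by decide)
      ⟨fun l hl => (h5 l hl).1 (by omega), fun d hd => by omega⟩
      (by
        intro k s₆ hk hs₆ hf₆ h9 hI
        rw [hv₅.tab.inp.σ] at hk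
        exact (preCell_spec A hc hs₆ hℓ hp (hv₅.fr hf₆) h0 hW (a := ⟨k, hk⟩) h9 hI).mono le_rfl
          fun s' _ _ h => h)
    rw [hv₅.tab.inp.σ] at hpre
    exact hpre.mono le_rfl fun s' _ _ h a => h.1.2 a a.2
  refine h.mono ?_ fun _ _ _ h => h
  have hm := hc.mpos
  generalize selCell.K = k
  have h1 : σ * (2 * k) ≤ (n + m + σ) * (2 * k) := Nat.mul_le_mul_right _ (by omega)
  calc _ = σ * (2 * k) + (2122 * σ + 422 * (n + m) + 677) := by ring
    _ ≤ (n + m + σ) * (2 * k) + 3000 * (n + m + σ) := Nat.add_le_add h1 (by omega)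
    _ = _ := by ring

end RAM

/-! ### Ranking -/

namespace RAM

variable {n σ m : ℕ}

theorem ite_one_zero_le (P : Prop) [Decidable P] {x : ℕ} (hx : 1 ≤ x) :
    (if P then 1 else 0) ≤ x := by
  split <;> omega

/-- The first position at which the string leaves the default walk. -/
def findProg : Prog :=
  .assign 5 (.lit 0) ;;
  .while ((.reg 5 <ₑ .reg 12) *ₑ (.load 1 (.reg 13 +ₑ .reg 5) +ₑ .lit 1 =ₑ .load 7 (.load 11 (.reg 5))))
    (.assign 5 (.reg 5 +ₑ .lit 1))

theorem findProg_spec {c : Cfg} (hN : 1 ≤ c.N) (hB : 1 ≤ c.B) {s : State} (hs : Bdd c s) {H : ℕ}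
    (hH : H ≤ s.reg 12) (h1 : ∀ h, h < H → s.mem 1 (s.reg 13 + h) + 1 = s.mem 7 (s.mem 11 h))
    (h2 : H = s.reg 12 ∨ s.mem 1 (s.reg 13 + H) + 1 ≠ s.mem 7 (s.mem 11 H)) :
    HT c findProg s (7 + (H * (1000 + 31) + 1000)) fun s' => s' = s.setReg 5 H := by
  refine HT.seq (T₁ := 7) (Q₁ := fun s' => s' = s.setReg 5 0)
    (HT.of_wp (p := .assign 5 (.lit 0)) hN hB hs ⟨Nat.zero_le _, Nat.zero_le _, rfl⟩) ?_
  rintro _ hs₁ - rfl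
  have hb := hs.1 12
  have hH' : H ≤ c.B := hH.trans hb
  refine (HT.while hN hB (e := (.reg 5 <ₑ .reg 12) *ₑ (.load 1 (.reg 13 +ₑ .reg 5) +ₑ .lit 1 =ₑ
      .load 7 (.load 11 (.reg 5)))) (p := .assign 5 (.reg 5 +ₑ .lit 1)) (T := 31) (k := H)
    (I := fun s' => ∃ h, h ≤ H ∧ s' = s.setReg 5 h) (μ := fun s' => H - s'.reg 5) hs₁ ⟨0, by omega, rfl⟩
    (by simp) ?_ ?_).mono (Nat.add_le_add (Nat.mul_le_mul_left _ (Nat.add_le_add_right (by decide) _))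
      (by decide)) ?_
  · rintro _ hs₂ - ⟨h, hh, rfl⟩
    simp only [Expr.ok, Expr.eval, Op.eval]
    -- The product serves as a conjunction: both factors are 0 or 1.
    refine ⟨⟨trivial, trivial⟩, ⟨⟨⟨trivial, trivial⟩, hB⟩, trivial⟩, ite_one_zero_le _ hN,
      ite_one_zero_le _ hB⟩
  · rintro _ hs₂ - ⟨h, hh, rfl⟩ he
    have hne : h ≠ H := by
      rintro rfl
      apply he
      simp only [Expr.eval, Op.eval, setReg_reg, setReg_mem]
      rcases h2 with h2 | h2
      · simp [← h2]
      · simp [h2]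
    refine (HT.of_wp (p := .assign 5 (.reg 5 +ₑ .lit 1)) hN hB hs₂ (Q := fun s' =>
      s' = s.setReg 5 (h + 1)) ?_).mono le_rfl ?_
    · simp [wp, Expr.ok, Expr.eval, Op.eval]
      refine ⟨hB, by omega, ?_⟩
      simp [State.setReg]
    · rintro _ - - rfl
      exact ⟨⟨h + 1, by omega, rfl⟩, by simp; omega⟩
  · rintro _ - - ⟨⟨h, hh, rfl⟩, he⟩
    by_cases hlt : h < H
    · exfalso
      have := h1 h hlt
      simp only [Expr.eval, Op.eval, setReg_reg, setReg_mem] at he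
      simp [this] at he
      omega
    · rw [show h = H by omega]

/-- The edge `reg 21` belongs to the last call. -/
def lastE : Expr := (.reg 5 +ₑ .lit 1 =ₑ .reg 11) *ₑ (.reg 21 +ₑ .lit 1 =ₑ .load 8 (.reg 6))

theorem lastE_ok {c : Cfg} (hN : 1 ≤ c.N) (hB : 1 ≤ c.B) (s : State) : lastE.ok c s := by
  simp only [lastE, Expr.ok, Expr.eval, Op.eval]
  refine ⟨⟨⟨trivial, hB⟩, trivial⟩, ⟨⟨trivial, hB⟩, trivial⟩, ite_one_zero_le _ hN,
    ite_one_zero_le _ hB⟩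

theorem lastE_eval {A : PCA n σ} {u : Fin n} {ℓ p : ℕ} {s : State} (hv : Vert A m u ℓ p s) {b : Fin σ}
    (h21 : s.reg 21 = b) : lastE.eval s ≠ 0 ↔ A.Last m u ℓ p b := by
  simp only [lastE, Expr.eval, Op.eval, hv.pos, hv.root, hv.vert, h21,
    (hv.tab.cell (A.defaultAt u p)).snd, PCA.Last, ← optC_eq]
  by_cases h1 : p + 1 = PCA.topPos (A.key m u ℓ) 0 ℓ
  · rw [if_pos h1]
    by_cases h2 : b.val + 1 = optC (A.edges (A.defaultAt u p))[1]? <;> simp [h1, h2]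
  · rw [if_neg h1]
    simp [Ne.symm h1]

/-- Continue after the edge `reg 21` of the vertex at distance `reg 5`. -/
def moveProg : Prog :=
  .assign 2 (.load 0 (.reg 6 *ₑ .reg 1 +ₑ .reg 21) -ₑ .lit 1) ;;
  .assign 12 (.reg 12 -ₑ (.reg 5 +ₑ .lit 1)) ;; .assign 13 (.reg 13 +ₑ (.reg 5 +ₑ .lit 1))

theorem moveProg_spec (A : PCA n σ) {c : Cfg} (hc : c.Fits n σ m) {s : State} (hs : Bdd c s) {u : Fin n}
    {ℓ p : ℕ} (hv : Vert A m u ℓ p s) (hp : p < ℓ) (h13 : s.reg 13 + ℓ ≤ m) {b : Fin σ}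
    (h21 : s.reg 21 = b) (hb : (A.step (A.defaultAt u p) b).isSome) :
    HT c moveProg s moveProg.K fun s' => s'.reg 2 = A.target (A.defaultAt u p) b ∧
      s'.reg 12 = ℓ - 1 - p ∧ s'.reg 13 = s.reg 13 + (p + 1) := by
  have hsm := hc.small
  have hle := hc.le
  have e3 := table_apply A (A.defaultAt u p) b
  rw [if_pos hb] at e3
  have hbσ := b.2
  have hvn := (A.defaultAt u p).2
  have hqn := (A.target (A.defaultAt u p) b).2
  refine HT.of_wp hc.hN hc.hB hs ?_
  simp [moveProg, wp, Expr.ok, Expr.eval, Op.eval, hv.vert, hv.pos, hv.len, h21, hv.tab.inp.σ,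
    hv.tab.inp.table, e3]
  omega

/-- The contribution of the vertex at which the string leaves the default walk. -/
def addProg : Prog :=
  .ite lastE (.assign 4 (.reg 4 +ₑ .reg 10))
    (preProg ;; .assign 4 (.reg 4 +ₑ .load 17 (.reg 5) +ₑ .load 20 (.reg 21)))

/-- One call, followed down to the call that outputs the string. -/
def rankCall : Prog :=
  prepProg ;; findProg ;;
  .ite (.reg 5 <ₑ .reg 12)
    ((.assign 6 (.load 11 (.reg 5)) ;; .assign 21 (.load 1 (.reg 13 +ₑ .reg 5))) ;; addProg ;; moveProg)
    (.assign 12 (.lit 0))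

/-- Ranking. -/
def rankLoop : Prog :=
  (.assign 12 (.reg 3) ;; .assign 13 (.lit 0) ;; .assign 4 (.lit 0)) ;; .while (.reg 12) rankCall ;;
    .assign 0 (.reg 4)

/-- The rest of the string is at position `r` of the output of the current call, and the sum of `r`
and the strings counted so far is `R`. -/
def RankInv (A : PCA n σ) (m R : ℕ) (s : State) : Prop :=
  ∃ (u : Fin n) (ℓ r : ℕ) (z : List (Fin σ)), s.reg 2 = u ∧ s.reg 12 = ℓ ∧ s.reg 13 + ℓ ≤ m ∧
    (ℓ : ℕ∞) ≤ A.longest u ∧ (A.enumFrom u ℓ)[r]? = some z ∧ s.reg 4 + r = R ∧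
    ∀ k a, z[k]? = some a → s.mem 1 (s.reg 13 + k) = a.val

/-- For the saved edge the offset is the final value of the accumulator; for any other edge it is
the offset of the vertex plus that of the edge in its list. -/
theorem addProg_spec : ∃ K, ∀ {n σ m : ℕ} (A : PCA n σ) {c : Cfg} {s : State} {u : Fin n} {ℓ p o : ℕ}
    {b : Fin σ}, c.Fits n σ m → Bdd c s → Vert A m u ℓ p s → ℓ ≤ m → (ℓ : ℕ∞) ≤ A.longest u →
    A.Dev u ℓ p b → A.Offset m u ℓ p b o → PrepOut A m u ℓ s → s.reg 21 = b → s.reg 4 + o ≤ c.B →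
    HT c addProg s (K * (n + m + σ)) fun s' => s'.reg 4 = s.reg 4 + o := by
  obtain ⟨K, hK⟩ := preProg_spec
  refine ⟨K + 1000, fun {n σ m} A {c s u ℓ p o b} hc hs hv hℓ hu hd ho hP h21 hB => ?_⟩
  have hm := hc.mpos
  have hT : lastE.K + (K * (n + m + σ) + 500) ≤ (K + 1000) * (n + m + σ) := by
    have : lastE.K ≤ 500 := by decide
    rw [Nat.add_mul]
    omega
  have hle := lastE_eval hv h21
  refine (HT.ite hc.hN hc.hB hs (lastE_ok hc.hN hc.hB s) (T := K * (n + m + σ) + 500) ?_ ?_).mono hT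
    fun _ _ _ h => h
  · intro h
    rw [hle] at h
    rcases ho with ⟨_, ho⟩ | ⟨h', _⟩
    · refine (HT.of_wp hc.hN hc.hB hs ?_).mono
        (Nat.le_trans (by decide : _ ≤ 500) (Nat.le_add_left _ _)) fun _ _ _ h => h
      simp [wp, Expr.ok, Expr.eval, Op.eval, hP.acc, ← ho]
      exact hB
    · exact absurd h h'
  · intro h
    have hnl : ¬ A.Last m u ℓ p b := fun h' => hle.2 h' h
    rcases ho with ⟨h', _⟩ | ⟨_, hs', o₁, o₂, ho, ho'⟩
    · exact absurd h' hnl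
    have hk := hd.key_ne_zero hℓ hu
    have h0 : PCA.topPos (A.key m u ℓ) 0 ℓ ≠ 0 := fun h0 =>
      hk (PCA.topPos_eq_zero_iff.1 h0 p (Nat.zero_le _) hd.lt)
    have hW : A.weight m u ℓ p ≤ c.B := by
      have h1 := (A.one_add_sum_weight_le hℓ hu).trans (hc.cnt_le A hℓ u)
      rw [ho] at h1
      simp at h1
      omega
    refine HT.seq (hK A hc hs hv hℓ hd.lt h0 hW) ?_
    intro s₁ hs₁ hf₁ h20
    have e4 : s₁.reg 4 = s.reg 4 := hf₁.reg 4 (by decide)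
    have e5 : s₁.reg 5 = p := (hf₁.reg 5 (by decide)).trans hv.pos
    have e21 : s₁.reg 21 = b := (hf₁.reg 21 (by decide)).trans h21
    have e17 : s₁.mem 17 p = 1 + (o₁.map (A.weight m u ℓ)).sum := by
      rw [hf₁.mem 17 (by decide)]
      exact hP.start o₁ p o₂ ho
    have e20 := h20 b ⟨hd.isSome, hs'⟩
    refine (HT.of_wp hc.hN hc.hB hs₁ ?_).mono (by decide : _ ≤ 500) fun _ _ _ h => h
    simp [wp, Expr.ok, Expr.eval, Op.eval, e4, e5, e21, e17, e20]
    omega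

/-- Comparing the string with the default letters finds where it leaves. Adding the offset of the
block to register 4 and passing to the recursive call keeps the sum `R`. -/
theorem rankCall_spec : ∃ K, ∀ {n σ m : ℕ} (A : PCA n σ) {c : Cfg} {s : State} {R : ℕ},
    c.Fits n σ m → Bdd c s → Tab A m s → RankInv A m R s → R ≤ c.B → s.reg 12 ≠ 0 →
    HT c rankCall s (K * (n + m + σ)) fun s' => RankInv A m R s' ∧ s'.reg 12 < s.reg 12 := by
  obtain ⟨K₁, hK₁⟩ := prepProg_spec
  obtain ⟨K₂, hK₂⟩ := addProg_spec
  refine ⟨K₁ + K₂ + moveProg.K + 5000, fun {n σ m} A {c s R} hc hs ht hI hR h0 => ?_⟩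
  obtain ⟨u, ℓ, r, z, h2, h12, h13, hu, hz, h4, hx⟩ := hI
  have hℓ0 : 0 < ℓ := by omega
  have hℓ : ℓ ≤ m := by omega
  have hsm := hc.small
  have hle := hc.le
  suffices h : HT c rankCall s (K₁ * m + ((m * 1031 + 1007) + (30 +
      (200 + (K₂ * (n + m + σ) + moveProg.K))))) fun s' => RankInv A m R s' ∧ s'.reg 12 < s.reg 12 by
    refine h.mono ?_ fun _ _ _ h => h
    have hm := hc.mpos
    generalize moveProg.K = k
    have h1 : K₁ * m ≤ K₁ * (n + m + σ) := Nat.mul_le_mul_left _ (by omega)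
    have h2 : k ≤ k * (n + m + σ) := Nat.le_mul_of_pos_right _ (by omega)
    rw [Nat.add_mul, Nat.add_mul, Nat.add_mul]
    omega
  refine HT.seq (hK₁ A hc hs ht hℓ hu h2 h12) ?_
  intro s₁ hs₁ hf₁ hP
  have ht₁ := ht.fr hf₁
  have e12 : s₁.reg 12 = ℓ := (hf₁.reg 12 (by decide)).trans h12
  have e13 : s₁.reg 13 = s.reg 13 := hf₁.reg 13 (by decide)
  have e4 : s₁.reg 4 = s.reg 4 := hf₁.reg 4 (by decide)
  have e2 : s₁.reg 2 = u := (hf₁.reg 2 (by decide)).trans h2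
  have hx₁ : ∀ k a, z[k]? = some a → s₁.mem 1 (s.reg 13 + k) = a.val := by
    rw [hf₁.mem 1 (by decide)]; exact hx
  have hfst : ∀ h, h < ℓ → s₁.mem 7 (s₁.mem 11 h) = optC (A.edges (A.defaultAt u h))[0]? := by
    intro h hh
    rw [hP.walk h hh, (ht₁.cell _).fst]
  rcases PCA.index_cases hℓ hℓ0 hu hz with ⟨hr, hzd⟩ | ⟨p, b, z', o, r', hd, ho, hr, hzz, hz', hlt⟩
  · -- the string is the default walk
    have hfind := findProg_spec hc.hN hc.hB hs₁ (H := ℓ) (by rw [e12])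
      (by
        intro h hh
        obtain ⟨a, ha⟩ := PCA.exists_default_at hu hh
        rw [hfst h hh, e13, hx₁ h a, optC_eq, ha]
        rw [hzd, PCA.getElem?_defaultWord hu hh, ha]) (Or.inl e12.symm)
    refine HT.seq (hfind.mono ?_ fun _ _ _ h => h) ?_
    · have := Nat.mul_le_mul_right 1031 hℓ
      omega
    rintro _ hs₂ - rfl
    refine HT.ite hc.hN hc.hB hs₂ (e := .reg 5 <ₑ .reg 12) ⟨trivial, trivial⟩ (fun he => ?_) fun he => ?_
    · rw [eval_lt_ne_zero] at he
      simp [Expr.eval, e12] at he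
    · refine (HT.of_wp (p := .assign 12 (.lit 0)) hc.hN hc.hB hs₂ ?_).mono
        (Nat.le_trans (by decide : _ ≤ 200) (Nat.le_add_right _ _)) fun _ _ _ h => h
      -- The default walk has position 0, so nothing is added; length 0 stops the loop and leaves
      -- the empty rest at position 0.
      refine ⟨Nat.zero_le _, Nat.zero_le _, ⟨u, 0, 0, [], by simp [e2], by simp [Expr.eval], ?_, by simp,
        by simp [PCA.enumFrom], ?_, by simp⟩, ?_⟩
      · simp [e13]; omega
      · simp [e4]; omega
      · simp [Expr.eval]; omega
  · have hup := PCA.natCast_le_longest_of_le hu hd.lt.le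
    have hlen := PCA.length_defaultWord hup
    have hfind := findProg_spec hc.hN hc.hB hs₁ (H := p) (by rw [e12]; exact hd.lt.le)
      (by
        intro h hh
        have hh' : h < ℓ := hh.trans hd.lt
        obtain ⟨a, ha⟩ := PCA.exists_default_at hu hh'
        rw [hfst h hh', e13, hx₁ h a, optC_eq, ha]
        rw [hzz, List.getElem?_append_left (by omega), PCA.getElem?_defaultWord hup hh, ha])
      (Or.inr (by
        rw [hfst p hd.lt, e13, hx₁ p b, ne_eq, optC_eq]
        · exact hd.ne
        · rw [hzz, List.getElem?_append_right (by omega), hlen]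
          simp))
    have hb1 : s₁.mem 1 (s.reg 13 + p) = b := by
      refine hx₁ p b ?_
      rw [hzz, List.getElem?_append_right (by omega), hlen]
      simp
    refine HT.seq (hfind.mono ?_ fun _ _ _ h => h) ?_
    · have := Nat.mul_le_mul_right 1031 (hd.lt.le.trans hℓ)
      omega
    rintro _ hs₂ hf₂ rfl
    refine HT.ite hc.hN hc.hB hs₂ (e := .reg 5 <ₑ .reg 12) ⟨trivial, trivial⟩ (fun he => ?_) fun he => ?_
    swap
    · rw [eval_lt_eq_zero] at he
      simp [Expr.eval, e12] at he
      have := hd.lt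
      omega
    have hbσ := b.2
    have hvn := (A.defaultAt u p).2
    refine HT.seq (T₁ := 200) (Q₁ := fun s' => s' =
        ((s₁.setReg 5 p).setReg 6 (A.defaultAt u p)).setReg 21 b)
      ((HT.of_wp hc.hN hc.hB hs₂ ?_).mono (by decide) fun _ _ _ h => h) ?_
    · simp [wp, Expr.ok, Expr.eval, Op.eval, hP.walk p hd.lt, e13, hb1]
      omega
    rintro _ hs₃ hf₃ rfl
    have ht₃ := (ht₁.fr hf₂).fr hf₃
    set s₃ := ((s₁.setReg 5 p).setReg 6 (A.defaultAt u p)).setReg 21 b with hs3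
    have hv₃ : Vert A m u ℓ p s₃ := ⟨ht₃, by simp [hs3], by simp [hs3], by simp [hs3, hP.root],
      by simp [hs3, e12]⟩
    have hP₃ : PrepOut A m u ℓ s₃ := ⟨by simpa [hs3] using hP.walk, by simpa [hs3] using hP.key,
      by simpa [hs3] using hP.weight, by simpa [hs3] using hP.root, by simpa [hs3] using hP.start,
      by simpa [hs3] using hP.acc⟩
    have e4₃ : s₃.reg 4 = s.reg 4 := by simp [hs3, e4]
    refine HT.seq (hK₂ A hc hs₃ hv₃ hℓ hu hd ho hP₃ (by simp [hs3]) (by rw [e4₃]; omega)) ?_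
    intro s₄ hs₄ hf₄ h4'
    have hv₄ := hv₃.fr hf₄
    have e13₄ : s₄.reg 13 = s.reg 13 := (hf₄.reg 13 (by decide)).trans (by simp [hs3, e13])
    have e21₄ : s₄.reg 21 = b := (hf₄.reg 21 (by decide)).trans (by simp [hs3])
    refine (moveProg_spec A hc hs₄ hv₄ hd.lt (by rw [e13₄]; exact h13) e21₄ hd.isSome).mono le_rfl ?_
    rintro s₅ - hf₅ ⟨k2, k12, k13⟩
    have hpl := hd.lt
    refine ⟨⟨_, ℓ - 1 - p, r', z', k2, k12, by rw [k13, e13₄]; omega, hd.le, hz', ?_, ?_⟩, by omega⟩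
    · rw [hf₅.reg 4 (by decide), h4', e4₃]
      omega
    · intro k a hk
      rw [hf₅.mem 1 (by decide), hf₄.mem 1 (by decide), k13, e13₄]
      have := hx₁ (p + 1 + k) a (by
        rw [hzz, List.getElem?_append_right (by omega), hlen, show p + 1 + k - p = k + 1 by omega]
        exact hk)
      rw [add_assoc]
      exact this

/-- The length falls in every round, so there are at most `m` rounds. -/
theorem rankLoop_spec : ∃ K, ∀ {n σ m : ℕ} (A : PCA n σ) {c : Cfg} {s : State} {R : ℕ}
    {x : List (Fin σ)}, c.Fits n σ m → Bdd c s → Tab A m s → s.reg 2 = A.init →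
    (m : ℕ∞) ≤ A.longest A.init → (A.enumFrom A.init m)[R]? = some x →
    (∀ k a, x[k]? = some a → s.mem 1 k = a.val) →
    HT c rankLoop s (K * (m * (n + m + σ))) fun s' => s'.reg 0 = R := by
  obtain ⟨K, hK⟩ := rankCall_spec
  refine ⟨K + 1000, fun {n σ m} A {c s R x} hc hs ht h2 hu hR hx => ?_⟩
  have hsm := hc.small
  have hle := hc.le
  have hRB : R ≤ c.B := by
    have h1 := (List.getElem?_eq_some_iff.1 hR).1
    rw [A.length_enumFrom m _ hu] at h1
    exact h1.le.trans (hc.cnt_le A le_rfl _)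
  have h : HT c rankLoop s (100 + ((m * (6 + K * (n + m + σ)) + 6) + 20)) fun s' => s'.reg 0 = R := by
    refine HT.seq (T₁ := 100) (Q₁ := fun s' => s' = ((s.setReg 12 m).setReg 13 0).setReg 4 0)
      ((HT.of_wp hc.hN hc.hB hs (by
        simp [wp, Expr.ok, Expr.eval, ht.inp.m]; omega)).mono (by decide) fun _ _ _ h => h) ?_
    rintro _ hs₁ hf₁ rfl
    have ht₁ := ht.fr hf₁
    refine HT.seq (HT.while hc.hN hc.hB (e := .reg 12) (p := rankCall) (T := K * (n + m + σ)) (k := m)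
      (I := RankInv A m R) (μ := fun s' => s'.reg 12) hs₁ ?_ (by simp) (fun _ _ _ _ => trivial) ?_) ?_
    · exact ⟨A.init, m, R, x, by simp [h2], by simp, by simp, hu, hR, by simp, by simpa using hx⟩
    · intro s₂ hs₂ hf₂ hI he
      exact hK A hc hs₂ (ht₁.fr hf₂) hI hRB he
    · rintro s₂ hs₂ - ⟨⟨u, ℓ, r, z, k2, k12, k13, ku, kz, k4, -⟩, he⟩
      simp only [Expr.eval] at he
      obtain rfl : ℓ = 0 := by omega
      have hr : r = 0 := by
        have := (List.getElem?_eq_some_iff.1 kz).1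
        simpa [PCA.enumFrom] using this
      refine (HT.of_wp hc.hN hc.hB hs₂ ?_).mono (by decide) fun _ _ _ h => h
      simp [wp, Expr.ok, Expr.eval]
      omega
  refine h.mono ?_ fun _ _ _ h => h
  have hm := hc.mpos
  have h1 : 1 ≤ m * (n + m + σ) := Nat.mul_pos hm (by omega)
  have h2 : m ≤ m * (n + m + σ) := Nat.le_mul_of_pos_right _ (by omega)
  calc _ = K * (m * (n + m + σ)) + (6 * m + 126) := by ring
    _ ≤ K * (m * (n + m + σ)) + 1000 * (m * (n + m + σ)) := Nat.add_le_add_left (by omega) _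
    _ = _ := by ring

end RAM

/-! ### Unranking -/

namespace RAM

variable {n σ m : ℕ}

/-- Test whether the string belongs to the vertex at distance `reg 7`. -/
def vertCell : Prog :=
  .ite (.load 12 (.reg 7))
    (.ite (.reg 4 <ₑ .load 17 (.reg 7)) .skip
      (.ite (.reg 4 <ₑ .load 17 (.reg 7) +ₑ .load 18 (.reg 7)) (.assign 5 (.reg 7)) .skip))
    .skip

/-- The hypothesis says that the interval of positions of exactly one vertex contains the index; a
linear search then finds it. -/
theorem vertProg_spec {c : Cfg} (hN : 1 ≤ c.N) (hB : 1 ≤ c.B) {s : State} (hs : Bdd c s) {p : ℕ}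
    (hp : p < s.reg 12)
    (h : ∀ q, q < s.reg 12 → ((s.mem 12 q ≠ 0 ∧ s.mem 17 q ≤ s.reg 4 ∧
      s.reg 4 < s.mem 17 q + s.mem 18 q) ↔ q = p)) :
    HT c (forTo 7 12 vertCell) s (s.reg 12 * (500 + 61) + 37) fun s' => s'.reg 5 = p := by
  refine (HT.forTo hN hB (i := 7) (b := 12) (p := vertCell) (s := s) (T := 500)
    (fun k s' => p < k → s'.reg 5 = p) hs (by decide) (by decide) (by decide) (by simp) ?_).mono le_rfl
    fun s' _ _ h => h.1 hp
  intro k s₁ hk hs₁ hf₁ h7 hI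
  have e4 : s₁.reg 4 = s.reg 4 := hf₁.reg 4 (by decide)
  have e12 : s₁.mem 12 = s.mem 12 := hf₁.mem 12 (by decide)
  have e17 : s₁.mem 17 = s.mem 17 := hf₁.mem 17 (by decide)
  have e18 : s₁.mem 18 = s.mem 18 := hf₁.mem 18 (by decide)
  have hk' := h k hk
  have hkb := hs₁.1 7
  rw [h7] at hkb
  refine (HT.of_wp hN hB hs₁ ?_).mono (by decide) fun _ _ _ h => h
  simp [vertCell, wp, Expr.ok, Expr.eval, Op.eval, h7, e4, e12, e17, e18, -Order.lt_add_one_iff]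
  refine ⟨fun h1 => ⟨fun h2 h3 => hI ?_, fun h2 => ⟨fun h3 => ⟨hkb, fun h4 => (hk'.1 ⟨h1, h2, h3⟩)⟩,
    fun h3 h4 => hI ?_⟩⟩, fun h1 h2 => hI ?_⟩
  · have : k ≠ p := fun hh => by have := hk'.2 hh; omega
    omega
  · have : k ≠ p := fun hh => by have := hk'.2 hh; omega
    omega
  · have : k ≠ p := fun hh => (hk'.2 hh).1 h1
    omega

/-- Test whether the string belongs to the edge `reg 9`. -/
def letterCell : Prog :=
  selCell ;;
  .ite (.reg 14)
    (.ite (.reg 4 <ₑ .load 20 (.reg 9)) .skip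
      (.ite (.reg 4 <ₑ .load 20 (.reg 9) +ₑ
          .load 6 ((.reg 12 -ₑ (.reg 5 +ₑ .lit 1)) *ₑ .reg 0 +ₑ (.reg 14 -ₑ .lit 1)))
        (.assign 21 (.reg 9)) .skip))
    .skip

/-- Register 21 is written only for a treated edge whose interval contains the index, and by
`eq_of_pre` this is `b`. -/
theorem letterProg_spec (A : PCA n σ) {c : Cfg} (hc : c.Fits n σ m) {s : State} (hs : Bdd c s)
    {u : Fin n} {ℓ p : ℕ} (hℓ : ℓ ≤ m) (hp : p < ℓ) (hv : Vert A m u ℓ p s)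
    (h0 : PCA.topPos (A.key m u ℓ) 0 ℓ ≠ 0)
    (h20 : ∀ a : Fin σ, A.Act m u ℓ p a → s.mem 20 a = A.pre m u ℓ p a) {b : Fin σ}
    (hb : A.Act m u ℓ p b) (hb1 : A.pre m u ℓ p b ≤ s.reg 4)
    (hb2 : s.reg 4 < A.pre m u ℓ p b + A.wt u ℓ p b) :
    HT c (forTo 9 1 letterCell) s (σ * ((selCell.K + 1000) + 61) + 37) fun s' => s'.reg 21 = b := by
  classical
  have hsm := hc.small
  have hle := hc.le
  have hloop := HT.forTo hc.hN hc.hB (i := 9) (b := 1) (p := letterCell) (s := s)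
    (T := selCell.K + 1000) (fun k s' => b.val < k → s'.reg 21 = b) hs (by decide) (by decide)
    (by decide) (by simp)
    (by
      intro k s₁ hk hs₁ hf₁ h9 hI
      rw [hv.tab.inp.σ] at hk
      have hv₁ := hv.fr hf₁
      refine HT.seq (selCell_spec A hc hs₁ hv₁ h0 (a := ⟨k, hk⟩) h9) ?_
      intro s₂ hs₂ hf₂ h14
      have hv₂ := hv₁.fr hf₂
      have e4 : s₂.reg 4 = s.reg 4 := (hf₂.reg 4 (by decide)).trans (hf₁.reg 4 (by decide))
      have e20 : s₂.mem 20 = s.mem 20 := (hf₂.mem 20 (by decide)).trans (hf₁.mem 20 (by decide))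
      have e9 : s₂.reg 9 = k := (hf₂.reg 9 (by decide)).trans h9
      have hI₂ : b.val < k → s₂.reg 21 = b := by rw [hf₂.reg 21 (by decide)]; exact hI
      refine (HT.of_wp hc.hN hc.hB hs₂ ?_).mono (by decide) fun _ _ _ h => h
      by_cases hA : A.Act m u ℓ p ⟨k, hk⟩
      · rw [if_pos hA] at h14
        have hcnt := hv₂.tab.cnt (ℓ - (p + 1)) (A.target (A.defaultAt u p) ⟨k, hk⟩) (by omega)
        have hwt : A.wt u ℓ p ⟨k, hk⟩ = A.cnt (ℓ - (p + 1)) (A.target (A.defaultAt u p) ⟨k, hk⟩) := by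
          rw [PCA.wt]
          congr 1
          omega
        have hn := hc.npos
        have hpre := h20 _ hA
        simp only at hpre
        simp [wp, Expr.ok, Expr.eval, Op.eval, h14, e4, e20, e9, hv₂.len, hv₂.pos, hv₂.tab.inp.n, hcnt,
          hpre, ← hwt, -Order.lt_add_one_iff]
        have hne : (⟨k, hk⟩ : Fin σ) = b → k = b.val := fun h => by rw [← h]
        refine ⟨fun h1 h2 => hI₂ ?_, fun h1 => ⟨by omega, fun h2 => ⟨by omega, fun h3 => ?_⟩,
          fun h2 h3 => hI₂ ?_⟩⟩
        · have : k ≠ b.val := by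
            intro h
            have : (⟨k, hk⟩ : Fin σ) = b := Fin.ext h
            rw [this] at h1
            omega
          omega
        · exact hne (PCA.eq_of_pre hA hb h1 h2 hb1 hb2)
        · have : k ≠ b.val := by
            intro h
            have : (⟨k, hk⟩ : Fin σ) = b := Fin.ext h
            rw [this] at h2
            omega
          omega
      · rw [if_neg hA] at h14
        simp [wp, Expr.ok, Expr.eval, h14, -Order.lt_add_one_iff]
        intro h3
        refine hI₂ ?_
        have : k ≠ b.val := by
          intro h
          have : (⟨k, hk⟩ : Fin σ) = b := Fin.ext h
          rw [this] at hA
          exact hA hb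
        omega)
  rw [hv.tab.inp.σ] at hloop
  exact hloop.mono le_rfl fun s' _ _ h => h.1 b.2

/-- Output of one letter of the default walk. -/
def outCell : Prog := .store 1 (.reg 13 +ₑ .reg 7) (.load 7 (.load 11 (.reg 7)) -ₑ .lit 1)

theorem outProg_spec (A : PCA n σ) {c : Cfg} (hc : c.Fits n σ m) {s : State} (hs : Bdd c s)
    (ht : Tab A m s) {u : Fin n} {ℓ b : ℕ} (hu : (ℓ : ℕ∞) ≤ A.longest u)
    (hw : ∀ h, h < ℓ → s.mem 11 h = A.defaultAt u h) (hb : b ∉ [7]) (hbl : s.reg b ≤ ℓ) :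
    HT c (forTo 7 b outCell) s (s.reg b * (200 + 61) + 37) fun s' =>
      (∀ k, k < s.reg 13 → s'.mem 1 k = s.mem 1 k) ∧
      ∀ k a, (A.defaultWord u (s.reg b))[k]? = some a → s'.mem 1 (s.reg 13 + k) = a.val := by
  have hsm := hc.small
  have hle := hc.le
  have hub := PCA.natCast_le_longest_of_le hu hbl
  refine (HT.forTo hc.hN hc.hB (i := 7) (b := b) (p := outCell) (s := s) (T := 200)
    (fun j s' => (∀ k, k < s.reg 13 → s'.mem 1 k = s.mem 1 k) ∧
      ∀ k a, k < j → (A.defaultWord u (s.reg b))[k]? = some a → s'.mem 1 (s.reg 13 + k) = a.val) hs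
    (by decide) (by simp [outCell, Prog.wr]) (by simpa using hb) (by simp) ?_).mono le_rfl ?_
  · rintro j s₁ hj hs₁ hf₁ h7 ⟨hI1, hI2⟩
    obtain ⟨a, ha⟩ := PCA.exists_default_at hu (hj.trans_le hbl)
    have e11 : s₁.mem 11 j = A.defaultAt u j := by
      rw [hf₁.mem 11 (by simp [forTo, outCell, Prog.ws])]
      exact hw j (hj.trans_le hbl)
    have e7 : s₁.mem 7 (A.defaultAt u j) = a.val + 1 := by
      rw [hf₁.mem 7 (by simp [forTo, outCell, Prog.ws]), (ht.cell _).fst, ha]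
      rfl
    have e13 : s₁.reg 13 = s.reg 13 := hf₁.reg 13 (by simp [forTo, outCell, Prog.wr])
    have haσ := a.2
    refine (HT.of_wp hc.hN hc.hB hs₁ (Q := fun s' =>
      s'.mem 1 = Function.update (s₁.mem 1) (s.reg 13 + j) a) ?_).mono (by decide) ?_
    · simp [outCell, wp, Expr.ok, Expr.eval, Op.eval, h7, e11, e7, e13]
      omega
    · intro s₂ _ _ h2
      constructor
      · intro k hk
        rw [setReg_mem, h2, Function.update_of_ne (by omega)]
        exact hI1 k hk
      · intro k d hk hd
        rw [setReg_mem, h2]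
        by_cases hkj : k = j
        · subst hkj
          rw [PCA.getElem?_defaultWord hub hj, ha] at hd
          simp at hd
          rw [Function.update_self, hd]
        · rw [Function.update_of_ne (by omega)]
          exact hI2 k d (by omega) hd
  · rintro s' - - ⟨⟨h1, h2⟩, -⟩
    refine ⟨h1, fun k a hk => h2 k a ?_ hk⟩
    have := (List.getElem?_eq_some_iff.1 hk).1
    rwa [PCA.length_defaultWord hub] at this

/-- Choice of the recursive call that outputs the string. -/
def chooseProg : Prog :=
  .ite (.reg 4 <ₑ .reg 10)
    (forTo 7 12 vertCell ;;
      (.assign 6 (.load 11 (.reg 5)) ;; .assign 4 (.reg 4 -ₑ .load 17 (.reg 5))) ;;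
      preProg ;; forTo 9 1 letterCell ;; .assign 4 (.reg 4 -ₑ .load 20 (.reg 21)))
    (.assign 4 (.reg 4 -ₑ .reg 10) ;; .assign 5 (.reg 11 -ₑ .lit 1) ;; .assign 6 (.load 11 (.reg 5)) ;;
      .assign 21 (.load 8 (.reg 6) -ₑ .lit 1))

/-- All blocks but the last one lie below the accumulator, so one comparison recognises the last
call. Otherwise the intervals of the vertices, and then those of the edges, single out the block. -/
theorem chooseProg_spec : ∃ K, ∀ {n σ m : ℕ} (A : PCA n σ) {c : Cfg} {s : State} {u : Fin n}
    {ℓ p o r : ℕ} {b : Fin σ}, c.Fits n σ m → Bdd c s → Tab A m s → s.reg 12 = ℓ → ℓ ≤ m →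
    (ℓ : ℕ∞) ≤ A.longest u → A.Dev u ℓ p b → A.Offset m u ℓ p b o → PrepOut A m u ℓ s →
    s.reg 4 = o + r → r < A.wt u ℓ p b →
    HT c chooseProg s (K * (n + m + σ)) fun s' => Vert A m u ℓ p s' ∧ s'.reg 21 = b ∧ s'.reg 4 = r := by
  obtain ⟨K, hK⟩ := preProg_spec
  refine ⟨K + selCell.K + 5000, fun {n σ m} A {c s u ℓ p o r b} hc hs ht h12 hℓ hu hd ho hP h4 hr => ?_⟩
  have hsm := hc.small
  have hle := hc.le
  have hm := hc.mpos
  have hpl := hd.lt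
  have hk := hd.key_ne_zero hℓ hu
  have h0 : PCA.topPos (A.key m u ℓ) 0 ℓ ≠ 0 := fun h0 =>
    hk (PCA.topPos_eq_zero_iff.1 h0 p (Nat.zero_le _) hd.lt)
  have hbσ := b.2
  have hvn := (A.defaultAt u p).2
  have h4b := hs.1 4
  have hwalk := hP.walk p hpl
  suffices h : HT c chooseProg s (30 + ((m * 561 + 37) + (200 + (K * (n + m + σ) +
      ((σ * ((selCell.K + 1000) + 61) + 37) + 100))))) fun s' => Vert A m u ℓ p s' ∧ s'.reg 21 = b ∧
        s'.reg 4 = r by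
    refine h.mono ?_ fun _ _ _ h => h
    generalize selCell.K = k
    have h1 : σ * k ≤ (n + m + σ) * k := Nat.mul_le_mul_right _ (by omega)
    calc _ = K * (n + m + σ) + σ * k + (1061 * σ + 561 * m + 404) := by ring
      _ ≤ K * (n + m + σ) + (n + m + σ) * k + 5000 * (n + m + σ) :=
        Nat.add_le_add (Nat.add_le_add_left h1 _) (by omega)
      _ = _ := by ring
  refine HT.ite hc.hN hc.hB hs (e := .reg 4 <ₑ .reg 10) ⟨trivial, trivial⟩ (fun he => ?_) fun he => ?_
  · rw [eval_lt_ne_zero] at he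
    simp only [Expr.eval, hP.acc] at he
    rcases ho with ⟨_, ho⟩ | ⟨hnl, hsk, o₁, o₂, ho, ho'⟩
    · omega
    have hact : A.Act m u ℓ p b := ⟨hd.isSome, hsk⟩
    have hpw := A.pre_add_wt_le_weight hact
    have hfind := vertProg_spec hc.hN hc.hB hs (p := p) (by rw [h12]; exact hpl) (by
      intro q hq
      rw [h12] at hq
      rw [hP.key q hq]
      constructor
      · rintro ⟨q1, q2, q3⟩
        have hqo := PCA.mem_order.2 ⟨hq, q1⟩
        obtain ⟨o₃, o₄, ho₂⟩ := List.append_of_mem hqo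
        rw [hP.start o₃ q o₄ ho₂] at q2 q3
        rw [hP.weight q hqo] at q3
        -- Position 0 belongs to the default walk, so indices among the blocks are shifted by one.
        exact PCA.eq_of_prefix_sum (W := A.weight m u ℓ) (r := s.reg 4 - 1) ho₂ ho (by omega)
          (by omega) (by omega) (by omega)
      · rintro rfl
        rw [hP.start o₁ q o₂ ho, hP.weight q (by rw [ho]; simp)]
        exact ⟨hk, by omega, by omega⟩)
    rw [h12] at hfind
    refine HT.seq (hfind.mono (Nat.add_le_add_right (Nat.mul_le_mul_right _ hℓ) _) fun _ _ _ h => h) ?_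
    intro s₁ hs₁ hf₁ e5
    have ht₁ := ht.fr hf₁
    have e4 : s₁.reg 4 = o + r := (hf₁.reg 4 (by decide)).trans h4
    have e11 : s₁.mem 11 p = A.defaultAt u p := by rw [hf₁.mem 11 (by decide)]; exact hwalk
    have e17 : s₁.mem 17 p = 1 + (o₁.map (A.weight m u ℓ)).sum := by
      rw [hf₁.mem 17 (by decide)]; exact hP.start o₁ p o₂ ho
    refine HT.seq (T₁ := 200) (Q₁ := fun s' => s' = (s₁.setReg 6 (A.defaultAt u p)).setReg 4
        (A.pre m u ℓ p b + r))
      ((HT.of_wp hc.hN hc.hB hs₁ ?_).mono (by decide) fun _ _ _ h => h) ?_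
    · have : o + r - (1 + (o₁.map (A.weight m u ℓ)).sum) = A.pre m u ℓ p b + r := by omega
      simp [wp, Expr.ok, Expr.eval, Op.eval, e5, e11, e17, e4, this]
      omega
    rintro _ hs₂ hf₂ rfl
    have ht₂ := ht₁.fr hf₂
    set s₂ := (s₁.setReg 6 (A.defaultAt u p)).setReg 4 (A.pre m u ℓ p b + r) with hs2
    have hv₂ : Vert A m u ℓ p s₂ := ⟨ht₂, by simp [hs2, e5], by simp [hs2],
      by simp [hs2, hf₁.reg 11 (by decide), hP.root], by simp [hs2, hf₁.reg 12 (by decide), h12]⟩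
    have hW : A.weight m u ℓ p ≤ c.B := by
      have h1 := (A.one_add_sum_weight_le hℓ hu).trans (hc.cnt_le A hℓ u)
      rw [ho] at h1
      simp at h1
      omega
    refine HT.seq (hK A hc hs₂ hv₂ hℓ hpl h0 hW) ?_
    intro s₃ hs₃ hf₃ h20
    have hv₃ := hv₂.fr hf₃
    have e4₃ : s₃.reg 4 = A.pre m u ℓ p b + r := (hf₃.reg 4 (by decide)).trans (by simp [hs2])
    refine HT.seq (letterProg_spec A hc hs₃ hℓ hpl hv₃ h0 h20 hact (by omega) (by omega)) ?_
    intro s₄ hs₄ hf₄ e21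
    have hv₄ := hv₃.fr hf₄
    have e4₄ : s₄.reg 4 = A.pre m u ℓ p b + r := (hf₄.reg 4 (by decide)).trans e4₃
    have e20 : s₄.mem 20 b = A.pre m u ℓ p b := by rw [hf₄.mem 20 (by decide)]; exact h20 b hact
    refine (HT.of_wp hc.hN hc.hB hs₄ (Q := fun s' => s'.reg 21 = b ∧ s'.reg 4 = r) ?_).mono (by decide)
      fun s' _ hf₅ h => ⟨hv₄.fr hf₅, h⟩
    simp [wp, Expr.ok, Expr.eval, Op.eval, e4₄, e21, e20]
    omega
  · rw [eval_lt_eq_zero] at he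
    simp only [Expr.eval, hP.acc] at he
    rcases ho with ⟨hl, ho⟩ | ⟨hnl, hsk, o₁, o₂, ho, ho'⟩
    swap
    -- A block other than the last one ends no later than the block group of its vertex, hence below
    -- the accumulator.
    · have hpw := A.pre_add_wt_le_weight (m := m) (b := b) (p := p) ⟨hd.isSome, hsk⟩
      rw [ho] at he
      simp at he
      omega
    have hsnd := (ht.cell (A.defaultAt u p)).snd
    rw [hl.2, optC] at hsnd
    refine (HT.of_wp hc.hN hc.hB hs (Q := fun s' => s' = (((s.setReg 4 r).setReg 5 p).setReg 6
      (A.defaultAt u p)).setReg 21 b) ?_).mono (Nat.le_trans (by decide : _ ≤ 200) (by omega)) ?_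
    · have : o + r - (1 + ((A.order m u ℓ).map (A.weight m u ℓ)).sum) = r := by omega
      simp [wp, Expr.ok, Expr.eval, Op.eval, h4, hP.acc, hP.root, hl.1, hwalk, hsnd, this]
      omega
    · rintro _ - hf rfl
      exact ⟨⟨ht.fr hf, by simp, by simp, by simp [hP.root], by simp [h12]⟩, by simp, by simp⟩

/-- One call, followed down to the call that outputs the string. -/
def unrankCall : Prog :=
  prepProg ;;
  .ite (.reg 4)
    (chooseProg ;; forTo 7 5 outCell ;; .store 1 (.reg 13 +ₑ .reg 5) (.reg 21) ;; moveProg)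
    (forTo 7 12 outCell ;; .assign 13 (.reg 13 +ₑ .reg 12) ;; .assign 12 (.lit 0))

/-- Unranking. -/
def unrankLoop : Prog :=
  (.assign 12 (.reg 3) ;; .assign 13 (.lit 0) ;; .assign 4 (.reg 4 -ₑ .lit 1)) ;;
    .while (.reg 12) unrankCall

/-- The first part of the string has been output, and the rest is at position `reg 4` of the output of
the current call. -/
def UnrankInv (A : PCA n σ) (m : ℕ) (x : List (Fin σ)) (s : State) : Prop :=
  ∃ (u : Fin n) (ℓ : ℕ), s.reg 2 = u ∧ s.reg 12 = ℓ ∧ s.reg 13 + ℓ = m ∧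
    (ℓ : ℕ∞) ≤ A.longest u ∧ (A.enumFrom u ℓ)[s.reg 4]? = some (x.drop (s.reg 13)) ∧
    ∀ k a, k < s.reg 13 → x[k]? = some a → s.mem 1 k = a.val

/-- Index 0 is the default walk, which completes the string. A positive index lies in a block: the
default letters up to its vertex and its edge label are written, and the index is reduced by the
offset. -/
theorem unrankCall_spec : ∃ K, ∀ {n σ m : ℕ} (A : PCA n σ) {c : Cfg} {s : State} {x : List (Fin σ)},
    c.Fits n σ m → Bdd c s → Tab A m s → UnrankInv A m x s → s.reg 12 ≠ 0 →
    HT c unrankCall s (K * (n + m + σ)) fun s' => UnrankInv A m x s' ∧ s'.reg 12 < s.reg 12 := by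
  obtain ⟨K₁, hK₁⟩ := prepProg_spec
  obtain ⟨K₂, hK₂⟩ := chooseProg_spec
  refine ⟨K₁ + K₂ + moveProg.K + 5000, fun {n σ m} A {c s x} hc hs ht hI h0 => ?_⟩
  obtain ⟨u, ℓ, h2, h12, h13, hu, hz, hx⟩ := hI
  have hℓ0 : 0 < ℓ := by omega
  have hℓ : ℓ ≤ m := by omega
  have hsm := hc.small
  have hle := hc.le
  suffices h : HT c unrankCall s (K₁ * m + (6 + (K₂ * (n + m + σ) + ((m * 261 + 37) +
      (200 + moveProg.K))))) fun s' => UnrankInv A m x s' ∧ s'.reg 12 < s.reg 12 by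
    refine h.mono ?_ fun _ _ _ h => h
    have hm := hc.mpos
    generalize moveProg.K = k
    have h1 : K₁ * m ≤ K₁ * (n + m + σ) := Nat.mul_le_mul_left _ (by omega)
    have h2 : k ≤ k * (n + m + σ) := Nat.le_mul_of_pos_right _ (by omega)
    rw [Nat.add_mul, Nat.add_mul, Nat.add_mul]
    omega
  refine HT.seq (hK₁ A hc hs ht hℓ hu h2 h12) ?_
  intro s₁ hs₁ hf₁ hP
  have ht₁ := ht.fr hf₁
  have e12 : s₁.reg 12 = ℓ := (hf₁.reg 12 (by decide)).trans h12
  have e13 : s₁.reg 13 = s.reg 13 := hf₁.reg 13 (by decide)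
  have e4 : s₁.reg 4 = s.reg 4 := hf₁.reg 4 (by decide)
  have e2 : s₁.reg 2 = u := (hf₁.reg 2 (by decide)).trans h2
  have em : s₁.mem 1 = s.mem 1 := hf₁.mem 1 (by decide)
  have hdrop : ∀ k, s.reg 13 ≤ k → x[k]? = (x.drop (s.reg 13))[k - s.reg 13]? := by
    intro k hk
    rw [List.getElem?_drop]
    congr 1
    omega
  rcases PCA.index_cases hℓ hℓ0 hu hz with ⟨hr, hzd⟩ | ⟨p, b, z', o, r', hd, ho, hr, hzz, hz', hlt⟩
  · -- the string is the default walk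
    refine HT.ite hc.hN hc.hB hs₁ (e := .reg 4) trivial (fun he => ?_) fun he => ?_
    · simp only [Expr.eval] at he
      omega
    have hout := outProg_spec A hc hs₁ ht₁ hu hP.walk (b := 12) (by decide) (by rw [e12])
    rw [e12, e13] at hout
    refine (HT.seq (T₂ := 100) hout ?_).mono ?_ fun _ _ _ h => h
    · rintro s₂ hs₂ hf₂ ⟨k1, k2⟩
      have g12 : s₂.reg 12 = ℓ := (hf₂.reg 12 (by decide)).trans e12
      have g13 : s₂.reg 13 = s.reg 13 := (hf₂.reg 13 (by decide)).trans e13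
      have g2 : s₂.reg 2 = u := (hf₂.reg 2 (by decide)).trans e2
      have g4 : s₂.reg 4 = 0 := (hf₂.reg 4 (by decide)).trans (e4.trans hr)
      refine (HT.of_wp hc.hN hc.hB hs₂ (Q := fun s' => s' = (s₂.setReg 13 m).setReg 12 0) ?_).mono
        (by decide) ?_
      · simp [wp, Expr.ok, Expr.eval, Op.eval, g12, g13, h13]
        omega
      · rintro _ - - rfl
        refine ⟨⟨u, 0, by simp [g2], by simp, by simp, by simp, ?_, ?_⟩, by simp; omega⟩
        · have hlx : (x.drop (s.reg 13)).length = ℓ := by rw [hzd, PCA.length_defaultWord hu]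
          rw [List.length_drop] at hlx
          simp [PCA.enumFrom, g4]
          omega
        · intro k a hk hka
          simp at hk ⊢
          rcases Nat.lt_or_ge k (s.reg 13) with hlt | hge
          · rw [k1 k hlt, em]
            exact hx k a hlt hka
          · rw [hdrop k hge, hzd] at hka
            have := k2 _ a hka
            rwa [show s.reg 13 + (k - s.reg 13) = k by omega] at this
    · have hl := Nat.mul_le_mul_right 261 hℓ
      have h : ∀ a b k k' : ℕ, a ≤ b → a + 37 + 100 ≤ k' + (b + 37 + (200 + k)) := by omega
      exact h _ _ _ _ hl
  · have hup := PCA.natCast_le_longest_of_le hu hd.lt.le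
    have hlen := PCA.length_defaultWord hup
    have hpl := hd.lt
    refine HT.ite hc.hN hc.hB hs₁ (e := .reg 4) trivial (fun he => ?_) fun he => ?_
    swap
    · simp only [Expr.eval] at he
      -- Every offset counts the default walk, so index 0 cannot lie in a block.
      have : 1 ≤ o := by
        rcases ho with ⟨_, ho⟩ | ⟨_, _, _, _, _, ho⟩ <;> omega
      omega
    refine HT.seq (hK₂ A hc hs₁ ht₁ e12 hℓ hu hd ho hP (e4.trans hr) hlt) ?_
    rintro s₂ hs₂ hf₂ ⟨hv₂, g21, g4⟩
    have g13 : s₂.reg 13 = s.reg 13 := (hf₂.reg 13 (by decide)).trans e13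
    have gm : s₂.mem 1 = s.mem 1 := (hf₂.mem 1 (by decide)).trans em
    have hout := outProg_spec A hc hs₂ hv₂.tab hu
      (by rw [hf₂.mem 11 (by decide)]; exact hP.walk) (b := 5) (by decide)
      (by rw [hv₂.pos]; exact hpl.le)
    rw [hv₂.pos, g13] at hout
    refine HT.seq (hout.mono ?_ fun _ _ _ h => h) ?_
    · exact Nat.add_le_add_right (Nat.mul_le_mul_right 261 (hpl.le.trans hℓ)) 37
    rintro s₃ hs₃ hf₃ ⟨k1, k2⟩
    have hv₃ := hv₂.fr hf₃
    have g13₃ : s₃.reg 13 = s.reg 13 := (hf₃.reg 13 (by decide)).trans g13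
    have g21₃ : s₃.reg 21 = b := (hf₃.reg 21 (by decide)).trans g21
    have g4₃ : s₃.reg 4 = r' := (hf₃.reg 4 (by decide)).trans g4
    have hbσ := b.2
    refine HT.seq (T₁ := 200) (Q₁ := fun s' => s' = s₃.setMem 1 (s.reg 13 + p) b)
      ((HT.of_wp hc.hN hc.hB hs₃ ?_).mono (by decide) fun _ _ _ h => h) ?_
    · simp [wp, Expr.ok, Expr.eval, Op.eval, g13₃, g21₃, hv₃.pos]
      omega
    rintro _ hs₄ hf₄ rfl
    have hv₄ := hv₃.fr hf₄
    refine (moveProg_spec A hc hs₄ hv₄ hpl (by simp [g13₃]; omega) (by simp [g21₃]) hd.isSome).mono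
      le_rfl ?_
    rintro s₅ - hf₅ ⟨l2, l12, l13⟩
    rw [setMem_reg, g13₃] at l13
    have l4 : s₅.reg 4 = r' := (hf₅.reg 4 (by decide)).trans (by simp [g4₃])
    have l1 : s₅.mem 1 = Function.update (s₃.mem 1) (s.reg 13 + p) b := by
      rw [hf₅.mem 1 (by decide)]; simp
    refine ⟨⟨_, ℓ - 1 - p, l2, l12, by omega, hd.le, ?_, ?_⟩, by omega⟩
    · rw [l4, hz', l13, ← List.drop_drop, hzz, List.drop_append, List.drop_of_length_le (by omega),
        hlen]
      simp
    · intro k a hk hka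
      rw [l1]
      rw [l13] at hk
      rcases Nat.lt_or_ge k (s.reg 13) with hlt | hge
      · rw [Function.update_of_ne (by omega), k1 k hlt, gm]
        exact hx k a hlt hka
      · rw [hdrop k hge, hzz] at hka
        by_cases hkp : k = s.reg 13 + p
        · subst hkp
          rw [List.getElem?_append_right (by omega), hlen,
            show s.reg 13 + p - s.reg 13 - p = 0 by omega, List.getElem?_cons_zero] at hka
          simp at hka
          rw [Function.update_self, hka]
        · rw [Function.update_of_ne hkp]
          rw [List.getElem?_append_left (by omega)] at hka
          have := k2 _ a hka
          rwa [show s.reg 13 + (k - s.reg 13) = k by omega] at this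

theorem unrankLoop_spec : ∃ K, ∀ {n σ m : ℕ} (A : PCA n σ) {c : Cfg} {s : State} {i : ℕ}
    {x : List (Fin σ)}, c.Fits n σ m → Bdd c s → Tab A m s → s.reg 2 = A.init → s.reg 4 = i →
    (m : ℕ∞) ≤ A.longest A.init → (A.enumFrom A.init m)[i - 1]? = some x →
    HT c unrankLoop s (K * (m * (n + m + σ))) fun s' =>
      ∀ (k : ℕ) (a : Fin σ), x[k]? = some a → s'.mem 1 k = a := by
  obtain ⟨K, hK⟩ := unrankCall_spec
  refine ⟨K + 1000, fun {n σ m} A {c s i x} hc hs ht h2 h4 hu hx => ?_⟩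
  have hsm := hc.small
  have hle := hc.le
  have h4b := hs.1 4
  have hxl := (A.mem_enumFrom m _ hu x (List.mem_of_getElem? hx)).2
  have h : HT c unrankLoop s (100 + (m * (6 + K * (n + m + σ)) + 6)) fun s' =>
      ∀ (k : ℕ) (a : Fin σ), x[k]? = some a → s'.mem 1 k = a := by
    refine HT.seq (T₁ := 100) (Q₁ := fun s' => s' = ((s.setReg 12 m).setReg 13 0).setReg 4 (i - 1))
      ((HT.of_wp hc.hN hc.hB hs (by
        simp [wp, Expr.ok, Expr.eval, Op.eval, ht.inp.m, h4]; omega)).mono (by decide)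
        fun _ _ _ h => h) ?_
    rintro _ hs₁ hf₁ rfl
    have ht₁ := ht.fr hf₁
    refine (HT.while hc.hN hc.hB (e := .reg 12) (p := unrankCall) (T := K * (n + m + σ)) (k := m)
      (I := UnrankInv A m x) (μ := fun s' => s'.reg 12) hs₁ ?_ (by simp) (fun _ _ _ _ => trivial)
      ?_).mono le_rfl ?_
    · exact ⟨A.init, m, by simp [h2], by simp, by simp, hu, by simpa using hx, by simp⟩
    · intro s₂ hs₂ hf₂ hI he
      exact hK A hc hs₂ (ht₁.fr hf₂) hI he
    · rintro s₂ hs₂ - ⟨⟨u, ℓ, k2, k12, k13, ku, kz, k1⟩, he⟩ k a hka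
      simp only [Expr.eval] at he
      refine k1 k a ?_ hka
      have := (List.getElem?_eq_some_iff.1 hka).1
      omega
  refine h.mono ?_ fun _ _ _ h => h
  have hm := hc.mpos
  have h1 : 1 ≤ m * (n + m + σ) := Nat.mul_pos hm (by omega)
  have h2 : m ≤ m * (n + m + σ) := Nat.le_mul_of_pos_right _ (by omega)
  calc _ = K * (m * (n + m + σ)) + (6 * m + 106) := by ring
    _ ≤ K * (m * (n + m + σ)) + 1000 * (m * (n + m + σ)) := Nat.add_le_add_left (by omega) _
    _ = _ := by ring

end RAM

/-! ### The complete programs -/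

namespace RAM

variable {n σ m : ℕ}

/-- The tables that do not depend on the string or its number. -/
def tabProg : Prog := matrixProg ;; longestProg ;; countProg ;; edgeProg

theorem tabProg_spec : ∃ K, ∀ {n σ m : ℕ} (A : PCA n σ) {c : Cfg} {s : State},
    c.Fits n σ m → Bdd c s → Inp A m s → (∀ g ∈ [2, 3, 4], ∀ k, s.mem g k = 0) →
    HT c tabProg s (K * (n * σ + m * (n * n))) (Tab A m) := by
  obtain ⟨K₁, h₁⟩ := matrixProg_spec
  obtain ⟨K₂, h₂⟩ := longestProg_spec
  obtain ⟨K₃, h₃⟩ := countProg_spec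
  obtain ⟨K₄, h₄⟩ := edgeProg_spec
  refine ⟨K₁ + K₂ + K₃ + K₄, fun {n σ m} A {c s} hc hs hi hz => ?_⟩
  have h : HT c tabProg s (K₁ * (n * σ) + (K₂ * (n * n) + (K₃ * (m * (n * n)) + K₄ * (n * σ))))
      (Tab A m) := by
    refine HT.seq (h₁ A hc hs hi (hz 2 (by simp)) (hz 3 (by simp))) ?_
    intro s₁ hs₁ hf₁ hm
    have hi₁ := hi.fr hf₁
    refine HT.seq (h₂ A hc hs₁ hi₁ hm fun k => ?_) ?_
    · rw [hf₁.mem 4 (by decide)]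
      exact hz 4 (by simp) k
    intro s₂ hs₂ hf₂ hl
    have hi₂ := hi₁.fr hf₂
    refine HT.seq (h₃ A hc hs₂ hi₂ fun v u => ?_) ?_
    · rw [hf₂.mem 2 (by decide)]
      exact hm.mat v u
    intro s₃ hs₃ hf₃ hn
    have hi₃ := hi₂.fr hf₃
    have hl₃ : LenOut A m s₃ := fun v => by rw [hf₃.mem 4 (by decide)]; exact hl v
    refine (h₄ A hc hs₃ hi₃ hl₃).mono le_rfl ?_
    intro s₄ _ hf₄ he
    refine ⟨hi₃.fr hf₄, fun v => ?_, fun l v hlm => ?_, he⟩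
    · rw [hf₄.mem 4 (by decide)]
      exact hl₃ v
    · rw [hf₄.mem 6 (by decide)]
      exact hn l v hlm
  refine h.mono ?_ fun _ _ _ h => h
  have hnn : n * n ≤ m * (n * n) := Nat.le_mul_of_pos_left _ hc.mpos
  generalize n * σ = a at *
  generalize m * (n * n) = b at *
  have e2 := Nat.mul_le_mul_left K₂ hnn
  have e : (K₁ + K₂ + K₃ + K₄) * (a + b) = K₁ * a + (K₂ * b + (K₃ * b + K₄ * a)) +
    (K₁ * b + K₂ * a + K₃ * a + K₄ * b) := by ring
  omega

/-! ### Bounds for the input and the total running time -/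

/-- The bounds used for words of `wd` bits. -/
def Cfg.of (wd n σ m : ℕ) : Cfg where
  wd := wd
  N := 2 * (n + σ + m) + 8
  B := (2 * (n + σ + m) + 8) * σ ^ m

theorem Cfg.fits_of (wd : ℕ) (hn : 0 < n) (hσ : 0 < σ) (hm : 0 < m) :
    (Cfg.of wd n σ m).Fits n σ m where
  small := le_rfl
  le := Nat.le_mul_of_pos_right _ (Nat.pow_pos hσ)
  pow := Nat.le_mul_of_pos_left _ (by omega)
  npos := hn
  σpos := hσ
  mpos := hm

theorem _root_.PCA.table_le (A : PCA n σ) (k : ℕ) : A.table k ≤ n := by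
  unfold PCA.table
  split
  · split
    · omega
    · omega
  · omega

theorem bdd_input (A : PCA n σ) {c : Cfg} (hc : c.Fits n σ m) {i : ℕ} (hi : i ≤ c.B)
    (x : List (Fin σ)) : Bdd c (A.input m i x) := by
  have hsm := hc.small
  have hle := hc.le
  have hinit := A.init.2
  constructor
  · intro r
    rcases r with _ | _ | _ | _ | _ | r <;> simp [PCA.input] <;> omega
  · intro g k
    have ht := A.table_le k
    simp only [PCA.input]
    split_ifs
    · omega
    · rw [List.getD_eq_getElem?_getD, List.getElem?_map]
      rcases h : x[k]? with _ | a
      · simp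
      · have := a.2
        simp
        omega
    · omega

theorem inp_input (A : PCA n σ) (i : ℕ) (x : List (Fin σ)) : Inp A m (A.input m i x) :=
  ⟨rfl, rfl, rfl, fun _ => rfl⟩

/-- Since `n ≤ n * n`, the `m` rounds of cost `n + m + σ` fit into the same bound as the tables. -/
theorem HT.after_tab {q : Prog} {K₁ K₂ : ℕ} (A : PCA n σ) {c : Cfg} {i : ℕ} {x : List (Fin σ)}
    {Q : State → Prop} (hc : c.Fits n σ m)
    (h₁ : HT c tabProg (A.input m i x) (K₁ * (n * σ + m * (n * n))) (Tab A m))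
    (h₂ : ∀ s, Bdd c s → Fr tabProg (A.input m i x) s → Tab A m s →
      HT c q s (K₂ * (m * (n + m + σ))) Q) :
    HT c (tabProg ;; q) (A.input m i x) ((K₁ + K₂) * (n * σ + m * (n * n + m + σ))) Q := by
  refine (HT.seq h₁ h₂).mono ?_ fun _ _ _ h => h
  have hn : n ≤ n * n := Nat.le_mul_of_pos_left _ hc.npos
  have e1 : n * σ + m * (n * n) ≤ n * σ + m * (n * n + m + σ) := by gcongr; omega
  have e2 : m * (n + m + σ) ≤ n * σ + m * (n * n + m + σ) :=
    (Nat.mul_le_mul_left m (by omega)).trans (Nat.le_add_left _ _)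
  rw [Nat.add_mul]
  exact Nat.add_le_add (Nat.mul_le_mul_left _ e1) (Nat.mul_le_mul_left _ e2)

theorem rank_spec : ∃ K, ∀ {n σ m : ℕ} (A : PCA n σ) {c : Cfg} {R : ℕ} {x : List (Fin σ)},
    c.Fits n σ m → (m : ℕ∞) ≤ A.longest A.init → (A.enumFrom A.init m)[R]? = some x →
    HT c (tabProg ;; rankLoop) (A.input m 0 x) (K * (n * σ + m * (n * n + m + σ)))
      fun s => s.reg 0 = R := by
  obtain ⟨K₁, h₁⟩ := tabProg_spec
  obtain ⟨K₂, h₂⟩ := rankLoop_spec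
  refine ⟨K₁ + K₂, fun {n σ m} A {c R x} hc hu hx => ?_⟩
  refine HT.after_tab A hc (h₁ A hc (bdd_input A hc (Nat.zero_le _) x) (inp_input A 0 x) ?_) ?_
  · simp [PCA.input]
  · intro s hs hf ht
    refine h₂ A hc hs ht (hf.reg 2 (by decide)) hu hx ?_
    intro k a hk
    rw [hf.mem 1 (by decide)]
    simp [PCA.input, hk]

theorem unrank_spec : ∃ K, ∀ {n σ m : ℕ} (A : PCA n σ) {c : Cfg} {i : ℕ} {x : List (Fin σ)},
    c.Fits n σ m → (m : ℕ∞) ≤ A.longest A.init → (A.enumFrom A.init m)[i - 1]? = some x →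
    HT c (tabProg ;; unrankLoop) (A.input m i []) (K * (n * σ + m * (n * n + m + σ)))
      fun s => ∀ (k : ℕ) (a : Fin σ), x[k]? = some a → s.mem 1 k = a := by
  obtain ⟨K₁, h₁⟩ := tabProg_spec
  obtain ⟨K₂, h₂⟩ := unrankLoop_spec
  refine ⟨K₁ + K₂, fun {n σ m} A {c i x} hc hu hx => ?_⟩
  -- The number given as input is itself a legal cell: it is at most the number of walks.
  have hi : i ≤ c.B := by
    have h := (List.getElem?_eq_some_iff.1 hx).1
    rw [A.length_enumFrom m _ hu] at h
    have := hc.cnt_le A le_rfl A.init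
    omega
  refine HT.after_tab A hc (h₁ A hc (bdd_input A hc hi []) (inp_input A i []) ?_) ?_
  · simp [PCA.input]
  · intro s hs hf ht
    exact h₂ A hc hs ht (hf.reg 2 (by decide)) (hf.reg 4 (by decide)) hu hx

/-! ### Numbers of words -/

theorem size_le_logb {x : ℕ} (hx : 0 < x) : (x.size : ℝ) ≤ Real.logb 2 x + 1 := by
  have h0 : 0 < x.size := Nat.size_pos.2 hx
  have h : 2 ^ (x.size - 1) ≤ x := Nat.lt_size.1 (by omega)
  have h1 : ((x.size - 1 : ℕ) : ℝ) ≤ Real.logb 2 x := by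
    rw [Real.le_logb_iff_rpow_le (by norm_num) (by exact_mod_cast hx), Real.rpow_natCast]
    exact_mod_cast h
  rw [Nat.cast_sub h0] at h1
  push_cast at h1
  linarith

theorem words_le_of_size_le {wd x : ℕ} {b : ℝ} (hw : 1 ≤ wd) (h : (x.size : ℝ) ≤ b) :
    (words wd x : ℝ) ≤ b / wd + 1 := by
  rw [words]
  push_cast
  have h1 : ((x.size / wd : ℕ) : ℝ) ≤ (x.size : ℝ) / wd := Nat.cast_div_le
  have h2 : (x.size : ℝ) / wd ≤ b / wd := by gcongr
  linarith

/-- A small number has at most `c * wd + 5` bits, hence at most `c + 6` words. The bound for cells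
has `m log σ` further bits and one more from rounding, hence at most `c + 7 + m log σ / wd` words.
-/
theorem U_of_le {wd : ℕ} {c : ℝ} (hw : 1 ≤ wd) (hn : 0 < n) (hσ : 0 < σ) (hm : 0 < m)
    (hc : Real.logb 2 (max ((n : ℝ) * σ) m) ≤ c * wd) :
    0 ≤ c ∧ ((Cfg.of wd n σ m).U : ℝ) ≤ (c + 6) * (c + 7) * (1 + m * Real.logb 2 σ / wd) := by
  have hw' : (1 : ℝ) ≤ wd := by exact_mod_cast hw
  have hw0 : (0 : ℝ) < wd := by linarith
  obtain ⟨M, hM⟩ : ∃ M, M = max (n * σ) m := ⟨_, rfl⟩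
  have hMr : (M : ℝ) = max ((n : ℝ) * σ) m := by rw [hM]; push_cast; rfl
  have hM0 : 0 < M := hM ▸ lt_max_of_lt_right hm
  rw [← hMr] at hc
  have hlog : 0 ≤ Real.logb 2 M := Real.logb_nonneg (by norm_num) (by exact_mod_cast hM0)
  have hlσ : 0 ≤ Real.logb 2 σ := Real.logb_nonneg (by norm_num) (by exact_mod_cast hσ)
  -- The logarithm is nonnegative, since its argument is at least 1.
  have hc0 : 0 ≤ c := by
    by_contra h
    have : c * wd < 0 := mul_neg_of_neg_of_pos (not_le.1 h) hw0
    linarith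
  refine ⟨hc0, ?_⟩
  have hN : ((Cfg.of wd n σ m).N.size : ℝ) ≤ 5 + c * wd := by
    have h1 : n ≤ M := (Nat.le_mul_of_pos_right _ hσ).trans (hM ▸ le_max_left _ _)
    have h2 : σ ≤ M := (Nat.le_mul_of_pos_left _ hn).trans (hM ▸ le_max_left _ _)
    have h3 : m ≤ M := hM ▸ le_max_right _ _
    -- With `n, σ, m ≤ M` and `1 ≤ M`, one has `2 (n + σ + m) + 8 ≤ 14 M ≤ 2 ^ 4 M`.
    have h4 : (Cfg.of wd n σ m).N.size ≤ 4 + M.size :=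
      (Nat.size_le_size (by simp only [Cfg.of]; omega)).trans (size_two_pow_mul_le 4 M)
    have h5 : ((Cfg.of wd n σ m).N.size : ℝ) ≤ 4 + M.size := by exact_mod_cast h4
    have := size_le_logb hM0
    linarith
  have hB : ((Cfg.of wd n σ m).B.size : ℝ) ≤ 6 + c * wd + m * Real.logb 2 σ := by
    have h4 : (Cfg.of wd n σ m).B.size ≤ (Cfg.of wd n σ m).N.size + (σ ^ m).size := size_mul_le _ _
    have h5 : ((Cfg.of wd n σ m).B.size : ℝ) ≤ (Cfg.of wd n σ m).N.size + (σ ^ m).size := by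
      exact_mod_cast h4
    have h6 := size_le_logb (Nat.pow_pos (n := m) hσ)
    rw [Nat.cast_pow, Real.logb_pow] at h6
    linarith
  have h1 := words_le_of_size_le hw hN
  have h2 := words_le_of_size_le hw hB
  have hX : 0 ≤ m * Real.logb 2 σ / wd := by positivity
  have d5 : 5 / (wd : ℝ) ≤ 5 := div_le_self (by norm_num) hw'
  have d6 : 6 / (wd : ℝ) ≤ 6 := div_le_self (by norm_num) hw'
  have dc : c * wd / wd = c := mul_div_cancel_right₀ _ hw0.ne'
  rw [add_div, dc] at h1
  rw [add_div, add_div, dc] at h2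
  have h3 : (words wd (Cfg.of wd n σ m).B : ℝ) ≤ (c + 7) * (1 + m * Real.logb 2 σ / wd) := by
    nlinarith
  have h4 : (words wd (Cfg.of wd n σ m).N : ℝ) ≤ c + 6 := by linarith
  calc ((Cfg.of wd n σ m).U : ℝ)
      = words wd (Cfg.of wd n σ m).N * words wd (Cfg.of wd n σ m).B := by
        rw [Cfg.U]; push_cast; rfl
    _ ≤ (c + 6) * ((c + 7) * (1 + m * Real.logb 2 σ / wd)) := by gcongr
    _ = _ := by ring

theorem le_timeBound {wd K t : ℕ} {c ω : ℝ} (hω : 2 ≤ ω) (hw : 1 ≤ wd) (hn : 0 < n) (hσ : 0 < σ)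
    (hm : 0 < m) (hc : Real.logb 2 (max ((n : ℝ) * σ) m) ≤ c * wd)
    (ht : t ≤ K * (n * σ + m * (n * n + m + σ)) * (Cfg.of wd n σ m).U) :
    (t : ℝ) ≤ K * ((c + 6) * (c + 7)) * timeBound ω wd n σ m := by
  obtain ⟨hc0, hU⟩ := U_of_le hw hn hσ hm hc
  have hn1 : (1 : ℝ) ≤ n := by exact_mod_cast hn
  -- The only place where the exponent enters: a quadratic cost per length is covered as soon as `ω
  -- ≥ 2`.
  have hp : (n : ℝ) * n ≤ (n : ℝ) ^ ω := by
    have := Real.rpow_le_rpow_of_exponent_le hn1 hω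
    rw [Real.rpow_two] at this
    nlinarith
  have ht' : (t : ℝ) ≤ K * (n * σ + m * (n * n + m + σ)) * (Cfg.of wd n σ m).U := by
    exact_mod_cast ht
  have hlσ : 0 ≤ Real.logb 2 σ := Real.logb_nonneg (by norm_num) (by exact_mod_cast hσ)
  refine ht'.trans ?_
  calc (K : ℝ) * (n * σ + m * (n * n + m + σ)) * (Cfg.of wd n σ m).U
      ≤ K * (n * σ + m * ((n : ℝ) ^ ω + m + σ)) *
        ((c + 6) * (c + 7) * (1 + m * Real.logb 2 σ / wd)) := by gcongr
    _ = _ := by rw [timeBound]; ring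

end RAM

theorem mainTheorem6 :
    ∃ rank unrank : RAM.Prog, ∀ c : ℝ, ∃ C : ℝ, ∀ ω : ℝ, 2 ≤ ω → ω ≤ 3 →
      ∀ (wd n σ m : ℕ) (A : PCA n σ), 1 ≤ m → 1 ≤ wd →
        Real.logb 2 (max ((n : ℝ) * σ) m) ≤ c * wd →
        (∀ x : List (Fin σ), x ∈ A.language → x.length = m →
          x ∈ A.enumeration m ∧
          ∃ (s : RAM.State) (t : ℕ), RAM.Runs wd rank (A.input m 0 x) s t ∧
            s.reg 0 = (A.enumeration m).idxOf x ∧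
            (t : ℝ) ≤ C * timeBound ω wd n σ m) ∧
        (∀ (i : ℕ) (x : List (Fin σ)), 1 ≤ i → (A.enumeration m)[i - 1]? = some x →
          x ∈ A.language ∧ x.length = m ∧
          ∃ (s : RAM.State) (t : ℕ), RAM.Runs wd unrank (A.input m i []) s t ∧
            (∀ (k : ℕ) (a : Fin σ), x[k]? = some a → s.mem 1 k = a) ∧
            (t : ℝ) ≤ C * timeBound ω wd n σ m) := by
  obtain ⟨K₁, h₁⟩ := RAM.rank_spec
  obtain ⟨K₂, h₂⟩ := RAM.unrank_spec
  refine ⟨RAM.Prog.seq RAM.tabProg RAM.rankLoop, RAM.Prog.seq RAM.tabProg RAM.unrankLoop, fun c =>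
    ⟨(K₁ + K₂ : ℕ) * ((c + 6) * (c + 7)), fun ω hω _ wd n σ m A hm hw hc => ?_⟩⟩
  have hn : 0 < n := A.init.pos
  -- A string of positive length shows that the alphabet is nonempty.
  have hσ : ∀ x : List (Fin σ), x.length = m → 0 < σ := fun x hx =>
    (x[0]'(by omega)).pos
  have hK : ∀ T, K₁ * T ≤ (K₁ + K₂) * T ∧ K₂ * T ≤ (K₁ + K₂) * T := fun T =>
    ⟨Nat.mul_le_mul_right _ (by omega), Nat.mul_le_mul_right _ (by omega)⟩
  constructor
  · intro x hx hxm
    have hu := PCA.le_longest_of_isWalk hx hxm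
    have hmem := A.mem_enumFrom_of_isWalk m A.init x hx hxm
    rw [PCA.enumeration, if_pos hu]
    refine ⟨hmem, ?_⟩
    -- Any position of the string may be fed to the specification of ranking; the first one is the
    -- number of strings output before it.
    have hR : (A.enumFrom A.init m)[(A.enumFrom A.init m).idxOf x]? = some x :=
      List.getElem?_idxOf hmem
    obtain ⟨s, t, hr, ht, -, hs⟩ := h₁ A (RAM.Cfg.fits_of wd hn (hσ x hxm) hm) hu hR
    exact ⟨s, t, hr, hs, RAM.le_timeBound hω hw hn (hσ x hxm) hm hc
      (ht.trans (Nat.mul_le_mul_right _ (hK _).1))⟩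
  · intro i x _ hx
    rw [PCA.enumeration] at hx
    split_ifs at hx with hu
    · obtain ⟨hxw, hxm⟩ := A.mem_enumFrom m _ hu x (List.mem_of_getElem? hx)
      obtain ⟨s, t, hr, ht, -, hs⟩ := h₂ A (RAM.Cfg.fits_of wd hn (hσ x hxm) hm) hu hx
      exact ⟨hxw, hxm, s, t, hr, hs, RAM.le_timeBound hω hw hn (hσ x hxm) hm hc
        (ht.trans (Nat.mul_le_mul_right _ (hK _).2))⟩
    · simp at hx
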